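/- **Setting.** Let $\rho>0$ and $L\ge 2$. Let $B_L\subset C_L$ be the real and complex Grassmann algebras on $L$ generators, $\epsilon:C_L\to\mathbb C$ the augmentation (body) map, and $S_\rho^{2|2}$ the supersphere, i.e. the set of points $(x^1,x^2,x^3,\theta^4,\theta^5)$ with $x^k\in B_L$ even, $\theta^\alpha\in B_L$ odd and $\sum_k (x^k)^2+2\theta^4\theta^5=\rho^2$. Let $S^2_\rho\subset\mathbb R^3$ be the sphere of radius $\rho$, and $\Phi(x,\theta)=(\epsilon(x^1),\epsilon(x^2),\epsilon(x^3))$. Let $P(S_\rho^{2|2})$ and $P(S^2_\rho)$ be the polynomials in the coordinates with complex coefficients, restricted to $S_\rho^{2|2}$ and to $S^2_\rho$. The classical body map $\beta:P(S_\rho^{2|2})\to P(S^2_\rho)$ is determined by $(\beta f)(\Phi(p))=\epsilon(f(p))$. *Classical harmonics.* The Lie superalgebra $\mathfrak{osp}(1|2)$, with even generators $J_1,J_2,J_3$ (spanning $\mathfrak{sl}(2)$) and odd generators $J_4,J_5$, acts on polynomial superfunctions by (with the Pauli matrices $\sigma_i$, $\alpha,\beta\in\{4,5\}$) $$J_i=-i\sum_{j,k}\varepsilon_{ijk}x^j\partial_k+\tfrac12\sum_{\alpha,\beta}(\sigma_i)_{\alpha\beta}\theta^\alpha\tfrac{\partial}{\partial\theta^\beta},\qquad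 J_\alpha=\tfrac12\sum_{k,\beta}\Big(i x^k(\sigma_2\sigma_k)_{\alpha\beta}\tfrac{\partial}{\partial\theta^\beta}-\theta^\beta(\sigma_k)_{\beta\alpha}\partial_k\Big).$$ Put $J_\pm=J_1\pm iJ_2$ and, for $n,\mu,k\ge 0$ with $\mu\le 1$ and $\mu+k\le n$, $c_{n,\mu,k}=\sqrt{4^\mu (n-\mu-k)!/(n!\,k!)}$. For $j\in\frac12\mathbb N_0$ and $n=2j$ let $$Y_j=\frac{\sqrt{(2j)!}}{2^j j!\,\rho^j}(x^1+ix^2)^j\ (j\in\mathbb N_0),\qquad Y_j=\frac{\sqrt{(2i+1)!}}{2^i i!\,\rho^{i+2}}(x^1+ix^2)^i\big(x^3\theta^4+(x^1+ix^2)\theta^5\big)\ (j=i+\tfrac12),$$ and let $Y_{j,\mu,k}\in P(S_\rho^{2|2})$ be the restriction of $c_{n,\mu,k}J_-^kJ_5^\mu Y_j$. Let $H_q\subset P(S_\rho^{2|2})$ be the sum of the $\mathfrak{osp}(1|2)$-submodules generated by the $Y_j$ with $j\le q$. Likewise, with $J_i=-i\sum\varepsilon_{ijk}x^j\partial_k$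 on $\mathbb C[x^1,x^2,x^3]$, let $\hat Y_{j,k}\in P(S_\rho^2)$ $(j\in\mathbb N_0,\ 0\le k\le 2j)$ be the restriction of $c_{2j,0,k}J_-^k\frac{\sqrt{(2j+1)!}}{2^jj!\rho^j}(x^1+ix^2)^j$, and let $C_q$ be the sum of the $\mathfrak{sl}(2)$-submodules generated by the $\hat Y_{j,0}$ with $j\le q$. *Truncated (super)spheres.* For $q\in\mathbb N_0$ let $V(\frac q2)$ be the irreducible $\mathfrak{sl}(2)$-module of spin $\frac q2$ and $V(\frac q2,\bar 1)$ the irreducible $\mathfrak{osp}(1|2)$-module with highest weight $j=\frac q2$ and odd highest weight vector; the latter has a basis $e_{l,m}$, $l\in\{j,j-\frac12\}$, $m=-l,\dots,l$, with the usual action of $J_3,J_\pm$ and $$J_4e_{j,m}=-\tfrac12\sqrt{j-m}\,e_{j-\frac12,m+\frac12},\quad J_4e_{j-\frac12,m}=-\tfrac12\sqrt{j+m+\tfrac12}\,e_{j,m+\frac12},$$ $$J_5e_{j,m}=\tfrac12\sqrt{j+m}\,e_{j-\frac12,m-\frac12},\quad J_5e_{j-\frac12,m}=-\tfrac12\sqrt{j-m+\tfrac12}\,e_{j,m-\frac12}.$$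 The truncated supersphere is $\mathcal S_q=\mathrm{End}\,V(\frac q2,\bar1)$, the truncated sphere is $\hat{\mathcal S}_q=\mathrm{End}\,V(\frac q2)$; the Lie (super)algebras act by (graded) commutators $\mathrm{ad}$. For $j\le q$ let $$T_j=\sqrt{\tfrac{2^j(2j-1)!!\,(q-j)!}{j!\,(q+j)!}}\,J_+^j\ (j\in\mathbb N_0),\qquad T_j=\tfrac1{q+\frac12}\sqrt{\tfrac{2^{i+4}(2i+1)!!\,(q-i-1)!}{i!\,(q+i+1)!}}\,J_+^i\big[(J_3-\tfrac34)J_4+J_+J_5\big]\ (j=i+\tfrac12)$$ in $\mathcal S_q$, and $\hat T_j=\sqrt{\frac{2^j(2j+1)!!(q+1)(q-j)!}{j!(q+j+1)!}}J_+^j$ in $\hat{\mathcal S}_q$ $(j\in\mathbb N_0)$. **Proposition.** (0) For every $q$ there are unique linear isomorphisms $\psi_q:H_q\to\mathcal S_q$ and $\hat\psi_q:C_q\to\hat{\mathcal S}_q$ with $\psi_q(Y_{j,\mu,k})=c_{2j,\mu,k}(\mathrm{ad}J_-)^k(\mathrm{ad}J_5)^\mu T_j$ and $\hat\psi_q(\hat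 Y_{j,k})=c_{2j,0,k}(\mathrm{ad}J_-)^k\hat T_j$ for all $j\le q$ and all admissible $\mu,k$; moreover $\beta(H_q)\subseteq C_q$. Hence the maps $$\eta_{q'q}=\psi_{q'}\psi_q^{-1},\quad \hat\eta_{q'q}=\hat\psi_{q'}\hat\psi_q^{-1}\ (q\le q'),\quad \eta_q=\psi_q^{-1},\quad \hat\eta_q=\hat\psi_q^{-1},\quad \beta_q=\hat\psi_q\circ\beta\circ\psi_q^{-1}:\mathcal S_q\to\hat{\mathcal S}_q$$ are defined (the inclusions $H_q\subseteq H_{q'}\subseteq P(S_\rho^{2|2})$ and $C_q\subseteq C_{q'}\subseteq P(S^2_\rho)$ being omitted). (1) $(\beta_q)$ is a surjective homomorphism $(\mathcal S_q,\eta_{q'q})\to(\hat{\mathcal S}_q,\hat\eta_{q'q})$ of directed systems of $\mathbb Z_2$-graded $\mathfrak{sl}(2)$-modules: the $\eta_{q'q}$ are even and $\mathfrak{sl}(2)$-equivariant, the $\hat\eta_{q'q}$ are $\mathfrak{sl}(2)$-equivariant, each $\beta_q$ is surjective, even ($\hat{\mathcal S}_q$ being trivially graded) and $\mathfrak{sl}(2)$-equivariant,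 and $\beta_{q'}\circ\eta_{q'q}=\hat\eta_{q'q}\circ\beta_q$ for $q\le q'$. (2) The $\eta_q$ and $\hat\eta_q$ induce linear isomorphisms $\varinjlim\mathcal S_q\cong P(S_\rho^{2|2})$ and $\varinjlim\hat{\mathcal S}_q\cong P(S_\rho^2)$, and under these $\varinjlim\beta_q$ is $\beta$. (3) For all $f,f'\in P(S_\rho^{2|2})$ there is $p$ with $f,f'\in H_p$, and for every such $p$ the two sequences, defined for $q\ge p$, $$\hat\eta_q\big(\beta_q(\psi_q(f)\psi_q(f'))\big)\qquad\text{and}\qquad \big(\beta(f)\beta(f')\big)_q:=\hat\psi_q^{-1}\big(\hat\psi_q(\beta(f))\,\hat\psi_q(\beta(f'))\big)$$ converge, as $q\to\infty$, in the Fréchet topology of $C^\infty(S_\rho^2,\mathbb C)$ (the quotient topology of $C^\infty(\mathbb R^3,\mathbb C)$ under restriction), to the same limit, namely $\beta(f)\beta(f')$. -/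

import Mathlib

open scoped ContDiff Topology

namespace FuzzySupersphere

noncomputable section

/-! ### The ordinary sphere, smooth functions and their Fréchet topology -/

/-- Euclidean three-space. -/
abbrev E3 : Type := EuclideanSpace ℝ (Fin 3)

/-- The sphere of radius `ρ` about the origin of `ℝ³`. -/
abbrev Sph (ρ : ℝ) : Type := Metric.sphere (0 : E3) ρ

/-- The smooth complex-valued functions on `ℝ³`, as a subalgebra of all functions. -/
def smoothSub : Subalgebra ℂ (E3 → ℂ) where
  carrier := {F | ContDiff ℝ ∞ F}
  mul_mem' := fun {F G} (hF : ContDiff ℝ ∞ F) (hG : ContDiff ℝ ∞ G) =>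
    show ContDiff ℝ ∞ (F * G) from hF.mul hG
  add_mem' := fun {F G} (hF : ContDiff ℝ ∞ F) (hG : ContDiff ℝ ∞ G) =>
    show ContDiff ℝ ∞ (F + G) from hF.add hG
  algebraMap_mem' := fun c => show ContDiff ℝ ∞ (fun _ : E3 => c) from contDiff_const

/-- The algebra `C^∞(ℝ³, ℂ)`. -/
def SmoothE3 : Type := smoothSub

instance : CommRing SmoothE3 := inferInstanceAs (CommRing smoothSub)
instance : Algebra ℂ SmoothE3 := inferInstanceAs (Algebra ℂ smoothSub)

/-- The `n`-th derivative of a smooth function, as a continuous map. -/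
def derivMap (n : ℕ) (F : SmoothE3) : C(E3, E3 [×n]→L[ℝ] ℂ) :=
  ⟨iteratedFDeriv ℝ n F.1, by
    have h : ContDiff ℝ ∞ F.1 := F.2
    exact h.continuous_iteratedFDeriv (by exact_mod_cast le_top)⟩

/-- The Fréchet topology of `C^∞(ℝ³, ℂ)`: uniform convergence of all derivatives on all
compact sets (each `C(E3, _)` carries the compact-open topology). -/
instance : TopologicalSpace SmoothE3 :=
  ⨅ n : ℕ, TopologicalSpace.induced (derivMap n) inferInstance

/-- Restriction of functions on `ℝ³` to the sphere. -/
def restrictFun (ρ : ℝ) : (E3 → ℂ) →ₐ[ℂ] (Sph ρ → ℂ) :=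
  AlgHom.pi (fun y => Pi.evalAlgHom ℂ (fun _ : E3 => ℂ) y.1)

/-- The smooth functions on the sphere: the restrictions of smooth functions on `ℝ³`. -/
def smoothSphereSub (ρ : ℝ) : Subalgebra ℂ (Sph ρ → ℂ) := smoothSub.map (restrictFun ρ)

/-- The algebra `C^∞(S_ρ, ℂ)`, i.e. `C^∞(ℝ³, ℂ)` modulo the functions vanishing on `S_ρ`. -/
def SmoothSphere (ρ : ℝ) : Type := smoothSphereSub ρ

instance (ρ : ℝ) : CommRing (SmoothSphere ρ) := inferInstanceAs (CommRing (smoothSphereSub ρ))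
instance (ρ : ℝ) : Algebra ℂ (SmoothSphere ρ) := inferInstanceAs (Algebra ℂ (smoothSphereSub ρ))

/-- The restriction map `C^∞(ℝ³, ℂ) → C^∞(S_ρ, ℂ)`. -/
def restrictSmooth (ρ : ℝ) (F : SmoothE3) : SmoothSphere ρ :=
  ⟨restrictFun ρ F.1, F.1, F.2, rfl⟩

/-- The Fréchet topology of `C^∞(S_ρ, ℂ)`: the quotient topology. -/
instance (ρ : ℝ) : TopologicalSpace (SmoothSphere ρ) :=
  TopologicalSpace.coinduced (restrictSmooth ρ) inferInstance

/-- The inclusion of `C^∞(S_ρ, ℂ)` into all functions on the sphere. -/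
def SmoothSphere.val (ρ : ℝ) : SmoothSphere ρ →ₐ[ℂ] (Sph ρ → ℂ) := (smoothSphereSub ρ).val

/-- The `k`-th coordinate function on the sphere. -/
def coord (ρ : ℝ) (k : Fin 3) : SmoothSphere ρ :=
  restrictSmooth ρ ⟨fun y => ((y k : ℝ) : ℂ),
    show ContDiff ℝ ∞ (fun y : E3 => ((y k : ℝ) : ℂ)) from
      Complex.ofRealCLM.contDiff.comp (EuclideanSpace.proj (𝕜 := ℝ) k).contDiff⟩

/-- A polynomial with complex coefficients as a smooth function on the sphere. -/
def polyOnSphere (ρ : ℝ) : MvPolynomial (Fin 3) ℂ →ₐ[ℂ] SmoothSphere ρ :=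
  MvPolynomial.aeval (coord ρ)

/-- The algebra `P(S_ρ)` of polynomial functions on the sphere. -/
def polySphere (ρ : ℝ) : Subalgebra ℂ (SmoothSphere ρ) := (polyOnSphere ρ).range

/-- The canonical projection from polynomials to polynomial functions on the sphere. -/
def projSphere (ρ : ℝ) : MvPolynomial (Fin 3) ℂ →ₗ[ℂ] polySphere ρ :=
  (polyOnSphere ρ).rangeRestrict.toLinearMap

/-! ### Grassmann algebras, vector superspace and supersphere -/

/-- The complex Grassmann algebra `C_L` on `L` generators. -/
abbrev Grass (L : ℕ) : Type := ExteriorAlgebra ℂ (Fin L → ℂ)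

/-- The real Grassmann algebra `B_L`, as the real subalgebra of `C_L` generated by the
standard basis of `ℂ^L`. -/
def realGrass (L : ℕ) : Subalgebra ℝ (Grass L) :=
  Algebra.adjoin ℝ (Set.range fun i : Fin L => ExteriorAlgebra.ι ℂ (Pi.single i (1 : ℂ)))

/-- The even (`i = 0`) or odd (`i = 1`) part of `C_L`. -/
def grassPart (L : ℕ) (i : ZMod 2) : Submodule ℂ (Grass L) :=
  CliffordAlgebra.evenOdd (0 : QuadraticForm ℂ (Fin L → ℂ)) i

/-- The body (augmentation) map on `C_L`. -/
def augment (L : ℕ) : Grass L →ₐ[ℂ] ℂ := ExteriorAlgebra.algebraMapInv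

/-- The real `(3|2)`-dimensional vector superspace over `B_L`: three even and two odd
coordinates. The odd coordinates `θ 0`, `θ 1` are usually numbered `θ⁴`, `θ⁵`. -/
structure Superspace (L : ℕ) where
  x : Fin 3 → Grass L
  θ : Fin 2 → Grass L
  x_real : ∀ k, x k ∈ realGrass L
  x_even : ∀ k, x k ∈ grassPart L 0
  θ_real : ∀ α, θ α ∈ realGrass L
  θ_odd : ∀ α, θ α ∈ grassPart L 1

/-- The body projection of the vector superspace onto `ℝ³` (the bodies of real elements are
real). -/
def Superspace.body {L : ℕ} (p : Superspace L) : E3 :=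
  WithLp.toLp 2 (fun k => (augment L (p.x k)).re)

/-- The `(2|2)`-dimensional supersphere of radius `ρ`. -/
def Supersphere (ρ : ℝ) (L : ℕ) : Type :=
  {p : Superspace L //
    ∑ k, p.x k ^ 2 + 2 * (p.θ 0 * p.θ 1) = algebraMap ℂ (Grass L) ((ρ : ℂ) ^ 2)}

/-! ### Polynomial superfunctions and the action of `osp(1|2)` -/

/-- Polynomial superfunctions on the vector superspace, through their superfield expansion:
`f` stands for `∑_M f_M θ^M`, where `M` runs over the subsets of the odd index set. -/
abbrev SuperPoly : Type := Finset (Fin 2) → MvPolynomial (Fin 3) ℂ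

/-- The value of a polynomial at three (commuting, even) Grassmann numbers. -/
def evalEven {L : ℕ} (p : Superspace L) : MvPolynomial (Fin 3) ℂ →ₗ[ℂ] Grass L :=
  (MvPolynomial.basisMonomials (Fin 3) ℂ).constr ℂ
    (fun m => p.x 0 ^ m 0 * p.x 1 ^ m 1 * p.x 2 ^ m 2)

/-- The product of the odd coordinates with index in `M`, in increasing order. -/
def thetaProd {L : ℕ} (p : Superspace L) (M : Finset (Fin 2)) : Grass L :=
  (if 0 ∈ M then p.θ 0 else 1) * (if 1 ∈ M then p.θ 1 else 1)

/-- The value `∑_M f_M(x) θ^M` of a polynomial superfunction at a point. -/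
def evalSuper {L : ℕ} (p : Superspace L) : SuperPoly →ₗ[ℂ] Grass L :=
  ∑ M, (LinearMap.mulRight ℂ (thetaProd p M)).comp ((evalEven p).comp (LinearMap.proj M))

/-- Restriction of polynomial superfunctions to Grassmann-valued functions on the
supersphere. -/
def restrictSuper (ρ : ℝ) (L : ℕ) : SuperPoly →ₗ[ℂ] (Supersphere ρ L → Grass L) :=
  LinearMap.pi (fun p => evalSuper p.1)

/-- The space `P(S_ρ)` of polynomial superfunctions on the supersphere. -/
def polySuper (ρ : ℝ) (L : ℕ) : Submodule ℂ (Supersphere ρ L → Grass L) :=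
  LinearMap.range (restrictSuper ρ L)

/-- The canonical projection from polynomial superfunctions on the vector superspace to those
on the supersphere. -/
def projSuper (ρ : ℝ) (L : ℕ) : SuperPoly →ₗ[ℂ] polySuper ρ L :=
  (restrictSuper ρ L).rangeRestrict

/-- Multiplication by the even coordinate `x^k`. -/
def mulX (k : Fin 3) : Module.End ℂ SuperPoly :=
  LinearMap.pi (fun M =>
    (LinearMap.mulLeft ℂ (MvPolynomial.X k : MvPolynomial (Fin 3) ℂ)).comp (LinearMap.proj M))

/-- The partial derivative `∂/∂x^k`. -/
def derivX (k : Fin 3) : Module.End ℂ SuperPoly :=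
  LinearMap.pi (fun M => (MvPolynomial.pderiv k).toLinearMap.comp (LinearMap.proj M))

/-- The sign `(-1)^{#{β ∈ M, β < α}}` from moving `θ^α` to its place in `θ^M`. -/
def thetaSign (α : Fin 2) (M : Finset (Fin 2)) : ℂ :=
  (-1) ^ (M.filter (fun β => β < α)).card

/-- Left multiplication by the odd coordinate `θ^α`. -/
def mulTheta (α : Fin 2) : Module.End ℂ SuperPoly :=
  LinearMap.pi (fun M =>
    if α ∈ M then thetaSign α M • LinearMap.proj (M.erase α) else 0)

/-- The (left) partial derivative `∂/∂θ^α`. -/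
def derivTheta (α : Fin 2) : Module.End ℂ SuperPoly :=
  LinearMap.pi (fun M =>
    if α ∈ M then 0 else thetaSign α M • LinearMap.proj (insert α M))

/-- The Pauli matrices. -/
def pauli : Fin 3 → Matrix (Fin 2) (Fin 2) ℂ :=
  ![!![0, 1; 1, 0], !![0, -Complex.I; Complex.I, 0], !![1, 0; 0, -1]]

/-- The even generators `J_i` of `osp(1|2)`, acting on polynomial superfunctions:
`-i ∑ ε_{ijk} x^j ∂_k + ½ ∑ (σ_i)_{αβ} θ^α ∂/∂θ^β` (indices of `Fin 3` are cyclic). -/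
def superJ (i : Fin 3) : Module.End ℂ SuperPoly :=
  (-Complex.I) • (mulX (i + 1) * derivX (i + 2) - mulX (i + 2) * derivX (i + 1))
    + (1 / 2 : ℂ) • ∑ α, ∑ β, pauli i α β • (mulTheta α * derivTheta β)

/-- The odd generators `J_4`, `J_5` (`α = 0, 1`) of `osp(1|2)`, acting on polynomial
superfunctions:
`½ ∑ (i x^k (σ_2 σ_k)_{αβ} ∂/∂θ^β - θ^β (σ_k)_{βα} ∂/∂x^k)`. -/
def superQ (α : Fin 2) : Module.End ℂ SuperPoly :=
  (1 / 2 : ℂ) • ∑ k : Fin 3, ∑ β,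
    ((Complex.I * (pauli 1 * pauli k) α β) • (mulX k * derivTheta β)
      - pauli k β α • (mulTheta β * derivX k))

/-- The lowering operator `J_- = J_1 - i J_2`. -/
def superJm : Module.End ℂ SuperPoly := superJ 0 - Complex.I • superJ 1

/-- For operators `T i` that represent generators of a Lie (super)algebra `g`, the cyclic
submodule `U(g) v`: the image of `U(g)` is the algebra generated by the operators. -/
def cyclic {ι M : Type} [AddCommGroup M] [Module ℂ M] (T : ι → Module.End ℂ M) (v : M) :
    Submodule ℂ M :=
  (Subalgebra.toSubmodule (Algebra.adjoin ℂ (Set.range T))).map (LinearMap.applyₗ v)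

/-- The polynomial `x¹ + i x²`. -/
def xPlus : MvPolynomial (Fin 3) ℂ :=
  MvPolynomial.X 0 + MvPolynomial.C Complex.I * MvPolynomial.X 1

/-- The normalized highest weight vector of superspin `j = n / 2`. With `n = 2 i` it is
`√((2i)!) / (2^i i! ρ^i) (x¹ + i x²)^i`, with `n = 2 i + 1` it is
`√((2i+1)!) / (2^i i! ρ^(i+2)) (x¹ + i x²)^i (x³ θ⁴ + (x¹ + i x²) θ⁵)`. -/
def superTop (ρ : ℝ) (n : ℕ) : SuperPoly :=
  if Even n then
    Pi.single ∅ (MvPolynomial.C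
      ((√(n.factorial) / (2 ^ (n / 2) * (n / 2).factorial * ρ ^ (n / 2)) : ℝ) : ℂ)
        * xPlus ^ (n / 2))
  else
    ((√(n.factorial) / (2 ^ (n / 2) * (n / 2).factorial * ρ ^ (n / 2 + 2)) : ℝ) : ℂ) •
      ((Pi.single {0} (xPlus ^ (n / 2) * MvPolynomial.X 2)
        + Pi.single {1} (xPlus ^ (n / 2) * xPlus) : SuperPoly))

/-- The normalization `√(4^(2(j-l)) Γ(l+m+1) / (Γ(2j+1) Γ(l-m+1)))`, written in terms of
`n = 2j`, `μ = 2(j-l)` and `k = l-m`. -/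
def normCoeff (n μ k : ℕ) : ℝ :=
  √(4 ^ μ * (n - μ - k).factorial / (n.factorial * k.factorial))

/-- The superspherical harmonic with superspin `j = n/2`, spin `l = j - μ/2` and magnetic
number `m = l - k`; here `μ ≤ 1` and `μ + k ≤ n`. -/
def superHarm (ρ : ℝ) (L n μ k : ℕ) : polySuper ρ L :=
  (normCoeff n μ k : ℂ) • projSuper ρ L ((superJm ^ k) ((superQ 1 ^ μ) (superTop ρ n)))

/-- The irreducible `osp(1|2)`-submodule of superspin `n/2` in `P(S_ρ)`. The action on the
supersphere is the action on representatives, so it is the projection of the submodule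
generated upstairs. -/
def superV (ρ : ℝ) (L n : ℕ) : Submodule ℂ (polySuper ρ L) :=
  (cyclic (Sum.elim superJ superQ) (superTop ρ n)).map (projSuper ρ L)

/-- The truncation `H_q`: the sum of the submodules of superspin `j ≤ q`, `j ∈ ½ℕ₀`. -/
def superTrunc (ρ : ℝ) (L q : ℕ) : Submodule ℂ (polySuper ρ L) :=
  ⨆ n : ℕ, ⨆ _ : n ≤ 2 * q, superV ρ L n

theorem superTrunc_mono (ρ : ℝ) (L : ℕ) : Monotone (superTrunc ρ L) := fun _ _ h =>
  iSup_mono fun _ => iSup_mono' fun hn => ⟨by omega, le_rfl⟩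

theorem superHarm_mem (ρ : ℝ) (L : ℕ) {q n : ℕ} (μ k : ℕ) (hn : n ≤ 2 * q) :
    superHarm ρ L n μ k ∈ superTrunc ρ L q := by
  refine Submodule.mem_iSup_of_mem n (Submodule.mem_iSup_of_mem hn ?_)
  refine Submodule.smul_mem _ _ (Submodule.mem_map_of_mem ?_)
  refine ⟨superJm ^ k * superQ 1 ^ μ, ?_, rfl⟩
  have hJ : ∀ i, superJ i ∈ Algebra.adjoin ℂ (Set.range (Sum.elim superJ superQ)) :=
    fun i => Algebra.subset_adjoin ⟨Sum.inl i, rfl⟩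
  have hQ : ∀ i, superQ i ∈ Algebra.adjoin ℂ (Set.range (Sum.elim superJ superQ)) :=
    fun i => Algebra.subset_adjoin ⟨Sum.inr i, rfl⟩
  exact Subalgebra.mul_mem _
    (Subalgebra.pow_mem _ (Subalgebra.sub_mem _ (hJ 0) (Subalgebra.smul_mem _ (hJ 1) _)) k)
    (Subalgebra.pow_mem _ (hQ 1) μ)

/-! ### Spherical harmonics and truncations on the ordinary sphere -/

/-- The angular momentum operators `-i ∑ ε_{ijk} x^j ∂_k` on polynomials. -/
def sphJ (i : Fin 3) : Module.End ℂ (MvPolynomial (Fin 3) ℂ) :=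
  (-Complex.I) •
    (LinearMap.mulLeft ℂ (MvPolynomial.X (i + 1)) * (MvPolynomial.pderiv (i + 2)).toLinearMap
      - LinearMap.mulLeft ℂ (MvPolynomial.X (i + 2)) *
          (MvPolynomial.pderiv (i + 1)).toLinearMap)

/-- The lowering operator `J_- = J_1 - i J_2`. -/
def sphJm : Module.End ℂ (MvPolynomial (Fin 3) ℂ) := sphJ 0 - Complex.I • sphJ 1

/-- The normalized highest weight spherical harmonic
`√((2j+1)!) / (2^j j! ρ^j) (x¹ + i x²)^j`. -/
def sphTop (ρ : ℝ) (j : ℕ) : MvPolynomial (Fin 3) ℂ :=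
  MvPolynomial.C ((√((2 * j + 1).factorial) / (2 ^ j * j.factorial * ρ ^ j) : ℝ) : ℂ)
    * xPlus ^ j

/-- The spherical harmonic with spin `j` and magnetic number `m = j - k`, `k ≤ 2j`. -/
def sphHarm (ρ : ℝ) (j k : ℕ) : polySphere ρ :=
  (normCoeff (2 * j) 0 k : ℂ) • projSphere ρ ((sphJm ^ k) (sphTop ρ j))

/-- The irreducible `sl(2)`-submodule of spin `j` in `P(S_ρ)`. -/
def sphV (ρ : ℝ) (j : ℕ) : Submodule ℂ (polySphere ρ) :=
  (cyclic sphJ (sphTop ρ j)).map (projSphere ρ)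

/-- The truncation `C_q`: the sum of the submodules of spin `j ≤ q`. -/
def sphTrunc (ρ : ℝ) (q : ℕ) : Submodule ℂ (polySphere ρ) :=
  ⨆ j : ℕ, ⨆ _ : j ≤ q, sphV ρ j

theorem sphTrunc_mono (ρ : ℝ) : Monotone (sphTrunc ρ) := fun _ _ h =>
  iSup_mono fun _ => iSup_mono' fun hn => ⟨by omega, le_rfl⟩

theorem sphHarm_mem (ρ : ℝ) {q j : ℕ} (k : ℕ) (hj : j ≤ q) :
    sphHarm ρ j k ∈ sphTrunc ρ q := by
  refine Submodule.mem_iSup_of_mem j (Submodule.mem_iSup_of_mem hj ?_)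
  refine Submodule.smul_mem _ _ (Submodule.mem_map_of_mem ?_)
  refine ⟨sphJm ^ k, ?_, rfl⟩
  have hJ : ∀ i, sphJ i ∈ Algebra.adjoin ℂ (Set.range sphJ) :=
    fun i => Algebra.subset_adjoin ⟨i, rfl⟩
  exact Subalgebra.pow_mem _
    (Subalgebra.sub_mem _ (hJ 0) (Subalgebra.smul_mem _ (hJ 1) _)) k

/-! ### The classical body map on polynomial superfunctions -/

theorem augment_gen {L : ℕ} (v : Fin L → ℂ) : augment L (ExteriorAlgebra.ι ℂ v) = 0 := by
  simp [augment, ExteriorAlgebra.algebraMapInv]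

theorem augment_odd {L : ℕ} {z : Grass L} (hz : z ∈ grassPart L 1) : augment L z = 0 := by
  refine CliffordAlgebra.odd_induction (0 : QuadraticForm ℂ (Fin L → ℂ))
    (P := fun z _ => augment L z = 0) ?_ ?_ ?_ z hz
  · intro v
    exact augment_gen v
  · intro a b _ _ ha hb
    rw [map_add, ha, hb, add_zero]
  · intro v w a _ ha
    rw [map_mul, ha, mul_zero]

theorem augment_real {L : ℕ} {z : Grass L} (hz : z ∈ realGrass L) :
    (((augment L z).re : ℝ) : ℂ) = augment L z := by
  have h : ∀ z ∈ realGrass L, (augment L z).im = 0 := by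
    intro z hz
    refine Algebra.adjoin_induction (p := fun z _ => (augment L z).im = 0)
      ?_ ?_ ?_ ?_ hz
    · rintro _ ⟨i, rfl⟩
      simp [augment_gen]
    · intro r
      have : algebraMap ℝ (Grass L) r = algebraMap ℂ (Grass L) (r : ℂ) := rfl
      rw [this, AlgHom.commutes]
      simp
    · intro a b _ _ ha hb
      simp [ha, hb]
    · intro a b _ _ ha hb
      simp [ha, hb]
  exact Complex.ext rfl (h z hz).symm

/-- The canonical inclusion of the sphere, the body of the supersphere, as the points without
soul: it is a section of the body projection. -/
def soulless (ρ : ℝ) (L : ℕ) (y : Sph ρ) : Supersphere ρ L :=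
  ⟨{ x := fun k => algebraMap ℝ (Grass L) (y.1 k)
     θ := fun _ => 0
     x_real := fun _ => Subalgebra.algebraMap_mem _ _
     x_even := fun k => by
      have h := (CliffordAlgebra.one_le_evenOdd_zero
        (0 : QuadraticForm ℂ (Fin L → ℂ))) (Submodule.algebraMap_mem ((y.1 k : ℝ) : ℂ))
      exact h
     θ_real := fun _ => Subalgebra.zero_mem _
     θ_odd := fun _ => Submodule.zero_mem _ }, by
    have h1 : ∑ k, (y.1 k) ^ 2 = ρ ^ 2 := by
      have h := y.2
      rw [mem_sphere_zero_iff_norm] at h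
      have h4 := EuclideanSpace.norm_sq_eq y.1
      rw [h] at h4
      simp [h4]
    have h2 : algebraMap ℂ (Grass L) ((ρ : ℂ) ^ 2) = algebraMap ℝ (Grass L) (ρ ^ 2) := by
      have : algebraMap ℝ (Grass L) (ρ ^ 2) = algebraMap ℂ (Grass L) ((ρ ^ 2 : ℝ) : ℂ) := rfl
      rw [this]
      push_cast
      rfl
    rw [h2, ← h1]
    simp⟩

theorem augment_evalEven {L : ℕ} (p : Superspace L) (F : MvPolynomial (Fin 3) ℂ) :
    augment L (evalEven p F) = MvPolynomial.aeval (fun k => ((p.body k : ℝ) : ℂ)) F := by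
  have h : (augment L).toLinearMap.comp (evalEven p)
      = (MvPolynomial.aeval (fun k => ((p.body k : ℝ) : ℂ))).toLinearMap := by
    refine (MvPolynomial.basisMonomials (Fin 3) ℂ).ext fun m => ?_
    have hb : ∀ k, ((p.body k : ℝ) : ℂ) = augment L (p.x k) := fun k =>
      augment_real (p.x_real k)
    have h3 : (evalEven p) ((MvPolynomial.basisMonomials (Fin 3) ℂ) m)
        = p.x 0 ^ m 0 * p.x 1 ^ m 1 * p.x 2 ^ m 2 := Module.Basis.constr_basis ..
    rw [LinearMap.comp_apply, h3]
    simp only [AlgHom.toLinearMap_apply, hb, map_mul, map_pow,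
      MvPolynomial.coe_basisMonomials, MvPolynomial.aeval_monomial, map_one, one_mul]
    rw [Finsupp.prod_fintype _ _ (fun _ => pow_zero _), Fin.prod_univ_three]
  exact congrArg (fun T => T F) h

theorem augment_evalSuper {L : ℕ} (p : Superspace L) (F : SuperPoly) :
    augment L (evalSuper p F) = MvPolynomial.aeval (fun k => ((p.body k : ℝ) : ℂ)) (F ∅) := by
  have h : ∀ M : Finset (Fin 2), augment L (thetaProd p M) = if M = ∅ then 1 else 0 := by
    intro M
    have h0 := augment_odd (p.θ_odd 0)
    have h1 := augment_odd (p.θ_odd 1)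
    by_cases a : (0 : Fin 2) ∈ M
    · have : M ≠ ∅ := fun h => by simp [h] at a
      rw [thetaProd, if_pos a, map_mul, h0, zero_mul, if_neg this]
    · by_cases b : (1 : Fin 2) ∈ M
      · have : M ≠ ∅ := fun h => by simp [h] at b
        rw [thetaProd, if_pos b, map_mul, h1, mul_zero, if_neg this]
      · have : M = ∅ := by
          ext i
          fin_cases i <;> simp [a, b]
        simp [thetaProd, this]
  simp only [evalSuper, LinearMap.sum_apply, LinearMap.comp_apply, LinearMap.mulRight_apply,
    map_sum, map_mul, h, LinearMap.proj_apply]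
  simp [augment_evalEven]

theorem polyOnSphere_apply (ρ : ℝ) (F : MvPolynomial (Fin 3) ℂ) (y : Sph ρ) :
    SmoothSphere.val ρ (polyOnSphere ρ F) y
      = MvPolynomial.aeval (fun k => ((y.1 k : ℝ) : ℂ)) F := by
  have h : ((Pi.evalAlgHom ℂ (fun _ : Sph ρ => ℂ) y).comp
      ((SmoothSphere.val ρ).comp (polyOnSphere ρ)))
      = MvPolynomial.aeval (fun k => ((y.1 k : ℝ) : ℂ)) := by
    refine MvPolynomial.algHom_ext fun k => ?_
    simp only [AlgHom.comp_apply, polyOnSphere, MvPolynomial.aeval_X]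
    rfl
  exact congrArg (fun T => T F) h

/-- The body map `(β f)(y) = ε(f(y))`, on arbitrary functions on the supersphere. -/
def bodyFun (ρ : ℝ) (L : ℕ) : (Supersphere ρ L → Grass L) →ₗ[ℂ] (Sph ρ → ℂ) :=
  LinearMap.pi (fun y => (augment L).toLinearMap.comp (LinearMap.proj (soulless ρ L y)))

theorem soulless_body (ρ : ℝ) (L : ℕ) (y : Sph ρ) : (soulless ρ L y).1.body = y.1 := by
  ext k
  have : (soulless ρ L y).1.x k = algebraMap ℂ (Grass L) ((y.1 k : ℝ) : ℂ) := rfl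
  simp [Superspace.body, this]

theorem bodyFun_proj (ρ : ℝ) (L : ℕ) (F : SuperPoly) :
    bodyFun ρ L (restrictSuper ρ L F) = SmoothSphere.val ρ (polyOnSphere ρ (F ∅)) := by
  funext y
  rw [polyOnSphere_apply]
  have h := augment_evalSuper (soulless ρ L y).1 F
  rw [soulless_body] at h
  exact h

/-- The classical body map, restricted to polynomial superfunctions on the supersphere. -/
def bodyMap (ρ : ℝ) (L : ℕ) : polySuper ρ L →ₗ[ℂ] polySphere ρ where
  toFun f := ⟨⟨bodyFun ρ L f.1, by
      obtain ⟨f, F, rfl⟩ := f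
      rw [bodyFun_proj]
      exact (polyOnSphere ρ (F ∅)).2⟩, by
      obtain ⟨f, F, rfl⟩ := f
      exact ⟨F ∅, Subtype.ext (bodyFun_proj ρ L F).symm⟩⟩
  map_add' f g := Subtype.ext (Subtype.ext ((bodyFun ρ L).map_add f.1 g.1))
  map_smul' c f := Subtype.ext (Subtype.ext ((bodyFun ρ L).map_smul c f.1))

/-- The defining property `(β f)(Φ p) = ε(f p)` of the body map, at every point `p` of the
supersphere with body `y`. -/
theorem bodyMap_apply (ρ : ℝ) (L : ℕ) (f : polySuper ρ L) (p : Supersphere ρ L) (y : Sph ρ)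
    (h : p.1.body = y.1) :
    SmoothSphere.val ρ (bodyMap ρ L f : SmoothSphere ρ) y = augment L (f.1 p) := by
  obtain ⟨f, F, rfl⟩ := f
  have h1 : SmoothSphere.val ρ (bodyMap ρ L ⟨restrictSuper ρ L F, F, rfl⟩ : SmoothSphere ρ)
      = bodyFun ρ L (restrictSuper ρ L F) := rfl
  rw [h1, bodyFun_proj, polyOnSphere_apply, ← h]
  exact (augment_evalSuper p.1 F).symm

/-! ### The irreducible representations and the truncated (super)spheres -/

/-- `J_+` on the irreducible `sl(2)`-module of dimension `N` (spin `l = (N - 1)/2`), in the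
basis `e_m`; the `i`-th basis vector has `m = l - i`. -/
def spinP (N : ℕ) : Matrix (Fin N) (Fin N) ℂ :=
  Matrix.of fun a b => if (a : ℕ) + 1 = b then ((√((b : ℝ) * (N - b)) : ℝ) : ℂ) else 0

/-- `J_-` on the irreducible `sl(2)`-module of dimension `N`. -/
def spinM (N : ℕ) : Matrix (Fin N) (Fin N) ℂ :=
  Matrix.of fun a b => if (a : ℕ) = b + 1 then ((√((a : ℝ) * (N - a)) : ℝ) : ℂ) else 0

/-- `J_3` on the irreducible `sl(2)`-module of dimension `N`. -/
def spinZ (N : ℕ) : Matrix (Fin N) (Fin N) ℂ :=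
  Matrix.diagonal fun a => ((N : ℂ) - 1) / 2 - (a : ℕ)

/-- The Cartesian generators `J_1`, `J_2`, `J_3` out of `J_+`, `J_-`, `J_3`. -/
def cartesian {A : Type} [AddCommGroup A] [Module ℂ A] (P M Z : A) : Fin 3 → A :=
  ![(1 / 2 : ℂ) • (P + M), (-Complex.I / 2) • (P - M), Z]

/-- The truncated sphere: the endomorphisms of the irreducible `sl(2)`-module of spin `q/2`. -/
abbrev NSp (q : ℕ) : Type := Matrix (Fin (q + 1)) (Fin (q + 1)) ℂ

/-- The truncated supersphere: the endomorphisms of the irreducible `osp(1|2)`-module of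
superspin `q/2` with odd highest weight vector. The basis consists of the `q + 1` vectors
of spin `q/2` (odd) and of the `q` vectors of spin `(q-1)/2` (even). -/
abbrev NSs (q : ℕ) : Type := Matrix (Fin (q + 1) ⊕ Fin q) (Fin (q + 1) ⊕ Fin q) ℂ

/-- `J_+` in the superspin `q/2` representation. -/
def ospP (q : ℕ) : NSs q := Matrix.fromBlocks (spinP (q + 1)) 0 0 (spinP q)

/-- `J_-` in the superspin `q/2` representation. -/
def ospM (q : ℕ) : NSs q := Matrix.fromBlocks (spinM (q + 1)) 0 0 (spinM q)

/-- `J_3` in the superspin `q/2` representation. -/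
def ospZ (q : ℕ) : NSs q := Matrix.fromBlocks (spinZ (q + 1)) 0 0 (spinZ q)

/-- `J_4` in the superspin `q/2` representation:
`e_{j,m} ↦ -½ √(j-m) e_{j-1/2,m+1/2}` and `e_{j-1/2,m} ↦ -½ √(j+m+1/2) e_{j,m+1/2}`. -/
def ospQ4 (q : ℕ) : NSs q :=
  Matrix.fromBlocks 0
    (Matrix.of fun a b => if (a : ℕ) = b then ((-(1 / 2) * √((q : ℝ) - b) : ℝ) : ℂ) else 0)
    (Matrix.of fun a b => if (a : ℕ) + 1 = b then ((-(1 / 2) * √(b : ℝ) : ℝ) : ℂ) else 0)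
    0

/-- `J_5` in the superspin `q/2` representation:
`e_{j,m} ↦ ½ √(j+m) e_{j-1/2,m-1/2}` and `e_{j-1/2,m} ↦ -½ √(j-m+1/2) e_{j,m-1/2}`. -/
def ospQ5 (q : ℕ) : NSs q :=
  Matrix.fromBlocks 0
    (Matrix.of fun a b => if (a : ℕ) = b + 1 then ((-(1 / 2) * √(a : ℝ) : ℝ) : ℂ) else 0)
    (Matrix.of fun a b => if (a : ℕ) = b then ((1 / 2 * √((q : ℝ) - b) : ℝ) : ℂ) else 0)
    0

/-- The generators `J_1`, `J_2`, `J_3` in the superspin `q/2` representation. -/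
def ospJ (q : ℕ) : Fin 3 → NSs q := cartesian (ospP q) (ospM q) (ospZ q)

/-- The generators `J_1`, `J_2`, `J_3` in the spin `q/2` representation. -/
def spinJ (q : ℕ) : Fin 3 → NSp q :=
  cartesian (spinP (q + 1)) (spinM (q + 1)) (spinZ (q + 1))

/-- The parity automorphism `f ↦ (-1)^{|f|} f` of the truncated supersphere. -/
def parity (q : ℕ) (f : NSs q) : NSs q :=
  Matrix.fromBlocks 1 0 0 (-1) * f * Matrix.fromBlocks 1 0 0 (-1)

/-- The graded commutator `[J, f]` with an odd element `J`. -/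
def oddComm (q : ℕ) (J f : NSs q) : NSs q := J * f - parity q f * J

/-- The commutator `[J, f]`, which is the graded one for even `J`. -/
def evenComm {A : Type} [Ring A] (J f : A) : A := J * f - f * J

/-- The normalized highest weight vector of superspin `j = n/2 ≤ q` for the adjoint action on
the truncated supersphere. With `n = 2 i` it is
`√(2^i (2i-1)!! (q-i)! / (i! (q+i)!)) J_+^i`, with `n = 2 i + 1` it is
`(q+1/2)⁻¹ √(2^(i+4) (2i+1)!! (q-i-1)! / (i! (q+i+1)!)) J_+^i ((J_3 - 3/4) J_4 + J_+ J_5)`. -/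
def ncSuperTop (q n : ℕ) : NSs q :=
  if Even n then
    ((√(2 ^ (n / 2) * (n - 1).doubleFactorial * (q - n / 2).factorial /
      ((n / 2).factorial * (q + n / 2).factorial)) : ℝ) : ℂ) • ospP q ^ (n / 2)
  else
    ((((q : ℝ) + 1 / 2)⁻¹ * √(2 ^ (n / 2 + 4) * n.doubleFactorial * (q - n / 2 - 1).factorial /
      ((n / 2).factorial * (q + n / 2 + 1).factorial)) : ℝ) : ℂ) •
        (ospP q ^ (n / 2) * ((ospZ q - (3 / 4 : ℂ) • 1) * ospQ4 q + ospP q * ospQ5 q))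

/-- The noncommutative superspherical harmonic with superspin `n/2`, spin `l = (n-μ)/2` and
magnetic number `l - k`. -/
def ncSuperHarm (q n μ k : ℕ) : NSs q :=
  (normCoeff n μ k : ℂ) • (evenComm (ospM q))^[k] ((oddComm q (ospQ5 q))^[μ] (ncSuperTop q n))

/-- The normalized highest weight vector of spin `j ≤ q` for the adjoint action on the
truncated sphere. -/
def ncSphTop (q j : ℕ) : NSp q :=
  ((√(2 ^ j * (2 * j + 1).doubleFactorial * (q + 1) * (q - j).factorial /
    (j.factorial * (q + j + 1).factorial)) : ℝ) : ℂ) • spinP (q + 1) ^ j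

/-- The noncommutative spherical harmonic with spin `j` and magnetic number `j - k`. -/
def ncSphHarm (q j k : ℕ) : NSp q :=
  (normCoeff (2 * j) 0 k : ℂ) • (evenComm (spinM (q + 1)))^[k] (ncSphTop q j)

/-- The defining property of `ψ_q`: superspherical harmonics of superspin at most `q` go to the
corresponding noncommutative ones. -/
def IsPsi {ρ : ℝ} {L q : ℕ} (ψ : superTrunc ρ L q ≃ₗ[ℂ] NSs q) : Prop :=
  ∀ (n μ k : ℕ) (hn : n ≤ 2 * q), μ ≤ 1 → μ + k ≤ n →
    ψ ⟨superHarm ρ L n μ k, superHarm_mem ρ L μ k hn⟩ = ncSuperHarm q n μ k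

/-- The defining property of the map `ψ_q` of the ordinary sphere. -/
def IsPsiHat {ρ : ℝ} {q : ℕ} (φ : sphTrunc ρ q ≃ₗ[ℂ] NSp q) : Prop :=
  ∀ (j k : ℕ) (hj : j ≤ q), k ≤ 2 * j →
    φ ⟨sphHarm ρ j k, sphHarm_mem ρ k hj⟩ = ncSphHarm q j k

/-! ### Directed systems and noncommutative body maps -/

section Systems

variable {M : Type} [AddCommGroup M] [Module ℂ M] {W : ℕ → Submodule ℂ M} {A : ℕ → Type}
  [∀ q, AddCommGroup (A q)] [∀ q, Module ℂ (A q)]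

/-- The maps `η_{r q} = ψ_r ∘ ι_{r q} ∘ ψ_q⁻¹` of the directed system obtained by transporting
the inclusions of an increasing sequence of subspaces. -/
def transition (hW : Monotone W) (ψ : ∀ q, W q ≃ₗ[ℂ] A q) (q r : ℕ) (h : q ≤ r) :
    A q →ₗ[ℂ] A r :=
  (ψ r).toLinearMap.comp ((Submodule.inclusion (hW h)).comp (ψ q).symm.toLinearMap)

/-- The limit homomorphisms `η_q = ι_q ∘ ψ_q⁻¹`. -/
def limitHom (ψ : ∀ q, W q ≃ₗ[ℂ] A q) (q : ℕ) : A q →ₗ[ℂ] M :=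
  (W q).subtype.comp (ψ q).symm.toLinearMap

theorem limitHom_transition (hW : Monotone W) (ψ : ∀ q, W q ≃ₗ[ℂ] A q) (q r : ℕ) (h : q ≤ r)
    (a : A q) : limitHom ψ r (transition hW ψ q r h a) = limitHom ψ q a := by
  simp [limitHom, transition]

instance directedSystem (hW : Monotone W) (ψ : ∀ q, W q ≃ₗ[ℂ] A q) :
    DirectedSystem A (fun q r h => transition hW ψ q r h) where
  map_self q x := by
    have : Submodule.inclusion (hW (le_refl q)) ((ψ q).symm x) = (ψ q).symm x := rfl
    simp [transition, this]
  map_map i j k hij hjk x := by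
    simp only [transition, LinearMap.comp_apply, LinearEquiv.coe_coe,
      LinearEquiv.symm_apply_apply]
    rfl

/-- The map from the direct limit of the system to the ambient space, induced by the limit
homomorphisms. -/
def fromLimit (hW : Monotone W) (ψ : ∀ q, W q ≃ₗ[ℂ] A q) :
    Module.DirectLimit A (transition hW ψ) →ₗ[ℂ] M :=
  Module.DirectLimit.lift ℂ ℕ A (transition hW ψ) (limitHom ψ) (limitHom_transition hW ψ)

end Systems

section Body

variable {ρ : ℝ} {L : ℕ}

/-- The noncommutative body map `β_q = φ_q ∘ β ∘ ψ_q⁻¹`, where `φ_q` is the map of the ordinary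
sphere. -/
def ncBody (hβ : ∀ q, ∀ f ∈ superTrunc ρ L q, bodyMap ρ L f ∈ sphTrunc ρ q)
    (ψ : ∀ q, superTrunc ρ L q ≃ₗ[ℂ] NSs q) (φ : ∀ q, sphTrunc ρ q ≃ₗ[ℂ] NSp q) (q : ℕ) :
    NSs q →ₗ[ℂ] NSp q :=
  (φ q).toLinearMap.comp (((bodyMap ρ L).restrict (hβ q)).comp (ψ q).symm.toLinearMap)

/-- The product `(f g)_q = ψ_q⁻¹(ψ_q(f) ψ_q(g))` of the fuzzy sphere at level `q`, viewed in
`C^∞(S_ρ, ℂ)`. -/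
def fuzzyProd (φ : ∀ q, sphTrunc ρ q ≃ₗ[ℂ] NSp q) (q : ℕ) (f g : sphTrunc ρ q) :
    SmoothSphere ρ :=
  (limitHom φ q (φ q f * φ q g) : polySphere ρ)

end Body

end

end FuzzySupersphere

open FuzzySupersphere

/-! Both sides of `ψ_q` decompose under the even subalgebra `sl(2)` into ladders: a highest weight
vector `v` of spin `l/2` together with `J_-^k v` for `k ≤ l`. A superspin `n/2` module consists of
two ladders, one through its top vector and one through `J_5` applied to it. Up to level `q` these
ladders have `(2q+1)^2` rungs in total, which is the dimension of `NSs q`, so `ψ_q` exists as soon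
as the rungs are independent on both sides. Raising operators reduce this to the independence of the
highest weight vectors (`ladder_independent`), the eigenvalue of `J_3` separates the spins
(`pair_independent`), and a direct computation settles the at most two vectors of each spin
(`sTop_pair_independent`, `nTop_pair`). A linear map that matches ladders is automatically
equivariant (`intertwine`), and parity acts on matching ladders by the same sign. This gives the
statements on the systems; the body map respects the truncations because it takes every ladder to
zero or to a multiple of a ladder of `(x¹ + i x²)^j`.

For the limits, put `h = 2ρ/(q+1)`. The matrices `h J_+`, `h J_3`, `h J_-` satisfy the relations of
the coordinates `x¹ + i x²`, `x³`, `x¹ - i x²` up to terms that vanish with `h`: their commutators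
carry a factor `h`, and the Casimir relation becomes the equation of the sphere with `ρ² - h²/4` in
place of `ρ²`. Hence a coordinate times a rung is a combination of rungs, by one formula valid for
matrices at every `q` and, with `h = 0`, for polynomials. The space `Symbols.symbols` of pairs
(sequence of matrices, polynomial) generated by rungs with convergent coefficients is therefore
closed under products. Reading only the polynomial components shows that the ladders span all
polynomials modulo the equation of the sphere, which yields exhaustion by the truncations. Reading
the matrices, a sequence of linear maps that converges on rungs converges on every product; the
normalizations are such that `φ_q⁻¹` converges in this sense to the identity.

On the supersphere `ψ_q(f)` splits into a block diagonal part and an off-diagonal part. Both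
diagonal blocks have the body of `f` as symbol. The off-diagonal part is a combination of
`J_4/(q+1)` and `J_5/(q+1)` with block diagonal coefficients that have symbols; since products of
two odd generators are of order `q`, products of two off-diagonal parts have symbol zero, and mixed
products are odd and have no body. Finally, `body_blocks` shows that the body of a matrix supported
on a single diagonal block tends to half of its symbol. The two halves add up to the product of the
bodies. -/

set_option linter.unusedSimpArgs false

namespace FuzzySupersphere
noncomputable section

/-! ### Abstract `sl(2)` and `osp(1|2)` relations -/

section Relations

variable {A : Type*} [Ring A] [Algebra ℂ A]

/-- The commutation relations of `J_+`, `J_-`, `J_3` in an associative algebra. -/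
structure IsSl2 (P M Z : A) : Prop where
  zp : Z * P - P * Z = P
  zm : Z * M - M * Z = -M
  pm : P * M - M * P = (2 : ℂ) • Z

/-- The relations of `J_+`, `J_-`, `J_3`, `J_4`, `J_5` in an associative superalgebra. -/
structure IsOsp (P M Z Q R : A) : Prop where
  qq : Q * Q = (1 / 4 : ℂ) • P
  rr : R * R = (-1 / 4 : ℂ) • M
  qr : Q * R + R * Q = (-1 / 2 : ℂ) • Z
  zq : Z * Q - Q * Z = (1 / 2 : ℂ) • Q
  zr : Z * R - R * Z = (-1 / 2 : ℂ) • R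

namespace IsOsp

variable {P M Z Q R : A}

/-- The even generators `P` and `M` are multiples of squares of odd ones. This is why five relations
suffice: everything else follows by commuting with squares. -/
theorem p_eq (h : IsOsp P M Z Q R) : P = (4 : ℂ) • (Q * Q) := by
  rw [h.qq, smul_smul]; norm_num

theorem m_eq (h : IsOsp P M Z Q R) : M = (-4 : ℂ) • (R * R) := by
  rw [h.rr, smul_smul]; norm_num

/-- The commutator of `Q²` with `R` is the commutator of `Q` with the anticommutator of `Q` and `R`,
which is a multiple of `Z`. -/
theorem pr (h : IsOsp P M Z Q R) : P * R - R * P = Q := by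
  have e : Q * Q * R - R * (Q * Q) = Q * (Q * R + R * Q) - (Q * R + R * Q) * Q := by noncomm_ring
  have e2 : Q * Q * R - R * (Q * Q) = (1 / 2 : ℂ) • (Z * Q - Q * Z) := by
    rw [e, h.qr, mul_smul_comm, smul_mul_assoc]; module
  rw [h.p_eq, smul_mul_assoc, mul_smul_comm, ← smul_sub, e2, h.zq]
  module

theorem mq (h : IsOsp P M Z Q R) : M * Q - Q * M = R := by
  have e : R * R * Q - Q * (R * R) = R * (Q * R + R * Q) - (Q * R + R * Q) * R := by noncomm_ring
  have e2 : R * R * Q - Q * (R * R) = (1 / 2 : ℂ) • (Z * R - R * Z) := by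
    rw [e, h.qr, mul_smul_comm, smul_mul_assoc]; module
  rw [h.m_eq, smul_mul_assoc, mul_smul_comm, ← smul_sub, e2, h.zr]
  module

theorem comm_pq (h : IsOsp P M Z Q R) : Commute P Q := by
  have : P * Q = Q * P := by
    rw [h.p_eq, smul_mul_assoc, mul_smul_comm, mul_assoc]
  exact this

theorem comm_mr (h : IsOsp P M Z Q R) : Commute M R := by
  have : M * R = R * M := by
    rw [h.m_eq, smul_mul_assoc, mul_smul_comm, mul_assoc]
  exact this

theorem isSl2 (h : IsOsp P M Z Q R) : IsSl2 P M Z where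
  zp := by
    have e : Z * (Q * Q) - Q * Q * Z = (Z * Q - Q * Z) * Q + Q * (Z * Q - Q * Z) := by noncomm_ring
    rw [h.zq] at e
    conv_lhs => rw [h.p_eq, smul_mul_assoc, mul_smul_comm, ← smul_sub, e]
    rw [h.p_eq, smul_mul_assoc, mul_smul_comm]
    module
  zm := by
    have e : Z * (R * R) - R * R * Z = (Z * R - R * Z) * R + R * (Z * R - R * Z) := by noncomm_ring
    rw [h.zr] at e
    conv_lhs => rw [h.m_eq, smul_mul_assoc, mul_smul_comm, ← smul_sub, e]
    rw [h.m_eq, smul_mul_assoc, mul_smul_comm]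
    module
  pm := by
    have e : P * (R * R) - R * R * P = (P * R - R * P) * R + R * (P * R - R * P) := by noncomm_ring
    rw [h.pr, h.qr] at e
    rw [h.m_eq, smul_mul_assoc, mul_smul_comm, ← smul_sub, e]
    module

end IsOsp

/-- The commutator with a fixed element, as a linear map. -/
def adE (J : A) : Module.End ℂ A := LinearMap.mulLeft ℂ J - LinearMap.mulRight ℂ J

theorem adE_apply (J f : A) : adE J f = J * f - f * J := rfl

theorem adE_mul (J f g : A) : adE J (f * g) = adE J f * g + f * adE J g := by
  simp only [adE_apply]; noncomm_ring

/-- The Jacobi identity. -/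
theorem IsSl2.ad {P M Z : A} (h : IsSl2 P M Z) : IsSl2 (adE P) (adE M) (adE Z) where
  zp := by
    ext f
    have e : Z * (P * f - f * P) - (P * f - f * P) * Z - (P * (Z * f - f * Z) - (Z * f - f * Z) * P)
      = (Z * P - P * Z) * f - f * (Z * P - P * Z) := by noncomm_ring
    simp only [LinearMap.sub_apply, Module.End.mul_apply, adE_apply, e, h.zp]
  zm := by
    ext f
    have e : Z * (M * f - f * M) - (M * f - f * M) * Z - (M * (Z * f - f * Z) - (Z * f - f * Z) * M)
      = (Z * M - M * Z) * f - f * (Z * M - M * Z) := by noncomm_ring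
    simp only [LinearMap.sub_apply, Module.End.mul_apply, adE_apply, e, h.zm, LinearMap.neg_apply]
    noncomm_ring
  pm := by
    ext f
    have e : P * (M * f - f * M) - (M * f - f * M) * P - (M * (P * f - f * P) - (P * f - f * P) * M)
      = (P * M - M * P) * f - f * (P * M - M * P) := by noncomm_ring
    simp only [LinearMap.sub_apply, Module.End.mul_apply, adE_apply, e, h.pm, LinearMap.smul_apply,
      smul_mul_assoc, mul_smul_comm, smul_sub]

/-- Left and right multiplication by `J` are commuting nilpotent maps, so their difference is
nilpotent. -/
theorem adE_nilpotent {J : A} (h : IsNilpotent J) : IsNilpotent (adE J) := by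
  have hc : Commute (LinearMap.mulLeft ℂ J) (LinearMap.mulRight ℂ J) :=
    LinearMap.commute_mulLeft_right J J
  refine hc.isNilpotent_sub ?_ ?_
  · obtain ⟨n, hn⟩ := h
    exact ⟨n, by ext x; simp [LinearMap.pow_mulLeft, hn]⟩
  · obtain ⟨n, hn⟩ := h
    exact ⟨n, by ext x; simp [LinearMap.pow_mulRight, hn]⟩

end Relations

/-! ### Highest weight vectors and their ladders -/

section Ladder

variable {V : Type*} [AddCommGroup V] [Module ℂ V]

/-- `v` is a highest weight vector of spin `l / 2`, on which `J_-` acts nilpotently. -/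
structure IsTop (P M Z : Module.End ℂ V) (l : ℕ) (v : V) : Prop where
  p : P v = 0
  z : Z v = ((l : ℂ) / 2) • v
  nil : ∃ N : ℕ, (M ^ N) v = 0

variable {P M Z : Module.End ℂ V}

theorem IsSl2.zm_apply (h : IsSl2 P M Z) (v : V) : Z (M v) = M (Z v) - M v := by
  have e := congrArg (fun T : Module.End ℂ V => T v) h.zm
  simp only [LinearMap.sub_apply, Module.End.mul_apply, LinearMap.neg_apply] at e
  rw [sub_eq_iff_eq_add] at e
  rw [e]; abel

theorem IsSl2.pm_apply (h : IsSl2 P M Z) (v : V) : P (M v) = M (P v) + (2 : ℂ) • Z v := by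
  have e := congrArg (fun T : Module.End ℂ V => T v) h.pm
  simp only [LinearMap.sub_apply, Module.End.mul_apply, LinearMap.smul_apply] at e
  rw [sub_eq_iff_eq_add] at e
  rw [e]; abel

namespace IsTop

variable {l : ℕ} {v : V}

theorem smul (hv : IsTop P M Z l v) (c : ℂ) : IsTop P M Z l (c • v) where
  p := by rw [map_smul, hv.p, smul_zero]
  z := by rw [map_smul, hv.z, smul_comm]
  nil := hv.nil.imp fun N hN => by rw [map_smul, hN, smul_zero]

theorem z_pow (h : IsSl2 P M Z) (hv : IsTop P M Z l v) (k : ℕ) : Z ((M ^ k) v) = ((l : ℂ) / 2 - k) • (M ^ k) v := by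
  induction k with
  | zero => simpa using hv.z
  | succ k ih =>
    rw [pow_succ', Module.End.mul_apply, h.zm_apply, ih, map_smul]
    push_cast
    module

theorem p_pow (h : IsSl2 P M Z) (hv : IsTop P M Z l v) (k : ℕ) :
    P ((M ^ (k + 1)) v) = (((k : ℂ) + 1) * ((l : ℂ) - k)) • (M ^ k) v := by
  induction k with
  | zero =>
    simp only [zero_add, pow_one, pow_zero, Module.End.one_apply]
    rw [h.pm_apply, hv.p, map_zero, hv.z]
    push_cast
    module
  | succ k ih =>
    rw [pow_succ', Module.End.mul_apply, h.pm_apply, ih, hv.z_pow h, map_smul,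
      ← Module.End.mul_apply, ← pow_succ']
    push_cast
    module

/-- Local nilpotency replaces finite dimensionality here, since spaces of polynomials are infinite
dimensional. -/
theorem pow_succ_eq_zero (h : IsSl2 P M Z) (hv : IsTop P M Z l v) : (M ^ (l + 1)) v = 0 := by
  classical
  by_cases h0 : v = 0
  · rw [h0, map_zero]
  have hN := Nat.find_spec hv.nil
  set N := Nat.find hv.nil with hNdef
  obtain ⟨k, hk⟩ : ∃ k, N = k + 1 := by
    refine Nat.exists_eq_succ_of_ne_zero fun h1 => h0 ?_
    rw [h1] at hN
    simpa using hN
  have hne : (M ^ k) v ≠ 0 := Nat.find_min hv.nil (by omega)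
  -- With `N = k + 1` minimal, raising `M^N v = 0` gives `(k+1)(l-k) M^k v = 0` with `M^k v ≠ 0`,
  -- which forces `k = l`.
  have e := hv.p_pow h k
  rw [← hk, hN, map_zero] at e
  rcases smul_eq_zero.1 e.symm with e | e
  · rcases mul_eq_zero.1 e with e | e
    · exact absurd e (Nat.cast_add_one_ne_zero k)
    · have : l = k := by exact_mod_cast sub_eq_zero.1 e
      rw [this, ← hk, hN]
  · exact absurd e hne

theorem pow_eq_zero (h : IsSl2 P M Z) (hv : IsTop P M Z l v) {k : ℕ} (hk : l < k) : (M ^ k) v = 0 := by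
  obtain ⟨m, rfl⟩ := Nat.exists_eq_add_of_le hk
  rw [add_comm, pow_add, Module.End.mul_apply, hv.pow_succ_eq_zero h, map_zero]

/-- Together with `p_pow_pow_of_lt` this makes `P^K` a detector for rung `K`: it returns the top
vector from rung `K` and kills the rungs above it, those with `k < K`. -/
theorem p_pow_pow (h : IsSl2 P M Z) (hv : IsTop P M Z l v) (k : ℕ) (hk : k ≤ l) : ∃ c : ℂ, c ≠ 0 ∧ (P ^ k) ((M ^ k) v) = c • v := by
  induction k with
  | zero => exact ⟨1, one_ne_zero, by simp⟩
  | succ k ih =>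
    obtain ⟨c, hc, e⟩ := ih (by omega)
    refine ⟨((k : ℂ) + 1) * ((l : ℂ) - k) * c, ?_, ?_⟩
    · refine mul_ne_zero (mul_ne_zero (Nat.cast_add_one_ne_zero k) ?_) hc
      rw [sub_ne_zero]
      exact_mod_cast (by omega : l ≠ k)
    · rw [pow_succ, Module.End.mul_apply, hv.p_pow h, map_smul, e, smul_smul]

theorem p_pow_pow_of_lt (h : IsSl2 P M Z) (hv : IsTop P M Z l v) {k K : ℕ} (hk : k < K) : (P ^ K) ((M ^ k) v) = 0 := by
  induction k generalizing K with
  | zero =>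
    obtain ⟨m, rfl⟩ := Nat.exists_eq_add_of_le hk
    rw [add_comm, pow_add, pow_zero, Module.End.one_apply, Module.End.mul_apply, Nat.succ_eq_add_one,
      zero_add, pow_one, hv.p, map_zero]
  | succ k ih =>
    obtain ⟨m, rfl⟩ : ∃ m, K = m + 1 := ⟨K - 1, by omega⟩
    rw [pow_succ, Module.End.mul_apply, hv.p_pow h, map_smul, ih (by omega), smul_zero]

end IsTop

theorem pow_apply_mem {P : Module.End ℂ V} {N : Submodule ℂ V} (hN : ∀ x ∈ N, P x ∈ N) (k : ℕ)
    {x : V} (hx : x ∈ N) : (P ^ k) x ∈ N := by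
  induction k with
  | zero => simpa
  | succ k ih => rw [pow_succ', Module.End.mul_apply]; exact hN _ ih

/-- If highest weight vectors are independent modulo an invariant subspace, then so are the
vectors of their ladders. -/
theorem ladder_independent {ι : Type*} [Fintype ι] (h : IsSl2 P M Z) {N : Submodule ℂ V}
    (hN : ∀ x ∈ N, P x ∈ N) {l : ι → ℕ} {v : ι → V} (hv : ∀ i, IsTop P M Z (l i) (v i))
    (hind : ∀ c : ι → ℂ, ∑ i, c i • v i ∈ N → ∀ i, c i = 0)
    (g : (Σ i, Fin (l i + 1)) → ℂ) (hg : ∑ t, g t • (M ^ (t.2 : ℕ)) (v t.1) ∈ N) : ∀ t, g t = 0 := by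
  classical
  by_contra! hne
  obtain ⟨t0, ht0⟩ := hne
  -- Among the nonzero coefficients one with the largest number of lowerings `K` is chosen. Applying
  -- `P^K` then leaves a relation between top vectors only.
  obtain ⟨t, ht, hmax⟩ := Finset.exists_max_image (Finset.univ.filter fun t => g t ≠ 0)
    (fun t => (t.2 : ℕ)) ⟨t0, by simpa using ht0⟩
  rw [Finset.mem_filter] at ht
  set K : ℕ := (t.2 : ℕ) with hK
  have hc : ∀ i, ∃ c : ℂ, (K ≤ l i → c ≠ 0) ∧ (K ≤ l i → (P ^ K) ((M ^ K) (v i)) = c • v i) := by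
    intro i
    by_cases hi : K ≤ l i
    · obtain ⟨c, h1, h2⟩ := (hv i).p_pow_pow h K hi
      exact ⟨c, fun _ => h1, fun _ => h2⟩
    · exact ⟨0, fun h => absurd h hi, fun h => absurd h hi⟩
  choose c hc0 hc1 using hc
  have key : (P ^ K) (∑ t, g t • (M ^ (t.2 : ℕ)) (v t.1))
      = ∑ i, (∑ k : Fin (l i + 1), if (k : ℕ) = K then g ⟨i, k⟩ * c i else 0) • v i := by
    rw [map_sum, Fintype.sum_sigma]
    refine Finset.sum_congr rfl fun i _ => ?_
    rw [Finset.sum_smul]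
    refine Finset.sum_congr rfl fun k _ => ?_
    rw [map_smul]
    rcases lt_trichotomy (k : ℕ) K with hk | hk | hk
    · rw [(hv i).p_pow_pow_of_lt h hk, if_neg hk.ne, zero_smul, smul_zero]
    · rw [if_pos hk, hk, hc1 i (by have := k.2; omega), smul_smul]
    · have : g ⟨i, k⟩ = 0 := by
        by_contra hne
        have := hmax ⟨i, k⟩ (by simpa using hne)
        simp only at this
        omega
      rw [if_neg hk.ne', this, zero_smul, zero_smul]
  have h1 := hind _ (key ▸ pow_apply_mem hN K hg) t.1
  rw [Finset.sum_eq_single t.2 (fun k _ hk => if_neg fun e => hk (Fin.ext e))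
    (by simp), if_pos rfl] at h1
  rcases mul_eq_zero.1 h1 with h1 | h1
  · exact ht.2 h1
  · exact hc0 t.1 (by have := t.2.2; omega) h1

/-- A sum of eigenvectors with distinct eigenvalues that lies in an invariant subspace has all
its terms in this subspace. -/
theorem mem_of_sum_mem {ι : Type*} {N : Submodule ℂ V} (hN : ∀ x ∈ N, Z x ∈ N) (ev : ι → ℂ)
    (hev : Function.Injective ev) (s : Finset ι) (u : ι → V) (hu : ∀ i ∈ s, Z (u i) = ev i • u i)
    (hs : ∑ i ∈ s, u i ∈ N) : ∀ i ∈ s, u i ∈ N := by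
  classical
  induction s using Finset.induction_on generalizing u with
  | empty => simp
  | insert a s ha ih =>
    -- Applying `Z - ev a` removes the term `a` and multiplies every other term by a nonzero scalar.
    have h1 : ∑ i ∈ s, (ev i - ev a) • u i ∈ N := by
      have h2 := N.sub_mem (hN _ hs) (N.smul_mem (ev a) hs)
      convert h2 using 1
      rw [map_sum, Finset.smul_sum, ← Finset.sum_sub_distrib, Finset.sum_insert ha,
        hu a (Finset.mem_insert_self a s), sub_self, zero_add]
      refine Finset.sum_congr rfl fun i hi => ?_
      rw [hu i (Finset.mem_insert_of_mem hi), sub_smul]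
    have h3 := ih (fun i => (ev i - ev a) • u i) (fun i hi => by
      rw [map_smul, hu i (Finset.mem_insert_of_mem hi), smul_comm]) h1
    have h4 : ∀ i ∈ s, u i ∈ N := by
      intro i hi
      have h5 : ev i - ev a ≠ 0 := sub_ne_zero.2 fun e => ha (hev e ▸ hi)
      exact (N.smul_mem_iff h5).1 (h3 i hi)
    intro i hi
    rcases Finset.mem_insert.1 hi with rfl | hi
    · rw [Finset.sum_insert ha] at hs
      exact (N.add_mem_iff_left (N.sum_mem h4)).1 hs
    · exact h4 i hi

theorem natCast_div_two_injective : Function.Injective fun n : ℕ => (n : ℂ) / 2 := by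
  intro a b hab
  have : (a : ℂ) = b := by simpa using hab
  exact_mod_cast this

/-- Independence of two families of highest weight vectors, one for each spin. -/
theorem pair_independent {N : Submodule ℂ V} (hN : ∀ x ∈ N, Z x ∈ N) {m : ℕ} {v w : ℕ → V}
    (hv : ∀ n ≤ m, Z (v n) = ((n : ℂ) / 2) • v n) (hw : ∀ n < m, Z (w n) = ((n : ℂ) / 2) • w n)
    (hpair : ∀ n < m, ∀ a b : ℂ, a • v n + b • w n ∈ N → a = 0 ∧ b = 0)
    (hlast : ∀ a : ℂ, a • v m ∈ N → a = 0) (c : Fin (m + 1) ⊕ Fin m → ℂ)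
    (hc : ∑ i, c i • Sum.elim (fun n : Fin (m + 1) => v n) (fun n : Fin m => w n) i ∈ N) :
    ∀ i, c i = 0 := by
  -- The summands are grouped by weight. Each weight below the last carries two vectors, the last
  -- weight only one.
  let u : Fin (m + 1) → V := Fin.lastCases (c (Sum.inl (Fin.last m)) • v m)
    (fun i => c (Sum.inl i.castSucc) • v i + c (Sum.inr i) • w i)
  have hu1 : u (Fin.last m) = c (Sum.inl (Fin.last m)) • v m := Fin.lastCases_last
  have hu2 : ∀ i : Fin m, u i.castSucc = c (Sum.inl i.castSucc) • v i + c (Sum.inr i) • w i :=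
    fun i => Fin.lastCases_castSucc _
  have hsum : ∑ i, u i ∈ N := by
    convert hc using 1
    rw [Fin.sum_univ_castSucc, Fintype.sum_sum_type, Fin.sum_univ_castSucc, hu1]
    simp only [hu2, Finset.sum_add_distrib, Sum.elim_inl, Sum.elim_inr, Fin.val_castSucc,
      Fin.val_last]
    abel
  have hmem := mem_of_sum_mem hN (fun i : Fin (m + 1) => ((i : ℕ) : ℂ) / 2)
    (natCast_div_two_injective.comp Fin.val_injective) Finset.univ u (by
      intro i _
      refine Fin.lastCases ?_ (fun i => ?_) i
      · rw [hu1, map_smul, hv m le_rfl, smul_comm]; rfl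
      · rw [hu2, map_add, map_smul, map_smul, hv i i.2.le, hw i i.2, smul_add]
        simp only [Fin.val_castSucc]
        rw [smul_comm, smul_comm (c (Sum.inr i))]) hsum
  have h1 : c (Sum.inl (Fin.last m)) = 0 := hlast _ (hu1 ▸ hmem _ (Finset.mem_univ _))
  have h2 : ∀ i : Fin m, _ := fun i => hpair i i.2 _ _ (hu2 i ▸ hmem i.castSucc (Finset.mem_univ _))
  rintro (i | i)
  · refine Fin.lastCases h1 (fun i => (h2 i).1) i
  · exact (h2 i).2

/-- The span of the ladders of a family of vectors. -/
def ladderSpan {ι : Type*} (M : Module.End ℂ V) (v : ι → V) : Submodule ℂ V :=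
  Submodule.span ℂ (Set.range fun t : ι × ℕ => (M ^ t.2) (v t.1))

theorem pow_mem_ladderSpan {ι : Type*} (M : Module.End ℂ V) (v : ι → V) (i : ι) (k : ℕ) :
    (M ^ k) (v i) ∈ ladderSpan M v := Submodule.subset_span ⟨(i, k), rfl⟩

/-- A linear map between `sl(2)`-modules that matches ladders is equivariant on their span. -/
theorem intertwine {ι W : Type*} [AddCommGroup W] [Module ℂ W] {P' M' Z' : Module.End ℂ W}
    (h : IsSl2 P M Z) (h' : IsSl2 P' M' Z') {l : ι → ℕ} {v : ι → V} {w : ι → W}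
    (hv : ∀ i, IsTop P M Z (l i) (v i)) (hw : ∀ i, IsTop P' M' Z' (l i) (w i))
    (θ : V →ₗ[ℂ] W) (hθ : ∀ i k, k ≤ l i → θ ((M ^ k) (v i)) = (M' ^ k) (w i))
    {F : V} (hF : F ∈ ladderSpan M v) :
    (P F ∈ ladderSpan M v ∧ M F ∈ ladderSpan M v ∧ Z F ∈ ladderSpan M v) ∧
      θ (P F) = P' (θ F) ∧ θ (M F) = M' (θ F) ∧ θ (Z F) = Z' (θ F) := by
  -- Beyond the length of a ladder both sides vanish, so the bound on `k` can be dropped.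
  have hθ' : ∀ i k, θ ((M ^ k) (v i)) = (M' ^ k) (w i) := by
    intro i k
    by_cases hk : k ≤ l i
    · exact hθ i k hk
    · rw [(hv i).pow_eq_zero h (by omega), (hw i).pow_eq_zero h' (by omega), map_zero]
  induction hF using Submodule.span_induction with
  | mem x hx =>
    obtain ⟨⟨i, k⟩, rfl⟩ := hx
    refine ⟨⟨?_, ?_, ?_⟩, ?_, ?_, ?_⟩
    · cases k with
      | zero => simp [(hv i).p]
      | succ k =>
        simp only [(hv i).p_pow h]
        exact Submodule.smul_mem _ _ (pow_mem_ladderSpan M v i k)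
    · simp only [← Module.End.mul_apply, ← pow_succ']
      exact pow_mem_ladderSpan M v i (k + 1)
    · simp only [(hv i).z_pow h]
      exact Submodule.smul_mem _ _ (pow_mem_ladderSpan M v i k)
    · cases k with
      | zero =>
        have := hθ' i 0
        rw [pow_zero, pow_zero, Module.End.one_apply, Module.End.one_apply] at this
        simp only [pow_zero, Module.End.one_apply, (hv i).p, this, (hw i).p, map_zero]
      | succ k => simp only [hθ', (hv i).p_pow h, (hw i).p_pow h', map_smul]
    · simp only [hθ', ← Module.End.mul_apply, ← pow_succ']
    · simp only [hθ', (hv i).z_pow h, (hw i).z_pow h', map_smul]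
  | zero => simp
  | add x y _ _ hx hy =>
    obtain ⟨⟨a1, a2, a3⟩, a4, a5, a6⟩ := hx
    obtain ⟨⟨b1, b2, b3⟩, b4, b5, b6⟩ := hy
    simp only [map_add, *]
    exact ⟨⟨Submodule.add_mem _ a1 b1, Submodule.add_mem _ a2 b2, Submodule.add_mem _ a3 b3⟩,
      trivial, trivial, trivial⟩
  | smul c x _ hx =>
    obtain ⟨⟨a1, a2, a3⟩, a4, a5, a6⟩ := hx
    simp only [map_smul, *]
    exact ⟨⟨Submodule.smul_mem _ _ a1, Submodule.smul_mem _ _ a2, Submodule.smul_mem _ _ a3⟩,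
      trivial, trivial, trivial⟩

end Ladder
end
end FuzzySupersphere

namespace FuzzySupersphere
noncomputable section

open MvPolynomial (X C pderiv)

/-! ### Angular momentum operators as derivations -/

/-- Polynomials in the coordinates of three-space. -/
abbrev Poly : Type := MvPolynomial (Fin 3) ℂ

/-- The polynomial `x¹ - i x²`. -/
def xMinus : Poly := X 0 - C Complex.I * X 1

/-- The derivation `∂₁ + i ∂₂`. -/
def dPl : Derivation ℂ Poly Poly := pderiv 0 + Complex.I • pderiv 1

/-- The derivation `∂₁ - i ∂₂`. -/
def dMi : Derivation ℂ Poly Poly := pderiv 0 - Complex.I • pderiv 1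

/-- The derivation `∂₃`. -/
def dZ : Derivation ℂ Poly Poly := pderiv 2

/-- The raising operator `J_+ = J_1 + i J_2`. -/
def sphJp : Module.End ℂ Poly := sphJ 0 + Complex.I • sphJ 1

theorem sphJ_apply (i : Fin 3) (F : Poly) :
    sphJ i F = (-Complex.I) • (X (i + 1) * pderiv (i + 2) F - X (i + 2) * pderiv (i + 1) F) := rfl

theorem dPl_apply (F : Poly) : dPl F = pderiv 0 F + Complex.I • pderiv 1 F := rfl
theorem dMi_apply (F : Poly) : dMi F = pderiv 0 F - Complex.I • pderiv 1 F := rfl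
theorem dZ_apply (F : Poly) : dZ F = pderiv 2 F := rfl

theorem I_smul_I_smul {V : Type*} [AddCommGroup V] [Module ℂ V] (v : V) :
    Complex.I • Complex.I • v = -v := by
  rw [smul_smul, Complex.I_mul_I, neg_one_smul]

@[simp] theorem dPl_xPlus : dPl xPlus = 0 := by
  simp [dPl_apply, xPlus, MvPolynomial.pderiv_X, MvPolynomial.C_mul']
  rw [← MvPolynomial.C_1, MvPolynomial.smul_eq_C_mul, MvPolynomial.smul_eq_C_mul, ← map_mul,
    ← map_mul, ← map_add]
  simp

@[simp] theorem dMi_xMinus : dMi xMinus = 0 := by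
  simp [dMi_apply, xMinus, MvPolynomial.pderiv_X, MvPolynomial.C_mul']
  rw [← MvPolynomial.C_1, MvPolynomial.smul_eq_C_mul, MvPolynomial.smul_eq_C_mul, ← map_mul,
    ← map_mul, ← map_add]
  simp

@[simp] theorem dPl_xMinus : dPl xMinus = 2 := by
  simp [dPl_apply, xMinus, MvPolynomial.pderiv_X, MvPolynomial.C_mul']
  rw [I_smul_I_smul]
  norm_num

@[simp] theorem dMi_xPlus : dMi xPlus = 2 := by
  simp [dMi_apply, xPlus, MvPolynomial.pderiv_X, MvPolynomial.C_mul']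
  rw [I_smul_I_smul]
  norm_num

@[simp] theorem dPl_X2 : dPl (X 2) = 0 := by simp [dPl_apply, MvPolynomial.pderiv_X]
@[simp] theorem dMi_X2 : dMi (X 2) = 0 := by simp [dMi_apply, MvPolynomial.pderiv_X]
@[simp] theorem dZ_X2 : dZ (X 2) = 1 := by simp [dZ_apply]
@[simp] theorem dZ_xPlus : dZ xPlus = 0 := by
  simp [dZ_apply, xPlus, MvPolynomial.pderiv_X, MvPolynomial.pderiv_C_mul]
@[simp] theorem dZ_xMinus : dZ xMinus = 0 := by
  simp [dZ_apply, xMinus, MvPolynomial.pderiv_X, MvPolynomial.pderiv_C_mul]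

theorem pderiv_comm (i j : Fin 3) (F : Poly) :
    pderiv i (pderiv j F) = pderiv j (pderiv i F) := by
  have h : ⁅(pderiv i : Derivation ℂ Poly Poly), (pderiv j : Derivation ℂ Poly Poly)⁆ = 0 := by
    refine MvPolynomial.derivation_ext fun k => ?_
    rw [Derivation.commutator_apply, MvPolynomial.pderiv_X, MvPolynomial.pderiv_X,
      Derivation.zero_apply]
    simp only [Pi.single_apply]
    split_ifs <;> simp
  have := congrArg (fun T : Derivation ℂ Poly Poly => T F) h
  simpa [Derivation.commutator_apply, sub_eq_zero] using this

theorem C_I_mul_C_I : (C Complex.I : Poly) * C Complex.I = -1 := by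
  rw [← map_mul, Complex.I_mul_I, map_neg, map_one]

theorem dPl_dMi (F : Poly) : dPl (dMi F) = dMi (dPl F) := by
  simp only [dPl_apply, dMi_apply, map_add, map_sub, Derivation.map_smul, pderiv_comm 1 0]
  module

theorem dPl_dZ (F : Poly) : dPl (dZ F) = dZ (dPl F) := by
  simp only [dPl_apply, dZ_apply, map_add, Derivation.map_smul, pderiv_comm 2 0, pderiv_comm 2 1]

theorem dMi_dZ (F : Poly) : dMi (dZ F) = dZ (dMi F) := by
  simp only [dMi_apply, dZ_apply, map_sub, Derivation.map_smul, pderiv_comm 2 0, pderiv_comm 2 1]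

theorem sphJp_apply (F : Poly) : sphJp F = X 2 * dPl F - xPlus * dZ F := by
  simp only [sphJp, LinearMap.add_apply, LinearMap.smul_apply, sphJ_apply, xPlus, dPl_apply,
    dZ_apply, MvPolynomial.smul_eq_C_mul, map_neg, zero_add, Fin.reduceAdd]
  linear_combination (-(X 2 * pderiv 0 F - X 0 * pderiv 2 F)) * C_I_mul_C_I

theorem sphJm_apply (F : Poly) : sphJm F = xMinus * dZ F - X 2 * dMi F := by
  simp only [sphJm, LinearMap.sub_apply, LinearMap.smul_apply, sphJ_apply, xMinus, dMi_apply,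
    dZ_apply, MvPolynomial.smul_eq_C_mul, map_neg, zero_add, Fin.reduceAdd]
  linear_combination (X 2 * pderiv 0 F - X 0 * pderiv 2 F) * C_I_mul_C_I

theorem two_sphJ2_apply (F : Poly) : (2 : ℂ) • sphJ 2 F = xPlus * dMi F - xMinus * dPl F := by
  rw [two_smul]
  simp only [sphJ_apply, xMinus, xPlus, dMi_apply, dPl_apply, MvPolynomial.smul_eq_C_mul, map_neg,
    Fin.reduceAdd]
  ring

theorem sphJ2_apply (F : Poly) :
    sphJ 2 F = (1 / 2 : ℂ) • (xPlus * dMi F - xMinus * dPl F) := by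
  rw [← two_sphJ2_apply, smul_smul]; norm_num

/-! ### The action of `osp(1|2)` in components -/

/-- The raising operator `J_+ = J_1 + i J_2` on superfunctions. -/
def superJp : Module.End ℂ SuperPoly := superJ 0 + Complex.I • superJ 1

theorem finset_fin_two (M : Finset (Fin 2)) : M = ∅ ∨ M = {0} ∨ M = {1} ∨ M = {0, 1} := by
  revert M; decide

theorem superPoly_ext {F G : SuperPoly} (h0 : F ∅ = G ∅) (h1 : F {0} = G {0})
    (h2 : F {1} = G {1}) (h3 : F {0, 1} = G {0, 1}) : F = G := by
  funext M
  rcases finset_fin_two M with rfl | rfl | rfl | rfl <;> assumption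

theorem mulX_apply (k : Fin 3) (F : SuperPoly) (M : Finset (Fin 2)) : mulX k F M = X k * F M := rfl
theorem derivX_apply (k : Fin 3) (F : SuperPoly) (M : Finset (Fin 2)) :
    derivX k F M = pderiv k (F M) := rfl
theorem mulTheta_apply (α : Fin 2) (F : SuperPoly) (M : Finset (Fin 2)) :
    mulTheta α F M = if α ∈ M then thetaSign α M • F (M.erase α) else 0 := by
  simp only [mulTheta, LinearMap.pi_apply]; split_ifs <;> rfl
theorem derivTheta_apply (α : Fin 2) (F : SuperPoly) (M : Finset (Fin 2)) :
    derivTheta α F M = if α ∈ M then 0 else thetaSign α M • F (insert α M) := by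
  simp only [derivTheta, LinearMap.pi_apply]; split_ifs <;> rfl

theorem thetaSign_zero (M : Finset (Fin 2)) : thetaSign 0 M = 1 := by
  simp [thetaSign]

theorem thetaSign_one (M : Finset (Fin 2)) : thetaSign 1 M = if 0 ∈ M then -1 else 1 := by
  rcases finset_fin_two M with rfl | rfl | rfl | rfl <;> simp [thetaSign, Finset.filter_insert, Finset.filter_singleton]

section Components
variable (F : SuperPoly)

theorem mulTheta_zero : mulTheta 0 F ∅ = 0 ∧ mulTheta 0 F {0} = F ∅ ∧ mulTheta 0 F {1} = 0 ∧
    mulTheta 0 F {0, 1} = F {1} := by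
  simp only [mulTheta_apply, thetaSign_zero]
  simp [show ({0, 1} : Finset (Fin 2)).erase 0 = {1} from by decide,
    show ({0} : Finset (Fin 2)).erase 0 = ∅ from by decide]

theorem mulTheta_one : mulTheta 1 F ∅ = 0 ∧ mulTheta 1 F {0} = 0 ∧ mulTheta 1 F {1} = F ∅ ∧
    mulTheta 1 F {0, 1} = -F {0} := by
  simp only [mulTheta_apply, thetaSign_one]
  simp [show ({0, 1} : Finset (Fin 2)).erase 1 = {0} from by decide,
    show ({1} : Finset (Fin 2)).erase 1 = ∅ from by decide]

theorem derivTheta_zero : derivTheta 0 F ∅ = F {0} ∧ derivTheta 0 F {0} = 0 ∧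
    derivTheta 0 F {1} = F {0, 1} ∧ derivTheta 0 F {0, 1} = 0 := by
  simp only [derivTheta_apply, thetaSign_zero]
  simp

theorem derivTheta_one : derivTheta 1 F ∅ = F {1} ∧ derivTheta 1 F {0} = -F {0, 1} ∧
    derivTheta 1 F {1} = 0 ∧ derivTheta 1 F {0, 1} = 0 := by
  simp only [derivTheta_apply, thetaSign_one]
  simp [show (insert 1 {0} : Finset (Fin 2)) = {0, 1} from by decide]

theorem superJ_apply (i : Fin 3) (M : Finset (Fin 2)) :
    superJ i F M = sphJ i (F M) + (1 / 2 : ℂ) •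
      (pauli i 0 0 • mulTheta 0 (derivTheta 0 F) M + pauli i 0 1 • mulTheta 0 (derivTheta 1 F) M
      + (pauli i 1 0 • mulTheta 1 (derivTheta 0 F) M
        + pauli i 1 1 • mulTheta 1 (derivTheta 1 F) M)) := by
  simp only [superJ, Fin.sum_univ_two, LinearMap.add_apply, LinearMap.smul_apply, Pi.add_apply,
    Pi.smul_apply, LinearMap.sub_apply, Pi.sub_apply, Module.End.mul_apply, mulX_apply,
    derivX_apply, sphJ_apply]

theorem superJp_apply : superJp F ∅ = sphJp (F ∅) ∧ superJp F {0} = sphJp (F {0}) + F {1} ∧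
    superJp F {1} = sphJp (F {1}) ∧ superJp F {0, 1} = sphJp (F {0, 1}) := by
  simp only [superJp, LinearMap.add_apply, LinearMap.smul_apply, Pi.add_apply, Pi.smul_apply,
    superJ_apply, mulTheta_zero, mulTheta_one, derivTheta_zero, derivTheta_one, sphJp, pauli]
  simp
  have e : ∀ v : Poly, Complex.I • (2⁻¹ : ℂ) • Complex.I • v = -((2⁻¹ : ℂ) • v) := fun v => by
    rw [smul_comm (2⁻¹ : ℂ), I_smul_I_smul, ← smul_neg]
  simp only [e]
  constructor <;> module

theorem superJm_apply : superJm F ∅ = sphJm (F ∅) ∧ superJm F {0} = sphJm (F {0}) ∧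
    superJm F {1} = sphJm (F {1}) + F {0} ∧ superJm F {0, 1} = sphJm (F {0, 1}) := by
  simp only [superJm, LinearMap.sub_apply, LinearMap.smul_apply, Pi.sub_apply, Pi.smul_apply,
    superJ_apply, mulTheta_zero, mulTheta_one, derivTheta_zero, derivTheta_one, sphJm, pauli]
  simp
  have e : ∀ v : Poly, Complex.I • (2⁻¹ : ℂ) • Complex.I • v = -((2⁻¹ : ℂ) • v) := fun v => by
    rw [smul_comm (2⁻¹ : ℂ), I_smul_I_smul, ← smul_neg]
  simp only [e]
  constructor <;> module

theorem superJ2_apply : superJ 2 F ∅ = sphJ 2 (F ∅) ∧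
    superJ 2 F {0} = sphJ 2 (F {0}) + (1 / 2 : ℂ) • F {0} ∧
    superJ 2 F {1} = sphJ 2 (F {1}) - (1 / 2 : ℂ) • F {1} ∧
    superJ 2 F {0, 1} = sphJ 2 (F {0, 1}) := by
  simp only [superJ_apply, mulTheta_zero, mulTheta_one, derivTheta_zero, derivTheta_one, pauli]
  simp
  module

theorem superQ_apply (α : Fin 2) (M : Finset (Fin 2)) :
    superQ α F M = (1 / 2 : ℂ) • ∑ k : Fin 3,
      (((Complex.I * (pauli 1 * pauli k) α 0) • (X k * derivTheta 0 F M)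
        - pauli k 0 α • mulTheta 0 (derivX k F) M)
      + ((Complex.I * (pauli 1 * pauli k) α 1) • (X k * derivTheta 1 F M)
        - pauli k 1 α • mulTheta 1 (derivX k F) M)) := by
  simp only [superQ, Fin.sum_univ_two, LinearMap.smul_apply, Pi.smul_apply, LinearMap.sum_apply,
    Finset.sum_apply, LinearMap.add_apply, Pi.add_apply, LinearMap.sub_apply, Pi.sub_apply,
    Module.End.mul_apply, mulX_apply]

theorem superQ_zero_apply :
    superQ 0 F ∅ = (1 / 2 : ℂ) • (xPlus * F {0} - X 2 * F {1}) ∧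
    superQ 0 F {0} = (1 / 2 : ℂ) • (X 2 * F {0, 1} - dZ (F ∅)) ∧
    superQ 0 F {1} = (1 / 2 : ℂ) • (xPlus * F {0, 1} - dPl (F ∅)) ∧
    superQ 0 F {0, 1} = (1 / 2 : ℂ) • (dPl (F {0}) - dZ (F {1})) := by
  simp only [superQ_apply, mulTheta_zero, mulTheta_one, derivTheta_zero, derivTheta_one,
    derivX_apply, pauli, Fin.sum_univ_three, xPlus, dPl_apply, dZ_apply, MvPolynomial.C_mul']
  simp
  simp only [MvPolynomial.smul_eq_C_mul]
  refine ⟨?_, ?_, ?_, ?_⟩ <;> ring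

theorem superQ_one_apply :
    superQ 1 F ∅ = (-1 / 2 : ℂ) • (xMinus * F {1} + X 2 * F {0}) ∧
    superQ 1 F {0} = (-1 / 2 : ℂ) • (dMi (F ∅) - xMinus * F {0, 1}) ∧
    superQ 1 F {1} = (-1 / 2 : ℂ) • (X 2 * F {0, 1} - dZ (F ∅)) ∧
    superQ 1 F {0, 1} = (-1 / 2 : ℂ) • (dMi (F {1}) + dZ (F {0})) := by
  simp only [superQ_apply, mulTheta_zero, mulTheta_one, derivTheta_zero, derivTheta_one,
    derivX_apply, pauli, Fin.sum_univ_three, xMinus, dMi_apply, dZ_apply, MvPolynomial.C_mul']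
  simp
  have e : (-1 / 2 : ℂ) = -2⁻¹ := by norm_num
  simp only [e, MvPolynomial.smul_eq_C_mul, map_neg]
  refine ⟨?_, ?_, ?_, ?_⟩ <;> ring

end Components

-- In the coordinates `xPlus`, `xMinus`, `X 2` the derivations `dPl`, `dMi`, `dZ` take constant
-- values, so this relation and the next four become polynomial identities in each of the four
-- components.
set_option maxHeartbeats 1000000 in
theorem super_qq : superQ 0 * superQ 0 = (1 / 4 : ℂ) • superJp := by
  refine LinearMap.ext fun F => ?_
  apply superPoly_ext <;>
  simp only [Module.End.mul_apply, LinearMap.smul_apply, Pi.smul_apply, LinearMap.add_apply,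
    Pi.add_apply, LinearMap.sub_apply, Pi.sub_apply, superQ_zero_apply, superQ_one_apply,
    superJp_apply, superJm_apply, superJ2_apply, sphJp_apply, sphJm_apply, sphJ2_apply, map_sub,
    map_add, Derivation.leibniz, smul_eq_mul, Derivation.map_smul, dPl_xPlus, dMi_xPlus, dZ_xPlus, dPl_xMinus,
      dMi_xMinus, dZ_xMinus, dPl_X2, dMi_X2, dZ_X2, dPl_dMi, dPl_dZ, dMi_dZ] <;>
  algebra

set_option maxHeartbeats 1000000 in
theorem super_rr : superQ 1 * superQ 1 = (-1 / 4 : ℂ) • superJm := by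
  refine LinearMap.ext fun F => ?_
  apply superPoly_ext <;>
  simp only [Module.End.mul_apply, LinearMap.smul_apply, Pi.smul_apply, LinearMap.add_apply,
    Pi.add_apply, LinearMap.sub_apply, Pi.sub_apply, superQ_zero_apply, superQ_one_apply,
    superJp_apply, superJm_apply, superJ2_apply, sphJp_apply, sphJm_apply, sphJ2_apply, map_sub,
    map_add, Derivation.leibniz, smul_eq_mul, Derivation.map_smul, dPl_xPlus, dMi_xPlus, dZ_xPlus, dPl_xMinus,
      dMi_xMinus, dZ_xMinus, dPl_X2, dMi_X2, dZ_X2, dPl_dMi, dPl_dZ, dMi_dZ] <;>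
  algebra

set_option maxHeartbeats 1000000 in
theorem super_qr : superQ 0 * superQ 1 + superQ 1 * superQ 0 = (-1 / 2 : ℂ) • superJ 2 := by
  refine LinearMap.ext fun F => ?_
  apply superPoly_ext <;>
  simp only [Module.End.mul_apply, LinearMap.smul_apply, Pi.smul_apply, LinearMap.add_apply,
    Pi.add_apply, LinearMap.sub_apply, Pi.sub_apply, superQ_zero_apply, superQ_one_apply,
    superJp_apply, superJm_apply, superJ2_apply, sphJp_apply, sphJm_apply, sphJ2_apply, map_sub,
    map_add, Derivation.leibniz, smul_eq_mul, Derivation.map_smul, dPl_xPlus, dMi_xPlus, dZ_xPlus, dPl_xMinus,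
      dMi_xMinus, dZ_xMinus, dPl_X2, dMi_X2, dZ_X2, dPl_dMi, dPl_dZ, dMi_dZ] <;>
  algebra

set_option maxHeartbeats 1000000 in
theorem super_zq : superJ 2 * superQ 0 - superQ 0 * superJ 2 = (1 / 2 : ℂ) • superQ 0 := by
  refine LinearMap.ext fun F => ?_
  apply superPoly_ext <;>
  simp only [Module.End.mul_apply, LinearMap.smul_apply, Pi.smul_apply, LinearMap.add_apply,
    Pi.add_apply, LinearMap.sub_apply, Pi.sub_apply, superQ_zero_apply, superQ_one_apply,
    superJp_apply, superJm_apply, superJ2_apply, sphJp_apply, sphJm_apply, sphJ2_apply, map_sub,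
    map_add, Derivation.leibniz, smul_eq_mul, Derivation.map_smul, dPl_xPlus, dMi_xPlus, dZ_xPlus, dPl_xMinus,
      dMi_xMinus, dZ_xMinus, dPl_X2, dMi_X2, dZ_X2, dPl_dMi, dPl_dZ, dMi_dZ] <;>
  algebra

set_option maxHeartbeats 1000000 in
theorem super_zr : superJ 2 * superQ 1 - superQ 1 * superJ 2 = (-1 / 2 : ℂ) • superQ 1 := by
  refine LinearMap.ext fun F => ?_
  apply superPoly_ext <;>
  simp only [Module.End.mul_apply, LinearMap.smul_apply, Pi.smul_apply, LinearMap.add_apply,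
    Pi.add_apply, LinearMap.sub_apply, Pi.sub_apply, superQ_zero_apply, superQ_one_apply,
    superJp_apply, superJm_apply, superJ2_apply, sphJp_apply, sphJm_apply, sphJ2_apply, map_sub,
    map_add, Derivation.leibniz, smul_eq_mul, Derivation.map_smul, dPl_xPlus, dMi_xPlus, dZ_xPlus, dPl_xMinus,
      dMi_xMinus, dZ_xMinus, dPl_X2, dMi_X2, dZ_X2, dPl_dMi, dPl_dZ, dMi_dZ] <;>
  algebra

theorem isOsp_super : IsOsp superJp superJm (superJ 2) (superQ 0) (superQ 1) :=
  ⟨super_qq, super_rr, super_qr, super_zq, super_zr⟩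

/-- The component without odd coordinates transforms by the orbital part alone, so the relations for
superfunctions restrict to it. -/
theorem isSl2_sph : IsSl2 sphJp sphJm (sphJ 2) where
  zp := by
    refine LinearMap.ext fun F => ?_
    have := congrFun (congrArg (fun T : Module.End ℂ SuperPoly => T (fun _ => F))
      isOsp_super.isSl2.zp) ∅
    simpa only [LinearMap.sub_apply, Pi.sub_apply, Module.End.mul_apply, superJp_apply,
      superJ2_apply] using this
  zm := by
    refine LinearMap.ext fun F => ?_
    have := congrFun (congrArg (fun T : Module.End ℂ SuperPoly => T (fun _ => F))
      isOsp_super.isSl2.zm) ∅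
    simpa only [LinearMap.sub_apply, Pi.sub_apply, Module.End.mul_apply, superJm_apply,
      superJ2_apply, LinearMap.neg_apply, Pi.neg_apply] using this
  pm := by
    refine LinearMap.ext fun F => ?_
    have := congrFun (congrArg (fun T : Module.End ℂ SuperPoly => T (fun _ => F))
      isOsp_super.isSl2.pm) ∅
    simpa only [LinearMap.sub_apply, Pi.sub_apply, Module.End.mul_apply, superJm_apply,
      superJp_apply, superJ2_apply, LinearMap.smul_apply, Pi.smul_apply] using this

end
end FuzzySupersphere

namespace FuzzySupersphere
noncomputable section

open MvPolynomial (X C pderiv)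

/-! ### Highest weight vectors among polynomials -/

theorem sphJm_mul (F G : Poly) : sphJm (F * G) = sphJm F * G + F * sphJm G := by
  simp only [sphJm_apply, Derivation.leibniz, smul_eq_mul]; ring

theorem sphJ_mul (i : Fin 3) (F G : Poly) : sphJ i (F * G) = sphJ i F * G + F * sphJ i G := by
  simp only [sphJ_apply, Derivation.leibniz, smul_eq_mul, MvPolynomial.smul_eq_C_mul]; ring

@[simp] theorem sphJm_xPlus : sphJm xPlus = -2 * X 2 := by
  simp only [sphJm_apply, dZ_xPlus, dMi_xPlus]; ring

@[simp] theorem sphJm_X2 : sphJm (X 2) = xMinus := by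
  simp only [sphJm_apply, dZ_X2, dMi_X2]; ring

@[simp] theorem sphJm_xMinus : sphJm xMinus = 0 := by
  simp only [sphJm_apply, dZ_xMinus, dMi_xMinus]; ring

theorem sphJm_C (c : ℂ) : sphJm (C c) = 0 := by
  simp [sphJm_apply, dZ_apply, dMi_apply]

theorem sphJp_xPlus_pow (j : ℕ) : sphJp (xPlus ^ j) = 0 := by
  simp [sphJp_apply, Derivation.leibniz_pow]

theorem sphJ2_xPlus_pow (j : ℕ) : sphJ 2 (xPlus ^ j) = (j : ℂ) • xPlus ^ j := by
  rw [sphJ2_apply, Derivation.leibniz_pow, Derivation.leibniz_pow, dMi_xPlus, dPl_xPlus]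
  cases j with
  | zero => simp
  | succ j =>
    simp only [smul_zero, mul_zero, sub_zero, Nat.add_sub_cancel, smul_eq_mul, nsmul_eq_mul,
      MvPolynomial.smul_eq_C_mul]
    have h : (C (1 / 2 : ℂ) : Poly) * 2 = 1 := by
      rw [← map_ofNat (C : ℂ →+* Poly) 2, ← map_mul]; norm_num
    have h2 : (C ((j + 1 : ℕ) : ℂ) : Poly) = ((j + 1 : ℕ) : Poly) := map_natCast _ _
    rw [h2]
    linear_combination (((j + 1 : ℕ) : Poly) * xPlus ^ (j + 1)) * h

/-- The square of the radius. -/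
def radSq : Poly := ∑ k, X k ^ 2

theorem radSq_eq : radSq = xPlus * xMinus + X 2 ^ 2 := by
  rw [radSq, Fin.sum_univ_three, xPlus, xMinus]
  linear_combination (X 1 ^ 2 : Poly) * C_I_mul_C_I

theorem sphJ_radSq (i : Fin 3) : sphJ i radSq = 0 := by
  have h : ∀ k, pderiv k radSq = 2 * X k := by
    intro k
    rw [radSq, map_sum, Finset.sum_eq_single k]
    · rw [MvPolynomial.pderiv_pow, MvPolynomial.pderiv_X_self]; simp
    · intro j _ hj
      rw [MvPolynomial.pderiv_pow, MvPolynomial.pderiv_X_of_ne hj, mul_zero]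
    · simp
  rw [sphJ_apply, h, h]
  rw [show (X (i + 1) * (2 * X (i + 2)) - X (i + 2) * (2 * X (i + 1)) : Poly) = 0 by ring, smul_zero]

/-! ### Local nilpotency of the lowering derivation. -/

section LocallyNilpotent

variable {A : Type*} [Ring A] [Algebra ℂ A] {D : Module.End ℂ A}

theorem pow_apply_eq_zero_mono {V : Type*} [AddCommGroup V] [Module ℂ V] {D : Module.End ℂ V}
    {m n : ℕ} (hmn : m ≤ n) {v : V} (h : (D ^ m) v = 0) : (D ^ n) v = 0 := by
  obtain ⟨k, rfl⟩ := Nat.exists_eq_add_of_le hmn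
  rw [add_comm, pow_add, Module.End.mul_apply, h, map_zero]

/-- By the Leibniz rule every term of `D^n (f g)` has at least `a` derivatives on `f` or at least
`b` on `g`. -/
theorem pow_mul_eq_zero (hD : ∀ f g, D (f * g) = D f * g + f * D g) (n a b : ℕ) (hn : a + b ≤ n + 1)
    (f g : A) (ha : (D ^ a) f = 0) (hb : (D ^ b) g = 0) : (D ^ n) (f * g) = 0 := by
  induction n generalizing a b f g with
  | zero =>
    rcases Nat.eq_zero_or_pos a with rfl | ha'
    · simp only [pow_zero, Module.End.one_apply] at ha; simp [ha]
    · obtain rfl : b = 0 := by omega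
      simp only [pow_zero, Module.End.one_apply] at hb; simp [hb]
  | succ n ih =>
    rcases a with _ | a
    · simp only [pow_zero, Module.End.one_apply] at ha; simp [ha]
    rcases b with _ | b
    · simp only [pow_zero, Module.End.one_apply] at hb; simp [hb]
    rw [pow_succ, Module.End.mul_apply, hD, map_add,
      ih a (b + 1) (by omega) _ _ (by rwa [pow_succ, Module.End.mul_apply] at ha) hb,
      ih (a + 1) b (by omega) _ _ ha (by rwa [pow_succ, Module.End.mul_apply] at hb), add_zero]

end LocallyNilpotent

/-- The elements killed by a power of a derivation form a subalgebra. It contains `xPlus`, `X 2` and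
`xMinus`, which lie on one terminating chain and generate all polynomials. -/
theorem exists_sphJm_pow_eq_zero (F : Poly) : ∃ N : ℕ, (sphJm ^ N) F = 0 := by
  have hadd : ∀ F G : Poly, (∃ N : ℕ, (sphJm ^ N) F = 0) → (∃ N : ℕ, (sphJm ^ N) G = 0) →
      ∃ N : ℕ, (sphJm ^ N) (F + G) = 0 := by
    rintro F G ⟨a, ha⟩ ⟨b, hb⟩
    exact ⟨max a b, by rw [map_add, pow_apply_eq_zero_mono (le_max_left a b) ha,
      pow_apply_eq_zero_mono (le_max_right a b) hb, add_zero]⟩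
  have hmul : ∀ F G : Poly, (∃ N : ℕ, (sphJm ^ N) F = 0) → (∃ N : ℕ, (sphJm ^ N) G = 0) →
      ∃ N : ℕ, (sphJm ^ N) (F * G) = 0 := by
    rintro F G ⟨a, ha⟩ ⟨b, hb⟩
    exact ⟨a + b, pow_mul_eq_zero sphJm_mul (a + b) a b (by omega) F G ha hb⟩
  have hC : ∀ c : ℂ, ∃ N : ℕ, (sphJm ^ N) (C c : Poly) = 0 := fun c => ⟨1, by simp [sphJm_C]⟩
  have hm : ∃ N : ℕ, (sphJm ^ N) xMinus = 0 := ⟨1, by simp⟩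
  have hz : ∃ N : ℕ, (sphJm ^ N) (X 2) = 0 := ⟨2, by simp [pow_succ]⟩
  have hp : ∃ N : ℕ, (sphJm ^ N) xPlus = 0 := ⟨3, by
    have : sphJm (-2 * X 2) = C (-2) * xMinus := by
      rw [show (-2 : Poly) = C (-2) by rw [map_neg, map_ofNat], sphJm_mul, sphJm_C, sphJm_X2]; ring
    simp only [pow_succ, pow_zero, one_mul, Module.End.mul_apply, sphJm_xPlus, this, sphJm_mul,
      sphJm_C, sphJm_xMinus, zero_mul, mul_zero, add_zero]⟩
  have hX : ∀ i : Fin 3, ∃ N : ℕ, (sphJm ^ N) (X i : Poly) = 0 := by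
    have h0 : (X 0 : Poly) = C (1 / 2) * (xPlus + xMinus) := by
      have : (C (1 / 2 : ℂ) : Poly) * 2 = 1 := by
        rw [← map_ofNat (C : ℂ →+* Poly) 2, ← map_mul]; norm_num
      rw [xPlus, xMinus]; linear_combination (-X 0 : Poly) * this
    have h1 : (X 1 : Poly) = C (Complex.I / 2) * (xMinus + C (-1) * xPlus) := by
      have : (C (Complex.I / 2) : Poly) * 2 = C Complex.I := by
        rw [← map_ofNat (C : ℂ →+* Poly) 2, ← map_mul]; congr 1; ring
      rw [xPlus, xMinus, map_neg, map_one]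
      linear_combination (C Complex.I * X 1 : Poly) * this + (X 1 : Poly) * C_I_mul_C_I
    intro i
    fin_cases i
    · exact h0 ▸ hmul _ _ (hC _) (hadd _ _ hp hm)
    · exact h1 ▸ hmul _ _ (hC _) (hadd _ _ hm (hmul _ _ (hC _) hp))
    · exact hz
  induction F using MvPolynomial.induction_on with
  | C c => exact hC c
  | add F G hF hG => exact hadd F G hF hG
  | mul_X F i hF => exact hmul _ _ hF (hX i)

theorem isTop_xPlus_pow (j : ℕ) : IsTop sphJp sphJm (sphJ 2) (2 * j) (xPlus ^ j) where
  p := sphJp_xPlus_pow j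
  z := by rw [sphJ2_xPlus_pow]; push_cast; congr 1; ring
  nil := exists_sphJm_pow_eq_zero _

/-! ### Highest weight vectors among superfunctions -/

theorem superJm_pow_empty (k : ℕ) (F : SuperPoly) :
    ((superJm ^ k) F) ∅ = (sphJm ^ k) (F ∅) := by
  induction k generalizing F with
  | zero => rfl
  | succ k ih => rw [pow_succ, pow_succ, Module.End.mul_apply, Module.End.mul_apply, ih,
      (superJm_apply F).1]

theorem superJm_pow_zero_comp (k : ℕ) (F : SuperPoly) :
    ((superJm ^ k) F) {0} = (sphJm ^ k) (F {0}) := by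
  induction k generalizing F with
  | zero => rfl
  | succ k ih => rw [pow_succ, pow_succ, Module.End.mul_apply, Module.End.mul_apply, ih,
      (superJm_apply F).2.1]

theorem superJm_pow_pair (k : ℕ) (F : SuperPoly) :
    ((superJm ^ k) F) {0, 1} = (sphJm ^ k) (F {0, 1}) := by
  induction k generalizing F with
  | zero => rfl
  | succ k ih => rw [pow_succ, pow_succ, Module.End.mul_apply, Module.End.mul_apply, ih,
      (superJm_apply F).2.2.2]

theorem superJm_pow_one_comp {F : SuperPoly} (hF : F {0} = 0) (k : ℕ) :
    ((superJm ^ k) F) {1} = (sphJm ^ k) (F {1}) := by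
  induction k generalizing F with
  | zero => rfl
  | succ k ih =>
    have h : (superJm F) {0} = 0 := by rw [(superJm_apply F).2.1, hF, map_zero]
    rw [pow_succ, pow_succ, Module.End.mul_apply, Module.End.mul_apply, ih h,
      (superJm_apply F).2.2.1, hF, add_zero]

theorem exists_superJm_pow_eq_zero (F : SuperPoly) : ∃ N : ℕ, (superJm ^ N) F = 0 := by
  obtain ⟨a, ha⟩ := exists_sphJm_pow_eq_zero (F ∅)
  obtain ⟨b, hb⟩ := exists_sphJm_pow_eq_zero (F {0})
  obtain ⟨c, hc⟩ := exists_sphJm_pow_eq_zero (F {0, 1})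
  -- After `m` lowerings the components `∅`, `{0}` and `{0, 1}` are gone. Only then does the
  -- component `{1}`, otherwise fed by `{0}`, evolve on its own.
  set m := a + b + c
  obtain ⟨d, hd⟩ := exists_sphJm_pow_eq_zero (((superJm ^ m) F) {1})
  have h0 : ((superJm ^ m) F) {0} = 0 := by
    rw [superJm_pow_zero_comp, pow_apply_eq_zero_mono (by omega) hb]
  refine ⟨d + m, ?_⟩
  rw [pow_add, Module.End.mul_apply]
  apply superPoly_ext
  · rw [superJm_pow_empty, superJm_pow_empty, pow_apply_eq_zero_mono (by omega : a ≤ m) ha, map_zero]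
    rfl
  · rw [superJm_pow_zero_comp, h0, map_zero]; rfl
  · rw [superJm_pow_one_comp h0, hd]; rfl
  · rw [superJm_pow_pair, superJm_pow_pair, pow_apply_eq_zero_mono (by omega : c ≤ m) hc, map_zero]
    rfl

/-- The even highest weight vector `(x¹ + i x²)^i`. -/
def evenTop (i : ℕ) : SuperPoly := Pi.single ∅ (xPlus ^ i)

/-- The odd highest weight vector `(x¹ + i x²)^i (x³ θ⁴ + (x¹ + i x²) θ⁵)`. -/
def oddTop (i : ℕ) : SuperPoly := Pi.single {0} (xPlus ^ i * X 2) + Pi.single {1} (xPlus ^ i * xPlus)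

theorem evenTop_apply (i : ℕ) : evenTop i ∅ = xPlus ^ i ∧ evenTop i {0} = 0 ∧ evenTop i {1} = 0 ∧
    evenTop i {0, 1} = 0 := by
  refine ⟨Pi.single_eq_same _ _, ?_, ?_, ?_⟩ <;> exact Pi.single_eq_of_ne (by decide) _

theorem oddTop_apply (i : ℕ) : oddTop i ∅ = 0 ∧ oddTop i {0} = xPlus ^ i * X 2 ∧
    oddTop i {1} = xPlus ^ i * xPlus ∧ oddTop i {0, 1} = 0 := by
  refine ⟨?_, ?_, ?_, ?_⟩ <;> rw [oddTop, Pi.add_apply]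
  · rw [Pi.single_eq_of_ne (by decide), Pi.single_eq_of_ne (by decide), add_zero]
  · rw [Pi.single_eq_same, Pi.single_eq_of_ne (by decide), add_zero]
  · rw [Pi.single_eq_same, Pi.single_eq_of_ne (by decide), zero_add]
  · rw [Pi.single_eq_of_ne (by decide), Pi.single_eq_of_ne (by decide), add_zero]

theorem superQ_zero_evenTop (i : ℕ) : superQ 0 (evenTop i) = 0 := by
  apply superPoly_ext <;>
  simp [superQ_zero_apply, evenTop_apply, Derivation.leibniz_pow]

theorem superQ_zero_oddTop (i : ℕ) : superQ 0 (oddTop i) = 0 := by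
  apply superPoly_ext <;>
  simp only [superQ_zero_apply, oddTop_apply, Derivation.leibniz_pow, Derivation.leibniz,
    dPl_xPlus, dZ_xPlus, dPl_X2, map_zero, smul_zero, mul_zero, sub_zero, add_zero, Pi.zero_apply]
  rw [show (xPlus * (xPlus ^ i * X 2) - X 2 * (xPlus ^ i * xPlus) : Poly) = 0 by ring, smul_zero]

theorem superQ_one_evenTop (i : ℕ) :
    superQ 1 (evenTop i) = Pi.single {0} ((-(i : ℂ)) • xPlus ^ (i - 1)) := by
  apply superPoly_ext <;>
  simp only [superQ_one_apply, evenTop_apply, Derivation.leibniz_pow, dMi_xPlus, dZ_xPlus]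
  · rw [Pi.single_eq_of_ne (by decide)]; simp
  · rw [Pi.single_eq_same, mul_zero, sub_zero, show (2 : Poly) = (2 : ℂ) • 1 by
      rw [MvPolynomial.smul_eq_C_mul, map_ofNat, mul_one], smul_eq_mul, mul_smul_comm, mul_one,
      ← Nat.cast_smul_eq_nsmul ℂ, smul_smul, smul_smul]
    congr 1; ring
  · rw [Pi.single_eq_of_ne (by decide)]; simp
  · rw [Pi.single_eq_of_ne (by decide)]; simp

/-- The factor `radSq` becomes `ρ²` on the ordinary sphere, so this vector has the same body as a
multiple of `evenTop i`; the two are told apart only by their `θ⁴θ⁵` components. -/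
theorem superQ_one_oddTop (i : ℕ) :
    superQ 1 (oddTop i) = (-1 / 2 : ℂ) • (Pi.single ∅ (xPlus ^ i * radSq) +
      Pi.single {0, 1} ((2 * (i : ℂ) + 3) • xPlus ^ i)) := by
  apply superPoly_ext <;>
  simp only [superQ_one_apply, oddTop_apply, Derivation.leibniz_pow, Derivation.leibniz, dMi_xPlus,
    dZ_xPlus, dZ_X2, Pi.smul_apply, Pi.add_apply]
  · rw [Pi.single_eq_same, Pi.single_eq_of_ne (by decide), radSq_eq, add_zero]
    congr 1; ring
  · rw [Pi.single_eq_of_ne (by decide), Pi.single_eq_of_ne (by decide)]; simp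
  · rw [Pi.single_eq_of_ne (by decide), Pi.single_eq_of_ne (by decide)]; simp
  · rw [Pi.single_eq_same, Pi.single_eq_of_ne (by decide)]
    have h2 : (C (2 * (i : ℂ) + 3) : Poly) = 2 * (i : Poly) + 3 := by
      rw [map_add, map_mul, map_natCast, map_ofNat, map_ofNat]
    simp only [MvPolynomial.smul_eq_C_mul, h2, smul_zero, smul_eq_mul, nsmul_eq_mul]
    cases i with
    | zero => simp; norm_num
    | succ i => simp only [Nat.add_sub_cancel]; push_cast; ring

/-- The highest weight vector of superspin `n / 2`, without normalization. -/
def sTop (n : ℕ) : SuperPoly := if Even n then evenTop (n / 2) else oddTop (n / 2)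

theorem sTop_even (i : ℕ) : sTop (2 * i) = evenTop i := by
  rw [sTop, if_pos (even_two_mul i), Nat.mul_div_cancel_left i two_pos]

theorem sTop_odd (i : ℕ) : sTop (2 * i + 1) = oddTop i := by
  rw [sTop, if_neg (by simp), show (2 * i + 1) / 2 = i by omega]

/-- The normalization of the highest weight vector of superspin `n / 2`. -/
def superTopCoeff (ρ : ℝ) (n : ℕ) : ℝ :=
  if Even n then √(n.factorial) / (2 ^ (n / 2) * (n / 2).factorial * ρ ^ (n / 2))
  else √(n.factorial) / (2 ^ (n / 2) * (n / 2).factorial * ρ ^ (n / 2 + 2))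

theorem superTop_eq (ρ : ℝ) (n : ℕ) : superTop ρ n = (superTopCoeff ρ n : ℂ) • sTop n := by
  unfold superTop superTopCoeff sTop
  split_ifs
  · rw [evenTop]
    funext M
    rw [Pi.smul_apply]
    by_cases hM : M = ∅
    · subst hM; rw [Pi.single_eq_same, Pi.single_eq_same, MvPolynomial.smul_eq_C_mul]
    · rw [Pi.single_eq_of_ne hM, Pi.single_eq_of_ne hM, smul_zero]
  · rfl

theorem superTopCoeff_ne_zero {ρ : ℝ} (hρ : 0 < ρ) (n : ℕ) : (superTopCoeff ρ n : ℂ) ≠ 0 := by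
  rw [Complex.ofReal_ne_zero, superTopCoeff]
  split_ifs <;> positivity

theorem superQ_zero_sTop (n : ℕ) : superQ 0 (sTop n) = 0 := by
  unfold sTop; split_ifs
  · exact superQ_zero_evenTop _
  · exact superQ_zero_oddTop _

theorem superJ2_sTop (n : ℕ) : superJ 2 (sTop n) = ((n : ℂ) / 2) • sTop n := by
  rcases Nat.even_or_odd' n with ⟨i, rfl | rfl⟩
  · rw [sTop_even]
    apply superPoly_ext <;>
    simp only [superJ2_apply, evenTop_apply, sphJ2_xPlus_pow, Pi.smul_apply]
    · push_cast; congr 1; ring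
    all_goals simp
  · rw [sTop_odd]
    have h0 : sphJ 2 (X 2) = 0 := by simp [sphJ2_apply]
    have h1 : sphJ 2 xPlus = xPlus := by simpa using sphJ2_xPlus_pow 1
    apply superPoly_ext <;>
    simp only [superJ2_apply, oddTop_apply, sphJ_mul, sphJ2_xPlus_pow, Pi.smul_apply, h0, h1]
    · simp
    · push_cast; rw [mul_zero, add_zero, smul_mul_assoc]; module
    · push_cast; rw [smul_mul_assoc]; module
    · simp

theorem isTop_sTop (n : ℕ) : IsTop superJp superJm (superJ 2) n (sTop n) where
  p := by
    rw [isOsp_super.p_eq, LinearMap.smul_apply, Module.End.mul_apply, superQ_zero_sTop, map_zero,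
      smul_zero]
  z := superJ2_sTop n
  nil := exists_superJm_pow_eq_zero _

theorem superQ_one_sTop_zero : superQ 1 (sTop 0) = 0 := by
  rw [show sTop 0 = evenTop 0 from sTop_even 0, superQ_one_evenTop]; simp

/-- Since `[J_+, J_5] = J_4` annihilates the top vector, so does `J_+` annihilate its image under
`J_5`; the weight drops by one half. -/
theorem isTop_superQ_one_sTop (n : ℕ) :
    IsTop superJp superJm (superJ 2) n (superQ 1 (sTop (n + 1))) where
  p := by
    have h := congrArg (fun T : Module.End ℂ SuperPoly => T (sTop (n + 1))) isOsp_super.pr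
    simpa only [LinearMap.sub_apply, Module.End.mul_apply, (isTop_sTop _).p, map_zero, sub_zero,
      superQ_zero_sTop] using h
  z := by
    have h := congrArg (fun T : Module.End ℂ SuperPoly => T (sTop (n + 1))) isOsp_super.zr
    simp only [LinearMap.sub_apply, Module.End.mul_apply, superJ2_sTop, map_smul,
      LinearMap.smul_apply, sub_eq_iff_eq_add] at h
    rw [h]; push_cast; module
  nil := exists_superJm_pow_eq_zero _

/-! ### Stability of a pair of ladders under the odd generators. -/

section Osp

variable {V : Type*} [AddCommGroup V] [Module ℂ V] {P M Z Q R : Module.End ℂ V}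

/-- The span of the two ladders that make up an `osp(1|2)`-module. -/
theorem osp_ladder_invariant (h : IsOsp P M Z Q R) {v : V} (hQ : Q v = 0) {c : ℂ}
    (hZ : Z v = c • v) {F : V} (hF : F ∈ ladderSpan M ![v, R v]) :
    Q F ∈ ladderSpan M ![v, R v] ∧ R F ∈ ladderSpan M ![v, R v] := by
  have hR : ∀ (k : ℕ) (u : V), R ((M ^ k) u) = (M ^ k) (R u) := by
    intro k u
    have := (h.comm_mr.pow_left k).eq
    exact (congrArg (fun T : Module.End ℂ V => T u) this).symm
  have hQM : ∀ u : V, Q (M u) = M (Q u) - R u := by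
    intro u
    have := congrArg (fun T : Module.End ℂ V => T u) h.mq
    simp only [LinearMap.sub_apply, Module.End.mul_apply] at this
    rw [← this]; abel
  -- Since `[J_-, J_4] = J_5` commutes with `J_-`, commuting `J_4` past a power of `J_-` behaves
  -- like differentiating the power.
  have hQk : ∀ (k : ℕ) (u : V), Q ((M ^ (k + 1)) u)
      = (M ^ (k + 1)) (Q u) - ((k : ℂ) + 1) • (M ^ k) (R u) := by
    intro k
    induction k with
    | zero => intro u; simp [hQM]
    | succ k ih =>
      intro u
      rw [pow_succ, Module.End.mul_apply, ih, hQM, map_sub, ← Module.End.mul_apply, ← pow_succ,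
        ← hR k (M u), ← Module.End.mul_apply (M ^ k) M u, ← pow_succ, hR]
      push_cast
      module
  have hRR : R (R v) = (-1 / 4 : ℂ) • M v := by
    have := congrArg (fun T : Module.End ℂ V => T v) h.rr
    simpa only [Module.End.mul_apply, LinearMap.smul_apply] using this
  have hQR : Q (R v) = (-1 / 2 * c : ℂ) • v := by
    have := congrArg (fun T : Module.End ℂ V => T v) h.qr
    simp only [Module.End.mul_apply, LinearMap.add_apply, LinearMap.smul_apply, hQ, map_zero,
      add_zero, hZ, smul_smul] at this
    exact this
  have m0 : ∀ k, (M ^ k) v ∈ ladderSpan M ![v, R v] := pow_mem_ladderSpan M ![v, R v] 0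
  have m1 : ∀ k, (M ^ k) (R v) ∈ ladderSpan M ![v, R v] := pow_mem_ladderSpan M ![v, R v] 1
  induction hF using Submodule.span_induction with
  | mem x hx =>
    obtain ⟨⟨i, k⟩, rfl⟩ := hx
    fin_cases i
    · simp only [Fin.zero_eta, Matrix.cons_val_zero]
      refine ⟨?_, hR k v ▸ m1 k⟩
      cases k with
      | zero => simp [hQ]
      | succ k =>
        rw [hQk, hQ, map_zero, zero_sub]
        exact Submodule.neg_mem _ (Submodule.smul_mem _ _ (m1 k))
    · simp only [Fin.mk_one, Matrix.cons_val_one, Matrix.cons_val_fin_one]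
      constructor
      · cases k with
        | zero =>
          simp only [pow_zero, Module.End.one_apply, hQR]
          exact Submodule.smul_mem _ _ (m0 0)
        | succ k =>
          rw [hQk, hQR, hRR, map_smul, map_smul, ← Module.End.mul_apply, ← pow_succ]
          exact Submodule.sub_mem _ (Submodule.smul_mem _ _ (m0 _))
            (Submodule.smul_mem _ _ (Submodule.smul_mem _ _ (m0 _)))
      · rw [hR, hRR, map_smul, ← Module.End.mul_apply, ← pow_succ]
        exact Submodule.smul_mem _ _ (m0 _)
  | zero => simp
  | add x y _ _ hx hy =>
    rw [map_add, map_add]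
    exact ⟨Submodule.add_mem _ hx.1 hy.1, Submodule.add_mem _ hx.2 hy.2⟩
  | smul c x _ hx =>
    rw [map_smul, map_smul]
    exact ⟨Submodule.smul_mem _ _ hx.1, Submodule.smul_mem _ _ hx.2⟩

end Osp

/-- A cyclic submodule is contained in every invariant subspace that contains its generator. -/
theorem cyclic_le {ι V : Type} [AddCommGroup V] [Module ℂ V] {T : ι → Module.End ℂ V} {v : V}
    {W : Submodule ℂ V} (hv : v ∈ W) (hW : ∀ i, ∀ x ∈ W, T i x ∈ W) : cyclic T v ≤ W := by
  rintro _ ⟨A, hA, rfl⟩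
  have : ∀ x ∈ W, A x ∈ W := by
    refine Algebra.adjoin_induction (p := fun A _ => ∀ x ∈ W, A x ∈ W) ?_ ?_ ?_ ?_ hA
    · rintro _ ⟨i, rfl⟩; exact hW i
    · intro r x hx; exact W.smul_mem r hx
    · intro a b _ _ ha hb x hx; exact W.add_mem (ha x hx) (hb x hx)
    · intro a b _ _ ha hb x hx; exact ha _ (hb x hx)
  exact this v hv

/-- The Cartesian generators are combinations of `J_+`, `J_-`, `J_3`. -/
theorem superJ_eq (i : Fin 3) : superJ i = cartesian superJp superJm (superJ 2) i := by
  fin_cases i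
  · simp only [cartesian, superJp, superJm, Fin.zero_eta, Matrix.cons_val_zero]; module
  · simp only [cartesian, superJp, superJm, Fin.mk_one, Matrix.cons_val_one]
    have e : (-Complex.I / 2) * Complex.I = 1 / 2 := by
      rw [div_mul_eq_mul_div, neg_mul, Complex.I_mul_I, neg_neg]
    simp only [smul_sub, smul_add, smul_smul, e]
    simp only [Matrix.cons_val_zero]
    module
  · rfl

theorem sphJ_eq (i : Fin 3) : sphJ i = cartesian sphJp sphJm (sphJ 2) i := by
  fin_cases i
  · simp only [cartesian, sphJp, sphJm, Fin.zero_eta, Matrix.cons_val_zero]; module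
  · simp only [cartesian, sphJp, sphJm, Fin.mk_one, Matrix.cons_val_one]
    have e : (-Complex.I / 2) * Complex.I = 1 / 2 := by
      rw [div_mul_eq_mul_div, neg_mul, Complex.I_mul_I, neg_neg]
    simp only [smul_sub, smul_add, smul_smul, e]
    simp only [Matrix.cons_val_zero]
    module
  · rfl

/-- The two ladders through the top vector and its image under `J_5` are stable under the odd
generators, and these generate the even ones. -/
theorem cyclic_superTop_le (ρ : ℝ) (n : ℕ) :
    cyclic (Sum.elim superJ superQ) (superTop ρ n) ≤ ladderSpan superJm ![sTop n, superQ 1 (sTop n)] := by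
  have hinv := fun {F} => osp_ladder_invariant isOsp_super (superQ_zero_sTop n) (superJ2_sTop n) (F := F)
  have hP : ∀ F ∈ ladderSpan superJm ![sTop n, superQ 1 (sTop n)],
      superJp F ∈ ladderSpan superJm ![sTop n, superQ 1 (sTop n)] := fun F hF => by
    rw [isOsp_super.p_eq]; exact Submodule.smul_mem _ _ (hinv (hinv hF).1).1
  have hM : ∀ F ∈ ladderSpan superJm ![sTop n, superQ 1 (sTop n)],
      superJm F ∈ ladderSpan superJm ![sTop n, superQ 1 (sTop n)] := fun F hF => by
    have e : superJm F = (-4 : ℂ) • superQ 1 (superQ 1 F) :=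
      congrArg (fun T : Module.End ℂ SuperPoly => T F) isOsp_super.m_eq
    rw [e]; exact Submodule.smul_mem _ _ (hinv (hinv hF).2).2
  have hZ : ∀ F ∈ ladderSpan superJm ![sTop n, superQ 1 (sTop n)],
      superJ 2 F ∈ ladderSpan superJm ![sTop n, superQ 1 (sTop n)] := fun F hF => by
    have : superJ 2 = (-2 : ℂ) • (superQ 0 * superQ 1 + superQ 1 * superQ 0) := by
      rw [isOsp_super.qr, smul_smul]; norm_num
    rw [this]
    exact Submodule.smul_mem _ _ (Submodule.add_mem _ (hinv (hinv hF).2).1 (hinv (hinv hF).1).2)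
  refine cyclic_le ?_ ?_
  · rw [superTop_eq]
    exact Submodule.smul_mem _ _ (pow_mem_ladderSpan superJm ![sTop n, superQ 1 (sTop n)] 0 0)
  · rintro (i | α) F hF
    · rw [Sum.elim_inl, superJ_eq]
      fin_cases i
      · exact Submodule.smul_mem _ _ (Submodule.add_mem _ (hP F hF) (hM F hF))
      · exact Submodule.smul_mem _ _ (Submodule.sub_mem _ (hP F hF) (hM F hF))
      · exact hZ F hF
    · rw [Sum.elim_inr]
      fin_cases α
      · exact (hinv hF).1
      · exact (hinv hF).2

theorem cyclic_sphTop_le (ρ : ℝ) (j : ℕ) :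
    cyclic sphJ (sphTop ρ j) ≤ ladderSpan sphJm (fun _ : Unit => xPlus ^ j) := by
  have hinv := fun {F} => intertwine isSl2_sph isSl2_sph (fun _ : Unit => isTop_xPlus_pow j)
    (fun _ : Unit => isTop_xPlus_pow j) LinearMap.id (fun _ _ _ => rfl) (F := F)
  refine cyclic_le ?_ ?_
  · rw [sphTop, ← MvPolynomial.smul_eq_C_mul]
    exact Submodule.smul_mem _ _ (pow_mem_ladderSpan sphJm (fun _ : Unit => xPlus ^ j) () 0)
  · intro i F hF
    rw [sphJ_eq]
    obtain ⟨⟨h1, h2, h3⟩, -⟩ := hinv hF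
    fin_cases i
    · exact Submodule.smul_mem _ _ (Submodule.add_mem _ h1 h2)
    · exact Submodule.smul_mem _ _ (Submodule.sub_mem _ h1 h2)
    · exact h3

end
end FuzzySupersphere

namespace FuzzySupersphere
noncomputable section

open MvPolynomial (X C pderiv)

/-! ### Polynomials vanishing on the sphere -/

/-- Evaluation of a polynomial at a real point. -/
def evalAt (y : E3) : Poly →ₐ[ℂ] ℂ := MvPolynomial.aeval (fun k => ((y k : ℝ) : ℂ))

theorem evalAt_X (y : E3) (k : Fin 3) : evalAt y (X k) = ((y k : ℝ) : ℂ) :=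
  MvPolynomial.aeval_X _ _

theorem mem_sphere_iff {ρ : ℝ} (hρ : 0 < ρ) (y : E3) :
    y ∈ Metric.sphere (0 : E3) ρ ↔ y 0 ^ 2 + y 1 ^ 2 + y 2 ^ 2 = ρ ^ 2 := by
  rw [mem_sphere_zero_iff_norm, ← sq_eq_sq₀ (norm_nonneg _) hρ.le, EuclideanSpace.norm_sq_eq,
    Fin.sum_univ_three]
  simp

theorem polyOnSphere_eq_zero_iff (ρ : ℝ) (F : Poly) :
    polyOnSphere ρ F = 0 ↔ ∀ y : Sph ρ, evalAt y.1 F = 0 := by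
  constructor
  · intro h y
    have := polyOnSphere_apply ρ F y
    rw [h, map_zero] at this
    exact this.symm
  · intro h
    refine Subtype.ext (funext fun y => ?_)
    exact (polyOnSphere_apply ρ F y).trans (h y)

theorem projSphere_eq_zero_iff (ρ : ℝ) (F : Poly) :
    projSphere ρ F = 0 ↔ ∀ y : Sph ρ, evalAt y.1 F = 0 := by
  rw [← polyOnSphere_eq_zero_iff]
  exact Subtype.ext_iff

theorem hasDerivAt_aeval (F : Poly) {γ : ℝ → Fin 3 → ℂ} {γ' : Fin 3 → ℂ} {t : ℝ}
    (h : ∀ k, HasDerivAt (fun s => γ s k) (γ' k) t) :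
    HasDerivAt (fun s => MvPolynomial.aeval (γ s) F)
      (∑ k, γ' k * MvPolynomial.aeval (γ t) (pderiv k F)) t := by
  induction F using MvPolynomial.induction_on with
  | C c => simpa using hasDerivAt_const t c
  | add F G hF hG =>
    simp only [map_add, mul_add, Finset.sum_add_distrib]
    exact hF.add hG
  | mul_X F i hF =>
    have := hF.mul (h i)
    simp only [map_mul, MvPolynomial.aeval_X]
    refine this.congr_deriv ?_
    have e : ∀ k, γ' k * MvPolynomial.aeval (γ t) (pderiv k (F * X i))
        = γ' k * MvPolynomial.aeval (γ t) (pderiv k F) * γ t i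
          + MvPolynomial.aeval (γ t) F * (γ' k * if k = i then 1 else 0) := by
      intro k
      rw [MvPolynomial.pderiv_mul, MvPolynomial.pderiv_X, Pi.single_apply, map_add, map_mul,
        map_mul, MvPolynomial.aeval_X]
      have : (MvPolynomial.aeval (γ t)) (if i = k then (1 : Poly) else 0)
          = if k = i then 1 else 0 := by
        by_cases hk : k = i
        · rw [if_pos hk.symm, if_pos hk, map_one]
        · rw [if_neg (Ne.symm hk), if_neg hk, map_zero]
      rw [this]; ring
    simp only [e, Finset.sum_add_distrib, ← Finset.sum_mul, ← Finset.mul_sum]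
    simp

/-- The rotation of a point in the plane orthogonal to the `i`-th axis. -/
def rotate (i : Fin 3) (y : E3) (t : ℝ) : E3 :=
  WithLp.toLp 2 fun k => if k = i + 1 then Real.cos t * y (i + 1) - Real.sin t * y (i + 2)
    else if k = i + 2 then Real.sin t * y (i + 1) + Real.cos t * y (i + 2) else y k

theorem rotate_apply (i : Fin 3) (y : E3) (t : ℝ) (k : Fin 3) :
    rotate i y t k = if k = i + 1 then Real.cos t * y (i + 1) - Real.sin t * y (i + 2)
    else if k = i + 2 then Real.sin t * y (i + 1) + Real.cos t * y (i + 2) else y k := rfl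

theorem rotate_mem {ρ : ℝ} (hρ : 0 < ρ) (i : Fin 3) {y : E3} (hy : y ∈ Metric.sphere (0 : E3) ρ)
    (t : ℝ) : rotate i y t ∈ Metric.sphere (0 : E3) ρ := by
  rw [mem_sphere_iff hρ] at hy ⊢
  rw [← hy]
  have := Real.sin_sq_add_cos_sq t
  fin_cases i <;> simp only [rotate_apply] <;> simp [Fin.ext_iff] <;>
    first
    | linear_combination (y 1 ^ 2 + y 2 ^ 2) * this
    | linear_combination (y 0 ^ 2 + y 2 ^ 2) * this
    | linear_combination (y 0 ^ 2 + y 1 ^ 2) * this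

theorem rotate_zero (i : Fin 3) (y : E3) : rotate i y 0 = y := by
  ext k
  rw [rotate_apply]
  split_ifs with h1 h2
  · simp [h1]
  · simp [h2]
  · rfl

/-- Up to the factor `-i`, `sphJ i F` at a point of the sphere is the derivative of `F` along the
rotation about the `i`-th axis. That curve stays on the sphere, where `F` is constantly zero. -/
theorem projSphere_sphJ {ρ : ℝ} (hρ : 0 < ρ) (i : Fin 3) {F : Poly} (hF : projSphere ρ F = 0) :
    projSphere ρ (sphJ i F) = 0 := by
  rw [projSphere_eq_zero_iff] at hF ⊢
  intro y
  have hd : ∀ k, HasDerivAt (fun s => ((rotate i y.1 s k : ℝ) : ℂ))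
      (((if k = i + 1 then -y.1 (i + 2) else if k = i + 2 then y.1 (i + 1) else 0 : ℝ)) : ℂ) 0 := by
    intro k
    refine HasDerivAt.ofReal_comp ?_
    simp only [rotate_apply]
    split_ifs with h1 h2
    · refine (((Real.hasDerivAt_cos 0).mul_const (y.1 (i + 1))).sub
        ((Real.hasDerivAt_sin 0).mul_const (y.1 (i + 2)))).congr_deriv ?_
      simp
    · refine (((Real.hasDerivAt_sin 0).mul_const (y.1 (i + 1))).add
        ((Real.hasDerivAt_cos 0).mul_const (y.1 (i + 2)))).congr_deriv ?_
      simp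
    · exact hasDerivAt_const _ _
  have h1 := hasDerivAt_aeval F hd
  have h2 : (fun s => MvPolynomial.aeval (fun k => ((rotate i y.1 s k : ℝ) : ℂ)) F)
      = fun _ => (0 : ℂ) := by
    funext s
    exact hF ⟨rotate i y.1 s, rotate_mem hρ i y.2 s⟩
  rw [h2] at h1
  have h3 := h1.unique (hasDerivAt_const _ _)
  rw [rotate_zero] at h3
  rw [sphJ_apply, map_smul, map_sub, map_mul, map_mul, evalAt_X, evalAt_X]
  have h4 : ∑ k, (((if k = i + 1 then -y.1 (i + 2) else if k = i + 2 then y.1 (i + 1) else 0 : ℝ)) : ℂ)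
      * evalAt y.1 (pderiv k F) = (y.1 (i + 1) : ℂ) * evalAt y.1 (pderiv (i + 2) F)
        - (y.1 (i + 2) : ℂ) * evalAt y.1 (pderiv (i + 1) F) := by
    have : ∀ (a b : ℝ) (g : Fin 3 → ℂ), ∑ k, ((if k = i + 1 then -a else if k = i + 2 then b else 0 : ℝ) : ℂ)
        * g k = (b : ℂ) * g (i + 2) - (a : ℂ) * g (i + 1) := by
      intro a b g
      fin_cases i <;> simp [Fin.sum_univ_three] <;> ring
    exact this (y.1 (i + 2)) (y.1 (i + 1)) fun k => evalAt y.1 (pderiv k F)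
  rw [← h4]
  have h5 : ∑ k, (((if k = i + 1 then -y.1 (i + 2) else if k = i + 2 then y.1 (i + 1) else 0 : ℝ)) : ℂ)
      * evalAt y.1 (pderiv k F) = 0 := h3
  rw [h5, smul_zero]

/-- The Euler operator. -/
def euler : Derivation ℂ Poly Poly := ∑ k, (X k : Poly) • pderiv k

theorem euler_apply (F : Poly) : euler F = ∑ k, X k * pderiv k F := by
  simp [euler, Fin.sum_univ_three]

theorem euler_X (k : Fin 3) : euler (X k) = X k := by
  rw [euler_apply, Finset.sum_eq_single k]
  · rw [MvPolynomial.pderiv_X_self, mul_one]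
  · intro j _ hj; rw [MvPolynomial.pderiv_X_of_ne hj.symm, mul_zero]
  · simp

theorem pderiv_euler (k : Fin 3) (F : Poly) : pderiv k (euler F) = euler (pderiv k F) + pderiv k F := by
  rw [euler_apply, euler_apply, map_sum]
  simp only [MvPolynomial.pderiv_mul, Finset.sum_add_distrib, pderiv_comm k]
  rw [add_comm]
  congr 1
  rw [Finset.sum_eq_single k]
  · rw [MvPolynomial.pderiv_X_self, one_mul]
  · intro j _ hj; rw [MvPolynomial.pderiv_X_of_ne hj, zero_mul]
  · simp

/-- Rotations preserve the degree. This is what keeps the fourth equation of `superKer` invariant.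
-/
theorem euler_sphJ (i : Fin 3) (F : Poly) : euler (sphJ i F) = sphJ i (euler F) := by
  rw [sphJ_apply, sphJ_apply, pderiv_euler, pderiv_euler, Derivation.map_smul, map_sub,
    Derivation.leibniz, Derivation.leibniz, euler_X, euler_X]
  simp only [smul_eq_mul]
  congr 1; ring

theorem euler_xPlus : euler xPlus = xPlus := by
  rw [xPlus, map_add, euler_X, Derivation.leibniz, euler_X, ← MvPolynomial.algebraMap_eq,
    Derivation.map_algebraMap, smul_zero, add_zero, smul_eq_mul]

theorem euler_xPlus_pow (j : ℕ) : euler (xPlus ^ j) = (j : ℂ) • xPlus ^ j := by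
  rw [Derivation.leibniz_pow, euler_xPlus]
  cases j with
  | zero => simp
  | succ j => rw [Nat.add_sub_cancel, smul_eq_mul, ← pow_succ, Nat.cast_smul_eq_nsmul]

theorem euler_radSq : euler radSq = 2 * radSq := by
  rw [radSq, map_sum, Finset.mul_sum]
  refine Finset.sum_congr rfl fun k _ => ?_
  rw [Derivation.leibniz_pow, euler_X]
  simp only [smul_eq_mul, nsmul_eq_mul]; push_cast; ring

theorem evalAt_radSq {ρ : ℝ} (hρ : 0 < ρ) (y : Sph ρ) : evalAt y.1 radSq = (ρ : ℂ) ^ 2 := by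
  rw [radSq, map_sum, Fin.sum_univ_three]
  simp only [map_pow, evalAt_X]
  have := (mem_sphere_iff hρ y.1).1 y.2
  exact_mod_cast this

/-! ### Restriction of superfunctions -/

/-- Superfunctions that satisfy the equations which vanishing on the supersphere implies. -/
def superKer (ρ : ℝ) : Submodule ℂ SuperPoly where
  carrier := {F | projSphere ρ (F ∅) = 0 ∧ projSphere ρ (F {0}) = 0 ∧ projSphere ρ (F {1}) = 0 ∧
    projSphere ρ ((ρ : ℂ) ^ 2 • F {0, 1} - euler (F ∅)) = 0}
  zero_mem' := by simp
  add_mem' := by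
    rintro F G ⟨a1, a2, a3, a4⟩ ⟨b1, b2, b3, b4⟩
    simp only [Set.mem_ofPred_eq, Pi.add_apply, map_add, a1, b1, a2, b2, a3, b3, smul_add, add_zero,
      add_sub_add_comm, a4, b4, and_self]
  smul_mem' := by
    rintro c F ⟨a1, a2, a3, a4⟩
    refine ⟨?_, ?_, ?_, ?_⟩
    · rw [Pi.smul_apply, map_smul, a1, smul_zero]
    · rw [Pi.smul_apply, map_smul, a2, smul_zero]
    · rw [Pi.smul_apply, map_smul, a3, smul_zero]
    · rw [Pi.smul_apply, Pi.smul_apply, Derivation.map_smul, smul_comm, ← smul_sub, map_smul, a4,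
        smul_zero]

/-- Invariance under the even generators is enough, because independence is checked on
`sl(2)`-ladders only. -/
theorem superJ_mem_superKer {ρ : ℝ} (hρ : 0 < ρ) (i : Fin 3) {F : SuperPoly} (hF : F ∈ superKer ρ) :
    superJ i F ∈ superKer ρ := by
  obtain ⟨a1, a2, a3, a4⟩ := hF
  have e := superJ_apply F i
  refine ⟨?_, ?_, ?_, ?_⟩
  · simp only [e, mulTheta_zero, mulTheta_one]
    simp [projSphere_sphJ hρ i a1]
  · simp only [e, mulTheta_zero, mulTheta_one, derivTheta_zero, derivTheta_one]
    simp [projSphere_sphJ hρ i a2, a2, a3]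
  · simp only [e, mulTheta_zero, mulTheta_one, derivTheta_zero, derivTheta_one]
    simp [projSphere_sphJ hρ i a3, a2, a3]
  · have h0 : superJ i F ∅ = sphJ i (F ∅) := by
      simp only [e, mulTheta_zero, mulTheta_one]; simp
    -- The spin part acts on `θ⁴θ⁵` by half the trace of a Pauli matrix, which is zero.
    have h1 : superJ i F {0, 1} = sphJ i (F {0, 1}) := by
      simp only [e, mulTheta_zero, mulTheta_one, derivTheta_zero, derivTheta_one]
      fin_cases i <;> simp [pauli]
    rw [h0, h1, euler_sphJ, ← map_smul, ← map_sub]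
    exact projSphere_sphJ hρ i a4

theorem superJp_mem_superKer {ρ : ℝ} (hρ : 0 < ρ) {F : SuperPoly} (hF : F ∈ superKer ρ) :
    superJp F ∈ superKer ρ :=
  Submodule.add_mem _ (superJ_mem_superKer hρ 0 hF)
    (Submodule.smul_mem _ _ (superJ_mem_superKer hρ 1 hF))

/-! ### Evaluation at points of the supersphere with soul. -/

section Point

variable {L : ℕ}

/-- The `i`-th generator of the Grassmann algebra. -/
def gen (i : Fin L) : Grass L := ExteriorAlgebra.ι ℂ (Pi.single i (1 : ℂ))

theorem gen_sq (i : Fin L) : gen i * gen i = 0 := ExteriorAlgebra.ι_sq_zero _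

theorem gen_swap (i j : Fin L) : gen i * gen j = -(gen j * gen i) :=
  eq_neg_of_add_eq_zero_left (ExteriorAlgebra.ι_add_mul_swap _ _)

theorem gen_real (i : Fin L) : gen i ∈ realGrass L := Algebra.subset_adjoin ⟨i, rfl⟩

theorem gen_odd (i : Fin L) : gen i ∈ grassPart L 1 :=
  CliffordAlgebra.ι_mem_evenOdd_one (0 : QuadraticForm ℂ (Fin L → ℂ)) _

/-- Contraction with the dual basis strips off generators, after which the augmentation reads off
the coefficients one by one. -/
theorem gen_independent {i j : Fin L} (hij : i ≠ j) {a b c d : ℂ}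
    (h : a • (1 : Grass L) + b • gen i + c • gen j + d • (gen i * gen j) = 0) :
    a = 0 ∧ b = 0 ∧ c = 0 ∧ d = 0 := by
  let D (k : Fin L) : Grass L →ₗ[ℂ] Grass L :=
    CliffordAlgebra.contractLeft (Q := (0 : QuadraticForm ℂ (Fin L → ℂ))) (LinearMap.proj k)
  have hD1 : ∀ k, D k 1 = 0 := fun k => CliffordAlgebra.contractLeft_one _ _
  have hDg : ∀ k l, D k (gen l) = if l = k then 1 else 0 := by
    intro k l
    have := CliffordAlgebra.contractLeft_ι (0 : QuadraticForm ℂ (Fin L → ℂ)) (LinearMap.proj k)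
      (Pi.single l (1 : ℂ))
    refine this.trans ?_
    rw [LinearMap.proj_apply, Pi.single_apply]
    by_cases hl : l = k
    · rw [if_pos hl, if_pos hl.symm, map_one]
    · rw [if_neg hl, if_neg (Ne.symm hl), map_zero]
  have hDgg : D i (gen i * gen j) = gen j := by
    have := CliffordAlgebra.contractLeft_ι_mul (Q := (0 : QuadraticForm ℂ (Fin L → ℂ)))
      (LinearMap.proj i) (Pi.single i (1 : ℂ)) (gen j)
    refine this.trans ?_
    have h2 : CliffordAlgebra.contractLeft (Q := (0 : QuadraticForm ℂ (Fin L → ℂ)))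
        (LinearMap.proj i) (gen j) = 0 := (hDg i j).trans (if_neg hij.symm)
    rw [h2, mul_zero, sub_zero, LinearMap.proj_apply, Pi.single_eq_same, one_smul]
  have aug : ∀ k, augment L (gen k) = 0 := fun k => augment_gen _
  have ha : a = 0 := by
    have := congrArg (augment L) h
    simpa [aug] using this
  have h1 := congrArg (D i) h
  rw [ha, zero_smul, zero_add, map_add, map_add, map_smul, map_smul, map_smul, hDg, hDg, hDgg,
    if_pos rfl, if_neg hij.symm, smul_zero, add_zero, map_zero] at h1
  have hb : b = 0 := by
    have := congrArg (augment L) h1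
    simpa [aug] using this
  have hd : d = 0 := by
    have := congrArg (D j) h1
    rw [map_add, map_smul, map_smul, hD1, hDg, if_pos rfl, smul_zero, zero_add, map_zero] at this
    simpa using congrArg (augment L) this
  have hc : c = 0 := by
    have := congrArg (D j) h
    rw [ha, hb, hd, zero_smul, zero_smul, zero_smul, zero_add, zero_add, add_zero, map_smul, hDg,
      if_pos rfl, map_zero] at this
    simpa using congrArg (augment L) this
  exact ⟨ha, hb, hc, hd⟩

theorem one_mem_grassPart : (1 : Grass L) ∈ grassPart L 0 :=
  Submodule.one_le.1 (CliffordAlgebra.one_le_evenOdd_zero (0 : QuadraticForm ℂ (Fin L → ℂ)))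

theorem gen_mul_gen_even (i j : Fin L) : gen i * gen j ∈ grassPart L 0 :=
  CliffordAlgebra.ι_mul_ι_mem_evenOdd_zero (0 : QuadraticForm ℂ (Fin L → ℂ)) _ _

theorem gen_mul_gen_sq (i j : Fin L) : gen i * gen j * (gen i * gen j) = 0 := by
  rw [mul_assoc, ← mul_assoc (gen j), gen_swap j i, neg_mul, mul_neg, mul_assoc (gen i) (gen j),
    gen_sq, mul_zero, mul_zero, neg_zero]

/-- The point of the supersphere over `y` with odd coordinates two of the generators. -/
def soulPoint {ρ : ℝ} (y : E3) (i j : Fin L) : Superspace L where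
  x k := ((y k : ℝ) : ℂ) • (1 - (((ρ ^ 2)⁻¹ : ℝ) : ℂ) • (gen i * gen j))
  θ := ![gen i, gen j]
  x_real k := Subalgebra.smul_mem _ (Subalgebra.sub_mem _ (Subalgebra.one_mem _)
    (Subalgebra.smul_mem _ (Subalgebra.mul_mem _ (gen_real i) (gen_real j)) ((ρ ^ 2)⁻¹ : ℝ))) (y k)
  x_even k := Submodule.smul_mem _ _ (Submodule.sub_mem _ one_mem_grassPart
    (Submodule.smul_mem _ _ (gen_mul_gen_even i j)))
  θ_real α := by fin_cases α <;> exact gen_real _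
  θ_odd α := by fin_cases α <;> exact gen_odd _

theorem one_sub_pow {w : Grass L} (hw : w * w = 0) (s : ℂ) (n : ℕ) :
    (1 - s • w) ^ n = 1 - ((n : ℂ) * s) • w := by
  induction n with
  | zero => simp
  | succ n ih =>
    rw [pow_succ, ih, sub_mul, one_mul, mul_sub, mul_one, smul_mul_smul_comm, hw, smul_zero, sub_zero]
    push_cast
    module

/-- With `w = gen i * gen j` and `w² = 0`, the factor `1 - ρ⁻² w` squares to `1 - 2ρ⁻² w`. The even
coordinates thus contribute `ρ² - 2w`, and the odd ones add `2w`. -/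
theorem soulPoint_mem {ρ : ℝ} (hρ : 0 < ρ) (y : Sph ρ) (i j : Fin L) :
    ∑ k, (soulPoint (ρ := ρ) y.1 i j).x k ^ 2
      + 2 * ((soulPoint (ρ := ρ) y.1 i j).θ 0 * (soulPoint (ρ := ρ) y.1 i j).θ 1)
      = algebraMap ℂ (Grass L) ((ρ : ℂ) ^ 2) := by
  have h : (((y.1 0 : ℝ) : ℂ)) ^ 2 + ((y.1 1 : ℝ) : ℂ) ^ 2 + ((y.1 2 : ℝ) : ℂ) ^ 2 = (ρ : ℂ) ^ 2 := by
    exact_mod_cast (mem_sphere_iff hρ y.1).1 y.2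
  simp only [soulPoint, smul_pow, one_sub_pow (gen_mul_gen_sq i j), Fin.sum_univ_three, ← add_smul, h]
  simp only [Matrix.cons_val_zero, Matrix.cons_val_one, Matrix.cons_val_fin_one]
  rw [smul_sub, smul_smul, Algebra.algebraMap_eq_smul_one, ← two_smul ℂ (1 : Grass L) |>.trans
    one_add_one_eq_two, smul_mul_assoc, one_mul]
  have : (ρ : ℂ) ^ 2 * (((2 : ℕ) : ℂ) * (((ρ ^ 2)⁻¹ : ℝ) : ℂ)) = 2 := by
    have : (ρ : ℂ) ≠ 0 := by exact_mod_cast hρ.ne'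
    push_cast; field_simp
  rw [this]; abel

theorem evalEven_monomial (p : Superspace L) (m : Fin 3 →₀ ℕ) :
    evalEven p (MvPolynomial.monomial m 1) = p.x 0 ^ m 0 * p.x 1 ^ m 1 * p.x 2 ^ m 2 :=
  Module.Basis.constr_basis ..

theorem poly_linearMap_ext {V : Type*} [AddCommGroup V] [Module ℂ V] {S T : Poly →ₗ[ℂ] V}
    (h : ∀ m, S (MvPolynomial.monomial m 1) = T (MvPolynomial.monomial m 1)) : S = T :=
  (MvPolynomial.basisMonomials (Fin 3) ℂ).ext h

/-- Rescaling all coordinates by `1 - s w` with `w² = 0` is an exact first order Taylor expansion in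
the radial direction, which is where the Euler operator enters. -/
theorem evalEven_soulPoint {ρ : ℝ} (y : E3) (i j : Fin L) (F : Poly) :
    evalEven (soulPoint (ρ := ρ) y i j) F = evalAt y F • (1 : Grass L)
      - ((((ρ ^ 2)⁻¹ : ℝ) : ℂ) * evalAt y (euler F)) • (gen i * gen j) := by
  have h : evalEven (soulPoint (ρ := ρ) y i j) = (evalAt y).toLinearMap.smulRight (1 : Grass L)
      - ((((ρ ^ 2)⁻¹ : ℝ) : ℂ) • (evalAt y).toLinearMap.comp (euler : Poly →ₗ[ℂ] Poly)).smulRight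
        (gen i * gen j) := by
    refine poly_linearMap_ext fun m => ?_
    have hE : euler (MvPolynomial.monomial m (1 : ℂ)) = ((m 0 + m 1 + m 2 : ℕ) : ℂ) •
        MvPolynomial.monomial m (1 : ℂ) := by
      rw [euler_apply, Fin.sum_univ_three]
      simp only [MvPolynomial.X_mul_pderiv_monomial]
      rw [← add_smul, ← add_smul, Nat.cast_smul_eq_nsmul]
    have hm : evalAt y (MvPolynomial.monomial m (1 : ℂ)) = ((y 0 : ℝ) : ℂ) ^ m 0 *
        ((y 1 : ℝ) : ℂ) ^ m 1 * ((y 2 : ℝ) : ℂ) ^ m 2 := by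
      rw [evalAt, MvPolynomial.aeval_monomial, map_one, one_mul,
        Finsupp.prod_fintype _ _ (fun _ => pow_zero _), Fin.prod_univ_three]
    rw [evalEven_monomial]
    simp only [LinearMap.sub_apply, LinearMap.smulRight_apply, LinearMap.smul_apply,
      LinearMap.comp_apply, AlgHom.toLinearMap_apply, 
      Derivation.coeFn_coe, hE, map_smul, hm]
    simp only [soulPoint, smul_pow, smul_mul_smul_comm, ← pow_add]
    rw [one_sub_pow (gen_mul_gen_sq i j), smul_sub, smul_smul]
    simp only [smul_eq_mul]
    congr 2; ring
  rw [h]; rfl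

theorem sum_finset_fin_two {V : Type*} [AddCommMonoid V] (f : Finset (Fin 2) → V) :
    ∑ M, f M = f ∅ + f {0} + f {1} + f {0, 1} := by
  have : (Finset.univ : Finset (Finset (Fin 2))) = {∅, {0}, {1}, {0, 1}} := by decide
  rw [this, Finset.sum_insert (by decide), Finset.sum_insert (by decide),
    Finset.sum_insert (by decide), Finset.sum_singleton]
  abel

theorem evalSuper_apply (p : Superspace L) (F : SuperPoly) :
    evalSuper p F = evalEven p (F ∅) + evalEven p (F {0}) * p.θ 0 + evalEven p (F {1}) * p.θ 1
      + evalEven p (F {0, 1}) * (p.θ 0 * p.θ 1) := by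
  rw [evalSuper, LinearMap.sum_apply, sum_finset_fin_two]
  simp [thetaProd, mul_assoc]

theorem projSuper_eq_zero_iff (ρ : ℝ) (F : SuperPoly) :
    projSuper ρ L F = 0 ↔ ∀ p : Supersphere ρ L, evalSuper p.1 F = 0 := by
  rw [Subtype.ext_iff]
  exact funext_iff

/-- Evaluation at the points `soulPoint`, which need two distinct generators, gives four
coefficients, and these are the four equations of `superKer`. Only this inclusion is needed:
independence modulo a space that contains the kernel implies independence after restriction. -/
theorem ker_projSuper_le {ρ : ℝ} (hρ : 0 < ρ) (hL : 2 ≤ L) {F : SuperPoly}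
    (hF : projSuper ρ L F = 0) : F ∈ superKer ρ := by
  rw [projSuper_eq_zero_iff] at hF
  let i : Fin L := ⟨0, by omega⟩
  let j : Fin L := ⟨1, by omega⟩
  have hij : i ≠ j := by simp [i, j]
  have key : ∀ y : Sph ρ, evalAt y.1 (F ∅) = 0 ∧ evalAt y.1 (F {0}) = 0 ∧ evalAt y.1 (F {1}) = 0 ∧
      evalAt y.1 (F {0, 1}) - (((ρ ^ 2)⁻¹ : ℝ) : ℂ) * evalAt y.1 (euler (F ∅)) = 0 := by
    intro y
    have h := hF ⟨soulPoint (ρ := ρ) y.1 i j, soulPoint_mem hρ y i j⟩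
    rw [evalSuper_apply] at h
    simp only [evalEven_soulPoint] at h
    have t0 : (soulPoint (ρ := ρ) y.1 i j).θ 0 = gen i := rfl
    have t1 : (soulPoint (ρ := ρ) y.1 i j).θ 1 = gen j := rfl
    have z0 : gen i * gen j * gen i = 0 := by
      rw [gen_swap i j, neg_mul, mul_assoc, gen_sq, mul_zero, neg_zero]
    have z1 : gen i * gen j * gen j = 0 := by rw [mul_assoc, gen_sq, mul_zero]
    simp only [t0, t1, sub_mul, smul_mul_assoc, one_mul, z0, z1, gen_mul_gen_sq, smul_zero,
      sub_zero] at h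
    refine gen_independent hij (Eq.trans ?_ h)
    module
  refine ⟨?_, ?_, ?_, ?_⟩
  · rw [projSphere_eq_zero_iff]; exact fun y => (key y).1
  · rw [projSphere_eq_zero_iff]; exact fun y => (key y).2.1
  · rw [projSphere_eq_zero_iff]; exact fun y => (key y).2.2.1
  · rw [projSphere_eq_zero_iff]
    intro y
    have hρ' : (ρ : ℂ) ≠ 0 := by exact_mod_cast hρ.ne'
    have h := (key y).2.2.2
    push_cast at h
    rw [map_sub, map_smul, smul_eq_mul]
    linear_combination (ρ : ℂ) ^ 2 * h + evalAt y.1 (euler (F ∅)) * (mul_inv_cancel₀ (pow_ne_zero 2 hρ'))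

end Point

theorem bodyMap_projSuper (ρ : ℝ) (L : ℕ) (F : SuperPoly) :
    bodyMap ρ L (projSuper ρ L F) = projSphere ρ (F ∅) :=
  Subtype.ext (Subtype.ext (bodyFun_proj ρ L F))

/-! ### Signs in the Grassmann algebra -/

section Signs

variable {L : ℕ}

theorem ι_mul_ι_comm (u v : Fin L → ℂ) (z : Grass L) :
    ExteriorAlgebra.ι ℂ u * ExteriorAlgebra.ι ℂ v * z
      = z * (ExteriorAlgebra.ι ℂ u * ExteriorAlgebra.ι ℂ v) := by
  have swap : ∀ a b : Fin L → ℂ, ExteriorAlgebra.ι ℂ a * ExteriorAlgebra.ι ℂ b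
      = -(ExteriorAlgebra.ι ℂ b * ExteriorAlgebra.ι ℂ a) := fun a b =>
    eq_neg_of_add_eq_zero_left (ExteriorAlgebra.ι_add_mul_swap _ _)
  induction z using ExteriorAlgebra.induction with
  | algebraMap r => exact (Algebra.commutes r _).symm
  | ι w =>
    rw [mul_assoc, swap v w, mul_neg, ← mul_assoc, swap u w, neg_mul, neg_neg, mul_assoc]
  | mul a b ha hb => rw [← mul_assoc, ha, mul_assoc, hb, mul_assoc]
  | add a b ha hb => rw [mul_add, add_mul, ha, hb]

theorem even_comm {z : Grass L} (hz : z ∈ grassPart L 0) (a : Grass L) : z * a = a * z := by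
  refine CliffordAlgebra.even_induction (0 : QuadraticForm ℂ (Fin L → ℂ))
    (motive := fun z _ => z * a = a * z) ?_ ?_ ?_ z hz
  · intro r
    exact Algebra.commutes r a
  · intro x y _ _ hx hy
    rw [add_mul, mul_add, hx, hy]
  · intro u v x _ hx
    have := ι_mul_ι_comm u v a
    exact (mul_assoc _ _ _).trans ((congrArg _ hx).trans ((mul_assoc _ _ _).symm.trans
      ((congrArg (· * x) this).trans (mul_assoc _ _ _))))

/-- Products of two generators are central, so one induction over each factor in steps of two
generators reduces the claim to the anticommutation of single vectors. -/
theorem odd_anticomm {z w : Grass L} (hz : z ∈ grassPart L 1) (hw : w ∈ grassPart L 1) :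
    z * w = -(w * z) := by
  have h1 : ∀ u : Fin L → ℂ, ExteriorAlgebra.ι ℂ u * w = -(w * ExteriorAlgebra.ι ℂ u) := by
    intro u
    refine CliffordAlgebra.odd_induction (0 : QuadraticForm ℂ (Fin L → ℂ))
      (P := fun w _ => ExteriorAlgebra.ι ℂ u * w = -(w * ExteriorAlgebra.ι ℂ u)) ?_ ?_ ?_ w hw
    · intro v
      exact eq_neg_of_add_eq_zero_left (ExteriorAlgebra.ι_add_mul_swap _ _)
    · intro x y _ _ hx hy
      rw [add_mul, mul_add, hx, hy, neg_add]
    · intro v v' x _ hx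
      have e1 := ι_mul_ι_comm v v' (ExteriorAlgebra.ι ℂ u)
      calc ExteriorAlgebra.ι ℂ u * (ExteriorAlgebra.ι ℂ v * ExteriorAlgebra.ι ℂ v' * x)
          = ExteriorAlgebra.ι ℂ v * ExteriorAlgebra.ι ℂ v' * (ExteriorAlgebra.ι ℂ u * x) := by
            rw [← mul_assoc, ← e1, mul_assoc]
        _ = -(ExteriorAlgebra.ι ℂ v * ExteriorAlgebra.ι ℂ v' * x * ExteriorAlgebra.ι ℂ u) := by
            rw [hx, mul_neg, mul_assoc _ x]
  refine CliffordAlgebra.odd_induction (0 : QuadraticForm ℂ (Fin L → ℂ))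
    (P := fun z _ => z * w = -(w * z)) ?_ ?_ ?_ z hz
  · exact h1
  · intro x y _ _ hx hy
    rw [add_mul, mul_add, hx, hy, neg_add]
  · intro v v' x _ hx
    have e1 := ι_mul_ι_comm v v' w
    calc ExteriorAlgebra.ι ℂ v * ExteriorAlgebra.ι ℂ v' * x * w
        = -(ExteriorAlgebra.ι ℂ v * ExteriorAlgebra.ι ℂ v' * w * x) := by
          rw [mul_assoc, hx, mul_neg, ← mul_assoc]
      _ = -(w * (ExteriorAlgebra.ι ℂ v * ExteriorAlgebra.ι ℂ v' * x)) := by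
          rw [e1, mul_assoc]

theorem odd_sq {z : Grass L} (hz : z ∈ grassPart L 1) : z * z = 0 := by
  have h := odd_anticomm hz hz
  have h2 : (2 : ℂ) • (z * z) = 0 := by
    rw [two_smul]; nth_rw 1 [h]; rw [neg_add_cancel]
  exact (smul_eq_zero.1 h2).resolve_left two_ne_zero

/-- Even coordinates are central, so `evalEven p`, although defined on monomials, is an algebra
homomorphism into the centre. -/
theorem evalEven_mul (p : Superspace L) (F G : Poly) :
    evalEven p (F * G) = evalEven p F * evalEven p G := by
  have h : ∀ k m, p.x k ∈ Subalgebra.center ℂ (Grass L) → p.x k ^ m ∈ Subalgebra.center ℂ (Grass L) :=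
    fun k m hk => Subalgebra.pow_mem _ hk m
  have hc : ∀ k, p.x k ∈ Subalgebra.center ℂ (Grass L) := fun k =>
    Subalgebra.mem_center_iff.2 fun b => (even_comm (p.x_even k) b).symm
  let ev : Poly →ₐ[ℂ] Subalgebra.center ℂ (Grass L) :=
    MvPolynomial.aeval fun k => (⟨p.x k, hc k⟩ : Subalgebra.center ℂ (Grass L))
  have e : evalEven p = (Subalgebra.center ℂ (Grass L)).val.toLinearMap.comp ev.toLinearMap := by
    refine poly_linearMap_ext fun m => ?_
    rw [evalEven_monomial, LinearMap.comp_apply, AlgHom.toLinearMap_apply, AlgHom.toLinearMap_apply,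
      MvPolynomial.aeval_monomial, (algebraMap ℂ (Subalgebra.center ℂ (Grass L))).map_one, one_mul,
      Finsupp.prod_fintype _ _ (fun _ => pow_zero _), Fin.prod_univ_three]
    rfl
  simp only [e, LinearMap.comp_apply, AlgHom.toLinearMap_apply, map_mul]

theorem evalEven_X (p : Superspace L) (k : Fin 3) : evalEven p (X k) = p.x k := by
  rw [MvPolynomial.X, evalEven_monomial]
  fin_cases k <;> simp

theorem evalEven_C (p : Superspace L) (c : ℂ) : evalEven p (C c) = algebraMap ℂ (Grass L) c := by
  have : (C c : Poly) = c • MvPolynomial.monomial 0 1 := by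
    rw [MvPolynomial.smul_monomial, smul_eq_mul, mul_one]; rfl
  rw [this, map_smul, evalEven_monomial, Algebra.algebraMap_eq_smul_one]
  simp

theorem evalEven_radSq_sub {ρ : ℝ} (p : Supersphere ρ L) :
    evalEven p.1 (radSq - C ((ρ : ℂ) ^ 2)) = -(2 * (p.1.θ 0 * p.1.θ 1)) := by
  have hp := p.2
  rw [map_sub, radSq, map_sum, evalEven_C, sub_eq_iff_eq_add, eq_neg_add_iff_add_eq, ← eq_comm]
  simp only [pow_two, evalEven_mul, evalEven_X] at hp ⊢
  rw [← hp, add_comm]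

/-- The relation `∑ (x^k)² + 2 θ⁴ θ⁵ = ρ²` on the supersphere. -/
theorem projSuper_relation (ρ : ℝ) (G : Poly) :
    projSuper ρ L (Pi.single ∅ ((radSq - C ((ρ : ℂ) ^ 2)) * G))
      = projSuper ρ L (Pi.single {0, 1} ((-2 : ℂ) • G)) := by
  rw [← sub_eq_zero, ← map_sub, projSuper_eq_zero_iff]
  intro p
  rw [map_sub, sub_eq_zero, evalSuper_apply, evalSuper_apply]
  simp only [Pi.single_eq_same, Pi.single_eq_of_ne (show ({0} : Finset (Fin 2)) ≠ ∅ by decide),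
    Pi.single_eq_of_ne (show ({1} : Finset (Fin 2)) ≠ ∅ by decide),
    Pi.single_eq_of_ne (show ({0, 1} : Finset (Fin 2)) ≠ ∅ by decide),
    Pi.single_eq_of_ne (show (∅ : Finset (Fin 2)) ≠ {0, 1} by decide),
    Pi.single_eq_of_ne (show ({0} : Finset (Fin 2)) ≠ {0, 1} by decide),
    Pi.single_eq_of_ne (show ({1} : Finset (Fin 2)) ≠ {0, 1} by decide), map_zero, zero_mul,
    add_zero, zero_add, evalEven_mul, evalEven_radSq_sub, map_smul]
  have h2 : ∀ a : Grass L, 2 * a = (2 : ℂ) • a := fun a => by rw [two_smul, two_mul]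
  have hc : p.1.θ 0 * p.1.θ 1 * evalEven p.1 G = evalEven p.1 G * (p.1.θ 0 * p.1.θ 1) := by
    refine even_comm ?_ _
    have := SetLike.mul_mem_graded (A := CliffordAlgebra.evenOdd (0 : QuadraticForm ℂ (Fin L → ℂ)))
      (p.1.θ_odd 0) (p.1.θ_odd 1)
    exact this
  rw [h2, neg_mul, smul_mul_assoc, hc, smul_mul_assoc, neg_smul]

/-- On the supersphere `radSq - ρ²` equals `-2 θ⁴θ⁵`, which is annihilated by every further odd
coordinate. -/
theorem projSuper_relation_odd (ρ : ℝ) (M : Finset (Fin 2)) (hM : M ≠ ∅) (G : Poly) :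
    projSuper ρ L (Pi.single M ((radSq - C ((ρ : ℂ) ^ 2)) * G)) = 0 := by
  rw [projSuper_eq_zero_iff]
  intro p
  have hc : p.1.θ 0 * p.1.θ 1 * evalEven p.1 G = evalEven p.1 G * (p.1.θ 0 * p.1.θ 1) := by
    refine even_comm ?_ _
    have := SetLike.mul_mem_graded (A := CliffordAlgebra.evenOdd (0 : QuadraticForm ℂ (Fin L → ℂ)))
      (p.1.θ_odd 0) (p.1.θ_odd 1)
    exact this
  have key : ∀ α, p.1.θ 0 * p.1.θ 1 * p.1.θ α = 0 := by
    intro α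
    fin_cases α
    · simp only [Fin.zero_eta]
      rw [odd_anticomm (p.1.θ_odd 0) (p.1.θ_odd 1), neg_mul, mul_assoc, odd_sq (p.1.θ_odd 0),
        mul_zero, neg_zero]
    · simp only [Fin.mk_one]
      rw [mul_assoc, odd_sq (p.1.θ_odd 1), mul_zero]
  have e : evalEven p.1 ((radSq - C ((ρ : ℂ) ^ 2)) * G)
      = (-2 : ℂ) • (evalEven p.1 G * (p.1.θ 0 * p.1.θ 1)) := by
    rw [evalEven_mul, evalEven_radSq_sub, neg_mul, mul_assoc, hc, neg_smul, two_smul, two_mul]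
  rw [evalSuper_apply]
  rcases finset_fin_two M with rfl | rfl | rfl | rfl
  · exact absurd rfl hM
  · rw [Pi.single_eq_same, Pi.single_eq_of_ne (by decide), Pi.single_eq_of_ne (by decide),
      Pi.single_eq_of_ne (by decide), e, smul_mul_assoc, mul_assoc, key 0]
    simp
  · rw [Pi.single_eq_same, Pi.single_eq_of_ne (by decide), Pi.single_eq_of_ne (by decide),
      Pi.single_eq_of_ne (by decide), e, smul_mul_assoc, mul_assoc, key 1]
    simp
  · rw [Pi.single_eq_same, Pi.single_eq_of_ne (by decide), Pi.single_eq_of_ne (by decide),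
      Pi.single_eq_of_ne (by decide), e, smul_mul_assoc, mul_assoc, ← mul_assoc (p.1.θ 0 * p.1.θ 1),
      key 0]
    simp

end Signs

end
end FuzzySupersphere

namespace FuzzySupersphere
noncomputable section

/-! ### The matrices of the irreducible representations -/

theorem fromBlocks_sub' {l m n o : Type*} (A A' : Matrix n l ℂ) (B B' : Matrix n m ℂ)
    (C C' : Matrix o l ℂ) (D D' : Matrix o m ℂ) :
    Matrix.fromBlocks A B C D - Matrix.fromBlocks A' B' C' D'
      = Matrix.fromBlocks (A - A') (B - B') (C - C') (D - D') := by
  simp only [sub_eq_add_neg, Matrix.fromBlocks_neg, Matrix.fromBlocks_add]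

/-- The matrices below have at most one nonzero entry in each row, so a sum over the middle index
has at most one term. The value `0` covers the case that the middle index runs off the block. -/
theorem mul_apply_pick {l m n : ℕ} (A : Matrix (Fin l) (Fin m) ℂ) (B : Matrix (Fin m) (Fin n) ℂ)
    (i : Fin l) (j : Fin n) (c : ℕ) (h : ∀ k : Fin m, (k : ℕ) ≠ c → A i k * B k j = 0) :
    (A * B) i j = if hc : c < m then A i ⟨c, hc⟩ * B ⟨c, hc⟩ j else 0 := by
  rw [Matrix.mul_apply]
  split_ifs with hc
  · exact Finset.sum_eq_single _ (fun k _ hk => h k fun e => hk (Fin.ext e)) (by simp)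
  · exact Finset.sum_eq_zero fun k _ => h k (by have := k.2; omega)

/-- The block of `J_4` that raises the spin. -/
def q4a (q : ℕ) : Matrix (Fin (q + 1)) (Fin q) ℂ :=
  Matrix.of fun a b => if (a : ℕ) = b then ((-(1 / 2) * √((q : ℝ) - b) : ℝ) : ℂ) else 0

/-- The block of `J_4` that lowers the spin. -/
def q4b (q : ℕ) : Matrix (Fin q) (Fin (q + 1)) ℂ :=
  Matrix.of fun a b => if (a : ℕ) + 1 = b then ((-(1 / 2) * √(b : ℝ) : ℝ) : ℂ) else 0

/-- The block of `J_5` that raises the spin. -/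
def q5a (q : ℕ) : Matrix (Fin (q + 1)) (Fin q) ℂ :=
  Matrix.of fun a b => if (a : ℕ) = b + 1 then ((-(1 / 2) * √(a : ℝ) : ℝ) : ℂ) else 0

/-- The block of `J_5` that lowers the spin. -/
def q5b (q : ℕ) : Matrix (Fin q) (Fin (q + 1)) ℂ :=
  Matrix.of fun a b => if (a : ℕ) = b then ((1 / 2 * √((q : ℝ) - b) : ℝ) : ℂ) else 0

theorem ospQ4_eq (q : ℕ) : ospQ4 q = Matrix.fromBlocks 0 (q4a q) (q4b q) 0 := rfl
theorem ospQ5_eq (q : ℕ) : ospQ5 q = Matrix.fromBlocks 0 (q5a q) (q5b q) 0 := rfl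

theorem sqrt_mul_sqrt_cast (q i : ℕ) (h : i ≤ q) :
    √((q : ℝ) - i) * √((q : ℝ) - i) = (q : ℝ) - i :=
  Real.mul_self_sqrt (sub_nonneg.2 (by exact_mod_cast h))

theorem q4a_mul_q4b (q : ℕ) : q4a q * q4b q = (1 / 4 : ℂ) • spinP (q + 1) := by
  ext i j
  rw [mul_apply_pick _ _ i j i]
  · simp only [q4a, q4b, spinP, Matrix.of_apply, Matrix.smul_apply, smul_eq_mul]
    by_cases h : (i : ℕ) + 1 = j
    · have hi : (i : ℕ) < q := by have := j.2; omega
      rw [dif_pos hi, if_pos trivial, if_pos h, if_pos h, ← h]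
      have : ((i + 1 : ℕ) : ℝ) * ((q + 1 : ℕ) - (i + 1 : ℕ)) = ((i + 1 : ℕ) : ℝ) * ((q : ℝ) - i) := by
        push_cast; ring
      rw [this, Real.sqrt_mul (Nat.cast_nonneg _)]
      push_cast; ring
    · simp [if_neg h]
  · intro k hk
    simp only [q4a, Matrix.of_apply]
    rw [if_neg (Ne.symm hk), zero_mul]

theorem q4b_mul_q4a (q : ℕ) : q4b q * q4a q = (1 / 4 : ℂ) • spinP q := by
  ext i j
  rw [mul_apply_pick _ _ i j (i + 1)]
  · simp only [q4a, q4b, spinP, Matrix.of_apply, Matrix.smul_apply, smul_eq_mul]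
    by_cases h : (i : ℕ) + 1 = j
    · rw [dif_pos (by have := i.2; omega), if_pos trivial, if_pos h, if_pos h, ← h,
        Real.sqrt_mul (Nat.cast_nonneg _)]
      push_cast; ring
    · simp [if_neg h]
  · intro k hk
    simp only [q4b, Matrix.of_apply]
    rw [if_neg (Ne.symm hk), zero_mul]

theorem q5a_mul_q5b (q : ℕ) : q5a q * q5b q = (-1 / 4 : ℂ) • spinM (q + 1) := by
  ext i j
  rw [mul_apply_pick _ _ i j j]
  · simp only [q5a, q5b, spinM, Matrix.of_apply, Matrix.smul_apply, smul_eq_mul]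
    by_cases h : (i : ℕ) = j + 1
    · have hi : (j : ℕ) < q := by have := i.2; omega
      rw [dif_pos hi, if_pos trivial, if_pos h, if_pos h, h]
      have : ((j + 1 : ℕ) : ℝ) * ((q + 1 : ℕ) - (j + 1 : ℕ)) = ((j + 1 : ℕ) : ℝ) * ((q : ℝ) - j) := by
        push_cast; ring
      rw [this, Real.sqrt_mul (Nat.cast_nonneg _)]
      push_cast; ring
    · simp [if_neg h]
  · intro k hk
    simp only [q5b, Matrix.of_apply]
    rw [if_neg hk, mul_zero]

theorem q5b_mul_q5a (q : ℕ) : q5b q * q5a q = (-1 / 4 : ℂ) • spinM q := by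
  ext i j
  rw [mul_apply_pick _ _ i j i]
  · simp only [q5a, q5b, spinM, Matrix.of_apply, Matrix.smul_apply, smul_eq_mul]
    by_cases h : (i : ℕ) = j + 1
    · rw [dif_pos (by have := i.2; omega), if_pos trivial, if_pos h, if_pos h,
        Real.sqrt_mul (Nat.cast_nonneg _)]
      push_cast; ring
    · simp [if_neg h]
  · intro k hk
    simp only [q5b, Matrix.of_apply]
    rw [if_neg (Ne.symm hk), zero_mul]

theorem q4a_mul_q5b (q : ℕ) :
    q4a q * q5b q = Matrix.diagonal fun i : Fin (q + 1) => (-(1 / 4) * ((q : ℂ) - (i : ℕ))) := by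
  ext i j
  rw [mul_apply_pick _ _ i j i, Matrix.diagonal_apply]
  · simp only [q4a, q5b, Matrix.of_apply]
    by_cases h : i = j
    · subst h
      rw [if_pos rfl]
      by_cases hi : (i : ℕ) < q
      · rw [dif_pos hi, if_pos trivial, if_pos rfl, ← Complex.ofReal_mul, show -(1 / 2) * √((q : ℝ) - (i : ℕ)) * (1 / 2 * √((q : ℝ) - (i : ℕ)))
          = -(1 / 4) * (√((q : ℝ) - (i : ℕ)) * √((q : ℝ) - (i : ℕ))) by ring,
          sqrt_mul_sqrt_cast q i hi.le]
        push_cast; ring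
      -- In the last row there is no middle index, in agreement with `q - i = 0`.
      · have : (i : ℕ) = q := by have := i.2; omega
        have e : ((i : ℕ) : ℂ) = q := by rw [this]
        rw [dif_neg hi, e]; ring
    · have : (i : ℕ) ≠ j := fun e => h (Fin.ext e)
      simp [if_neg h, this]
  · intro k hk
    simp only [q4a, Matrix.of_apply]
    rw [if_neg (Ne.symm hk), zero_mul]

theorem q4b_mul_q5a (q : ℕ) :
    q4b q * q5a q = Matrix.diagonal fun i : Fin q => ((1 / 4) * (((i : ℕ) : ℂ) + 1)) := by
  ext i j
  rw [mul_apply_pick _ _ i j (i + 1), Matrix.diagonal_apply, dif_pos (by have := i.2; omega)]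
  · simp only [q4b, q5a, Matrix.of_apply]
    by_cases h : i = j
    · subst h
      rw [if_pos trivial, if_pos rfl, if_pos rfl]
      have := Real.mul_self_sqrt (Nat.cast_nonneg (α := ℝ) ((i : ℕ) + 1))
      rw [← Complex.ofReal_mul, show -(1 / 2) * √(((i : ℕ) + 1 : ℕ) : ℝ) * (-(1 / 2) * √(((i : ℕ) + 1 : ℕ) : ℝ))
          = (1 / 4) * (√(((i : ℕ) + 1 : ℕ) : ℝ) * √(((i : ℕ) + 1 : ℕ) : ℝ)) by ring, this]
      push_cast; ring
    · have : (i : ℕ) ≠ j := fun e => h (Fin.ext e)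
      simp [if_neg h, this]
  · intro k hk
    simp only [q4b, Matrix.of_apply]
    rw [if_neg (Ne.symm hk), zero_mul]

theorem q5a_mul_q4b (q : ℕ) :
    q5a q * q4b q = Matrix.diagonal fun i : Fin (q + 1) => ((1 / 4) * ((i : ℕ) : ℂ)) := by
  ext i j
  rw [mul_apply_pick _ _ i j (i - 1), Matrix.diagonal_apply]
  · simp only [q5a, q4b, Matrix.of_apply]
    -- At `i = 0` the truncated index `i - 1` does not satisfy the matching condition, and the
    -- diagonal entry is `0` as well.
    by_cases hi0 : (i : ℕ) = 0
    · have : ¬ (i : ℕ) = i - 1 + 1 := by omega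
      simp [hi0]
    · have hi1 : (i : ℕ) = i - 1 + 1 := by omega
      rw [dif_pos (by have := i.2; omega), if_pos hi1, ← hi1]
      by_cases h : i = j
      · subst h
        rw [if_pos rfl, if_pos rfl]
        have := Real.mul_self_sqrt (Nat.cast_nonneg (α := ℝ) (i : ℕ))
        rw [← Complex.ofReal_mul, show -(1 / 2) * √((i : ℕ) : ℝ) * (-(1 / 2) * √((i : ℕ) : ℝ))
            = (1 / 4) * (√((i : ℕ) : ℝ) * √((i : ℕ) : ℝ)) by ring, this]
        push_cast; ring
      · have : (i : ℕ) ≠ j := fun e => h (Fin.ext e)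
        simp [if_neg h, this]
  · intro k hk
    simp only [q5a, Matrix.of_apply]
    rw [if_neg (by omega), zero_mul]

theorem q5b_mul_q4a (q : ℕ) :
    q5b q * q4a q = Matrix.diagonal fun i : Fin q => (-(1 / 4) * ((q : ℂ) - (i : ℕ))) := by
  ext i j
  rw [mul_apply_pick _ _ i j i, Matrix.diagonal_apply, dif_pos (by have := i.2; omega)]
  · simp only [q5b, q4a, Matrix.of_apply]
    by_cases h : i = j
    · subst h
      rw [if_pos rfl, if_pos trivial, if_pos rfl, ← Complex.ofReal_mul, show 1 / 2 * √((q : ℝ) - (i : ℕ)) * (-(1 / 2) * √((q : ℝ) - (i : ℕ)))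
          = -(1 / 4) * (√((q : ℝ) - (i : ℕ)) * √((q : ℝ) - (i : ℕ))) by ring,
          sqrt_mul_sqrt_cast q i i.2.le]
      push_cast; ring
    · have : (i : ℕ) ≠ j := fun e => h (Fin.ext e)
      simp [if_neg h, this]
  · intro k hk
    simp only [q5b, Matrix.of_apply]
    rw [if_neg (Ne.symm hk), zero_mul]

/-! ### The relations of the superspin representation. -/

/-- The grading operator of the superspin `q / 2` representation. -/
def grading (q : ℕ) : NSs q := Matrix.fromBlocks 1 0 0 (-1)

theorem parity_eq (q : ℕ) (f : NSs q) : parity q f = grading q * f * grading q := rfl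

/-- The commutator `[J_4, J_5]`, which is constant on the two blocks. -/
def ospK (q : ℕ) : NSs q := Matrix.fromBlocks ((-(q : ℂ) / 4) • 1) 0 0 ((((q : ℂ) + 1) / 4) • 1)

theorem ospQ4_mul_ospQ5 (q : ℕ) : ospQ4 q * ospQ5 q = (1 / 2 : ℂ) • (ospK q - (1 / 2 : ℂ) • ospZ q) := by
  rw [ospQ4_eq, ospQ5_eq, Matrix.fromBlocks_multiply, q4a_mul_q5b, q4b_mul_q5a, ospK, ospZ,
    Matrix.fromBlocks_smul, fromBlocks_sub', Matrix.fromBlocks_smul]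
  simp only [Matrix.zero_mul, Matrix.mul_zero, zero_add, add_zero, smul_zero, sub_zero, spinZ,
    Matrix.fromBlocks_inj, true_and]
  constructor
  · ext i j
    simp only [Matrix.diagonal_apply, Matrix.smul_apply, Matrix.sub_apply, Matrix.one_apply,
      smul_eq_mul]
    split_ifs
    · push_cast; ring
    · ring
  · ext i j
    simp only [Matrix.diagonal_apply, Matrix.smul_apply, Matrix.sub_apply, Matrix.one_apply,
      smul_eq_mul]
    split_ifs
    · push_cast; ring
    · ring

theorem ospQ5_mul_ospQ4 (q : ℕ) :
    ospQ5 q * ospQ4 q = (-1 / 2 : ℂ) • (ospK q + (1 / 2 : ℂ) • ospZ q) := by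
  rw [ospQ4_eq, ospQ5_eq, Matrix.fromBlocks_multiply, q5a_mul_q4b, q5b_mul_q4a, ospK, ospZ,
    Matrix.fromBlocks_smul, Matrix.fromBlocks_add, Matrix.fromBlocks_smul]
  simp only [Matrix.zero_mul, Matrix.mul_zero, zero_add, add_zero, smul_zero, sub_zero, spinZ,
    Matrix.fromBlocks_inj, true_and]
  constructor
  · ext i j
    simp only [Matrix.diagonal_apply, Matrix.smul_apply, Matrix.add_apply, Matrix.one_apply,
      smul_eq_mul]
    split_ifs
    · push_cast; ring
    · ring
  · ext i j
    simp only [Matrix.diagonal_apply, Matrix.smul_apply, Matrix.add_apply, Matrix.one_apply,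
      smul_eq_mul]
    split_ifs
    · push_cast; ring
    · ring

theorem isOsp_nc (q : ℕ) : IsOsp (ospP q) (ospM q) (ospZ q) (ospQ4 q) (ospQ5 q) where
  qq := by
    rw [ospQ4_eq, Matrix.fromBlocks_multiply, q4a_mul_q4b, q4b_mul_q4a, ospP, Matrix.fromBlocks_smul]
    simp
  rr := by
    rw [ospQ5_eq, Matrix.fromBlocks_multiply, q5a_mul_q5b, q5b_mul_q5a, ospM, Matrix.fromBlocks_smul]
    simp
  qr := by
    rw [ospQ4_mul_ospQ5, ospQ5_mul_ospQ4]; module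
  zq := by
    rw [ospQ4_eq, ospZ, Matrix.fromBlocks_multiply, Matrix.fromBlocks_multiply,
      fromBlocks_sub', Matrix.fromBlocks_smul]
    simp only [Matrix.zero_mul, Matrix.mul_zero, zero_add, add_zero, smul_zero, sub_zero, spinZ,
      Matrix.fromBlocks_inj, true_and, and_true]
    constructor
    · ext i j
      simp only [Matrix.sub_apply, Matrix.diagonal_mul, Matrix.mul_diagonal, q4a, Matrix.of_apply,
        Matrix.smul_apply, smul_eq_mul]
      split_ifs with h
      · rw [h]; push_cast; ring
      · ring
    · ext i j
      simp only [Matrix.sub_apply, Matrix.diagonal_mul, Matrix.mul_diagonal, q4b, Matrix.of_apply,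
        Matrix.smul_apply, smul_eq_mul]
      split_ifs with h
      · rw [← h]; push_cast; ring
      · ring
  zr := by
    rw [ospQ5_eq, ospZ, Matrix.fromBlocks_multiply, Matrix.fromBlocks_multiply,
      fromBlocks_sub', Matrix.fromBlocks_smul]
    simp only [Matrix.zero_mul, Matrix.mul_zero, zero_add, add_zero, smul_zero, sub_zero, spinZ,
      Matrix.fromBlocks_inj, true_and, and_true]
    constructor
    · ext i j
      simp only [Matrix.sub_apply, Matrix.diagonal_mul, Matrix.mul_diagonal, q5a, Matrix.of_apply,
        Matrix.smul_apply, smul_eq_mul]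
      split_ifs with h
      · rw [h]; push_cast; ring
      · ring
    · ext i j
      simp only [Matrix.sub_apply, Matrix.diagonal_mul, Matrix.mul_diagonal, q5b, Matrix.of_apply,
        Matrix.smul_apply, smul_eq_mul]
      split_ifs with h
      · rw [h]; push_cast; ring
      · ring

theorem isSl2_nc (q : ℕ) : IsSl2 (ospP q) (ospM q) (ospZ q) := (isOsp_nc q).isSl2

/-- The spin `q/2` representation is the upper diagonal block of the superspin `q/2` one. -/
theorem isSl2_spin (q : ℕ) : IsSl2 (spinP (q + 1)) (spinM (q + 1)) (spinZ (q + 1)) := by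
  have h := isSl2_nc q
  have hz := h.zp
  have hm := h.zm
  have hp := h.pm
  simp only [ospP, ospM, ospZ, Matrix.fromBlocks_multiply, fromBlocks_sub',
    Matrix.fromBlocks_smul, Matrix.fromBlocks_neg, Matrix.fromBlocks_inj, Matrix.mul_zero,
    add_zero] at hz hm hp
  exact ⟨hz.1, hm.1, hp.1⟩

/-- The Casimir operator of the spin `q / 2` representation. -/
theorem casimir_spin (q : ℕ) : spinZ (q + 1) * spinZ (q + 1) + spinZ (q + 1)
    + spinM (q + 1) * spinP (q + 1) = ((q : ℂ) / 2 * ((q : ℂ) / 2 + 1)) • 1 := by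
  have h : spinM (q + 1) * spinP (q + 1)
      = Matrix.diagonal fun i : Fin (q + 1) => ((i : ℕ) : ℂ) * ((q : ℂ) + 1 - (i : ℕ)) := by
    ext i j
    rw [mul_apply_pick _ _ i j (i - 1), Matrix.diagonal_apply, dif_pos (by have := i.2; omega)]
    · simp only [spinM, spinP, Matrix.of_apply]
      by_cases hi0 : (i : ℕ) = 0
      · simp [hi0]
      · have hi1 : (i : ℕ) = i - 1 + 1 := by omega
        rw [if_pos hi1, ← hi1]
        by_cases hij : i = j
        · subst hij
          rw [if_pos rfl, if_pos rfl, ← Complex.ofReal_mul, Real.mul_self_sqrt]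
          · push_cast; ring
          · refine mul_nonneg (Nat.cast_nonneg _) (sub_nonneg.2 ?_)
            exact_mod_cast i.2.le
        · have : (i : ℕ) ≠ j := fun e => hij (Fin.ext e)
          simp [if_neg hij, this]
    · intro k hk
      simp only [spinM, Matrix.of_apply]
      rw [if_neg (by omega), zero_mul]
  rw [h, spinZ, Matrix.diagonal_mul_diagonal, Matrix.diagonal_add, Matrix.diagonal_add,
    ← Matrix.diagonal_one, ← Matrix.diagonal_smul]
  congr 1
  funext i
  simp only [Pi.smul_apply, smul_eq_mul, mul_one]
  push_cast; ring

theorem fromBlocks_diag_pow {m n : Type*} [Fintype m] [Fintype n] [DecidableEq m] [DecidableEq n]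
    (A : Matrix m m ℂ) (D : Matrix n n ℂ) (k : ℕ) :
    Matrix.fromBlocks A 0 0 D ^ k = Matrix.fromBlocks (A ^ k) 0 0 (D ^ k) := by
  induction k with
  | zero => simp
  | succ k ih => rw [pow_succ, ih, Matrix.fromBlocks_multiply]; simp [pow_succ]

theorem ospP_pow (q k : ℕ) :
    ospP q ^ k = Matrix.fromBlocks (spinP (q + 1) ^ k) 0 0 (spinP q ^ k) := fromBlocks_diag_pow _ _ _

theorem spinM_pow_apply (N k : ℕ) (i j : Fin N) (h : (i : ℕ) ≠ j + k) : (spinM N ^ k) i j = 0 := by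
  induction k generalizing i with
  | zero => rw [pow_zero, Matrix.one_apply_ne fun e => h (by rw [e, add_zero])]
  | succ k ih =>
    rw [pow_succ', Matrix.mul_apply]
    refine Finset.sum_eq_zero fun c _ => ?_
    by_cases hc : (i : ℕ) = c + 1
    · rw [ih c (by omega), mul_zero]
    · simp only [spinM, Matrix.of_apply]
      rw [if_neg hc, zero_mul]

theorem spinM_nilpotent (N : ℕ) : IsNilpotent (spinM N) :=
  ⟨N, by ext i j; exact spinM_pow_apply N N i j (by have := i.2; omega)⟩

theorem ospM_nilpotent (q : ℕ) : IsNilpotent (ospM q) := by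
  refine ⟨q + 1, ?_⟩
  rw [ospM, fromBlocks_diag_pow]
  have h1 : spinM (q + 1) ^ (q + 1) = 0 := by
    ext i j; exact spinM_pow_apply _ _ i j (by have := i.2; omega)
  have h2 : spinM q ^ (q + 1) = 0 := by
    ext i j; exact spinM_pow_apply _ _ i j (by have := i.2; omega)
  rw [h1, h2, Matrix.fromBlocks_zero]

/-- A single explicit row is enough to see that powers of `J_+`, and their products with the blocks
of `J_4`, do not vanish. -/
theorem spinP_pow_first_row {N : ℕ} (k : ℕ) (hk : k < N) :
    (∀ b : Fin N, (b : ℕ) ≠ k → (spinP N ^ k) ⟨0, by omega⟩ b = 0) ∧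
      (spinP N ^ k) ⟨0, by omega⟩ ⟨k, hk⟩ ≠ 0 := by
  induction k with
  | zero =>
    refine ⟨fun b hb => ?_, by simp⟩
    rw [pow_zero, Matrix.one_apply_ne]
    intro e; exact hb (by rw [← e])
  | succ k ih =>
    obtain ⟨h1, h2⟩ := ih (by omega)
    have key : ∀ b : Fin N, (spinP N ^ (k + 1)) ⟨0, by omega⟩ b
        = (spinP N ^ k) ⟨0, by omega⟩ ⟨k, by omega⟩ * spinP N ⟨k, by omega⟩ b := by
      intro b
      rw [pow_succ, mul_apply_pick _ _ _ _ k, dif_pos (by omega)]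
      intro c hc
      rw [h1 c hc, zero_mul]
    constructor
    · intro b hb
      rw [key]
      simp only [spinP, Matrix.of_apply]
      rw [if_neg (Ne.symm hb), mul_zero]
    · rw [key]
      refine mul_ne_zero h2 ?_
      simp only [spinP, Matrix.of_apply]
      rw [if_pos trivial, Complex.ofReal_ne_zero]
      refine (Real.sqrt_pos.2 (mul_pos (by positivity) (sub_pos.2 ?_))).ne'
      exact_mod_cast hk

theorem spinP_pow_ne_zero {N k : ℕ} (hk : k < N) : spinP N ^ k ≠ 0 := fun h =>
  (spinP_pow_first_row k hk).2 (by rw [h]; rfl)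

theorem spinP_pow_mul_q4a_ne_zero {q k : ℕ} (hk : k < q) : spinP (q + 1) ^ k * q4a q ≠ 0 := by
  intro h
  have e := congrFun (congrFun h ⟨0, by omega⟩) ⟨k, hk⟩
  rw [mul_apply_pick _ _ _ _ k, dif_pos (by omega)] at e
  · rcases mul_eq_zero.1 e with e | e
    · exact (spinP_pow_first_row k (by omega)).2 e
    · simp only [q4a, Matrix.of_apply, if_pos trivial, Complex.ofReal_eq_zero, if_true] at e
      rcases mul_eq_zero.1 e with e | e
      · norm_num at e
      · have : (0 : ℝ) < q - k := sub_pos.2 (by exact_mod_cast hk)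
        exact (Real.sqrt_pos.2 this).ne' e
  · intro c hc
    rw [(spinP_pow_first_row k (by omega)).1 c hc, zero_mul]

theorem spinP_pow_mul_q4b_ne_zero {q k : ℕ} (hk : k < q) : spinP q ^ k * q4b q ≠ 0 := by
  intro h
  have e := congrFun (congrFun h ⟨0, by omega⟩) ⟨k + 1, by omega⟩
  rw [mul_apply_pick _ _ _ _ k, dif_pos (by omega)] at e
  · rcases mul_eq_zero.1 e with e | e
    · exact (spinP_pow_first_row k (by omega)).2 e
    · simp only [q4b, Matrix.of_apply, if_pos trivial, Complex.ofReal_eq_zero, if_true] at e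
      rcases mul_eq_zero.1 e with e | e
      · norm_num at e
      · exact (Real.sqrt_pos.2 (by positivity)).ne' e
  · intro c hc
    rw [(spinP_pow_first_row k (by omega)).1 c hc, zero_mul]

/-! ### Highest weight vectors among matrices -/

theorem IsSl2.adE_z_pow {A : Type*} [Ring A] [Algebra ℂ A] {P M Z : A} (h : IsSl2 P M Z) (j : ℕ) :
    adE Z (P ^ j) = (j : ℂ) • P ^ j := by
  induction j with
  | zero => simp [adE_apply]
  | succ j ih =>
    rw [pow_succ, adE_mul, ih, adE_apply, h.zp, smul_mul_assoc]
    push_cast; module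

theorem adE_self_pow {A : Type*} [Ring A] [Algebra ℂ A] (P : A) (j : ℕ) : adE P (P ^ j) = 0 := by
  rw [adE_apply, ← pow_succ, ← pow_succ', sub_self]

theorem isTop_spinP_pow (q j : ℕ) :
    IsTop (adE (spinP (q + 1))) (adE (spinM (q + 1))) (adE (spinZ (q + 1))) (2 * j)
      (spinP (q + 1) ^ j) where
  p := adE_self_pow _ _
  z := by rw [(isSl2_spin q).adE_z_pow]; push_cast; congr 1; ring
  nil := (adE_nilpotent (spinM_nilpotent (q + 1))).imp fun N hN => by rw [hN]; rfl

theorem grading_sq (q : ℕ) : grading q * grading q = 1 := by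
  rw [grading, Matrix.fromBlocks_multiply]; simp

theorem grading_comm_P (q : ℕ) : Commute (grading q) (ospP q) := by
  have : grading q * ospP q = ospP q * grading q := by
    rw [grading, ospP, Matrix.fromBlocks_multiply, Matrix.fromBlocks_multiply]; simp
  exact this

theorem grading_comm_M (q : ℕ) : Commute (grading q) (ospM q) := by
  have : grading q * ospM q = ospM q * grading q := by
    rw [grading, ospM, Matrix.fromBlocks_multiply, Matrix.fromBlocks_multiply]; simp
  exact this

theorem grading_comm_Z (q : ℕ) : Commute (grading q) (ospZ q) := by
  have : grading q * ospZ q = ospZ q * grading q := by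
    rw [grading, ospZ, Matrix.fromBlocks_multiply, Matrix.fromBlocks_multiply]; simp
  exact this

theorem grading_Q4 (q : ℕ) : grading q * ospQ4 q = -(ospQ4 q * grading q) := by
  rw [grading, ospQ4_eq, Matrix.fromBlocks_multiply, Matrix.fromBlocks_multiply,
    Matrix.fromBlocks_neg]; simp

theorem grading_Q5 (q : ℕ) : grading q * ospQ5 q = -(ospQ5 q * grading q) := by
  rw [grading, ospQ5_eq, Matrix.fromBlocks_multiply, Matrix.fromBlocks_multiply,
    Matrix.fromBlocks_neg]; simp

/-- The highest weight vector of superspin `n / 2` in the truncated supersphere, without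
normalization. -/
def nTop (q n : ℕ) : NSs q :=
  if Even n then ospP q ^ (n / 2) else ospP q ^ (n / 2) * (grading q * ospQ4 q)

theorem nTop_even (q i : ℕ) : nTop q (2 * i) = ospP q ^ i := by
  rw [nTop, if_pos (even_two_mul i), Nat.mul_div_cancel_left i two_pos]

theorem nTop_odd (q i : ℕ) : nTop q (2 * i + 1) = ospP q ^ i * (grading q * ospQ4 q) := by
  rw [nTop, if_neg (by simp), show (2 * i + 1) / 2 = i by omega]

/-- The odd operator in the definition of the highest weight vectors of half-integer superspin. -/
theorem odd_top_operator (q : ℕ) :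
    (ospZ q - (3 / 4 : ℂ) • 1) * ospQ4 q + ospP q * ospQ5 q
      = ((2 * (q : ℂ) + 1) / 4) • (grading q * ospQ4 q) := by
  have h := isOsp_nc q
  have e1 : ospP q * ospQ5 q = (4 : ℂ) • (ospQ4 q * (ospQ4 q * ospQ5 q)) := by
    nth_rw 1 [h.p_eq]
    rw [smul_mul_assoc, mul_assoc]
  have e2 : ospQ4 q * ospZ q = ospZ q * ospQ4 q - (1 / 2 : ℂ) • ospQ4 q := by
    rw [← h.zq]; abel
  -- On each block `ospK q` is the scalar `1/8 - (2q+1)/8 · grading q`, and the grading anticommutes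
  -- with `J_4`. The constant `3/4` in the operator is the one for which all multiples of `J_4`
  -- itself cancel.
  have e3 : ospQ4 q * ospK q = (1 / 8 : ℂ) • ospQ4 q + ((2 * (q : ℂ) + 1) / 8) • (grading q * ospQ4 q) := by
    rw [ospK, grading, ospQ4_eq, Matrix.fromBlocks_multiply, Matrix.fromBlocks_multiply,
      Matrix.fromBlocks_smul, Matrix.fromBlocks_smul, Matrix.fromBlocks_add]
    simp only [Matrix.zero_mul, Matrix.mul_zero, zero_add, add_zero, smul_zero, one_smul,
      Matrix.mul_smul, Matrix.mul_one, Matrix.one_mul, Matrix.neg_mul, Matrix.fromBlocks_inj,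
      true_and, and_true]
    constructor <;> module
  rw [e1, ospQ4_mul_ospQ5, sub_mul, smul_mul_assoc, one_mul, mul_smul_comm, mul_sub, mul_smul_comm,
    e2, e3]
  module

/-- Each exchange of `J_5` with `J_+` produces `-J_4`, which commutes with `J_+`. For `j = 0` the
truncated exponent is harmless because of the factor `j`. -/
theorem ospQ5_mul_ospP_pow (q j : ℕ) : ospQ5 q * ospP q ^ j = ospP q ^ j * ospQ5 q
    - (j : ℂ) • (ospP q ^ (j - 1) * ospQ4 q) := by
  have h := isOsp_nc q
  induction j with
  | zero => simp
  | succ j ih =>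
    have hpr : ospQ5 q * ospP q = ospP q * ospQ5 q - ospQ4 q := by
      have e := h.pr
      rw [sub_eq_iff_eq_add] at e
      rw [e]; abel
    have hpq : ospQ4 q * ospP q = ospP q * ospQ4 q := h.comm_pq.eq.symm
    have hj : (j : ℂ) • (ospP q ^ (j - 1) * (ospP q * ospQ4 q)) = (j : ℂ) • (ospP q ^ j * ospQ4 q) := by
      cases j with
      | zero => simp
      | succ j => rw [Nat.add_sub_cancel, ← mul_assoc, ← pow_succ]
    rw [Nat.add_sub_cancel, pow_succ, ← mul_assoc, ih, sub_mul, mul_assoc, hpr, mul_sub,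
      smul_mul_assoc, mul_assoc _ (ospQ4 q), hpq, hj, ← mul_assoc]
    push_cast; module

/-- The factor between `[J_5, T_n]` and the corresponding power of `J_+`. -/
theorem oddComm_nTop_odd (q i : ℕ) : oddComm q (ospQ5 q) (nTop q (2 * i + 1))
    = Matrix.fromBlocks ((((i : ℂ) - q) / 4) • spinP (q + 1) ^ i) 0 0
        ((-((q : ℂ) + 1 + i) / 4) • spinP q ^ i) := by
  have h := isOsp_nc q
  have hc : ∀ j, grading q * ospP q ^ j = ospP q ^ j * grading q := fun j =>
    ((grading_comm_P q).pow_right j).eq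
  -- The top vector is odd, so the graded commutator with `J_5` is an anticommutator.
  have hpar : parity q (nTop q (2 * i + 1)) = -(nTop q (2 * i + 1)) := by
    have e : grading q * (ospP q ^ i * (grading q * ospQ4 q)) * grading q
        = (grading q * ospP q ^ i) * ((grading q * ospQ4 q) * grading q) := by
      simp only [mul_assoc]
    have e' : grading q * ospQ4 q * grading q = -ospQ4 q := by
      rw [grading_Q4, neg_mul, mul_assoc, grading_sq, mul_one]
    rw [parity_eq, nTop_odd, e, e', hc, mul_neg, mul_assoc]
  have hQGQ : ospQ4 q * (grading q * ospQ4 q) = (-1 / 4 : ℂ) • (grading q * ospP q) := by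
    rw [← mul_assoc, ← neg_neg (ospQ4 q * grading q), ← grading_Q4, neg_mul, mul_assoc, h.qq,
      mul_smul_comm]
    module
  have hRGQ : ospQ5 q * (grading q * ospQ4 q) = -(grading q * (ospQ5 q * ospQ4 q)) := by
    rw [← mul_assoc, ← neg_neg (ospQ5 q * grading q), ← grading_Q5, neg_mul, mul_assoc]
  have hK : ospK q = ospQ4 q * ospQ5 q - ospQ5 q * ospQ4 q := by
    rw [ospQ4_mul_ospQ5, ospQ5_mul_ospQ4]; module
  have hpp : (i : ℂ) • (ospP q ^ (i - 1) * (grading q * ospP q))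
      = (i : ℂ) • (ospP q ^ i * grading q) := by
    cases i with
    | zero => simp
    | succ i => rw [Nat.add_sub_cancel, (grading_comm_P q).eq, ← mul_assoc, ← pow_succ]
  -- The anticommutator with `J_5` collapses to `[J_4, J_5] = ospK q` plus a scalar, both constant
  -- on the blocks.
  have e : oddComm q (ospQ5 q) (nTop q (2 * i + 1))
      = grading q * (ospP q ^ i * (ospK q + ((i : ℂ) / 4) • 1)) := by
    have e1 : oddComm q (ospQ5 q) (nTop q (2 * i + 1)) = ospP q ^ i * (grading q * ospK q)
        + (1 / 4 : ℂ) • ((i : ℂ) • (ospP q ^ (i - 1) * (grading q * ospP q))) := by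
      rw [oddComm, hpar, neg_mul, sub_neg_eq_add, nTop_odd, ← mul_assoc, ospQ5_mul_ospP_pow, sub_mul,
        mul_assoc _ (ospQ5 q), hRGQ, smul_mul_assoc, mul_assoc _ (ospQ4 q), hQGQ, hK,
        mul_assoc (ospP q ^ i), mul_assoc (grading q), mul_sub (grading q), mul_sub, mul_neg,
        mul_smul_comm]
      module
    rw [e1, hpp, ← mul_assoc (grading q), hc, mul_assoc, mul_add (grading q), mul_add, mul_smul_comm,
      mul_one, mul_smul_comm, smul_smul]
    congr 2; ring
  rw [e, grading, ospP_pow, ospK, ← Matrix.fromBlocks_one, Matrix.fromBlocks_smul,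
    Matrix.fromBlocks_add, Matrix.fromBlocks_multiply, Matrix.fromBlocks_multiply]
  simp only [Matrix.zero_mul, Matrix.mul_zero, zero_add, add_zero, smul_zero, Matrix.one_mul,
    Matrix.neg_mul, ← add_smul, Matrix.mul_smul, Matrix.mul_one, Matrix.fromBlocks_inj, true_and,
    neg_zero]
  constructor
  · congr 1; ring
  · module

theorem parity_ospP_pow (q i : ℕ) : parity q (ospP q ^ i) = ospP q ^ i := by
  rw [parity_eq, ((grading_comm_P q).pow_right i).eq, mul_assoc, grading_sq, mul_one]

theorem oddComm_nTop_even (q i : ℕ) : oddComm q (ospQ5 q) (nTop q (2 * i))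
    = (-(i : ℂ)) • (ospP q ^ (i - 1) * ospQ4 q) := by
  rw [oddComm, nTop_even, parity_ospP_pow, ospQ5_mul_ospP_pow]; module

theorem isTop_nTop (q n : ℕ) :
    IsTop (adE (ospP q)) (adE (ospM q)) (adE (ospZ q)) n (nTop q n) where
  p := by
    rcases Nat.even_or_odd' n with ⟨i, rfl | rfl⟩
    · rw [nTop_even, adE_self_pow]
    · have : adE (ospP q) (grading q * ospQ4 q) = 0 := by
        rw [adE_mul, adE_apply, adE_apply, (grading_comm_P q).eq, (isOsp_nc q).comm_pq.eq]; simp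
      rw [nTop_odd, adE_mul, adE_self_pow, this]; simp
  z := by
    rcases Nat.even_or_odd' n with ⟨i, rfl | rfl⟩
    · rw [nTop_even, (isSl2_nc q).adE_z_pow]; push_cast; congr 1; ring
    · have : adE (ospZ q) (grading q * ospQ4 q) = (1 / 2 : ℂ) • (grading q * ospQ4 q) := by
        rw [adE_mul, adE_apply, adE_apply, (grading_comm_Z q).eq, (isOsp_nc q).zq]; simp
      rw [nTop_odd, adE_mul, (isSl2_nc q).adE_z_pow, this, smul_mul_assoc, mul_smul_comm]
      push_cast; module
  nil := (adE_nilpotent (ospM_nilpotent q)).imp fun N hN => by rw [hN]; rfl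

theorem isTop_oddComm_nTop (q n : ℕ) :
    IsTop (adE (ospP q)) (adE (ospM q)) (adE (ospZ q)) n (oddComm q (ospQ5 q) (nTop q (n + 1))) where
  p := by
    rcases Nat.even_or_odd' n with ⟨i, rfl | rfl⟩
    · rw [oddComm_nTop_odd, adE_apply, ospP, Matrix.fromBlocks_multiply, Matrix.fromBlocks_multiply]
      simp [← pow_succ, ← pow_succ']
    · rw [show 2 * i + 1 + 1 = 2 * (i + 1) by ring, oddComm_nTop_even, map_smul, adE_mul,
        adE_self_pow, adE_apply, (isOsp_nc q).comm_pq.eq]; simp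
  z := by
    rcases Nat.even_or_odd' n with ⟨i, rfl | rfl⟩
    · have h := (isSl2_nc q).adE_z_pow i
      rw [adE_apply, ospZ, ospP_pow, Matrix.fromBlocks_multiply, Matrix.fromBlocks_multiply,
        fromBlocks_sub', Matrix.fromBlocks_smul, Matrix.fromBlocks_inj] at h
      simp only [Matrix.mul_zero, add_zero, Matrix.zero_mul, zero_add] at h
      rw [oddComm_nTop_odd, adE_apply, ospZ, Matrix.fromBlocks_multiply, Matrix.fromBlocks_multiply,
        fromBlocks_sub', Matrix.fromBlocks_smul]
      simp only [Matrix.mul_zero, add_zero, Matrix.zero_mul, zero_add, Matrix.mul_smul,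
        Matrix.smul_mul, ← smul_sub, h.1, h.2.2.2, smul_zero, sub_zero]
      congr 1 <;> · rw [smul_comm]; push_cast; congr 1; ring
    · rw [show 2 * i + 1 + 1 = 2 * (i + 1) by ring, oddComm_nTop_even, map_smul, adE_mul,
        Nat.add_sub_cancel, (isSl2_nc q).adE_z_pow, adE_apply, (isOsp_nc q).zq, smul_mul_assoc,
        mul_smul_comm]
      push_cast; module
  nil := (adE_nilpotent (ospM_nilpotent q)).imp fun N hN => by rw [hN]; rfl

theorem fromBlocks_eq_zero {m n : Type*} {A : Matrix m m ℂ} {B : Matrix m n ℂ} {C : Matrix n m ℂ}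
    {D : Matrix n n ℂ} (h : Matrix.fromBlocks A B C D = 0) : A = 0 ∧ B = 0 ∧ C = 0 ∧ D = 0 := by
  rwa [← Matrix.fromBlocks_zero, Matrix.fromBlocks_inj] at h

/-- The two vectors have different ratios between their blocks. For `n = 2i` they are multiples of
`J_+^i` on each block and comparing the blocks leaves `(2i+1) b = 0`; for `n = 2i + 1` the grading
flips one sign. The bound on `n` ensures that `J_+^i` is nonzero on the smaller block too. -/
theorem nTop_pair (q n : ℕ) (hn : n < 2 * q) (a b : ℂ)
    (h : a • nTop q n + b • oddComm q (ospQ5 q) (nTop q (n + 1)) = 0) : a = 0 ∧ b = 0 := by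
  rcases Nat.even_or_odd' n with ⟨i, rfl | rfl⟩
  · rw [nTop_even, oddComm_nTop_odd, ospP_pow, Matrix.fromBlocks_smul, Matrix.fromBlocks_smul,
      Matrix.fromBlocks_add] at h
    obtain ⟨h1, -, -, h4⟩ := fromBlocks_eq_zero h
    rw [smul_smul, ← add_smul, smul_eq_zero, or_iff_left (spinP_pow_ne_zero (by omega))] at h1 h4
    have h5 : b * (2 * (i : ℂ) + 1) = 0 := by linear_combination 4 * h1 - 4 * h4
    have h6 : (2 * (i : ℂ) + 1) ≠ 0 := by exact_mod_cast (by omega : 2 * i + 1 ≠ 0)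
    have hb : b = 0 := (mul_eq_zero.1 h5).resolve_right h6
    rw [hb, zero_mul, add_zero] at h1
    exact ⟨h1, hb⟩
  · rw [nTop_odd, show 2 * i + 1 + 1 = 2 * (i + 1) by ring, oddComm_nTop_even, Nat.add_sub_cancel,
      ospP_pow, grading, ospQ4_eq, Matrix.fromBlocks_multiply, Matrix.fromBlocks_multiply,
      Matrix.fromBlocks_multiply, Matrix.fromBlocks_smul, Matrix.fromBlocks_smul,
      Matrix.fromBlocks_smul, Matrix.fromBlocks_add] at h
    obtain ⟨-, h2, h3, -⟩ := fromBlocks_eq_zero h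
    simp only [Matrix.zero_mul, add_zero, Matrix.mul_zero, zero_add, Matrix.one_mul, Matrix.neg_mul,
      Matrix.mul_neg, smul_neg, ← neg_smul, smul_smul, ← add_smul, smul_eq_zero] at h2 h3
    rw [or_iff_left (spinP_pow_mul_q4a_ne_zero (by omega))] at h2
    rw [or_iff_left (spinP_pow_mul_q4b_ne_zero (by omega))] at h3
    push_cast at h2 h3
    have ha : a = 0 := by linear_combination (h2 - h3) / 2
    rw [ha, zero_add] at h2
    refine ⟨ha, (mul_eq_zero.1 h2).resolve_right ?_⟩
    exact neg_ne_zero.2 (by exact_mod_cast Nat.succ_ne_zero i)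

/-- At top superspin only the larger block of `J_+^q` survives, and there is no second vector of
that spin. -/
theorem nTop_last (q : ℕ) (a : ℂ) (h : a • nTop q (2 * q) = 0) : a = 0 := by
  rw [nTop_even, ospP_pow, Matrix.fromBlocks_smul] at h
  exact (smul_eq_zero.1 (fromBlocks_eq_zero h).1).resolve_right (spinP_pow_ne_zero (by omega))

end
end FuzzySupersphere

namespace FuzzySupersphere
noncomputable section

/-! ### Linear maps that match ladders -/

section Ladders

variable {V E W ι : Type} [AddCommGroup V] [Module ℂ V] [AddCommGroup E] [Module ℂ E]
  [AddCommGroup W] [Module ℂ W] {P M Z : Module.End ℂ V} {P' M' Z' : Module.End ℂ W}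

/-- The vectors `M ^ k v_i`, `k ≤ l_i`, of a family of ladders. -/
def rungs (M : Module.End ℂ V) (l : ι → ℕ) (v : ι → V) (t : Σ i, Fin (l i + 1)) : V :=
  (M ^ (t.2 : ℕ)) (v t.1)

/-- The subspace `N` only has to contain the kernel of `π` and to be stable under raising; it need
not be the kernel. -/
theorem ladder_linearIndependent [Fintype ι] (h : IsSl2 P M Z) (π : V →ₗ[ℂ] E) {N : Submodule ℂ V}
    (hker : ∀ x, π x = 0 → x ∈ N) (hN : ∀ x ∈ N, P x ∈ N) {l : ι → ℕ} {v : ι → V}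
    (hv : ∀ i, IsTop P M Z (l i) (v i))
    (hind : ∀ c : ι → ℂ, ∑ i, c i • v i ∈ N → ∀ i, c i = 0) :
    LinearIndependent ℂ fun t => π (rungs M l v t) := by
  rw [Fintype.linearIndependent_iff]
  intro g hg
  refine ladder_independent h hN hv hind g (hker _ ?_)
  rw [map_sum, ← hg]
  exact Finset.sum_congr rfl fun t _ => map_smul _ _ _

theorem map_ladderSpan (h : IsSl2 P M Z) (π : V →ₗ[ℂ] E) {l : ι → ℕ} {v : ι → V}
    (hv : ∀ i, IsTop P M Z (l i) (v i)) :
    (ladderSpan M v).map π = Submodule.span ℂ (Set.range fun t => π (rungs M l v t)) := by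
  rw [ladderSpan, Submodule.map_span]
  apply le_antisymm
  · rw [Submodule.span_le]
    rintro _ ⟨_, ⟨⟨i, k⟩, rfl⟩, rfl⟩
    by_cases hk : k ≤ l i
    · exact Submodule.subset_span ⟨⟨i, ⟨k, by omega⟩⟩, rfl⟩
    · have := (hv i).pow_eq_zero h (k := k) (by omega)
      simp only [this, map_zero]
      exact Submodule.zero_mem _
  · refine Submodule.span_mono ?_
    rintro _ ⟨⟨i, k⟩, rfl⟩
    exact ⟨_, ⟨(i, k), rfl⟩, rfl⟩

theorem exists_equiv_of_bases {σ : Type*} {b : σ → E} (hb : LinearIndependent ℂ b)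
    {T : Submodule ℂ E} (hT : T = Submodule.span ℂ (Set.range b)) {b' : σ → W}
    (hb' : LinearIndependent ℂ b') (hW : Submodule.span ℂ (Set.range b') = ⊤) :
    ∃ ψ : T ≃ₗ[ℂ] W, ∀ t, ((ψ.symm (b' t) : T) : E) = b t := by
  subst hT
  let B := Module.Basis.span hb
  let B' := Module.Basis.mk hb' hW.ge
  refine ⟨B.equiv B' (Equiv.refl σ), fun t => ?_⟩
  have h1 : b' t = B' t := (Module.Basis.mk_apply hb' hW.ge t).symm
  rw [h1, Module.Basis.equiv_symm, Module.Basis.equiv_apply]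
  exact congrArg Subtype.val (Module.Basis.span_apply hb t)

/-- A linear equivalence from a subspace `T` of `E` matches two families of ladders. -/
def Matches (π : V →ₗ[ℂ] E) (M : Module.End ℂ V) (M' : Module.End ℂ W) (l : ι → ℕ) (v : ι → V)
    (w : ι → W) {T : Submodule ℂ E} (ψ : T ≃ₗ[ℂ] W) : Prop :=
  ∀ i k, k ≤ l i → ((ψ.symm ((M' ^ k) (w i)) : T) : E) = π ((M ^ k) (v i))

/-- The rungs form a basis of `T` by independence and of `W` by independence and count, so matching
the two bases is a linear equivalence. -/
theorem exists_matches [Fintype ι] [FiniteDimensional ℂ W] (h : IsSl2 P M Z) (h' : IsSl2 P' M' Z')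
    (π : V →ₗ[ℂ] E) {N : Submodule ℂ V}
    (hker : ∀ x, π x = 0 → x ∈ N) (hN : ∀ x ∈ N, P x ∈ N) {l : ι → ℕ} {v : ι → V} {w : ι → W}
    (hv : ∀ i, IsTop P M Z (l i) (v i)) (hw : ∀ i, IsTop P' M' Z' (l i) (w i))
    (hind : ∀ c : ι → ℂ, ∑ i, c i • v i ∈ N → ∀ i, c i = 0)
    (hind' : ∀ c : ι → ℂ, ∑ i, c i • w i ∈ (⊥ : Submodule ℂ W) → ∀ i, c i = 0)
    (hcard : ∑ i, (l i + 1) = Module.finrank ℂ W)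
    {T : Submodule ℂ E} (hT : T = (ladderSpan M v).map π) :
    ∃ ψ : T ≃ₗ[ℂ] W, Matches π M M' l v w ψ := by
  have hb := ladder_linearIndependent h π hker hN hv hind
  have hb' : LinearIndependent ℂ fun t => rungs M' l w t :=
    ladder_linearIndependent h' LinearMap.id (N := ⊥) (fun x hx => hx) (by simp) hw hind'
  have hs := hb'.span_eq_top_of_card_eq_finrank' (by simp [hcard])
  obtain ⟨ψ, hψ⟩ := exists_equiv_of_bases hb (hT.trans (map_ladderSpan h π hv)) hb' hs
  exact ⟨ψ, fun i k hk => hψ ⟨i, ⟨k, by omega⟩⟩⟩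

variable {π : V →ₗ[ℂ] E} {l : ι → ℕ} {v : ι → V} {w : ι → W} {T : Submodule ℂ E}

theorem Matches.apply {ψ : T ≃ₗ[ℂ] W} (hψ : Matches π M M' l v w ψ) {i : ι} {k : ℕ} (hk : k ≤ l i)
    (hm : π ((M ^ k) (v i)) ∈ T) : ψ ⟨π ((M ^ k) (v i)), hm⟩ = (M' ^ k) (w i) := by
  rw [← LinearEquiv.eq_symm_apply]
  exact Subtype.ext (hψ i k hk).symm

theorem Matches.unique (h : IsSl2 P M Z) (hv : ∀ i, IsTop P M Z (l i) (v i))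
    (hT : T = (ladderSpan M v).map π) {ψ ψ' : T ≃ₗ[ℂ] W}
    (hψ : Matches π M M' l v w ψ) (hψ' : Matches π M M' l v w ψ') : ψ = ψ' := by
  have key : ∀ f (hf : f ∈ T), ψ ⟨f, hf⟩ = ψ' ⟨f, hf⟩ := by
    intro f hf
    have hf' := hf
    rw [hT, map_ladderSpan h π hv] at hf'
    have hle : Submodule.span ℂ (Set.range fun t => π (rungs M l v t)) ≤ T := by
      rw [hT, map_ladderSpan h π hv]
    induction hf' using Submodule.span_induction with
    | mem x hx =>
      obtain ⟨⟨i, k⟩, rfl⟩ := hx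
      exact (hψ.apply (by omega) hf).trans (hψ'.apply (by omega) hf).symm
    | zero => exact (map_zero ψ).trans (map_zero ψ').symm
    | add x y hx hy ihx ihy =>
      have e : (⟨x + y, hf⟩ : T) = ⟨x, hle hx⟩ + ⟨y, hle hy⟩ := rfl
      rw [e, map_add, map_add, ihx, ihy]
    | smul c x hx ihx =>
      have e : (⟨c • x, hf⟩ : T) = c • ⟨x, hle hx⟩ := rfl
      rw [e, map_smul, map_smul, ihx]
  exact LinearEquiv.ext fun f => key f.1 f.2

/-- Matching equivalences extend to the ambient space. -/
theorem exists_extension (ψ : T ≃ₗ[ℂ] W) (π : V →ₗ[ℂ] E) : ∃ θ : V →ₗ[ℂ] W,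
    ∀ F (hF : π F ∈ T), θ F = ψ ⟨π F, hF⟩ := by
  obtain ⟨Ψ, hΨ⟩ := LinearMap.exists_extend ψ.toLinearMap
  refine ⟨Ψ ∘ₗ π, fun F hF => ?_⟩
  exact congrArg (fun f : T →ₗ[ℂ] W => f ⟨π F, hF⟩) hΨ

theorem Matches.pow_symm_apply (h : IsSl2 P M Z) (h' : IsSl2 P' M' Z')
    (hv : ∀ i, IsTop P M Z (l i) (v i)) (hw : ∀ i, IsTop P' M' Z' (l i) (w i))
    {ψ : T ≃ₗ[ℂ] W} (hψ : Matches π M M' l v w ψ) (i : ι) (k : ℕ) :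
    ((ψ.symm ((M' ^ k) (w i)) : T) : E) = π ((M ^ k) (v i)) := by
  by_cases hk : k ≤ l i
  · exact hψ i k hk
  · rw [(hv i).pow_eq_zero h (by omega), (hw i).pow_eq_zero h' (by omega)]
    simp

/-- The action on `E` is not defined as an operator, so equivariance is expressed through
representatives in `V`. For this `ψ ∘ π` is extended to a linear map on all of `V`, to which
`intertwine` applies. -/
theorem Matches.equivariant (h : IsSl2 P M Z) (h' : IsSl2 P' M' Z')
    (hv : ∀ i, IsTop P M Z (l i) (v i)) (hw : ∀ i, IsTop P' M' Z' (l i) (w i))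
    (hT : T = (ladderSpan M v).map π) {ψ : T ≃ₗ[ℂ] W} (hψ : Matches π M M' l v w ψ)
    {F : V} (hF : F ∈ ladderSpan M v) {a : W} (ha : ((ψ.symm a : T) : E) = π F) (i : Fin 3) :
    cartesian P M Z i F ∈ ladderSpan M v ∧
      ((ψ.symm (cartesian P' M' Z' i a) : T) : E) = π (cartesian P M Z i F) := by
  obtain ⟨θ, hθ⟩ := exists_extension ψ π
  have hmem : ∀ G ∈ ladderSpan M v, π G ∈ T := fun G hG => by
    rw [hT]; exact Submodule.mem_map_of_mem hG
  have hval : ∀ G ∈ ladderSpan M v, ((ψ.symm (θ G) : T) : E) = π G := fun G hG => by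
    rw [hθ G (hmem G hG), LinearEquiv.symm_apply_apply]
  have hm : ∀ i k, k ≤ l i → θ ((M ^ k) (v i)) = (M' ^ k) (w i) := fun i k hk => by
    rw [hθ _ (hmem _ (pow_mem_ladderSpan M v i k)), hψ.apply hk]
  obtain ⟨⟨hp, hmm, hz⟩, ep, em, ez⟩ := intertwine h h' hv hw θ hm hF
  have hFa : θ F = a := by
    rw [hθ F (hmem F hF), ← LinearEquiv.eq_symm_apply]
    exact Subtype.ext ha.symm
  have hmem' : cartesian P M Z i F ∈ ladderSpan M v := by
    fin_cases i
    · exact Submodule.smul_mem _ _ (Submodule.add_mem _ hp hmm)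
    · exact Submodule.smul_mem _ _ (Submodule.sub_mem _ hp hmm)
    · exact hz
  refine ⟨hmem', ?_⟩
  have e : θ (cartesian P M Z i F) = cartesian P' M' Z' i a := by
    fin_cases i <;> simp [cartesian, ep, em, ez, hFa]
  rw [← hval _ hmem', e]

end Ladders

theorem cartesian_adE {A : Type} [Ring A] [Algebra ℂ A] (P M Z : A) (i : Fin 3) :
    cartesian (adE P) (adE M) (adE Z) i = adE (cartesian P M Z i) := by
  ext f
  fin_cases i <;>
    simp [cartesian, adE_apply, mul_add, add_mul, sub_mul, mul_sub] <;> module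

theorem evenComm_iterate {A : Type} [Ring A] [Algebra ℂ A] (J f : A) (k : ℕ) :
    (evenComm J)^[k] f = (adE J ^ k) f := by
  rw [Module.End.pow_apply]; rfl

/-! ### Generic facts on the systems -/

section Systems

variable {M : Type} [AddCommGroup M] [Module ℂ M] {W : ℕ → Submodule ℂ M} {A : ℕ → Type}
  [∀ q, AddCommGroup (A q)] [∀ q, Module ℂ (A q)]

theorem limitHom_injective (ψ : ∀ q, W q ≃ₗ[ℂ] A q) (q : ℕ) :
    Function.Injective (limitHom ψ q) := fun _ _ h =>
  (ψ q).symm.injective (Subtype.ext h)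

theorem fromLimit_bijective (hW : Monotone W) (ψ : ∀ q, W q ≃ₗ[ℂ] A q) (hU : ∀ f, ∃ q, f ∈ W q) :
    Function.Bijective (fromLimit hW ψ) := by
  constructor
  · exact Module.DirectLimit.lift_injective _ _ (limitHom_injective ψ)
  · intro f
    obtain ⟨q, hq⟩ := hU f
    refine ⟨Module.DirectLimit.of ℂ ℕ A (transition hW ψ) q (ψ q ⟨f, hq⟩), ?_⟩
    rw [fromLimit, Module.DirectLimit.lift_of]
    simp [limitHom]

end Systems

theorem normCoeff_ne_zero (n μ k : ℕ) : (normCoeff n μ k : ℂ) ≠ 0 := by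
  rw [Complex.ofReal_ne_zero, normCoeff]
  exact (Real.sqrt_pos.2 (by positivity)).ne'

end
end FuzzySupersphere

namespace FuzzySupersphere
noncomputable section
open MvPolynomial (X C pderiv)

/-! ### The ladders of the ordinary sphere -/

/-- The highest weight vectors that generate the truncation of the sphere. -/
def sphGens (ρ : ℝ) (q : ℕ) (j : Fin (q + 1)) : Poly := sphTop ρ j

/-- Twice the spins of `sphGens`. -/
def sphSpin (q : ℕ) (j : Fin (q + 1)) : ℕ := 2 * j

/-- The highest weight vectors of the truncated sphere. -/
def ncSphGens (q : ℕ) (j : Fin (q + 1)) : NSp q := ncSphTop q j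

/-- The normalization of the classical highest weight vector. -/
def sphTopCoeff (ρ : ℝ) (j : ℕ) : ℝ := √((2 * j + 1).factorial) / (2 ^ j * j.factorial * ρ ^ j)

theorem sphTop_eq (ρ : ℝ) (j : ℕ) : sphTop ρ j = (sphTopCoeff ρ j : ℂ) • xPlus ^ j := by
  rw [sphTop, MvPolynomial.smul_eq_C_mul]; rfl

theorem sphTopCoeff_pos {ρ : ℝ} (hρ : 0 < ρ) (j : ℕ) : 0 < sphTopCoeff ρ j := by
  rw [sphTopCoeff]; positivity

/-- The normalization of the highest weight vector of the truncated sphere. -/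
def ncSphCoeff (q j : ℕ) : ℝ := √(2 ^ j * (2 * j + 1).doubleFactorial * (q + 1) * (q - j).factorial /
    (j.factorial * (q + j + 1).factorial))

theorem ncSphTop_eq (q j : ℕ) : ncSphTop q j = (ncSphCoeff q j : ℂ) • spinP (q + 1) ^ j := rfl

theorem ncSphCoeff_pos (q j : ℕ) : 0 < ncSphCoeff q j := by
  have := Nat.doubleFactorial_pos (2 * j + 1)
  rw [ncSphCoeff]; positivity

theorem isTop_sphGens (ρ : ℝ) (q : ℕ) (j : Fin (q + 1)) :
    IsTop sphJp sphJm (sphJ 2) (sphSpin q j) (sphGens ρ q j) := by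
  rw [sphGens, sphTop_eq]; exact (isTop_xPlus_pow j).smul _

theorem isTop_ncSphGens (q : ℕ) (j : Fin (q + 1)) :
    IsTop (adE (spinP (q + 1))) (adE (spinM (q + 1))) (adE (spinZ (q + 1))) (sphSpin q j)
      (ncSphGens q j) := by
  rw [ncSphGens, ncSphTop_eq]; exact (isTop_spinP_pow q j).smul _

theorem sphV_term_mem (ρ : ℝ) {q j : ℕ} (hj : j ≤ q) (k : ℕ) :
    projSphere ρ ((sphJm ^ k) (sphTop ρ j)) ∈ sphTrunc ρ q := by
  have h := Submodule.smul_mem _ (normCoeff (2 * j) 0 k : ℂ)⁻¹ (sphHarm_mem ρ k hj)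
  rwa [sphHarm, smul_smul, inv_mul_cancel₀ (normCoeff_ne_zero _ _ _), one_smul] at h

theorem ladderSpan_le_iff {ι V : Type*} [AddCommGroup V] [Module ℂ V] {M : Module.End ℂ V} {v : ι → V}
    {S : Submodule ℂ V} : ladderSpan M v ≤ S ↔ ∀ i k, (M ^ k) (v i) ∈ S := by
  rw [ladderSpan, Submodule.span_le]
  constructor
  · intro h i k; exact h ⟨(i, k), rfl⟩
  · rintro h _ ⟨⟨i, k⟩, rfl⟩; exact h i k

/-- Cyclic submodules lie in ladder spans by stability, and conversely the rungs are nonzero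
multiples of harmonics. -/
theorem sphTrunc_eq {ρ : ℝ} (hρ : 0 < ρ) (q : ℕ) :
    sphTrunc ρ q = (ladderSpan sphJm (sphGens ρ q)).map (projSphere ρ) := by
  apply le_antisymm
  · refine iSup_le fun j => iSup_le fun hj => Submodule.map_mono ((cyclic_sphTop_le ρ j).trans ?_)
    rw [ladderSpan_le_iff]
    rintro - k
    have h := Submodule.smul_mem _ (sphTopCoeff ρ j : ℂ)⁻¹
      (pow_mem_ladderSpan sphJm (sphGens ρ q) ⟨j, by omega⟩ k)
    rwa [sphGens, sphTop_eq, map_smul, smul_smul, inv_mul_cancel₀, one_smul] at h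
    exact_mod_cast (sphTopCoeff_pos hρ j).ne'
  · rw [Submodule.map_le_iff_le_comap, ladderSpan_le_iff]
    intro j k
    exact sphV_term_mem ρ (by have := j.2; omega) k

/-- The matching condition that characterizes the map of the sphere. -/
abbrev SphMatches {ρ : ℝ} {q : ℕ} (φ : sphTrunc ρ q ≃ₗ[ℂ] NSp q) : Prop :=
  Matches (projSphere ρ) sphJm (adE (spinM (q + 1))) (sphSpin q) (sphGens ρ q) (ncSphGens q) φ

/-- The factor `normCoeff` is the same on both sides and does not vanish, so it can be dropped. -/
theorem isPsiHat_iff {ρ : ℝ} {q : ℕ} (φ : sphTrunc ρ q ≃ₗ[ℂ] NSp q) :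
    IsPsiHat φ ↔ SphMatches φ := by
  constructor
  · intro h j k hk
    have e := h j k (by have := j.2; omega) hk
    rw [← LinearEquiv.eq_symm_apply] at e
    have e' := congrArg (Subtype.val) e
    rw [ncSphHarm, evenComm_iterate, map_smul] at e'
    exact (smul_right_injective _ (normCoeff_ne_zero (2 * j) 0 k) e').symm
  · intro h j k hj hk
    have e := h ⟨j, by omega⟩ k hk
    rw [← LinearEquiv.eq_symm_apply, ncSphHarm, evenComm_iterate, map_smul]
    refine Subtype.ext ?_
    change _ = (normCoeff (2 * j) 0 k : ℂ) • ((φ.symm ((adE (spinM (q + 1)) ^ k) (ncSphTop q j)) : _) : polySphere ρ)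
    exact congrArg (fun z => (normCoeff (2 * j) 0 k : ℂ) • z) e.symm

theorem evalAt_north_xPlus {ρ : ℝ} : evalAt (WithLp.toLp 2 ![ρ, 0, 0]) xPlus = ρ := by
  rw [xPlus, map_add, map_mul, ← MvPolynomial.algebraMap_eq, AlgHom.commutes, evalAt_X, evalAt_X]
  simp

/-- A point of the sphere on the first axis. -/
def axisPoint {ρ : ℝ} (hρ : 0 < ρ) : Sph ρ :=
  ⟨WithLp.toLp 2 ![ρ, 0, 0], (mem_sphere_iff hρ _).2 (by simp)⟩

theorem evalAt_axisPoint_xPlus {ρ : ℝ} (hρ : 0 < ρ) : evalAt (axisPoint hρ).1 xPlus = ρ :=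
  evalAt_north_xPlus

theorem xPlus_pow_smul_eq_zero {ρ : ℝ} (hρ : 0 < ρ) (j : ℕ) {a : ℂ}
    (h : projSphere ρ (a • xPlus ^ j) = 0) : a = 0 := by
  have e := (projSphere_eq_zero_iff ρ _).1 h (axisPoint hρ)
  rw [map_smul, map_pow, evalAt_axisPoint_xPlus, smul_eq_mul] at e
  exact (mul_eq_zero.1 e).resolve_right (pow_ne_zero _ (by exact_mod_cast hρ.ne'))

/-- Eigenvectors to different eigenvalues are independent. -/
theorem weight_independent {V : Type*} [AddCommGroup V] [Module ℂ V] {Z : Module.End ℂ V}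
    {N : Submodule ℂ V} (hN : ∀ x ∈ N, Z x ∈ N) {m : ℕ} {v : Fin (m + 1) → V}
    (hv : ∀ j, Z (v j) = ((j : ℕ) : ℂ) • v j) (hne : ∀ j, ∀ a : ℂ, a • v j ∈ N → a = 0)
    (c : Fin (m + 1) → ℂ) (hc : ∑ j, c j • v j ∈ N) : ∀ j, c j = 0 := by
  intro j
  refine hne j _ (mem_of_sum_mem hN (fun j : Fin (m + 1) => ((j : ℕ) : ℂ)) ?_ Finset.univ
    (fun j => c j • v j) (fun j _ => ?_) hc j (Finset.mem_univ _))
  · intro a b hab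
    exact Fin.ext (Nat.cast_injective (R := ℂ) hab)
  · simp only [map_smul, hv, smul_comm (c j)]

/-- The first `q + 1` odd numbers add up to `(q+1)²`. -/
theorem sum_sphSpin (q : ℕ) : ∑ j, (sphSpin q j + 1) = Module.finrank ℂ (NSp q) := by
  rw [Module.finrank_matrix]
  simp only [sphSpin, Fintype.card_fin, Module.finrank_self, mul_one]
  rw [Fin.sum_univ_eq_sum_range (fun j => 2 * j + 1) (q + 1)]
  induction q with
  | zero => rfl
  | succ q ih => rw [Finset.sum_range_succ, ih]; ring

/-- Here `N` is the kernel of restriction itself, which is rotation invariant. The top vectors have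
distinct weights, so only their nonvanishing has to be checked, for functions at a point of the
first axis. -/
theorem exists_sphMatches {ρ : ℝ} (hρ : 0 < ρ) (q : ℕ) :
    ∃ φ : sphTrunc ρ q ≃ₗ[ℂ] NSp q, SphMatches φ := by
  have hker : ∀ i, ∀ x ∈ LinearMap.ker (projSphere ρ), sphJ i x ∈ LinearMap.ker (projSphere ρ) :=
    fun i x hx => projSphere_sphJ hρ i hx
  refine exists_matches isSl2_sph (isSl2_spin q).ad (projSphere ρ)
    (N := LinearMap.ker (projSphere ρ)) (fun x hx => hx) ?_ (isTop_sphGens ρ q) (isTop_ncSphGens q)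
    ?_ ?_ (sum_sphSpin q) (sphTrunc_eq hρ q)
  · intro x hx
    have e : sphJp x = sphJ 0 x + Complex.I • sphJ 1 x := rfl
    rw [e]
    exact Submodule.add_mem _ (hker 0 x hx) (Submodule.smul_mem _ _ (hker 1 x hx))
  · refine weight_independent (Z := sphJ 2) (hker 2) (fun j => ?_) fun j a ha => ?_
    · rw [(isTop_sphGens ρ q j).z, sphSpin]; push_cast; congr 1; ring
    · rw [sphGens, sphTop_eq, smul_smul] at ha
      exact (mul_eq_zero.1 (xPlus_pow_smul_eq_zero hρ j ha)).resolve_right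
        (by exact_mod_cast (sphTopCoeff_pos hρ j).ne')
  · refine weight_independent (Z := adE (spinZ (q + 1))) (by simp) (fun j => ?_) fun j a ha => ?_
    · rw [(isTop_ncSphGens q j).z, sphSpin]; push_cast; congr 1; ring
    · rw [Submodule.mem_bot, ncSphGens, ncSphTop_eq, smul_smul, smul_eq_zero,
        or_iff_left (spinP_pow_ne_zero j.2)] at ha
      exact (mul_eq_zero.1 ha).resolve_right (by exact_mod_cast (ncSphCoeff_pos q j).ne')

/-! ### The ladders of the supersphere -/

/-- The highest weight vectors (for the even subalgebra) that generate the truncation of the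
supersphere. -/
def superGens (ρ : ℝ) (q : ℕ) : Fin (2 * q + 1) ⊕ Fin (2 * q) → SuperPoly :=
  Sum.elim (fun n => superTop ρ n) fun n => superQ 1 (superTop ρ (n + 1))

/-- Twice the spins of `superGens`. -/
def superSpin (q : ℕ) : Fin (2 * q + 1) ⊕ Fin (2 * q) → ℕ := Sum.elim (fun n => n) fun n => n

/-- The highest weight vectors of the truncated supersphere. -/
def ncGens (q : ℕ) : Fin (2 * q + 1) ⊕ Fin (2 * q) → NSs q :=
  Sum.elim (fun n => ncSuperTop q n) fun n => oddComm q (ospQ5 q) (ncSuperTop q (n + 1))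

/-- The normalization of the highest weight vector of the truncated supersphere. -/
def ncTopCoeff (q n : ℕ) : ℝ :=
  if Even n then
    √(2 ^ (n / 2) * (n - 1).doubleFactorial * (q - n / 2).factorial /
      ((n / 2).factorial * (q + n / 2).factorial))
  else
    ((q : ℝ) + 1 / 2)⁻¹ * √(2 ^ (n / 2 + 4) * n.doubleFactorial * (q - n / 2 - 1).factorial /
      ((n / 2).factorial * (q + n / 2 + 1).factorial)) * ((2 * q + 1) / 4)

theorem ncSuperTop_eq (q n : ℕ) : ncSuperTop q n = (ncTopCoeff q n : ℂ) • nTop q n := by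
  rw [ncSuperTop, ncTopCoeff, nTop]
  split_ifs
  · rfl
  · rw [odd_top_operator, mul_smul_comm, smul_smul]
    push_cast; rfl

theorem ncTopCoeff_pos (q n : ℕ) : 0 < ncTopCoeff q n := by
  have h1 := Nat.doubleFactorial_pos n
  have h2 := Nat.doubleFactorial_pos (n - 1)
  rw [ncTopCoeff]
  split_ifs <;> positivity

theorem parity_smul (q : ℕ) (c : ℂ) (f : NSs q) : parity q (c • f) = c • parity q f := by
  rw [parity_eq, parity_eq, mul_smul_comm, smul_mul_assoc]

theorem parity_add (q : ℕ) (f g : NSs q) : parity q (f + g) = parity q f + parity q g := by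
  simp only [parity_eq, mul_add, add_mul]

theorem oddComm_smul (q : ℕ) (J : NSs q) (c : ℂ) (f : NSs q) :
    oddComm q J (c • f) = c • oddComm q J f := by
  rw [oddComm, oddComm, parity_smul, mul_smul_comm, smul_mul_assoc, smul_sub]

theorem isTop_superGens (ρ : ℝ) (q : ℕ) (i : Fin (2 * q + 1) ⊕ Fin (2 * q)) :
    IsTop superJp superJm (superJ 2) (superSpin q i) (superGens ρ q i) := by
  rcases i with n | n
  · simp only [superGens, superSpin, Sum.elim_inl, superTop_eq]
    exact (isTop_sTop n).smul _
  · simp only [superGens, superSpin, Sum.elim_inr, superTop_eq, map_smul]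
    exact (isTop_superQ_one_sTop n).smul _

theorem isTop_ncGens (q : ℕ) (i : Fin (2 * q + 1) ⊕ Fin (2 * q)) :
    IsTop (adE (ospP q)) (adE (ospM q)) (adE (ospZ q)) (superSpin q i) (ncGens q i) := by
  rcases i with n | n
  · simp only [ncGens, superSpin, Sum.elim_inl, ncSuperTop_eq]
    exact (isTop_nTop q n).smul _
  · simp only [ncGens, superSpin, Sum.elim_inr, ncSuperTop_eq, oddComm_smul]
    exact (isTop_oddComm_nTop q n).smul _

theorem superV_term_mem (ρ : ℝ) (L : ℕ) {q n : ℕ} (hn : n ≤ 2 * q) (μ k : ℕ) :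
    projSuper ρ L ((superJm ^ k) ((superQ 1 ^ μ) (superTop ρ n))) ∈ superTrunc ρ L q := by
  have h := Submodule.smul_mem _ (normCoeff n μ k : ℂ)⁻¹ (superHarm_mem ρ L μ k hn)
  rwa [superHarm, smul_smul, inv_mul_cancel₀ (normCoeff_ne_zero _ _ _), one_smul] at h

theorem sTop_pow_mem_ladderSpan {ρ : ℝ} (hρ : 0 < ρ) {q n : ℕ} (hn : n ≤ 2 * q) (k : ℕ) :
    (superJm ^ k) (sTop n) ∈ ladderSpan superJm (superGens ρ q) := by
  have h := Submodule.smul_mem _ (superTopCoeff ρ n : ℂ)⁻¹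
    (pow_mem_ladderSpan superJm (superGens ρ q) (Sum.inl ⟨n, by omega⟩) k)
  simp only [superGens, Sum.elim_inl] at h
  rwa [superTop_eq, map_smul, smul_smul, inv_mul_cancel₀ (superTopCoeff_ne_zero hρ n),
    one_smul] at h

theorem superQ_sTop_pow_mem_ladderSpan {ρ : ℝ} (hρ : 0 < ρ) {q n : ℕ} (hn : n < 2 * q) (k : ℕ) :
    (superJm ^ k) (superQ 1 (sTop (n + 1))) ∈ ladderSpan superJm (superGens ρ q) := by
  have h := Submodule.smul_mem _ (superTopCoeff ρ (n + 1) : ℂ)⁻¹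
    (pow_mem_ladderSpan superJm (superGens ρ q) (Sum.inr ⟨n, hn⟩) k)
  simp only [superGens, Sum.elim_inr] at h
  rwa [superTop_eq, map_smul, map_smul, smul_smul, inv_mul_cancel₀ (superTopCoeff_ne_zero hρ _),
    one_smul] at h

theorem superTrunc_eq {ρ : ℝ} (hρ : 0 < ρ) (L q : ℕ) :
    superTrunc ρ L q = (ladderSpan superJm (superGens ρ q)).map (projSuper ρ L) := by
  apply le_antisymm
  · refine iSup_le fun n => iSup_le fun hn => Submodule.map_mono ((cyclic_superTop_le ρ n).trans ?_)
    rw [ladderSpan_le_iff]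
    intro i k
    fin_cases i
    · exact sTop_pow_mem_ladderSpan hρ hn k
    · cases n with
      | zero =>
        -- The trivial module has a single ladder, since `J_5` annihilates constants.
        change (superJm ^ k) (superQ 1 (sTop 0)) ∈ _
        rw [superQ_one_sTop_zero, map_zero]; exact Submodule.zero_mem _
      | succ n => exact superQ_sTop_pow_mem_ladderSpan hρ (by omega) k
  · rw [Submodule.map_le_iff_le_comap, ladderSpan_le_iff]
    rintro (n | n) k
    · exact superV_term_mem ρ L (by have := n.2; omega) 0 k
    · have h := superV_term_mem ρ L (q := q) (n := n + 1) (by have := n.2; omega) 1 k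
      rwa [pow_one] at h

/-- The matching condition that characterizes the map of the supersphere. -/
abbrev SuperMatches {ρ : ℝ} {L q : ℕ} (ψ : superTrunc ρ L q ≃ₗ[ℂ] NSs q) : Prop :=
  Matches (projSuper ρ L) superJm (adE (ospM q)) (superSpin q) (superGens ρ q) (ncGens q) ψ

/-- The index `μ` selects one of the two ladders of a superspin. The second ladder of superspin
`(n+1)/2` has spin `n/2`, hence the shift between the two descriptions. -/
theorem isPsi_iff {ρ : ℝ} {L q : ℕ} (ψ : superTrunc ρ L q ≃ₗ[ℂ] NSs q) :
    IsPsi ψ ↔ SuperMatches ψ := by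
  have key : ∀ n μ k (hn : n ≤ 2 * q),
      (ψ ⟨superHarm ρ L n μ k, superHarm_mem ρ L μ k hn⟩ = ncSuperHarm q n μ k ↔
        ((ψ.symm ((adE (ospM q) ^ k) ((oddComm q (ospQ5 q))^[μ] (ncSuperTop q n))) : superTrunc ρ L q) :
          polySuper ρ L) = projSuper ρ L ((superJm ^ k) ((superQ 1 ^ μ) (superTop ρ n)))) := by
    intro n μ k hn
    rw [← LinearEquiv.eq_symm_apply, ncSuperHarm, evenComm_iterate, map_smul, ← Subtype.val_inj]
    constructor
    · intro e
      exact (smul_right_injective _ (normCoeff_ne_zero n μ k) e).symm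
    · intro e
      exact congrArg (fun z => (normCoeff n μ k : ℂ) • z) e.symm
  constructor
  · rintro h (n | n) k hk
    · exact (key n 0 k (by have := n.2; omega)).1 (h n 0 k (by have := n.2; omega) (by omega) (by have : k ≤ (n : ℕ) := hk; omega))
    · have e := (key (n + 1) 1 k (by have := n.2; omega)).1
        (h (n + 1) 1 k (by have := n.2; omega) le_rfl (by have : k ≤ (n : ℕ) := hk; omega))
      rwa [pow_one] at e
  · intro h n μ k hn hμ hk
    rw [key n μ k hn]
    rcases Nat.le_one_iff_eq_zero_or_eq_one.1 hμ with rfl | rfl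
    · exact h (Sum.inl ⟨n, by omega⟩) k (by simp [superSpin]; omega)
    · obtain ⟨n, rfl⟩ : ∃ m, n = m + 1 := ⟨n - 1, by omega⟩
      rw [pow_one]
      exact h (Sum.inr ⟨n, by omega⟩) k (by simp [superSpin]; omega)

/-- The two families have `(2q+1)(2q+2)/2` and `2q(2q+1)/2` rungs, in total `(2q+1)²`. -/
theorem sum_superSpin (q : ℕ) : ∑ j, (superSpin q j + 1) = Module.finrank ℂ (NSs q) := by
  rw [Module.finrank_matrix]
  simp only [superSpin, Fintype.card_fin, Fintype.card_sum, Module.finrank_self, mul_one,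
    Fintype.sum_sum_type, Sum.elim_inl, Sum.elim_inr]
  rw [Fin.sum_univ_eq_sum_range (fun j => j + 1) (2 * q + 1),
    Fin.sum_univ_eq_sum_range (fun j => j + 1) (2 * q)]
  induction q with
  | zero => rfl
  | succ q ih =>
    rw [show 2 * (q + 1) = 2 * q + 1 + 1 by ring]
    simp only [Finset.sum_range_succ] at ih ⊢
    linarith

/-- All equations are evaluated at the point of the first axis. For even `n` the body gives `a = b
ρ²/2` and the fourth equation of `superKer` then gives `(2i+1) b = 0`; for odd `n` the component of
`θ⁵` isolates `a` and that of `θ⁴` then isolates `b`. -/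
theorem sTop_pair_independent {ρ : ℝ} (hρ : 0 < ρ) (n : ℕ) {a b : ℂ}
    (h : a • sTop n + b • superQ 1 (sTop (n + 1)) ∈ superKer ρ) : a = 0 ∧ b = 0 := by
  have hρ' : (ρ : ℂ) ≠ 0 := by exact_mod_cast hρ.ne'
  obtain ⟨h0, h1, h2, h3⟩ := h
  rw [projSphere_eq_zero_iff] at h0 h1 h2 h3
  replace h0 := h0 (axisPoint hρ)
  replace h1 := h1 (axisPoint hρ)
  replace h2 := h2 (axisPoint hρ)
  replace h3 := h3 (axisPoint hρ)
  rcases Nat.even_or_odd' n with ⟨i, rfl | rfl⟩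
  · rw [sTop_even, sTop_odd, superQ_one_oddTop] at h0 h3
    obtain ⟨e0, -, -, e3⟩ := evenTop_apply i
    simp only [Pi.add_apply, Pi.smul_apply, e0, e3, Pi.single_eq_same] at h0 h3
    rw [Pi.single_eq_of_ne (by decide), Pi.single_eq_of_ne (by decide)] at h3
    rw [Pi.single_eq_of_ne (by decide)] at h0
    simp only [map_add, map_smul, map_mul, map_pow, evalAt_axisPoint_xPlus, evalAt_radSq hρ,
      smul_eq_mul, add_zero, zero_add, mul_zero, map_sub, Derivation.leibniz, euler_xPlus_pow,
      euler_radSq, smul_zero, map_zero, map_ofNat] at h0 h3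
    simp only [Derivation.map_smul, Derivation.leibniz, euler_xPlus_pow, euler_radSq, map_smul, map_add,
      map_mul, map_pow, evalAt_axisPoint_xPlus, evalAt_radSq hρ, smul_eq_mul, map_ofNat] at h3
    have hu : (ρ : ℂ) ^ i ≠ 0 := pow_ne_zero _ hρ'
    have h4 : a = b * ρ ^ 2 / 2 := by
      have : (ρ : ℂ) ^ i * (a - b * ρ ^ 2 / 2) = 0 := by linear_combination h0
      exact sub_eq_zero.1 ((mul_eq_zero.1 this).resolve_left hu)
    have h5 : (ρ : ℂ) ^ i * ρ ^ 2 * (2 * (i : ℂ) + 1) * b = 0 := by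
      rw [h4] at h3
      linear_combination (-2) * h3
    have h6 : (2 * (i : ℂ) + 1) ≠ 0 := by exact_mod_cast (by omega : 2 * i + 1 ≠ 0)
    have hb : b = 0 := (mul_eq_zero.1 h5).resolve_left
      (mul_ne_zero (mul_ne_zero hu (pow_ne_zero _ hρ')) h6)
    exact ⟨by rw [h4, hb]; ring, hb⟩
  · rw [sTop_odd, show 2 * i + 1 + 1 = 2 * (i + 1) by ring, sTop_even, superQ_one_evenTop] at h1 h2
    obtain ⟨-, e1, e2, -⟩ := oddTop_apply i
    simp only [Pi.add_apply, Pi.smul_apply, e1, e2, Pi.single_eq_same] at h1 h2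
    rw [Pi.single_eq_of_ne (by decide), smul_zero, add_zero, map_smul, map_mul, map_pow,
      evalAt_axisPoint_xPlus, smul_eq_mul] at h2
    have ha : a = 0 := (mul_eq_zero.1 h2).resolve_right (mul_ne_zero (pow_ne_zero _ hρ') hρ')
    rw [ha, zero_smul, zero_add, Nat.add_sub_cancel, smul_smul, map_smul, map_pow,
      evalAt_axisPoint_xPlus, smul_eq_mul] at h1
    have h4 := (mul_eq_zero.1 h1).resolve_right (pow_ne_zero _ hρ')
    refine ⟨ha, (mul_eq_zero.1 h4).resolve_right ?_⟩
    exact neg_ne_zero.2 (by exact_mod_cast Nat.succ_ne_zero i)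

theorem exists_superMatches {ρ : ℝ} (hρ : 0 < ρ) {L : ℕ} (hL : 2 ≤ L) (q : ℕ) :
    ∃ ψ : superTrunc ρ L q ≃ₗ[ℂ] NSs q, SuperMatches ψ := by
  refine exists_matches isOsp_super.isSl2 (isSl2_nc q).ad (projSuper ρ L)
    (N := superKer ρ) (fun x hx => ker_projSuper_le hρ hL hx) (fun x hx => superJp_mem_superKer hρ hx)
    (isTop_superGens ρ q) (isTop_ncGens q) ?_ ?_ (sum_superSpin q) (superTrunc_eq hρ L q)
  · refine pair_independent (Z := superJ 2) (v := superTop ρ) (w := fun n => superQ 1 (superTop ρ (n + 1)))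
      (fun x hx => superJ_mem_superKer hρ 2 hx)
      (fun n hn => (isTop_superGens ρ q (Sum.inl ⟨n, by omega⟩)).z)
      (fun n hn => (isTop_superGens ρ q (Sum.inr ⟨n, hn⟩)).z) ?_ ?_
    · intro n _ a b hab
      rw [superTop_eq, superTop_eq, map_smul, smul_smul, smul_smul] at hab
      obtain ⟨ha, hb⟩ := sTop_pair_independent hρ n hab
      exact ⟨(mul_eq_zero.1 ha).resolve_right (superTopCoeff_ne_zero hρ _),
        (mul_eq_zero.1 hb).resolve_right (superTopCoeff_ne_zero hρ _)⟩
    · intro a ha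
      rw [superTop_eq, smul_smul] at ha
      have h := (sTop_pair_independent hρ (2 * q) (a := a * superTopCoeff ρ (2 * q)) (b := 0) (by rwa [zero_smul, add_zero])).1
      exact (mul_eq_zero.1 h).resolve_right (superTopCoeff_ne_zero hρ _)
  · have hne : ∀ n, (ncTopCoeff q n : ℂ) ≠ 0 := fun n => by exact_mod_cast (ncTopCoeff_pos q n).ne'
    refine pair_independent (Z := adE (ospZ q)) (v := ncSuperTop q)
      (w := fun n => oddComm q (ospQ5 q) (ncSuperTop q (n + 1))) (by simp)
      (fun n hn => (isTop_ncGens q (Sum.inl ⟨n, by omega⟩)).z)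
      (fun n hn => (isTop_ncGens q (Sum.inr ⟨n, hn⟩)).z) ?_ ?_
    · intro n hn a b hab
      rw [Submodule.mem_bot, ncSuperTop_eq, ncSuperTop_eq, oddComm_smul, smul_smul, smul_smul] at hab
      obtain ⟨ha, hb⟩ := nTop_pair q n hn _ _ hab
      exact ⟨(mul_eq_zero.1 ha).resolve_right (hne _), (mul_eq_zero.1 hb).resolve_right (hne _)⟩
    · intro a ha
      rw [Submodule.mem_bot, ncSuperTop_eq, smul_smul] at ha
      exact (mul_eq_zero.1 (nTop_last q _ ha)).resolve_right (hne _)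

end
end FuzzySupersphere

namespace FuzzySupersphere
noncomputable section
open MvPolynomial (X C pderiv)

/-! ### Existence, uniqueness and equivariance -/

theorem existsUnique_isPsi {ρ : ℝ} (hρ : 0 < ρ) {L : ℕ} (hL : 2 ≤ L) (q : ℕ) :
    ∃! ψ : superTrunc ρ L q ≃ₗ[ℂ] NSs q, IsPsi ψ := by
  obtain ⟨ψ, hψ⟩ := exists_superMatches hρ hL q
  refine ⟨ψ, (isPsi_iff ψ).2 hψ, fun ψ' hψ' => ?_⟩
  exact Matches.unique isOsp_super.isSl2 (isTop_superGens ρ q) (superTrunc_eq hρ L q)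
    ((isPsi_iff ψ').1 hψ') hψ

theorem existsUnique_isPsiHat {ρ : ℝ} (hρ : 0 < ρ) (q : ℕ) :
    ∃! φ : sphTrunc ρ q ≃ₗ[ℂ] NSp q, IsPsiHat φ := by
  obtain ⟨φ, hφ⟩ := exists_sphMatches hρ q
  refine ⟨φ, (isPsiHat_iff φ).2 hφ, fun φ' hφ' => ?_⟩
  exact Matches.unique isSl2_sph (isTop_sphGens ρ q) (sphTrunc_eq hρ q)
    ((isPsiHat_iff φ').1 hφ') hφ

theorem xPlus_pow_ladder_mem {ρ : ℝ} (hρ : 0 < ρ) {q j : ℕ} (hj : j ≤ q) (k : ℕ) :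
    projSphere ρ ((sphJm ^ k) (xPlus ^ j)) ∈ sphTrunc ρ q := by
  have h := Submodule.smul_mem _ (sphTopCoeff ρ j : ℂ)⁻¹ (sphV_term_mem ρ hj k)
  rwa [sphTop_eq, map_smul, map_smul, smul_smul, inv_mul_cancel₀, one_smul] at h
  exact_mod_cast (sphTopCoeff_pos hρ j).ne'

theorem sphJm_radSq : sphJm radSq = 0 := by
  rw [sphJm, LinearMap.sub_apply, LinearMap.smul_apply, sphJ_radSq, sphJ_radSq, smul_zero, sub_zero]

theorem sphJm_pow_mul_radSq (k : ℕ) (F : Poly) :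
    (sphJm ^ k) (F * radSq) = (sphJm ^ k) F * radSq := by
  induction k with
  | zero => rfl
  | succ k ih =>
    rw [pow_succ', Module.End.mul_apply, ih, sphJm_mul, sphJm_radSq, mul_zero, add_zero,
      Module.End.mul_apply]

theorem projSphere_mul_radSq {ρ : ℝ} (hρ : 0 < ρ) (F : Poly) :
    projSphere ρ (F * radSq) = (ρ : ℂ) ^ 2 • projSphere ρ F := by
  rw [← map_smul, ← sub_eq_zero, ← map_sub, projSphere_eq_zero_iff]
  intro y
  rw [map_sub, map_mul, map_smul, evalAt_radSq hρ, smul_eq_mul]; ring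

/-- Besides the even top vectors, these are the only ladders with a body: `J_5` turns half-integer
superspin into the integer spin `i`. -/
theorem projSphere_superQ_sTop_empty {ρ : ℝ} (hρ : 0 < ρ) (i k : ℕ) :
    projSphere ρ (((superJm ^ k) (superQ 1 (sTop (2 * i + 1)))) ∅)
      = (-(ρ : ℂ) ^ 2 / 2) • projSphere ρ ((sphJm ^ k) (xPlus ^ i)) := by
  rw [superJm_pow_empty, sTop_odd, superQ_one_oddTop]
  simp only [Pi.smul_apply, Pi.add_apply, Pi.single_eq_same]
  rw [Pi.single_eq_of_ne (by decide), add_zero, map_smul, map_smul, sphJm_pow_mul_radSq,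
    projSphere_mul_radSq hρ, smul_smul]
  congr 1; ring

/-- Ladders of half-integer spin have no body, and those of integer spin `i` have a multiple of the
ladder of `xPlus ^ i` as body. The bound on `i` follows from the bound on the superspin. -/
theorem bodyMap_mem {ρ : ℝ} (hρ : 0 < ρ) (L q : ℕ) :
    ∀ f ∈ superTrunc ρ L q, bodyMap ρ L f ∈ sphTrunc ρ q := by
  have key : ladderSpan superJm (superGens ρ q) ≤
      (sphTrunc ρ q).comap (projSphere ρ ∘ₗ LinearMap.proj ∅) := by
    rw [ladderSpan_le_iff]
    rintro (n | n) k
    · simp only [superGens, Sum.elim_inl, superTop_eq, map_smul]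
      refine Submodule.smul_mem _ _ ?_
      rcases Nat.even_or_odd' n with ⟨i, hi | hi⟩
      · rw [hi, sTop_even]
        change projSphere ρ (((superJm ^ k) (evenTop i)) ∅) ∈ sphTrunc ρ q
        rw [superJm_pow_empty, (evenTop_apply i).1]
        exact xPlus_pow_ladder_mem hρ (by have := n.2; omega) k
      · rw [hi, sTop_odd]
        change projSphere ρ (((superJm ^ k) (oddTop i)) ∅) ∈ sphTrunc ρ q
        rw [superJm_pow_empty, (oddTop_apply i).1, map_zero, map_zero]
        exact Submodule.zero_mem _
    · simp only [superGens, Sum.elim_inr, superTop_eq, map_smul]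
      refine Submodule.smul_mem _ _ ?_
      change projSphere ρ (((superJm ^ k) (superQ 1 (sTop (n + 1)))) ∅) ∈ sphTrunc ρ q
      rcases Nat.even_or_odd' n with ⟨i, hi | hi⟩
      · rw [hi, projSphere_superQ_sTop_empty hρ]
        exact Submodule.smul_mem _ _ (xPlus_pow_ladder_mem hρ (by have := n.2; omega) k)
      · rw [hi, show 2 * i + 1 + 1 = 2 * (i + 1) by ring, sTop_even, superJm_pow_empty,
          superQ_one_evenTop, Pi.single_eq_of_ne (by decide), map_zero, map_zero]
        exact Submodule.zero_mem _
  intro f hf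
  rw [superTrunc_eq hρ] at hf
  obtain ⟨F, hF, rfl⟩ := hf
  rw [bodyMap_projSuper]
  exact key hF

/-! ### Parity of corresponding ladders. -/

/-- The parity automorphism of polynomial superfunctions. -/
def superParity : Module.End ℂ SuperPoly :=
  LinearMap.pi fun M => ((-1 : ℂ) ^ M.card) • LinearMap.proj M

theorem superParity_apply (F : SuperPoly) : superParity F ∅ = F ∅ ∧ superParity F {0} = -F {0} ∧
    superParity F {1} = -F {1} ∧ superParity F {0, 1} = F {0, 1} := by
  have h : ({0, 1} : Finset (Fin 2)).card = 2 := rfl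
  refine ⟨?_, ?_, ?_, ?_⟩ <;> simp [superParity, h]

theorem superParity_superJm (F : SuperPoly) : superParity (superJm F) = superJm (superParity F) := by
  obtain ⟨a0, a1, a2, a3⟩ := superParity_apply F
  obtain ⟨b0, b1, b2, b3⟩ := superParity_apply (superJm F)
  apply superPoly_ext
  · rw [b0]; simp only [superJm_apply, a0, a1, a2, a3]
  · rw [b1]; simp only [superJm_apply, a0, a1, a2, a3]; simp
  · rw [b2]; simp only [superJm_apply, a0, a1, a2, a3]; simp; try ring
  · rw [b3]; simp only [superJm_apply, a0, a1, a2, a3]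

theorem superParity_superJm_pow (k : ℕ) (F : SuperPoly) :
    superParity ((superJm ^ k) F) = (superJm ^ k) (superParity F) := by
  induction k generalizing F with
  | zero => rfl
  | succ k ih => rw [pow_succ, Module.End.mul_apply, Module.End.mul_apply, ih, superParity_superJm]

theorem superParity_single_even (M : Finset (Fin 2)) (hM : Even M.card) (f : Poly) :
    superParity (Pi.single M f) = Pi.single M f := by
  ext1 N
  by_cases h : N = M
  · subst h; simp [superParity, hM.neg_one_pow]
  · simp [superParity, Pi.single_eq_of_ne h]

theorem superParity_single_odd (M : Finset (Fin 2)) (hM : Odd M.card) (f : Poly) :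
    superParity (Pi.single M f) = -Pi.single M f := by
  ext1 N
  by_cases h : N = M
  · subst h; simp [superParity, hM.neg_one_pow]
  · simp [superParity, Pi.single_eq_of_ne h]

theorem superParity_sTop (n : ℕ) : superParity (sTop n) = ((-1 : ℂ) ^ n) • sTop n := by
  rcases Nat.even_or_odd' n with ⟨i, rfl | rfl⟩
  · rw [sTop_even, evenTop, superParity_single_even _ (by decide), pow_mul]; simp
  · rw [sTop_odd, oddTop, map_add, superParity_single_odd _ (by decide),
      superParity_single_odd _ (by decide), pow_succ, pow_mul]
    simp

theorem superParity_superQ_sTop (n : ℕ) :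
    superParity (superQ 1 (sTop (n + 1))) = ((-1 : ℂ) ^ n) • superQ 1 (sTop (n + 1)) := by
  rcases Nat.even_or_odd' n with ⟨i, rfl | rfl⟩
  · rw [sTop_odd, superQ_one_oddTop, map_smul, map_add, superParity_single_even _ (by decide),
      superParity_single_even _ (by decide), pow_mul]; simp
  · rw [show 2 * i + 1 + 1 = 2 * (i + 1) by ring, sTop_even, superQ_one_evenTop,
      superParity_single_odd _ (by decide), pow_succ, pow_mul]
    simp

/-- The sign of a generator. -/
def genSign (q : ℕ) (i : Fin (2 * q + 1) ⊕ Fin (2 * q)) : ℂ := (-1) ^ superSpin q i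

theorem superParity_superGens (ρ : ℝ) (q : ℕ) (i : Fin (2 * q + 1) ⊕ Fin (2 * q)) :
    superParity (superGens ρ q i) = genSign q i • superGens ρ q i := by
  rcases i with n | n
  · simp only [superGens, genSign, superSpin, Sum.elim_inl, superTop_eq, map_smul, superParity_sTop]
    rw [smul_comm]
  · simp only [superGens, genSign, superSpin, Sum.elim_inr, superTop_eq, map_smul,
      superParity_superQ_sTop]
    rw [smul_comm]

theorem parity_fromBlocks (q : ℕ) (A : Matrix (Fin (q + 1)) (Fin (q + 1)) ℂ)
    (B : Matrix (Fin (q + 1)) (Fin q) ℂ) (C : Matrix (Fin q) (Fin (q + 1)) ℂ)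
    (D : Matrix (Fin q) (Fin q) ℂ) :
    parity q (Matrix.fromBlocks A B C D) = Matrix.fromBlocks A (-B) (-C) D := by
  rw [parity, Matrix.fromBlocks_multiply, Matrix.fromBlocks_multiply]
  simp

theorem nTop_odd_blocks (q i : ℕ) : nTop q (2 * i + 1)
    = Matrix.fromBlocks 0 (spinP (q + 1) ^ i * q4a q) (-(spinP q ^ i * q4b q)) 0 := by
  rw [nTop_odd, ospP_pow, grading, ospQ4_eq, Matrix.fromBlocks_multiply, Matrix.fromBlocks_multiply]
  simp

theorem oddComm_nTop_even_blocks (q i : ℕ) : oddComm q (ospQ5 q) (nTop q (2 * i))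
    = (-(i : ℂ)) • Matrix.fromBlocks 0 (spinP (q + 1) ^ (i - 1) * q4a q)
        (spinP q ^ (i - 1) * q4b q) 0 := by
  rw [oddComm_nTop_even, ospP_pow, ospQ4_eq, Matrix.fromBlocks_multiply]
  simp

theorem parity_nTop (q n : ℕ) : parity q (nTop q n) = ((-1 : ℂ) ^ n) • nTop q n := by
  rcases Nat.even_or_odd' n with ⟨i, rfl | rfl⟩
  · rw [nTop_even, parity_ospP_pow, pow_mul]; simp
  · rw [nTop_odd_blocks, parity_fromBlocks, pow_succ, pow_mul]
    simp [Matrix.fromBlocks_neg]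

theorem parity_oddComm_nTop (q n : ℕ) : parity q (oddComm q (ospQ5 q) (nTop q (n + 1)))
    = ((-1 : ℂ) ^ n) • oddComm q (ospQ5 q) (nTop q (n + 1)) := by
  rcases Nat.even_or_odd' n with ⟨i, rfl | rfl⟩
  · rw [oddComm_nTop_odd, parity_fromBlocks, pow_mul]; simp
  · rw [show 2 * i + 1 + 1 = 2 * (i + 1) by ring, oddComm_nTop_even_blocks, parity_smul,
      parity_fromBlocks, pow_succ, pow_mul]
    simp [Matrix.fromBlocks_neg, Matrix.fromBlocks_smul]

theorem parity_ncGens (q : ℕ) (i : Fin (2 * q + 1) ⊕ Fin (2 * q)) :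
    parity q (ncGens q i) = genSign q i • ncGens q i := by
  rcases i with n | n
  · simp only [ncGens, genSign, superSpin, Sum.elim_inl, ncSuperTop_eq, parity_smul, parity_nTop]
    rw [smul_comm]
  · simp only [ncGens, genSign, superSpin, Sum.elim_inr, ncSuperTop_eq, oddComm_smul, parity_smul,
      parity_oddComm_nTop]
    rw [smul_comm]

theorem parity_mul (q : ℕ) (f g : NSs q) : parity q (f * g) = parity q f * parity q g := by
  simp only [parity_eq]
  rw [show grading q * f * grading q * (grading q * g * grading q)
    = grading q * f * (grading q * grading q) * g * grading q by simp only [mul_assoc], grading_sq,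
    mul_one, mul_assoc _ f g]

/-- The parity automorphism as a linear map. -/
def parityLin (q : ℕ) : Module.End ℂ (NSs q) where
  toFun := parity q
  map_add' := parity_add q
  map_smul' := parity_smul q

theorem parity_adE_ospM (q k : ℕ) (f : NSs q) :
    parity q ((adE (ospM q) ^ k) f) = (adE (ospM q) ^ k) (parity q f) := by
  have hM : parity q (ospM q) = ospM q := by
    rw [parity_eq, (grading_comm_M q).eq, mul_assoc, grading_sq, mul_one]
  have h1 : ∀ f, parity q (adE (ospM q) f) = adE (ospM q) (parity q f) := fun f => by
    rw [adE_apply, adE_apply, sub_eq_add_neg, parity_add, ← neg_one_smul ℂ, parity_smul, parity_mul,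
      parity_mul, hM, neg_one_smul, ← sub_eq_add_neg]
  induction k generalizing f with
  | zero => rfl
  | succ k ih => rw [pow_succ, Module.End.mul_apply, Module.End.mul_apply, ih, h1]

/-- Parity commutes with `J_-` and multiplies the generator `i` by `genSign q i` on both sides, so
`ψ` intertwines the parities rung by rung. -/
theorem SuperMatches.parity {ρ : ℝ} (hρ : 0 < ρ) {L q : ℕ} {ψ : superTrunc ρ L q ≃ₗ[ℂ] NSs q}
    (hψ : SuperMatches ψ) {F : SuperPoly} (hF : F ∈ ladderSpan superJm (superGens ρ q)) {a : NSs q}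
    (ha : ((ψ.symm a : superTrunc ρ L q) : polySuper ρ L) = projSuper ρ L F) :
    ((ψ.symm (parity q a) : superTrunc ρ L q) : polySuper ρ L) = projSuper ρ L (superParity F) := by
  obtain ⟨θ, hθ⟩ := exists_extension ψ (projSuper ρ L)
  have hmem : ∀ G ∈ ladderSpan superJm (superGens ρ q), projSuper ρ L G ∈ superTrunc ρ L q :=
    fun G hG => by rw [superTrunc_eq hρ]; exact Submodule.mem_map_of_mem hG
  have hm : ∀ i k, θ ((superJm ^ k) (superGens ρ q i)) = (adE (ospM q) ^ k) (ncGens q i) :=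
    fun i k => by
      rw [hθ _ (hmem _ (pow_mem_ladderSpan _ _ i k)), ← LinearEquiv.eq_symm_apply]
      exact Subtype.ext (Matches.pow_symm_apply isOsp_super.isSl2 (isSl2_nc q).ad
        (isTop_superGens ρ q) (isTop_ncGens q) hψ i k).symm
  have key : ladderSpan superJm (superGens ρ q) ≤
      (ladderSpan superJm (superGens ρ q)).comap superParity ⊓
        LinearMap.ker (θ ∘ₗ superParity - parityLin q ∘ₗ θ) := by
    rw [ladderSpan_le_iff]
    intro i k
    have e : superParity ((superJm ^ k) (superGens ρ q i))
        = genSign q i • (superJm ^ k) (superGens ρ q i) := by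
      rw [superParity_superJm_pow, superParity_superGens, map_smul]
    refine ⟨?_, ?_⟩
    · rw [SetLike.mem_coe, Submodule.mem_comap, e]
      exact Submodule.smul_mem _ _ (pow_mem_ladderSpan _ _ i k)
    · rw [SetLike.mem_coe, LinearMap.mem_ker, LinearMap.sub_apply, LinearMap.comp_apply,
        LinearMap.comp_apply, e, map_smul, hm]
      change _ - FuzzySupersphere.parity q _ = 0
      rw [parity_adE_ospM, parity_ncGens, map_smul, sub_self]
  obtain ⟨h1, h2⟩ := key hF
  have h3 : θ (superParity F) = FuzzySupersphere.parity q (θ F) := sub_eq_zero.1 h2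
  have hFa : θ F = a := by
    rw [hθ F (hmem F hF), ← LinearEquiv.eq_symm_apply]
    exact Subtype.ext ha.symm
  rw [← hFa, ← h3, hθ _ (hmem _ h1), LinearEquiv.symm_apply_apply]

/-! ### Properties of the transition and body maps. -/

section Families

variable {ρ : ℝ} {L : ℕ} {ψ : ∀ q, superTrunc ρ L q ≃ₗ[ℂ] NSs q} {φ : ∀ q, sphTrunc ρ q ≃ₗ[ℂ] NSp q}
  {hβ : ∀ q, ∀ f ∈ superTrunc ρ L q, bodyMap ρ L f ∈ sphTrunc ρ q}

theorem exists_superRep (hρ : 0 < ρ) (q : ℕ) (a : NSs q) :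
    ∃ F ∈ ladderSpan superJm (superGens ρ q), limitHom ψ q a = projSuper ρ L F := by
  obtain ⟨F, hF, e⟩ := (superTrunc_eq hρ L q).le ((ψ q).symm a).2
  exact ⟨F, hF, e.symm⟩

theorem exists_sphRep (hρ : 0 < ρ) (q : ℕ) (a : NSp q) :
    ∃ F ∈ ladderSpan sphJm (sphGens ρ q), limitHom φ q a = projSphere ρ F := by
  obtain ⟨F, hF, e⟩ := (sphTrunc_eq hρ q).le ((φ q).symm a).2
  exact ⟨F, hF, e.symm⟩

theorem limitHom_evenComm_super (hρ : 0 < ρ) (hψ : ∀ q, SuperMatches (ψ q)) {q : ℕ} {F : SuperPoly}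
    (hF : F ∈ ladderSpan superJm (superGens ρ q)) {a : NSs q} (ha : limitHom ψ q a = projSuper ρ L F)
    (i : Fin 3) : limitHom ψ q (evenComm (ospJ q i) a) = projSuper ρ L (superJ i F) := by
  have h := ((hψ q).equivariant isOsp_super.isSl2 (isSl2_nc q).ad (isTop_superGens ρ q)
    (isTop_ncGens q) (superTrunc_eq hρ L q) hF ha i).2
  rwa [cartesian_adE, ← superJ_eq] at h

/-- Any representative `F` is allowed because vanishing on the sphere is preserved by `sphJ`;
`limitHom_evenComm_super` asks for one in the ladder span instead. -/
theorem limitHom_evenComm_sph (hρ : 0 < ρ) (hφ : ∀ q, SphMatches (φ q)) {q : ℕ} {F : Poly}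
    {b : NSp q} (hb : limitHom φ q b = projSphere ρ F)
    (i : Fin 3) : limitHom φ q (evenComm (spinJ q i) b) = projSphere ρ (sphJ i F) := by
  obtain ⟨G, hG, e⟩ := exists_sphRep (φ := φ) hρ q b
  have h := ((hφ q).equivariant isSl2_sph (isSl2_spin q).ad (isTop_sphGens ρ q)
    (isTop_ncSphGens q) (sphTrunc_eq hρ q) hG e i).2
  rw [cartesian_adE, ← sphJ_eq] at h
  refine Eq.trans h ?_
  rw [← sub_eq_zero, ← map_sub, ← map_sub]
  refine projSphere_sphJ hρ i ?_
  rw [map_sub, ← e, hb, sub_self]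

theorem ladderSpan_superGens_mono (ρ : ℝ) {q r : ℕ} (h : q ≤ r) :
    ladderSpan superJm (superGens ρ q) ≤ ladderSpan superJm (superGens ρ r) := by
  rw [ladderSpan_le_iff]
  rintro (n | n) k
  · exact pow_mem_ladderSpan superJm (superGens ρ r) (Sum.inl ⟨n, by have := n.2; omega⟩) k
  · exact pow_mem_ladderSpan superJm (superGens ρ r) (Sum.inr ⟨n, by have := n.2; omega⟩) k

theorem limitHom_ncBody (q : ℕ) (a : NSs q) :
    limitHom φ q (ncBody hβ ψ φ q a) = bodyMap ρ L (limitHom ψ q a) := by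
  simp [limitHom, ncBody]

theorem transition_super (hρ : 0 < ρ) (hψ : ∀ q, SuperMatches (ψ q)) (q r : ℕ) (h : q ≤ r)
    (a : NSs q) :
    transition (superTrunc_mono ρ L) ψ q r h (parity q a)
        = parity r (transition (superTrunc_mono ρ L) ψ q r h a) ∧
      ∀ i, transition (superTrunc_mono ρ L) ψ q r h (evenComm (ospJ q i) a)
        = evenComm (ospJ r i) (transition (superTrunc_mono ρ L) ψ q r h a) := by
  obtain ⟨F, hF, e⟩ := exists_superRep (ψ := ψ) hρ q a
  have e' : limitHom ψ r (transition (superTrunc_mono ρ L) ψ q r h a) = projSuper ρ L F := by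
    rw [limitHom_transition, e]
  have hF' := ladderSpan_superGens_mono ρ h hF
  refine ⟨limitHom_injective ψ r ?_, fun i => limitHom_injective ψ r ?_⟩
  · rw [limitHom_transition]
    exact ((hψ q).parity hρ hF e).trans ((hψ r).parity hρ hF' e').symm
  · rw [limitHom_transition, limitHom_evenComm_super hρ hψ hF e,
      limitHom_evenComm_super hρ hψ hF' e']

theorem transition_sph (hρ : 0 < ρ) (hφ : ∀ q, SphMatches (φ q)) (q r : ℕ) (h : q ≤ r)
    (b : NSp q) (i : Fin 3) :
    transition (sphTrunc_mono ρ) φ q r h (evenComm (spinJ q i) b)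
      = evenComm (spinJ r i) (transition (sphTrunc_mono ρ) φ q r h b) := by
  obtain ⟨F, hF, e⟩ := exists_sphRep (φ := φ) hρ q b
  apply limitHom_injective φ r
  have e' : limitHom φ r (transition (sphTrunc_mono ρ) φ q r h b) = projSphere ρ F := by
    rw [limitHom_transition, e]
  rw [limitHom_transition, limitHom_evenComm_sph hρ hφ e, limitHom_evenComm_sph hρ hφ e']

/-- The body depends only on the component without odd coordinates, which parity fixes. -/
theorem ncBody_parity (hρ : 0 < ρ) (hψ : ∀ q, SuperMatches (ψ q)) (q : ℕ) (a : NSs q) :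
    ncBody hβ ψ φ q (parity q a) = ncBody hβ ψ φ q a := by
  obtain ⟨F, hF, e⟩ := exists_superRep (ψ := ψ) hρ q a
  apply limitHom_injective φ q
  have e' : limitHom ψ q (parity q a) = projSuper ρ L (superParity F) := (hψ q).parity hρ hF e
  rw [limitHom_ncBody, limitHom_ncBody, e, e', bodyMap_projSuper, bodyMap_projSuper,
    (superParity_apply F).1]

theorem superJ_empty (i : Fin 3) (F : SuperPoly) : superJ i F ∅ = sphJ i (F ∅) := by
  simp [superJ_apply, mulTheta_zero, mulTheta_one]

theorem ncBody_evenComm (hρ : 0 < ρ) (hψ : ∀ q, SuperMatches (ψ q)) (hφ : ∀ q, SphMatches (φ q))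
    (q : ℕ) (a : NSs q) (i : Fin 3) :
    ncBody hβ ψ φ q (evenComm (ospJ q i) a) = evenComm (spinJ q i) (ncBody hβ ψ φ q a) := by
  obtain ⟨F, hF, e⟩ := exists_superRep (ψ := ψ) hρ q a
  apply limitHom_injective φ q
  have e' : limitHom φ q (ncBody hβ ψ φ q a) = projSphere ρ (F ∅) := by
    rw [limitHom_ncBody, e, bodyMap_projSuper]
  rw [limitHom_ncBody, limitHom_evenComm_super hρ hψ hF e, bodyMap_projSuper,
    limitHom_evenComm_sph hρ hφ e', superJ_empty]

/-- The ladders of integer superspin `j ≤ q` starting from `evenTop j` already have as bodies all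
the ladders that span the truncation. -/
theorem ncBody_surjective (hρ : 0 < ρ) (q : ℕ) : Function.Surjective (ncBody hβ ψ φ q) := by
  have key : sphTrunc ρ q ≤ (superTrunc ρ L q).map (bodyMap ρ L) := by
    rw [sphTrunc_eq hρ, Submodule.map_le_iff_le_comap, ladderSpan_le_iff]
    intro j k
    refine ⟨(sphTopCoeff ρ j : ℂ) • projSuper ρ L ((superJm ^ k) (sTop (2 * j))),
      Submodule.smul_mem _ _ ?_, ?_⟩
    · rw [superTrunc_eq hρ]
      exact Submodule.mem_map_of_mem (sTop_pow_mem_ladderSpan hρ (by have := j.2; omega) k)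
    · rw [map_smul, bodyMap_projSuper, superJm_pow_empty, sTop_even, (evenTop_apply j).1, sphGens,
        sphTop_eq, map_smul, map_smul]
  intro b
  obtain ⟨f, hf, e⟩ := key ((φ q).symm b).2
  refine ⟨ψ q ⟨f, hf⟩, limitHom_injective φ q ?_⟩
  rw [limitHom_ncBody]
  have : limitHom ψ q (ψ q ⟨f, hf⟩) = f := by simp [limitHom]
  rw [this, e]; rfl

theorem ncBody_transition (q r : ℕ) (h : q ≤ r) :
    ncBody hβ ψ φ r ∘ₗ transition (superTrunc_mono ρ L) ψ q r h
      = transition (sphTrunc_mono ρ) φ q r h ∘ₗ ncBody hβ ψ φ q := by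
  ext1 a
  apply limitHom_injective φ r
  rw [LinearMap.comp_apply, LinearMap.comp_apply, limitHom_ncBody, limitHom_transition,
    limitHom_transition, limitHom_ncBody]

theorem fromLimit_map_ncBody
    (hc : ∀ q r (h : q ≤ r), ncBody hβ ψ φ r ∘ₗ transition (superTrunc_mono ρ L) ψ q r h
            = transition (sphTrunc_mono ρ) φ q r h ∘ₗ ncBody hβ ψ φ q)
    (z : Module.DirectLimit NSs (transition (superTrunc_mono ρ L) ψ)) :
    fromLimit (sphTrunc_mono ρ) φ (Module.DirectLimit.map (ncBody hβ ψ φ) hc z)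
      = bodyMap ρ L (fromLimit (superTrunc_mono ρ L) ψ z) := by
  induction z using Module.DirectLimit.induction_on with
  | ih q a =>
    rw [Module.DirectLimit.map_apply_of, fromLimit, fromLimit, Module.DirectLimit.lift_of,
      Module.DirectLimit.lift_of, limitHom_ncBody]

end Families

end
end FuzzySupersphere

namespace FuzzySupersphere
noncomputable section
open MvPolynomial (X C pderiv)
open Filter (Tendsto atTop)

/-! ### Multiplication by coordinates in terms of ladders -/

/-- The relations between the coordinates of a (fuzzy) sphere, with respect to the lowering
derivation `D`. -/
structure IsFuzzy {A : Type*} [Ring A] [Algebra ℂ A] (D : Module.End ℂ A) (x z y : A) (h : ℂ) :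
    Prop where
  leibniz : ∀ f g, D (f * g) = D f * g + f * D g
  dx : D x = (-2 : ℂ) • z
  dz : D z = y
  dy : D y = 0
  comm : z * x - x * z = h • x

namespace IsFuzzy

variable {A : Type*} [Ring A] [Algebra ℂ A] {D : Module.End ℂ A} {x z y : A} {h : ℂ}

theorem d_one (H : IsFuzzy D x z y h) : D 1 = 0 := by
  have e := H.leibniz 1 1
  simpa using e

/-- The Leibniz rule, with every `z` moved to the left at the price of a multiple of `h`. Solved for
`z * x ^ j` in `z_mul_pow`, it expresses a product with a coordinate by ladder elements. -/
theorem d_pow (H : IsFuzzy D x z y h) (j : ℕ) :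
    D (x ^ (j + 1)) = (-2 * ((j : ℂ) + 1)) • (z * x ^ j) + ((j : ℂ) * (j + 1) * h) • x ^ j := by
  induction j with
  | zero => simp [H.dx]
  | succ j ih =>
    have e : x * z = z * x - h • x := by rw [← H.comm]; abel
    rw [pow_succ' x (j + 1), H.leibniz, ih, H.dx, mul_add, mul_smul_comm, mul_smul_comm, ← mul_assoc x z,
      e, sub_mul, smul_mul_assoc, smul_mul_assoc, mul_assoc z, ← pow_succ']
    push_cast; module

theorem z_mul_pow (H : IsFuzzy D x z y h) (j : ℕ) :
    z * x ^ j = (-1 / (2 * ((j : ℂ) + 1))) • D (x ^ (j + 1)) + ((j : ℂ) / 2 * h) • x ^ j := by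
  have hj : (j : ℂ) + 1 ≠ 0 := by exact_mod_cast j.succ_ne_zero
  rw [H.d_pow, smul_add, smul_smul, smul_smul, add_assoc, ← add_smul,
    show -1 / (2 * ((j : ℂ) + 1)) * (-2 * (j + 1)) = 1 by field_simp,
    show -1 / (2 * ((j : ℂ) + 1)) * (j * (j + 1) * h) + j / 2 * h = 0 by field_simp; ring]
  simp

theorem d_d_pow (H : IsFuzzy D x z y h) (j : ℕ) :
    D (D (x ^ (j + 1))) = (-2 * ((j : ℂ) + 1)) • (y * x ^ j + z * D (x ^ j))
      + ((j : ℂ) * (j + 1) * h) • D (x ^ j) := by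
  rw [H.d_pow, map_add, map_smul, map_smul, H.leibniz, H.dz]

/-- Expanding `D² (x^(i+2))` gives one relation between `y x^(i+1)` and `z² x^i`, and the Casimir
combination `y x + z² + h z` another. Eliminating `z² x^i` leaves `y x^(i+1)` with the coefficient
`-2(i+2)(2i+3)`, which is invertible. -/
theorem y_mul_pow_succ (H : IsFuzzy D x z y h) (i : ℕ) :
    y * x ^ (i + 1) = (-1 / (2 * ((i : ℂ) + 2) * (2 * i + 3))) • D (D (x ^ (i + 2)))
      + (1 / 2 * h) • D (x ^ (i + 1))
      + ((2 * ((i : ℂ) + 1)) / (2 * i + 3)) • ((y * x + z * z + h • z) * x ^ i)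
      - (((i : ℂ) + 1) * i * (i + 2) / (2 * (2 * i + 3)) * h ^ 2) • x ^ i := by
  have h1 : (i : ℂ) + 2 ≠ 0 := by exact_mod_cast (by omega : i + 2 ≠ 0)
  have h2 : 2 * (i : ℂ) + 3 ≠ 0 := by exact_mod_cast (by omega : 2 * i + 3 ≠ 0)
  have e1 := H.d_d_pow (i + 1)
  have e2 : (y * x + z * z + h • z) * x ^ i
      = y * x ^ (i + 1) + z * (z * x ^ i) + h • (z * x ^ i) := by
    rw [add_mul, add_mul, smul_mul_assoc, mul_assoc, mul_assoc, ← pow_succ']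
  have e3 : z * D (x ^ (i + 1)) = (-2 * ((i : ℂ) + 1)) • (z * (z * x ^ i))
      + ((i : ℂ) * (i + 1) * h) • (z * x ^ i) := by
    rw [H.d_pow, mul_add, mul_smul_comm, mul_smul_comm]
  rw [e3, H.d_pow i] at e1
  rw [show i + 2 = i + 1 + 1 by ring, e1, e2, H.d_pow i]
  push_cast
  match_scalars <;> field_simp <;> ring

end IsFuzzy

/-- The scale `2 ρ / (q + 1)` of the coordinates of the truncated sphere. -/
def fuzzyScale (ρ : ℝ) (q : ℕ) : ℂ := 2 * (ρ : ℂ) / ((q : ℂ) + 1)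

theorem isFuzzy_spin (ρ : ℝ) (q : ℕ) : IsFuzzy (adE (spinM (q + 1)))
    (fuzzyScale ρ q • spinP (q + 1)) (fuzzyScale ρ q • spinZ (q + 1))
    (fuzzyScale ρ q • spinM (q + 1)) (fuzzyScale ρ q) where
  leibniz f g := adE_mul _ f g
  dx := by
    rw [map_smul, adE_apply, ← neg_sub, (isSl2_spin q).pm]; module
  dz := by
    rw [map_smul, adE_apply, ← neg_sub, (isSl2_spin q).zm]; module
  dy := by rw [map_smul, adE_apply, sub_self, smul_zero]
  comm := by
    simp only [smul_mul_smul_comm]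
    rw [← smul_sub, (isSl2_spin q).zp, smul_smul]

theorem isFuzzy_sph : IsFuzzy sphJm xPlus (X 2) xMinus 0 where
  leibniz := sphJm_mul
  dx := by rw [sphJm_xPlus, MvPolynomial.smul_eq_C_mul, map_neg, map_ofNat]
  dz := sphJm_X2
  dy := sphJm_xMinus
  comm := by rw [zero_smul]; ring

/-- The Casimir value is `(q/2)(q/2+1) = ((q+1)² - 1)/4`, and the scale is chosen so that `h²
(q+1)²/4 = ρ²`. -/
theorem casimir_fuzzy (ρ : ℝ) (q : ℕ) :
    (fuzzyScale ρ q • spinM (q + 1)) * (fuzzyScale ρ q • spinP (q + 1))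
      + (fuzzyScale ρ q • spinZ (q + 1)) * (fuzzyScale ρ q • spinZ (q + 1))
      + fuzzyScale ρ q • (fuzzyScale ρ q • spinZ (q + 1))
    = ((ρ : ℂ) ^ 2 - fuzzyScale ρ q ^ 2 / 4) • 1 := by
  have e := casimir_spin q
  have hq : (q : ℂ) + 1 ≠ 0 := by exact_mod_cast q.succ_ne_zero
  have e1 : ((ρ : ℂ) ^ 2 - fuzzyScale ρ q ^ 2 / 4)
      = fuzzyScale ρ q ^ 2 * ((q : ℂ) / 2 * ((q : ℂ) / 2 + 1)) := by
    rw [fuzzyScale]; field_simp; ring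
  rw [e1, mul_smul, ← e]
  simp only [smul_mul_smul_comm]
  module

theorem tendsto_fuzzyScale (ρ : ℝ) : Tendsto (fuzzyScale ρ) atTop (𝓝 0) := by
  have h := (tendsto_one_div_add_atTop_nhds_zero_nat (𝕜 := ℂ)).const_mul (2 * (ρ : ℂ))
  rw [mul_zero] at h
  exact h.congr fun q => by rw [fuzzyScale]; ring

/-! ### Sequences of matrices with a symbol -/

/-- Sequences of matrices, paired with a polynomial. -/
abbrev SymbolRing : Type := (∀ q, NSp q) × Poly

namespace Symbols

/-- Multiplication by a sequence of scalars, with a value for the limit. -/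
def scale (c : ℕ → ℂ) (d : ℂ) : Module.End ℂ SymbolRing :=
  LinearMap.prodMap (LinearMap.pi fun q => c q • LinearMap.proj q) (d • LinearMap.id)

theorem scale_apply (c : ℕ → ℂ) (d : ℂ) (r : SymbolRing) :
    scale c d r = (fun q => c q • r.1 q, d • r.2) := rfl

/-- The lowering derivation. -/
def lower : Module.End ℂ SymbolRing :=
  LinearMap.prodMap (LinearMap.pi fun q => adE (spinM (q + 1)) ∘ₗ LinearMap.proj q) sphJm

theorem lower_apply (r : SymbolRing) :
    lower r = (fun q => adE (spinM (q + 1)) (r.1 q), sphJm r.2) := rfl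

theorem lower_mul (r s : SymbolRing) : lower (r * s) = lower r * s + r * lower s := by
  refine Prod.ext (funext fun q => ?_) ?_
  · exact adE_mul _ _ _
  · exact sphJm_mul _ _

theorem lower_pow_apply (k : ℕ) (r : SymbolRing) :
    (lower ^ k) r = (fun q => (adE (spinM (q + 1)) ^ k) (r.1 q), (sphJm ^ k) r.2) := by
  induction k with
  | zero => rfl
  | succ k ih => simp only [pow_succ', Module.End.mul_apply, ih, lower_apply]

theorem lower_scale (c : ℕ → ℂ) (d : ℂ) (r : SymbolRing) :
    lower (scale c d r) = scale c d (lower r) := by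
  refine Prod.ext (funext fun q => ?_) ?_
  · exact map_smul (adE (spinM (q + 1))) (c q) (r.1 q)
  · exact map_smul sphJm d r.2

theorem scale_mul (c : ℕ → ℂ) (d : ℂ) (r s : SymbolRing) :
    scale c d r * s = scale c d (r * s) := by
  refine Prod.ext (funext fun q => ?_) ?_
  · exact smul_mul_assoc (c q) (r.1 q) (s.1 q)
  · exact smul_mul_assoc d r.2 s.2

theorem mul_scale (c : ℕ → ℂ) (d : ℂ) (r s : SymbolRing) :
    r * scale c d s = scale c d (r * s) := by
  refine Prod.ext (funext fun q => ?_) ?_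
  · exact mul_smul_comm (c q) (r.1 q) (s.1 q)
  · exact mul_smul_comm d r.2 s.2

theorem scale_scale (c e : ℕ → ℂ) (d f : ℂ) (r : SymbolRing) :
    scale c d (scale e f r) = scale (c * e) (d * f) r := by
  refine Prod.ext (funext fun q => ?_) ?_
  · exact smul_smul (c q) (e q) (r.1 q)
  · exact smul_smul d f r.2

/-- The scaled raising operator together with the coordinate `x¹ + i x²`. -/
def symX (ρ : ℝ) : SymbolRing := (fun q => fuzzyScale ρ q • spinP (q + 1), xPlus)

/-- The scaled diagonal operator together with the coordinate `x³`. -/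
def symZ (ρ : ℝ) : SymbolRing := (fun q => fuzzyScale ρ q • spinZ (q + 1), X 2)

/-- The scaled lowering operator together with the coordinate `x¹ - i x²`. -/
def symY (ρ : ℝ) : SymbolRing := (fun q => fuzzyScale ρ q • spinM (q + 1), xMinus)

theorem symX_pow (ρ : ℝ) (j : ℕ) :
    symX ρ ^ j = (fun q => (fuzzyScale ρ q • spinP (q + 1)) ^ j, xPlus ^ j) := rfl

theorem lower_symX (ρ : ℝ) : lower (symX ρ) = (-2 : ℂ) • symZ ρ :=
  Prod.ext (funext fun q => (isFuzzy_spin ρ q).dx) isFuzzy_sph.dx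

theorem lower_symZ (ρ : ℝ) : lower (symZ ρ) = symY ρ :=
  Prod.ext (funext fun q => (isFuzzy_spin ρ q).dz) isFuzzy_sph.dz

theorem lower_symY (ρ : ℝ) : lower (symY ρ) = 0 :=
  Prod.ext (funext fun q => (isFuzzy_spin ρ q).dy) isFuzzy_sph.dy

/-- Pairs of a sequence that vanishes eventually and a multiple of the equation of the sphere. -/
def negligible (ρ : ℝ) : Submodule ℂ SymbolRing where
  carrier := {r | (∀ᶠ q in atTop, r.1 q = 0) ∧ ∃ G, r.2 = (radSq - C ((ρ : ℂ) ^ 2)) * G}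
  zero_mem' := ⟨Filter.Eventually.of_forall fun _ => rfl, 0, (mul_zero _).symm⟩
  add_mem' := by
    rintro r s ⟨hr, G, eG⟩ ⟨hs, H, eH⟩
    refine ⟨?_, G + H, by rw [Prod.snd_add, eG, eH, mul_add]⟩
    filter_upwards [hr, hs] with q h1 h2
    rw [Prod.fst_add, Pi.add_apply, h1, h2, add_zero]
  smul_mem' := by
    rintro c r ⟨hr, G, eG⟩
    refine ⟨?_, c • G, by rw [Prod.smul_snd, eG, mul_smul_comm]⟩
    filter_upwards [hr] with q h1
    rw [Prod.smul_fst, Pi.smul_apply, h1, smul_zero]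

theorem mul_mem_negligible {ρ : ℝ} (r : SymbolRing) {s : SymbolRing} (hs : s ∈ negligible ρ) :
    r * s ∈ negligible ρ := by
  obtain ⟨h, G, e⟩ := hs
  refine ⟨?_, r.2 * G, by rw [Prod.snd_mul, e]; ring⟩
  filter_upwards [h] with q h1
  rw [Prod.fst_mul, Pi.mul_apply, h1, mul_zero]

theorem negligible_mul_mem {ρ : ℝ} {r : SymbolRing} (hr : r ∈ negligible ρ) (s : SymbolRing) :
    r * s ∈ negligible ρ := by
  obtain ⟨h, G, e⟩ := hr
  refine ⟨?_, G * s.2, by rw [Prod.snd_mul, e]; ring⟩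
  filter_upwards [h] with q h1
  rw [Prod.fst_mul, Pi.mul_apply, h1, zero_mul]

theorem scale_mem_negligible {ρ : ℝ} (c : ℕ → ℂ) (d : ℂ) {s : SymbolRing} (hs : s ∈ negligible ρ) :
    scale c d s ∈ negligible ρ := by
  obtain ⟨h, G, e⟩ := hs
  refine ⟨?_, d • G, by rw [scale_apply, e, mul_smul_comm]⟩
  filter_upwards [h] with q h1
  rw [scale_apply]; simp only [h1, smul_zero]

theorem lower_mem_negligible {ρ : ℝ} {s : SymbolRing} (hs : s ∈ negligible ρ) :
    lower s ∈ negligible ρ := by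
  obtain ⟨h, G, e⟩ := hs
  refine ⟨?_, sphJm G, ?_⟩
  · filter_upwards [h] with q h1
    rw [lower_apply]; simp only [h1, map_zero]
  · rw [lower_apply, e]
    simp only [sphJm_mul, map_sub, sphJm_radSq, sphJm_C, sub_zero, zero_mul, zero_add]

/-- The sequences of matrices that have a symbol: combinations of ladders with convergent
coefficients. -/
def symbols (ρ : ℝ) : Submodule ℂ SymbolRing :=
  Submodule.span ℂ {r | ∃ c d, Tendsto c atTop (𝓝 d) ∧ ∃ j k, r = scale c d ((lower ^ k) (symX ρ ^ j))}
    ⊔ negligible ρ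

variable {ρ : ℝ}

theorem negligible_le : negligible ρ ≤ symbols ρ := le_sup_right

theorem generator_mem {c : ℕ → ℂ} {d : ℂ} (h : Tendsto c atTop (𝓝 d)) (j k : ℕ) :
    scale c d ((lower ^ k) (symX ρ ^ j)) ∈ symbols ρ :=
  Submodule.mem_sup_left (Submodule.subset_span ⟨c, d, h, j, k, rfl⟩)

theorem symbols_le {N : Submodule ℂ SymbolRing}
    (h : ∀ c d, Tendsto c atTop (𝓝 d) → ∀ j k, scale c d ((lower ^ k) (symX ρ ^ j)) ∈ N)
    (hn : ∀ s ∈ negligible ρ, s ∈ N) : symbols ρ ≤ N := by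
  refine sup_le (Submodule.span_le.2 ?_) hn
  rintro _ ⟨c, d, hc, j, k, rfl⟩
  exact h c d hc j k

theorem scale_mem {c : ℕ → ℂ} {d : ℂ} (h : Tendsto c atTop (𝓝 d)) {s : SymbolRing}
    (hs : s ∈ symbols ρ) : scale c d s ∈ symbols ρ := by
  have : symbols ρ ≤ (symbols ρ).comap (scale c d) := by
    refine symbols_le (fun c' d' h' j k => ?_) fun s hs => negligible_le (scale_mem_negligible c d hs)
    rw [Submodule.mem_comap, scale_scale]
    exact generator_mem (h.mul h') j k
  exact this hs

theorem lower_mem {s : SymbolRing} (hs : s ∈ symbols ρ) : lower s ∈ symbols ρ := by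
  have : symbols ρ ≤ (symbols ρ).comap lower := by
    refine symbols_le (fun c' d' h' j k => ?_) fun s hs => negligible_le (lower_mem_negligible hs)
    rw [Submodule.mem_comap, lower_scale]
    have h := generator_mem (ρ := ρ) h' j (k + 1)
    rwa [pow_succ', Module.End.mul_apply] at h
  exact this hs

theorem scale_one (s : SymbolRing) : scale 1 1 s = s := by
  rw [scale_apply]; simp

theorem lower_pow_symX_pow_mem (j k : ℕ) : (lower ^ k) (symX ρ ^ j) ∈ symbols ρ := by
  have h := generator_mem (ρ := ρ) (c := 1) (d := 1) tendsto_const_nhds j k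
  rwa [scale_one] at h

theorem symX_pow_mem (j : ℕ) : symX ρ ^ j ∈ symbols ρ := lower_pow_symX_pow_mem j 0

/-- The identity `IsFuzzy.z_mul_pow` is read at once for matrices with `h = fuzzyScale ρ q` and for
polynomials with `h = 0`. The coefficients converge because `fuzzyScale` tends to zero. -/
theorem symZ_mul_symX_pow_mem (j : ℕ) : symZ ρ * symX ρ ^ j ∈ symbols ρ := by
  have e : symZ ρ * symX ρ ^ j = (-1 / (2 * ((j : ℂ) + 1))) • lower (symX ρ ^ (j + 1))
      + ((j : ℂ) / 2) • scale (fuzzyScale ρ) 0 (symX ρ ^ j) := by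
    refine Prod.ext (funext fun q => ?_) ?_
    · refine ((isFuzzy_spin ρ q).z_mul_pow j).trans ?_
      rw [mul_smul]; rfl
    · refine (isFuzzy_sph.z_mul_pow j).trans ?_
      rw [mul_smul]; rfl
  rw [e]
  exact Submodule.add_mem _ (Submodule.smul_mem _ _ (lower_mem (symX_pow_mem _)))
    (Submodule.smul_mem _ _ (scale_mem (tendsto_fuzzyScale ρ) (symX_pow_mem _)))

theorem symY_mul_symX_pow_mem (j : ℕ) : symY ρ * symX ρ ^ j ∈ symbols ρ := by
  have hs := tendsto_fuzzyScale ρ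
  cases j with
  | zero =>
    have e : symY ρ * symX ρ ^ 0 = (-1 / 2 : ℂ) • lower (lower (symX ρ ^ 1)) := by
      rw [pow_zero, mul_one, pow_one, lower_symX, map_smul, lower_symZ, smul_smul]; norm_num
    rw [e]
    exact Submodule.smul_mem _ _ (lower_mem (lower_mem (symX_pow_mem _)))
  | succ i =>
    -- The Casimir combination is the scalar `ρ² - h²/4` on matrices but `radSq` on polynomials. Its
    -- scalar part is taken with limit `ρ²`, and the discrepancy `radSq - ρ²` is the negligible
    -- summand.
    have e : symY ρ * symX ρ ^ (i + 1)
        = (-1 / (2 * ((i : ℂ) + 2) * (2 * i + 3))) • lower (lower (symX ρ ^ (i + 2)))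
          + (1 / 2 : ℂ) • scale (fuzzyScale ρ) 0 (lower (symX ρ ^ (i + 1)))
          + ((2 * ((i : ℂ) + 1)) / (2 * i + 3)) •
            (scale (fun q => (ρ : ℂ) ^ 2 - fuzzyScale ρ q ^ 2 / 4) ((ρ : ℂ) ^ 2) (symX ρ ^ i)
              + (0, (radSq - C ((ρ : ℂ) ^ 2)) * xPlus ^ i))
          - (((i : ℂ) + 1) * i * (i + 2) / (2 * (2 * i + 3))) •
            scale (fuzzyScale ρ ^ 2) 0 (symX ρ ^ i) := by
      refine Prod.ext (funext fun q => ?_) ?_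
      · refine ((isFuzzy_spin ρ q).y_mul_pow_succ i).trans ?_
        rw [casimir_fuzzy, smul_one_mul]
        simp only [Prod.fst_sub, Prod.fst_add, Prod.smul_fst, Pi.sub_apply, Pi.add_apply,
          Pi.smul_apply, scale_apply, lower_apply, symX_pow, Pi.zero_apply, add_zero, mul_smul,
          Pi.pow_apply]
      · refine (isFuzzy_sph.y_mul_pow_succ i).trans ?_
        have er : xMinus * xPlus + X 2 * X 2 + (0 : ℂ) • X 2 = radSq := by
          rw [radSq_eq, zero_smul]; ring
        rw [er]
        simp only [Prod.snd_sub, Prod.snd_add, Prod.smul_snd, scale_apply, lower_apply, symX_pow]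
        rw [mul_zero, zero_smul, zero_smul, zero_pow two_ne_zero, mul_zero, zero_smul,
          smul_zero, smul_zero, MvPolynomial.smul_eq_C_mul (xPlus ^ i) ((ρ : ℂ) ^ 2), ← add_mul,
          add_sub_cancel]
    rw [e]
    refine Submodule.sub_mem _ (Submodule.add_mem _ (Submodule.add_mem _ ?_ ?_) ?_) ?_
    · exact Submodule.smul_mem _ _ (lower_mem (lower_mem (symX_pow_mem _)))
    · exact Submodule.smul_mem _ _ (scale_mem hs (lower_mem (symX_pow_mem _)))
    · refine Submodule.smul_mem _ _ (Submodule.add_mem _ (scale_mem ?_ (symX_pow_mem _)) ?_)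
      · have h := ((hs.pow 2).div_const 4).const_sub ((ρ : ℂ) ^ 2)
        simpa using h
      · exact negligible_le ⟨Filter.Eventually.of_forall fun _ => rfl, _, rfl⟩
    · refine Submodule.smul_mem _ _ (scale_mem ?_ (symX_pow_mem _))
      have h := hs.pow 2
      rwa [zero_pow two_ne_zero] at h

/-- Induction by `s · D r = D (s r) - (D s) r`. Lowering leads from `x` to `z`, from `z` to `y` and
from `y` to zero, so the three coordinates have to be treated together. -/
theorem coordinate_mul_lower_pow_mem (j k : ℕ) :
    symX ρ * (lower ^ k) (symX ρ ^ j) ∈ symbols ρ ∧ symZ ρ * (lower ^ k) (symX ρ ^ j) ∈ symbols ρ ∧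
      symY ρ * (lower ^ k) (symX ρ ^ j) ∈ symbols ρ := by
  induction k with
  | zero =>
    refine ⟨?_, symZ_mul_symX_pow_mem j, symY_mul_symX_pow_mem j⟩
    change symX ρ * symX ρ ^ j ∈ _
    rw [← pow_succ']; exact symX_pow_mem _
  | succ k ih =>
    obtain ⟨h1, h2, h3⟩ := ih
    rw [pow_succ', Module.End.mul_apply]
    set r := (lower ^ k) (symX ρ ^ j)
    have e : ∀ s, s * lower r = lower (s * r) - lower s * r := fun s => by
      rw [lower_mul]; abel
    refine ⟨?_, ?_, ?_⟩
    · rw [e, lower_symX, smul_mul_assoc]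
      exact Submodule.sub_mem _ (lower_mem h1) (Submodule.smul_mem _ _ h2)
    · rw [e, lower_symZ]
      exact Submodule.sub_mem _ (lower_mem h2) h3
    · rw [e, lower_symY, zero_mul, sub_zero]
      exact lower_mem h3

theorem mul_mem_of_generators {s : SymbolRing}
    (h : ∀ j k, s * (lower ^ k) (symX ρ ^ j) ∈ symbols ρ) {t : SymbolRing} (ht : t ∈ symbols ρ) :
    s * t ∈ symbols ρ := by
  have : symbols ρ ≤ (symbols ρ).comap (LinearMap.mulLeft ℂ s) := by
    refine symbols_le (fun c d hc j k => ?_) fun t ht => negligible_le (mul_mem_negligible s ht)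
    rw [Submodule.mem_comap, LinearMap.mulLeft_apply, mul_scale]
    exact scale_mem hc (h j k)
  exact this ht

theorem symX_pow_mul_mem (j : ℕ) {t : SymbolRing} (ht : t ∈ symbols ρ) :
    symX ρ ^ j * t ∈ symbols ρ := by
  induction j with
  | zero => rwa [pow_zero, one_mul]
  | succ j ih =>
    rw [pow_succ', mul_assoc]
    exact mul_mem_of_generators (fun j k => (coordinate_mul_lower_pow_mem j k).1) ih

/-- The same integration by parts, now on the left factor; `t` has to be arbitrary in the induction
because it gets lowered too. -/
theorem lower_pow_mul_mem (j k : ℕ) {t : SymbolRing} (ht : t ∈ symbols ρ) :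
    (lower ^ k) (symX ρ ^ j) * t ∈ symbols ρ := by
  induction k generalizing t with
  | zero => exact symX_pow_mul_mem j ht
  | succ k ih =>
    rw [pow_succ', Module.End.mul_apply]
    have e : ∀ r : SymbolRing, lower r * t = lower (r * t) - r * lower t := fun r => by
      rw [lower_mul]; abel
    rw [e]
    exact Submodule.sub_mem _ (lower_mem (ih ht)) (ih (lower_mem ht))

theorem mul_mem {s t : SymbolRing} (hs : s ∈ symbols ρ) (ht : t ∈ symbols ρ) :
    s * t ∈ symbols ρ := by
  have : symbols ρ ≤ (symbols ρ).comap (LinearMap.mulRight ℂ t) := by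
    refine symbols_le (fun c d hc j k => ?_) fun s hs => negligible_le (negligible_mul_mem hs t)
    rw [Submodule.mem_comap, LinearMap.mulRight_apply, scale_mul]
    exact scale_mem hc (lower_pow_mul_mem j k ht)
  exact this hs

theorem one_mem : (1 : SymbolRing) ∈ symbols ρ := symX_pow_mem 0

theorem symX_mem : symX ρ ∈ symbols ρ := by simpa using symX_pow_mem (ρ := ρ) 1

theorem symZ_mem : symZ ρ ∈ symbols ρ := by simpa using symZ_mul_symX_pow_mem (ρ := ρ) 0

theorem symY_mem : symY ρ ∈ symbols ρ := by simpa using symY_mul_symX_pow_mem (ρ := ρ) 0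

/-- Every polynomial is a symbol. -/
theorem exists_symbol (ρ : ℝ) (F : Poly) : ∃ a, (a, F) ∈ symbols ρ := by
  induction F using MvPolynomial.induction_on with
  | C c =>
    refine ⟨c • 1, ?_⟩
    have h := Submodule.smul_mem (symbols ρ) c one_mem
    have e : c • (1 : SymbolRing) = (c • 1, C c) :=
      Prod.ext rfl (by rw [Prod.smul_snd, Prod.snd_one, MvPolynomial.smul_eq_C_mul, mul_one])
    rwa [e] at h
  | add F G hF hG =>
    obtain ⟨a, ha⟩ := hF
    obtain ⟨b, hb⟩ := hG
    exact ⟨a + b, Submodule.add_mem _ ha hb⟩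
  | mul_X F k hF =>
    obtain ⟨a, ha⟩ := hF
    have h : ∃ b, (b, (X k : Poly)) ∈ symbols ρ := by
      fin_cases k
      · refine ⟨((1 / 2 : ℂ) • (symX ρ + symY ρ)).1, ?_⟩
        have h := Submodule.smul_mem (symbols ρ) (1 / 2 : ℂ) (Submodule.add_mem _ symX_mem symY_mem)
        have e : (X 0 : Poly) = ((1 / 2 : ℂ) • (symX ρ + symY ρ)).2 := by
          simp only [Prod.smul_snd, Prod.snd_add, symX, symY, xPlus, xMinus]; module
        change (_, X 0) ∈ _
        rw [e]; exact h
      · refine ⟨((-Complex.I / 2 : ℂ) • (symX ρ - symY ρ)).1, ?_⟩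
        have h := Submodule.smul_mem (symbols ρ) (-Complex.I / 2 : ℂ)
          (Submodule.sub_mem _ symX_mem symY_mem)
        have e : (X 1 : Poly) = ((-Complex.I / 2 : ℂ) • (symX ρ - symY ρ)).2 := by
          simp only [Prod.smul_snd, Prod.snd_sub, symX, symY, xPlus, xMinus,
            ← MvPolynomial.smul_eq_C_mul]
          match_scalars
          · linear_combination Complex.I_sq
          · ring
        change (_, X 1) ∈ _
        rw [e]; exact h
      · exact ⟨_, symZ_mem⟩
    obtain ⟨b, hb⟩ := h
    exact ⟨a * b, mul_mem ha hb⟩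

/-- Polynomials are spanned by ladders, modulo the equation of the sphere. -/
theorem poly_mem_of_ladders (ρ : ℝ) {N : Submodule ℂ Poly}
    (h : ∀ j k, (sphJm ^ k) (xPlus ^ j) ∈ N) (hn : ∀ G, (radSq - C ((ρ : ℂ) ^ 2)) * G ∈ N) (F : Poly) :
    F ∈ N := by
  -- Only the polynomial component of the symbol is used; the matrices are carried along and
  -- forgotten.
  obtain ⟨a, ha⟩ := exists_symbol ρ F
  have : symbols ρ ≤ N.comap (LinearMap.snd ℂ _ _) := by
    refine symbols_le (fun c d hc j k => ?_) ?_
    · rw [Submodule.mem_comap, LinearMap.snd_apply, scale_apply, lower_pow_apply]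
      exact Submodule.smul_mem _ _ (h j k)
    · rintro s ⟨-, G, e⟩
      rw [Submodule.mem_comap, LinearMap.snd_apply, e]
      exact hn G
  exact this ha

end Symbols

end
end FuzzySupersphere

namespace FuzzySupersphere
noncomputable section
open MvPolynomial (X C pderiv)
open Filter (Tendsto atTop)

/-! ### The truncations exhaust the polynomial functions -/

theorem exists_mem_sphTrunc {ρ : ℝ} (hρ : 0 < ρ) (f : polySphere ρ) : ∃ q, f ∈ sphTrunc ρ q := by
  obtain ⟨f, F, rfl⟩ := f
  have key : F ∈ (⨆ q, sphTrunc ρ q).comap (projSphere ρ) := by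
    refine Symbols.poly_mem_of_ladders ρ (fun j k => ?_) (fun G => ?_) F
    · exact Submodule.mem_iSup_of_mem j (xPlus_pow_ladder_mem hρ le_rfl k)
    · rw [Submodule.mem_comap]
      have e : projSphere ρ ((radSq - C ((ρ : ℂ) ^ 2)) * G) = 0 := by
        rw [projSphere_eq_zero_iff]
        intro y
        have h : evalAt y.1 (C ((ρ : ℂ) ^ 2)) = (ρ : ℂ) ^ 2 := AlgHom.commutes _ _
        rw [map_mul, map_sub, evalAt_radSq hρ, h, sub_self, zero_mul]
      rw [e]; exact Submodule.zero_mem _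
  exact (Submodule.mem_iSup_of_directed _ (sphTrunc_mono ρ).directed_le).1 key

theorem superJm_pow_single_empty (k : ℕ) (f : Poly) :
    (superJm ^ k) (Pi.single ∅ f) = Pi.single ∅ ((sphJm ^ k) f) := by
  have h1 : (Pi.single ∅ f : SuperPoly) {0} = 0 := Pi.single_eq_of_ne (by decide) _
  apply superPoly_ext
  · rw [superJm_pow_empty, Pi.single_eq_same, Pi.single_eq_same]
  · rw [superJm_pow_zero_comp, Pi.single_eq_of_ne (by decide), Pi.single_eq_of_ne (by decide), map_zero]
  · rw [superJm_pow_one_comp h1, Pi.single_eq_of_ne (by decide), Pi.single_eq_of_ne (by decide), map_zero]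
  · rw [superJm_pow_pair, Pi.single_eq_of_ne (by decide), Pi.single_eq_of_ne (by decide), map_zero]

theorem superJm_pow_single_pair (k : ℕ) (f : Poly) :
    (superJm ^ k) (Pi.single {0, 1} f) = Pi.single {0, 1} ((sphJm ^ k) f) := by
  have h1 : (Pi.single {0, 1} f : SuperPoly) {0} = 0 := Pi.single_eq_of_ne (by decide) _
  apply superPoly_ext
  · rw [superJm_pow_empty, Pi.single_eq_of_ne (by decide), Pi.single_eq_of_ne (by decide), map_zero]
  · rw [superJm_pow_zero_comp, Pi.single_eq_of_ne (by decide), Pi.single_eq_of_ne (by decide), map_zero]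
  · rw [superJm_pow_one_comp h1, Pi.single_eq_of_ne (by decide), Pi.single_eq_of_ne (by decide), map_zero]
  · rw [superJm_pow_pair, Pi.single_eq_same, Pi.single_eq_same]

theorem superJm_pow_single_one (k : ℕ) (f : Poly) :
    (superJm ^ k) (Pi.single {1} f) = Pi.single {1} ((sphJm ^ k) f) := by
  have h1 : (Pi.single {1} f : SuperPoly) {0} = 0 := Pi.single_eq_of_ne (by decide) _
  apply superPoly_ext
  · rw [superJm_pow_empty, Pi.single_eq_of_ne (by decide), Pi.single_eq_of_ne (by decide), map_zero]
  · rw [superJm_pow_zero_comp, Pi.single_eq_of_ne (by decide), Pi.single_eq_of_ne (by decide), map_zero]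
  · rw [superJm_pow_one_comp h1, Pi.single_eq_same, Pi.single_eq_same]
  · rw [superJm_pow_pair, Pi.single_eq_of_ne (by decide), Pi.single_eq_of_ne (by decide), map_zero]

theorem superJm_single_zero (f : Poly) :
    superJm (Pi.single {0} f) = Pi.single {0} (sphJm f) + Pi.single {1} f := by
  obtain ⟨e0, e1, e2, e3⟩ := superJm_apply (Pi.single {0} f)
  have h1 : (Pi.single {0} f : SuperPoly) ∅ = 0 := Pi.single_eq_of_ne (by decide) _
  have h2 : (Pi.single {0} f : SuperPoly) {1} = 0 := Pi.single_eq_of_ne (by decide) _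
  have h3 : (Pi.single {0} f : SuperPoly) {0, 1} = 0 := Pi.single_eq_of_ne (by decide) _
  apply superPoly_ext
  · rw [e0, h1, map_zero, Pi.add_apply, Pi.single_eq_of_ne (by decide), Pi.single_eq_of_ne (by decide),
      add_zero]
  · rw [e1, Pi.single_eq_same, Pi.add_apply, Pi.single_eq_same, Pi.single_eq_of_ne (by decide), add_zero]
  · rw [e2, h2, Pi.single_eq_same, Pi.add_apply, Pi.single_eq_same, Pi.single_eq_of_ne (by decide),
      map_zero]
  · rw [e3, h3, map_zero, Pi.add_apply, Pi.single_eq_of_ne (by decide), Pi.single_eq_of_ne (by decide),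
      add_zero]

/-- On these components `J_-` is `sphJm` plus a commuting map of square zero from `{0}` to `{1}`, so
its power has just two terms of the binomial expansion. -/
theorem superJm_pow_single_zero (k : ℕ) (f : Poly) :
    (superJm ^ (k + 1)) (Pi.single {0} f)
      = Pi.single {0} ((sphJm ^ (k + 1)) f)
        + ((k : ℂ) + 1) • (Pi.single {1} ((sphJm ^ k) f) : SuperPoly) := by
  induction k with
  | zero => simp [superJm_single_zero]
  | succ k ih =>
    rw [pow_succ' superJm, Module.End.mul_apply, ih, map_add, map_smul, superJm_single_zero]
    have e := superJm_pow_single_one 1 ((sphJm ^ k) f)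
    rw [pow_one, pow_one, ← Module.End.mul_apply, ← pow_succ'] at e
    rw [e, ← Module.End.mul_apply, ← pow_succ']
    push_cast; module

/-- The inclusion of the polynomials as a component of the superfunctions. -/
def superSingle (M : Finset (Fin 2)) : Poly →ₗ[ℂ] SuperPoly :=
  LinearMap.single ℂ (fun _ : Finset (Fin 2) => Poly) M

-- Let `U` consist of the superfunctions whose restriction lies in some truncation. The known
-- ladders are combined until each component separately carries all ladders of `xPlus ^ j`; then
-- `poly_mem_of_ladders` fills every component with all polynomials.
set_option maxHeartbeats 400000 in
theorem exists_mem_superTrunc {ρ : ℝ} (hρ : 0 < ρ) {L : ℕ} (f : polySuper ρ L) :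
    ∃ q, f ∈ superTrunc ρ L q := by
  set U : Submodule ℂ SuperPoly := (⨆ q, superTrunc ρ L q).comap (projSuper ρ L) with hU
  have hgen : ∀ q, ∀ F ∈ ladderSpan superJm (superGens ρ q), F ∈ U := fun q F hF => by
    refine Submodule.mem_iSup_of_mem q ?_
    rw [superTrunc_eq hρ]
    exact Submodule.mem_map_of_mem hF
  have hs : ∀ n k, (superJm ^ k) (sTop n) ∈ U := fun n k =>
    hgen n _ (sTop_pow_mem_ladderSpan hρ (by omega) k)
  have hq : ∀ n k, (superJm ^ k) (superQ 1 (sTop (n + 1))) ∈ U := fun n k =>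
    hgen (n + 1) _ (superQ_sTop_pow_mem_ladderSpan hρ (by omega) k)
  have heven : ∀ j k, (Pi.single ∅ ((sphJm ^ k) (xPlus ^ j)) : SuperPoly) ∈ U := fun j k => by
    have h := hs (2 * j) k
    rwa [sTop_even, evenTop, superJm_pow_single_empty] at h
  have hne : ∀ j : ℕ, (j : ℂ) + 1 ≠ 0 := fun j => by exact_mod_cast j.succ_ne_zero
  -- These are the second ladders of integer superspin `j + 1`, where `J_5` gives a nonzero multiple
  -- of `xPlus ^ j θ⁴`.
  have hq0 : ∀ j k, (superJm ^ k) (Pi.single {0} (xPlus ^ j)) ∈ U := fun j k => by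
    have h := Submodule.smul_mem _ (-((j : ℂ) + 1))⁻¹ (hq (2 * j + 1) k)
    rw [show 2 * j + 1 + 1 = 2 * (j + 1) by ring, sTop_even, superQ_one_evenTop, Nat.add_sub_cancel,
      Pi.single_smul', map_smul, smul_smul] at h
    push_cast at h
    rwa [inv_mul_cancel₀ (neg_ne_zero.2 (hne j)), one_smul] at h
  have hone : ∀ j k, (Pi.single {1} ((sphJm ^ k) (xPlus ^ j)) : SuperPoly) ∈ U := fun j k => by
    cases j with
    | zero =>
      cases k with
      | zero =>
        have h := hq0 0 1
        rw [superJm_pow_single_zero 0] at h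
        simpa [isFuzzy_sph.d_one] using h
      | succ k =>
        rw [pow_zero, pow_succ, Module.End.mul_apply, isFuzzy_sph.d_one, map_zero, Pi.single_zero]
        exact Submodule.zero_mem _
    | succ j =>
      have h1 := hs (2 * j + 1) k
      have h2 := hq0 (j + 1) (k + 1)
      -- This puts the `θ⁴` part of the odd top vector on the ladder of `xPlus ^ (j + 1)`, so that
      -- it can be cancelled against `hq0`.
      have e : xPlus ^ j * X 2 = (-1 / (2 * ((j : ℂ) + 1))) • sphJm (xPlus ^ (j + 1)) := by
        have e := isFuzzy_sph.z_mul_pow j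
        rw [mul_zero, zero_smul, add_zero] at e
        rw [mul_comm, e]
      rw [superJm_pow_single_zero] at h2
      have h3 : (superJm ^ k) (sTop (2 * j + 1))
          = (-1 / (2 * ((j : ℂ) + 1))) • (Pi.single {0} ((sphJm ^ (k + 1)) (xPlus ^ (j + 1))) : SuperPoly)
            + ((-1 / (2 * ((j : ℂ) + 1))) * k) • (Pi.single {1} ((sphJm ^ k) (xPlus ^ (j + 1))) : SuperPoly)
            + Pi.single {1} ((sphJm ^ k) (xPlus ^ (j + 1))) := by
        rw [sTop_odd, oddTop, e, map_add, Pi.single_smul', map_smul, ← pow_succ, superJm_pow_single_one]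
        cases k with
        | zero => simp
        | succ k =>
          rw [superJm_pow_single_zero, pow_succ sphJm (k + 1), Module.End.mul_apply,
            ← Module.End.mul_apply (sphJm ^ k), ← pow_succ]
          push_cast; module
      have h4 := Submodule.add_mem _ h1 (Submodule.smul_mem _ (1 / (2 * ((j : ℂ) + 1))) h2)
      -- In this combination the `θ⁴` components cancel, and `1 - k/(2(j+1)) + (k+1)/(2(j+1))`
      -- remains in front of `θ⁵`.
      have h5 : (superJm ^ k) (sTop (2 * j + 1)) + (1 / (2 * ((j : ℂ) + 1))) •
          (Pi.single {0} ((sphJm ^ (k + 1)) (xPlus ^ (j + 1)))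
            + ((k : ℂ) + 1) • (Pi.single {1} ((sphJm ^ k) (xPlus ^ (j + 1))) : SuperPoly))
          = ((2 * (j : ℂ) + 3) / (2 * (j + 1))) • (Pi.single {1} ((sphJm ^ k) (xPlus ^ (j + 1))) : SuperPoly) := by
        have := hne j
        rw [h3]
        match_scalars <;> field_simp <;> ring
      rw [h5] at h4
      refine (Submodule.smul_mem_iff _ (div_ne_zero ?_ ?_)).1 h4
      · exact_mod_cast (by omega : 2 * j + 3 ≠ 0)
      · exact mul_ne_zero two_ne_zero (hne j)
  have hzero : ∀ j k, (Pi.single {0} ((sphJm ^ k) (xPlus ^ j)) : SuperPoly) ∈ U := fun j k => by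
    cases k with
    | zero => exact hq0 j 0
    | succ k =>
      have h := hq0 j (k + 1)
      rw [superJm_pow_single_zero] at h
      exact (Submodule.add_mem_iff_left _ (Submodule.smul_mem _ _ (hone j k))).1 h
  have hrel : ∀ G : Poly, ((Pi.single ∅ ((radSq - C ((ρ : ℂ) ^ 2)) * G) : SuperPoly)
      + (2 : ℂ) • (Pi.single {0, 1} G : SuperPoly) : SuperPoly) ∈ U := fun G => by
    have e : projSuper ρ L ((Pi.single ∅ ((radSq - C ((ρ : ℂ) ^ 2)) * G) : SuperPoly)
      + (2 : ℂ) • (Pi.single {0, 1} G : SuperPoly)) = 0 := by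
      rw [map_add, projSuper_relation, Pi.single_smul', map_smul, map_smul, ← add_smul]; norm_num
    rw [hU, Submodule.mem_comap, e]
    exact Submodule.zero_mem _
  -- The ladder of `J_5` on the odd top vector contains `radSq` and `θ⁴θ⁵` with coefficient `2j +
  -- 3`. The supersphere relation trades `radSq` for `ρ²` and takes away `2`, leaving the nonzero
  -- `2j + 1`.
  have hpair : ∀ j k, (Pi.single {0, 1} ((sphJm ^ k) (xPlus ^ j)) : SuperPoly) ∈ U := fun j k => by
    have h1 := Submodule.smul_mem _ (-2 : ℂ) (hq (2 * j) k)
    rw [sTop_odd, superQ_one_oddTop, map_smul, smul_smul, map_add, superJm_pow_single_empty,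
      superJm_pow_single_pair, sphJm_pow_mul_radSq, map_smul] at h1
    have h2 := hrel ((sphJm ^ k) (xPlus ^ j))
    have h3 := Submodule.smul_mem _ ((ρ : ℂ) ^ 2) (heven j k)
    have h4 := Submodule.sub_mem _ (Submodule.sub_mem _ h1 h2) h3
    set g := (sphJm ^ k) (xPlus ^ j)
    have e : (-2 * (-1 / 2) : ℂ) • ((Pi.single ∅ (g * radSq) : SuperPoly) + Pi.single {0, 1} ((2 * (j : ℂ) + 3) • g))
        - ((Pi.single ∅ ((radSq - C ((ρ : ℂ) ^ 2)) * g) : SuperPoly) + (2 : ℂ) • (Pi.single {0, 1} g : SuperPoly))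
        - (ρ : ℂ) ^ 2 • (Pi.single ∅ g : SuperPoly) = (2 * (j : ℂ) + 1) • (Pi.single {0, 1} g : SuperPoly) := by
      rw [sub_mul, Pi.single_sub, ← MvPolynomial.smul_eq_C_mul, Pi.single_smul', Pi.single_smul',
        mul_comm radSq]
      module
    rw [e] at h4
    exact (Submodule.smul_mem_iff _ (by exact_mod_cast (by omega : 2 * j + 1 ≠ 0))).1 h4
  -- Multiples of `radSq - ρ²` restrict to zero in these components. In the component `∅` they
  -- become `θ⁴θ⁵` terms, so that component is treated last.
  have hodd : ∀ M : Finset (Fin 2), M ≠ ∅ →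
      (∀ j k, (Pi.single M ((sphJm ^ k) (xPlus ^ j)) : SuperPoly) ∈ U) →
      ∀ F : Poly, (Pi.single M F : SuperPoly) ∈ U := by
    intro M hM h F
    refine Symbols.poly_mem_of_ladders ρ (N := U.comap (superSingle M)) h (fun G => ?_) F
    have e : projSuper ρ L (superSingle M ((radSq - C ((ρ : ℂ) ^ 2)) * G)) = 0 :=
      projSuper_relation_odd ρ M hM G
    rw [Submodule.mem_comap, hU, Submodule.mem_comap, e]
    exact Submodule.zero_mem _
  have hempty : ∀ F : Poly, (Pi.single ∅ F : SuperPoly) ∈ U := by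
    intro F
    refine Symbols.poly_mem_of_ladders ρ (N := U.comap (superSingle ∅)) heven (fun G => ?_) F
    exact (Submodule.add_mem_iff_left _
      (Submodule.smul_mem _ _ (hodd {0, 1} (by decide) hpair G))).1 (hrel G)
  obtain ⟨f, F, rfl⟩ := f
  have hF : F ∈ U := by
    have e : F = Pi.single ∅ (F ∅) + Pi.single {0} (F {0}) + Pi.single {1} (F {1})
        + Pi.single {0, 1} (F {0, 1}) := by
      have h := (Finset.univ_sum_single F).symm
      rwa [sum_finset_fin_two] at h
    rw [e]
    exact Submodule.add_mem _ (Submodule.add_mem _ (Submodule.add_mem _ (hempty _)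
      (hodd _ (by decide) hzero _)) (hodd _ (by decide) hone _)) (hodd _ (by decide) hpair _)
  exact (Submodule.mem_iSup_of_directed _ (superTrunc_mono ρ L).directed_le).1 hF

/-! ### The Fréchet topology -/

/-- The `n`-th derivative as a linear map. -/
def derivLin (n : ℕ) : SmoothE3 →ₗ[ℂ] C(E3, E3 [×n]→L[ℝ] ℂ) where
  toFun := derivMap n
  map_add' F G := by
    ext1 y
    have hF : ContDiff ℝ ∞ F.1 := F.2
    have hG : ContDiff ℝ ∞ G.1 := G.2
    exact iteratedFDeriv_add_apply (hF.contDiffAt.of_le (by exact_mod_cast le_top))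
      (hG.contDiffAt.of_le (by exact_mod_cast le_top))
  map_smul' c F := by
    ext1 y
    have hF : ContDiff ℝ ∞ F.1 := F.2
    exact iteratedFDeriv_const_smul_apply (hF.contDiffAt.of_le (by exact_mod_cast le_top))

theorem continuousAdd_smoothE3 : ContinuousAdd SmoothE3 :=
  continuousAdd_iInf fun n => continuousAdd_induced (derivLin n)

theorem continuousSMul_smoothE3 : ContinuousSMul ℂ SmoothE3 :=
  continuousSMul_iInf fun n => continuousSMul_induced (derivLin n)

theorem continuous_restrictSmooth (ρ : ℝ) : Continuous (restrictSmooth ρ) := continuous_coinduced_rng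

/-- Convergence of functions on the sphere that lifts to smooth functions on space. -/
def LiftConv (ρ : ℝ) (u : ℕ → SmoothSphere ρ) (w : SmoothSphere ρ) : Prop :=
  ∃ (U : ℕ → SmoothE3) (W : SmoothE3), (∀ᶠ q in atTop, restrictSmooth ρ (U q) = u q) ∧
    restrictSmooth ρ W = w ∧ Tendsto U atTop (𝓝 W)

namespace LiftConv

variable {ρ : ℝ} {u u' : ℕ → SmoothSphere ρ} {w w' : SmoothSphere ρ}

/-- Sums and multiples of convergent sequences are formed upstairs in `SmoothE3`, so the only
property of the quotient topology used is the continuity of restriction. -/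
theorem tendsto (h : LiftConv ρ u w) : Tendsto u atTop (𝓝 w) := by
  obtain ⟨U, W, h1, rfl, h2⟩ := h
  exact (((continuous_restrictSmooth ρ).tendsto W).comp h2).congr' h1

theorem congr' (h : LiftConv ρ u w) (e : ∀ᶠ q in atTop, u q = u' q) : LiftConv ρ u' w := by
  obtain ⟨U, W, h1, h3, h2⟩ := h
  refine ⟨U, W, ?_, h3, h2⟩
  filter_upwards [h1, e] with q a b using a.trans b

theorem add (h : LiftConv ρ u w) (h' : LiftConv ρ u' w') :
    LiftConv ρ (fun q => u q + u' q) (w + w') := by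
  have := continuousAdd_smoothE3
  obtain ⟨U, W, h1, rfl, h2⟩ := h
  obtain ⟨U', W', h1', rfl, h2'⟩ := h'
  refine ⟨fun q => U q + U' q, W + W', ?_, rfl, h2.add h2'⟩
  filter_upwards [h1, h1'] with q a b
  rw [← a, ← b]; rfl

theorem smul {c : ℕ → ℂ} {d : ℂ} (hc : Tendsto c atTop (𝓝 d)) (w : SmoothSphere ρ) :
    LiftConv ρ (fun q => c q • w) (d • w) := by
  have := continuousSMul_smoothE3
  obtain ⟨w, W, hW, rfl⟩ := w
  let V : SmoothE3 := ⟨W, hW⟩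
  have hV : Tendsto (fun q => c q • V) atTop (𝓝 (d • V)) := hc.smul tendsto_const_nhds
  exact ⟨fun q => c q • V, d • V, Filter.Eventually.of_forall fun _ => rfl, rfl, hV⟩

theorem const_smul (h : LiftConv ρ u w) (c : ℂ) : LiftConv ρ (fun q => c • u q) (c • w) := by
  have := continuousSMul_smoothE3
  obtain ⟨U, W, h1, rfl, h2⟩ := h
  refine ⟨fun q => c • U q, c • W, ?_, rfl, h2.const_smul c⟩
  filter_upwards [h1] with q a
  rw [← a]; rfl

theorem zero : LiftConv ρ (fun _ => 0) 0 :=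
  ⟨fun _ => 0, 0, Filter.Eventually.of_forall fun _ => rfl, rfl, tendsto_const_nhds⟩

end LiftConv

/-- Sequences of linear maps that converge on ladders converge on all sequences of matrices with a
symbol. -/
theorem liftConv_of_ladders {ρ : ℝ} (hρ : 0 < ρ) (Λ : ∀ q, NSp q →ₗ[ℂ] polySphere ρ) {d : ℂ}
    (h : ∀ j k, ∃ c : ℕ → ℂ, Tendsto c atTop (𝓝 d) ∧ ∀ᶠ q in atTop,
      Λ q ((adE (spinM (q + 1)) ^ k) ((fuzzyScale ρ q • spinP (q + 1)) ^ j))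
        = c q • projSphere ρ ((sphJm ^ k) (xPlus ^ j)))
    {s : SymbolRing} (hs : s ∈ Symbols.symbols ρ) :
    LiftConv ρ (fun q => (Λ q (s.1 q) : SmoothSphere ρ)) ((d • projSphere ρ s.2 : polySphere ρ)) := by
  let N : Submodule ℂ SymbolRing :=
    { carrier := {s | LiftConv ρ (fun q => (Λ q (s.1 q) : SmoothSphere ρ))
        ((d • projSphere ρ s.2 : polySphere ρ))}
      zero_mem' := by
        have h := LiftConv.zero (ρ := ρ)
        simpa using h
      add_mem' := by
        intro s t hs ht
        have h := LiftConv.add hs ht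
        simpa using h
      smul_mem' := by
        intro c s hs
        have h := LiftConv.const_smul hs c
        simp only [Set.mem_ofPred_eq, Prod.smul_fst, Pi.smul_apply, map_smul, Prod.smul_snd,
          smul_comm d c]
        exact h }
  have key : Symbols.symbols ρ ≤ N := by
    refine Symbols.symbols_le (fun c e hc j k => ?_) ?_
    · obtain ⟨c', hc', hev⟩ := h j k
      have h1 := LiftConv.smul (hc.mul hc') (projSphere ρ ((sphJm ^ k) (xPlus ^ j)) : SmoothSphere ρ)
      have h2 : LiftConv ρ (fun q => (Λ q (((Symbols.scale c e
          ((Symbols.lower ^ k) (Symbols.symX ρ ^ j)))).1 q) : SmoothSphere ρ))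
          (((e * d) • projSphere ρ ((sphJm ^ k) (xPlus ^ j)) : polySphere ρ)) := by
        refine h1.congr' ?_
        filter_upwards [hev] with q hq
        rw [Symbols.scale_apply, Symbols.lower_pow_apply]
        simp only [Symbols.symX_pow, map_smul, hq]
        rw [mul_smul]; rfl
      have e2 : (d • projSphere ρ (Symbols.scale c e ((Symbols.lower ^ k) (Symbols.symX ρ ^ j))).2)
          = (e * d) • projSphere ρ ((sphJm ^ k) (xPlus ^ j)) := by
        rw [Symbols.scale_apply, Symbols.lower_pow_apply]
        simp only [Symbols.symX_pow, map_smul, smul_smul, mul_comm]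
      change LiftConv ρ _ _
      rw [e2]
      exact h2
    · rintro s ⟨h1, G, e⟩
      change LiftConv ρ _ _
      -- For negligible pairs the sequence is eventually zero and the polynomial vanishes on the
      -- sphere.
      have e2 : projSphere ρ s.2 = 0 := by
        rw [e, projSphere_eq_zero_iff]
        intro y
        have h : evalAt y.1 (C ((ρ : ℂ) ^ 2)) = (ρ : ℂ) ^ 2 := AlgHom.commutes _ _
        rw [map_mul, map_sub, evalAt_radSq hρ, h, sub_self, zero_mul]
      rw [e2, smul_zero]
      refine LiftConv.zero.congr' ?_
      filter_upwards [h1] with q hq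
      rw [hq, map_zero]; rfl
  exact key hs

end
end FuzzySupersphere

namespace FuzzySupersphere
noncomputable section
open MvPolynomial (X C pderiv)
open Filter (Tendsto atTop)

/-! ### Asymptotics of the normalizations -/

theorem tendsto_ratio (a b : ℝ) : Tendsto (fun q : ℕ => ((q : ℝ) + a) / (q + b)) atTop (𝓝 1) := by
  have h := tendsto_add_mul_div_add_mul_atTop_nhds a b (1 : ℝ) one_ne_zero
  rw [div_one] at h
  exact h.congr fun q => by rw [one_mul, add_comm a, add_comm b]

/-- The square of the ratio between the normalizations, up to the scale of the coordinates. -/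
def weight (q j : ℕ) : ℝ := ((q : ℝ) + 1) ^ (2 * j) * (q - j).factorial / (q + j).factorial

theorem weight_pos (q j : ℕ) : 0 < weight q j := by rw [weight]; positivity

/-- The bound keeps the subtraction in the factorial from being truncated. The quotient of
successive weights tends to `1`, hence so does each weight. -/
theorem weight_succ {q j : ℕ} (h : j < q) :
    weight q (j + 1) = weight q j * (((q : ℝ) + 1) ^ 2 / (((q : ℝ) - j) * (q + j + 1))) := by
  obtain ⟨d, rfl⟩ : ∃ d, q = j + 1 + d := ⟨q - (j + 1), by omega⟩
  rw [weight, weight, show j + 1 + d - (j + 1) = d by omega, show j + 1 + d - j = d + 1 by omega,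
    show j + 1 + d + (j + 1) = j + 1 + d + j + 1 by ring, Nat.factorial_succ d,
    Nat.factorial_succ (j + 1 + d + j)]
  have h1 : ((j + 1 + d : ℕ) : ℝ) - j = d + 1 := by push_cast; ring
  have h2 : (d : ℝ) + 1 ≠ 0 := by positivity
  rw [h1]
  push_cast
  have h3 : ((j + 1 + d + j).factorial : ℝ) ≠ 0 := by positivity
  have h4 : (j : ℝ) + 1 + d + j + 1 ≠ 0 := by positivity
  field_simp
  ring

theorem tendsto_weight (j : ℕ) : Tendsto (fun q => weight q j) atTop (𝓝 1) := by
  induction j with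
  | zero =>
    refine tendsto_const_nhds.congr fun q => ?_
    rw [weight, mul_zero, pow_zero, one_mul, Nat.sub_zero, add_zero, div_self (by positivity)]
  | succ j ih =>
    have h := ih.mul ((tendsto_ratio 1 (-(j : ℝ))).mul (tendsto_ratio 1 ((j : ℝ) + 1)))
    rw [mul_one, mul_one] at h
    refine h.congr' ?_
    filter_upwards [Filter.eventually_gt_atTop j] with q hq
    rw [weight_succ hq, div_mul_div_comm, ← sub_eq_add_neg, ← add_assoc, sq]

theorem tendsto_sqrt_weight (j : ℕ) : Tendsto (fun q => √(weight q j)) atTop (𝓝 1) := by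
  have h := (tendsto_weight j).sqrt
  rwa [Real.sqrt_one] at h

theorem factorial_two_mul (j : ℕ) : ((2 * j).factorial : ℝ) = 2 ^ j * j.factorial * (2 * j - 1).doubleFactorial := by
  cases j with
  | zero => simp
  | succ j =>
    rw [show 2 * (j + 1) = 2 * j + 1 + 1 by ring, Nat.factorial_eq_mul_doubleFactorial,
      show 2 * j + 1 + 1 = 2 * (j + 1) by ring, Nat.doubleFactorial_two_mul,
      show 2 * (j + 1) - 1 = 2 * j + 1 by omega]
    push_cast; ring

theorem factorial_two_mul_add_one (j : ℕ) :
    ((2 * j + 1).factorial : ℝ) = 2 ^ j * j.factorial * (2 * j + 1).doubleFactorial := by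
  rw [Nat.factorial_eq_mul_doubleFactorial, Nat.doubleFactorial_two_mul]
  push_cast; ring

/-- Up to `√(weight q j)`, which tends to `1`, the two normalizations differ by the factor
`(2ρ/(q+1))^j`. Thus `fuzzyScale ρ q • J_+` plays the role of `x¹ + i x²`. -/
theorem ncTopCoeff_even {ρ : ℝ} (hρ : 0 < ρ) (q j : ℕ) : ncTopCoeff q (2 * j) * ((q : ℝ) + 1) ^ j
    = (2 * ρ) ^ j * superTopCoeff ρ (2 * j) * √(weight q j) := by
  have h1 : (2 * ρ) ^ j * superTopCoeff ρ (2 * j) = √((2 * j).factorial) / j.factorial := by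
    rw [superTopCoeff, if_pos (even_two_mul j), Nat.mul_div_cancel_left j two_pos, mul_pow]
    field_simp
  rw [h1, ncTopCoeff, if_pos (even_two_mul j), Nat.mul_div_cancel_left j two_pos,
    ← Real.sqrt_sq (show (0 : ℝ) ≤ ((q : ℝ) + 1) ^ j by positivity), ← Real.sqrt_mul (by positivity),
    div_mul_eq_mul_div (√_), ← Real.sqrt_mul (by positivity), eq_div_iff (by positivity),
    ← Real.sqrt_sq (show (0 : ℝ) ≤ (j.factorial : ℝ) by positivity), ← Real.sqrt_mul (by positivity),
    Real.sqrt_sq (by positivity), factorial_two_mul, weight]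
  congr 1
  field_simp
  ring

/-- Compared with the even case there is one more power of `q + 1`: the odd generator in `nTop`
comes with a decay of order `1/q`. -/
theorem ncTopCoeff_odd {ρ : ℝ} (hρ : 0 < ρ) (q j : ℕ) :
    ncTopCoeff q (2 * j + 1) * ((q : ℝ) + 1) ^ (j + 1)
    = ρ * (2 * ρ) ^ (j + 1) * superTopCoeff ρ (2 * j + 1) * √(weight q (j + 1)) := by
  have hj : (2 * j + 1) / 2 = j := by omega
  have ho : ¬ Even (2 * j + 1) := by simp
  have h1 : ρ * (2 * ρ) ^ (j + 1) * superTopCoeff ρ (2 * j + 1)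
      = 2 * √((2 * j + 1).factorial) / j.factorial := by
    rw [superTopCoeff, if_neg ho, hj, mul_pow]
    field_simp
    ring
  -- The factor `(q + 1/2)⁻¹` of the definition cancels the `(2q+1)/4` of `odd_top_operator`.
  have h2 : ∀ x : ℝ, ((q : ℝ) + 1 / 2)⁻¹ * x * ((2 * q + 1) / 4) = x / 2 := fun x => by
    field_simp; ring
  rw [h1, ncTopCoeff, if_neg ho, hj, h2, Nat.sub_sub,
    ← Real.sqrt_sq (show (0 : ℝ) ≤ ((q : ℝ) + 1) ^ (j + 1) by positivity), div_mul_eq_mul_div (√_),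
    ← Real.sqrt_mul (by positivity),
    div_mul_eq_mul_div (2 * √_), mul_assoc 2 (√_), ← Real.sqrt_mul (by positivity), div_eq_div_iff two_ne_zero (by positivity),
    ← Real.sqrt_sq (show (0 : ℝ) ≤ (j.factorial : ℝ) by positivity), ← Real.sqrt_mul (by positivity),
    Real.sqrt_sq (by positivity), factorial_two_mul_add_one, weight]
  have h4 : (2 : ℝ) * √(2 ^ j * j.factorial * (2 * j + 1).doubleFactorial *
      (((q : ℝ) + 1) ^ (2 * (j + 1)) * (q - (j + 1)).factorial / (q + (j + 1)).factorial)) * 2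
      = √(16 * (2 ^ j * j.factorial * (2 * j + 1).doubleFactorial *
      (((q : ℝ) + 1) ^ (2 * (j + 1)) * (q - (j + 1)).factorial / (q + (j + 1)).factorial))) := by
    rw [Real.sqrt_mul (by positivity) (_ * _), show (16 : ℝ) = 4 ^ 2 by norm_num,
      Real.sqrt_sq (by positivity)]
    ring
  rw [h4, ← add_assoc q j 1]
  congr 1
  field_simp
  ring

theorem ncSphCoeff_eq {ρ : ℝ} (hρ : 0 < ρ) (q j : ℕ) : ncSphCoeff q j * ((q : ℝ) + 1) ^ j
    = (2 * ρ) ^ j * sphTopCoeff ρ j * √(weight q j * (((q : ℝ) + 1) / (q + (j + 1)))) := by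
  have h1 : (2 * ρ) ^ j * sphTopCoeff ρ j = √((2 * j + 1).factorial) / j.factorial := by
    rw [sphTopCoeff, mul_pow]
    field_simp
  have h3 := weight_pos q j
  rw [h1, ncSphCoeff, ← Real.sqrt_sq (show (0 : ℝ) ≤ ((q : ℝ) + 1) ^ j by positivity),
    ← Real.sqrt_mul (by positivity),
    div_mul_eq_mul_div (√_), ← Real.sqrt_mul (by positivity), eq_div_iff (by positivity),
    ← Real.sqrt_sq (show (0 : ℝ) ≤ (j.factorial : ℝ) by positivity), ← Real.sqrt_mul (by positivity),
    Real.sqrt_sq (by positivity), factorial_two_mul_add_one, weight, Nat.factorial_succ (q + j)]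
  congr 1
  push_cast
  field_simp
  ring

/-- The ratio of the two irreducible components, asymptotically. -/
def blockRatio (q j : ℕ) : ℝ := √(((q : ℝ) - j) / (q + j + 1))

theorem tendsto_blockRatio (j : ℕ) : Tendsto (fun q => blockRatio q j) atTop (𝓝 1) := by
  have h := (tendsto_ratio (-(j : ℝ)) ((j : ℝ) + 1)).sqrt
  rw [Real.sqrt_one] at h
  exact h.congr fun q => by rw [blockRatio, ← sub_eq_add_neg, ← add_assoc]

theorem blockRatio_sq {q j : ℕ} (h : j < q) :
    blockRatio q j ^ 2 * ((q : ℝ) + j + 1) = (q : ℝ) - j := by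
  have h1 : (0 : ℝ) ≤ (q : ℝ) - j := sub_nonneg.2 (by exact_mod_cast h.le)
  rw [blockRatio, Real.sq_sqrt (by positivity), div_mul_cancel₀ _ (by positivity)]

/-- It brings the normalizations of superspin `j` and `j + 1/2`, which meet in `body_blocks`, to a
common factor. -/
theorem sqrt_weight_succ {q j : ℕ} (h : j < q) :
    ((q : ℝ) + 1) / √(weight q (j + 1)) = ((q : ℝ) + j + 1) * blockRatio q j / √(weight q j) := by
  have h1 : (0 : ℝ) < (q : ℝ) - j := sub_pos.2 (by exact_mod_cast h)
  have h2 := weight_pos q j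
  have h3 : 0 < blockRatio q j := Real.sqrt_pos.2 (by positivity)
  have h4 : √(weight q (j + 1)) = √(weight q j) * (((q : ℝ) + 1) / (((q : ℝ) + j + 1) * blockRatio q j)) := by
    rw [weight_succ h, Real.sqrt_mul h2.le]
    congr 1
    rw [Real.sqrt_eq_iff_mul_self_eq (by positivity) (by positivity), div_mul_div_comm]
    rw [show ((q : ℝ) + j + 1) * blockRatio q j * (((q : ℝ) + j + 1) * blockRatio q j)
      = (blockRatio q j ^ 2 * ((q : ℝ) + j + 1)) * ((q : ℝ) + j + 1) by ring, blockRatio_sq h]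
    ring
  have h5 : 0 < √(weight q j) := Real.sqrt_pos.2 h2
  rw [h4]
  field_simp

theorem fuzzyScale_pow (ρ : ℝ) (q j : ℕ) :
    fuzzyScale ρ q ^ j = (((2 * ρ) ^ j / ((q : ℝ) + 1) ^ j : ℝ) : ℂ) := by
  rw [fuzzyScale, div_pow]; push_cast; ring

theorem fuzzyScale_ne_zero {ρ : ℝ} (hρ : 0 < ρ) (q : ℕ) : fuzzyScale ρ q ≠ 0 := by
  have h1 : (ρ : ℂ) ≠ 0 := by exact_mod_cast hρ.ne'
  have h2 : (q : ℂ) + 1 ≠ 0 := by exact_mod_cast q.succ_ne_zero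
  exact div_ne_zero (mul_ne_zero two_ne_zero h1) h2

/-! ### The limit homomorphisms on ladders -/

theorem adE_pow_fromBlocks (q k : ℕ) (A : Matrix (Fin (q + 1)) (Fin (q + 1)) ℂ)
    (D : Matrix (Fin q) (Fin q) ℂ) :
    (adE (ospM q) ^ k) (Matrix.fromBlocks A 0 0 D)
      = Matrix.fromBlocks ((adE (spinM (q + 1)) ^ k) A) 0 0 ((adE (spinM q) ^ k) D) := by
  induction k with
  | zero => rfl
  | succ k ih =>
    rw [pow_succ', Module.End.mul_apply, ih, adE_apply, ospM, Matrix.fromBlocks_multiply,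
      Matrix.fromBlocks_multiply, fromBlocks_sub']
    simp [pow_succ', adE_apply]

section Families

variable {ρ : ℝ} {L : ℕ} {ψ : ∀ q, superTrunc ρ L q ≃ₗ[ℂ] NSs q} {φ : ∀ q, sphTrunc ρ q ≃ₗ[ℂ] NSp q}

theorem limitHom_sph_ladder (hφ : ∀ q, SphMatches (φ q)) {q j : ℕ} (hj : j ≤ q) (k : ℕ) :
    (ncSphCoeff q j : ℂ) • limitHom φ q ((adE (spinM (q + 1)) ^ k) (spinP (q + 1) ^ j))
      = (sphTopCoeff ρ j : ℂ) • projSphere ρ ((sphJm ^ k) (xPlus ^ j)) := by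
  have h := (hφ q).pow_symm_apply isSl2_sph (isSl2_spin q).ad (isTop_sphGens ρ q) (isTop_ncSphGens q)
    ⟨j, by omega⟩ k
  rw [sphGens, ncSphGens, sphTop_eq, ncSphTop_eq, map_smul, map_smul, map_smul, map_smul] at h
  exact h

theorem limitHom_super_sTop (hψ : ∀ q, SuperMatches (ψ q)) {q n : ℕ} (hn : n ≤ 2 * q) (k : ℕ) :
    (ncTopCoeff q n : ℂ) • limitHom ψ q ((adE (ospM q) ^ k) (nTop q n))
      = (superTopCoeff ρ n : ℂ) • projSuper ρ L ((superJm ^ k) (sTop n)) := by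
  have h := (hψ q).pow_symm_apply isOsp_super.isSl2 (isSl2_nc q).ad (isTop_superGens ρ q)
    (isTop_ncGens q) (Sum.inl ⟨n, by omega⟩) k
  simp only [superGens, ncGens, Sum.elim_inl, superTop_eq, ncSuperTop_eq, map_smul] at h
  exact h

theorem limitHom_super_superQ (hψ : ∀ q, SuperMatches (ψ q)) {q n : ℕ} (hn : n < 2 * q) (k : ℕ) :
    (ncTopCoeff q (n + 1) : ℂ) • limitHom ψ q ((adE (ospM q) ^ k) (oddComm q (ospQ5 q) (nTop q (n + 1))))
      = (superTopCoeff ρ (n + 1) : ℂ) • projSuper ρ L ((superJm ^ k) (superQ 1 (sTop (n + 1)))) := by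
  have h := (hψ q).pow_symm_apply isOsp_super.isSl2 (isSl2_nc q).ad (isTop_superGens ρ q)
    (isTop_ncGens q) (Sum.inr ⟨n, hn⟩) k
  simp only [superGens, ncGens, Sum.elim_inr, superTop_eq, ncSuperTop_eq, oddComm_smul, map_smul] at h
  exact h

theorem tendsto_limitHom_sph (hρ : 0 < ρ) (hφ : ∀ q, SphMatches (φ q)) (j k : ℕ) :
    ∃ c : ℕ → ℂ, Tendsto c atTop (𝓝 1) ∧ ∀ᶠ q in atTop,
      limitHom φ q ((adE (spinM (q + 1)) ^ k) ((fuzzyScale ρ q • spinP (q + 1)) ^ j))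
        = c q • projSphere ρ ((sphJm ^ k) (xPlus ^ j)) := by
  refine ⟨fun q => (((√(weight q j * (((q : ℝ) + 1) / (q + (j + 1)))))⁻¹ : ℝ) : ℂ), ?_, ?_⟩
  · have h := (((tendsto_weight j).mul (tendsto_ratio 1 ((j : ℝ) + 1))).sqrt).inv₀ (by simp)
    rw [mul_one, Real.sqrt_one, inv_one] at h
    exact_mod_cast (Complex.continuous_ofReal.tendsto 1).comp h
  · filter_upwards [Filter.eventually_ge_atTop j] with q hq
    have h1 := limitHom_sph_ladder hφ hq k
    have h2 := ncSphCoeff_eq hρ q j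
    have h3 : (ncSphCoeff q j : ℂ) ≠ 0 := by exact_mod_cast (ncSphCoeff_pos q j).ne'
    have h4 : 0 < √(weight q j * (((q : ℝ) + 1) / (q + (j + 1)))) :=
      Real.sqrt_pos.2 (mul_pos (weight_pos q j) (by positivity))
    apply smul_right_injective _ h3
    simp only
    rw [smul_pow, map_smul, map_smul, smul_comm, h1, smul_smul, smul_smul, fuzzyScale_pow,
      ← Complex.ofReal_mul, ← Complex.ofReal_mul]
    congr 2
    generalize √(weight q j * (((q : ℝ) + 1) / (q + (j + 1)))) = r at h2 h4
    field_simp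
    linarith

/-- For each rung of spin `j` the bodies `a`, `b` of the two single block matrices solve a two by
two linear system. One equation comes from the superspin `j` ladder, the other from the second
ladder of superspin `j + 1/2`. As the block ratio tends to `1`, each block receives one half in the
limit. -/
theorem body_blocks (hρ : 0 < ρ) (hψ : ∀ q, SuperMatches (ψ q)) {q j : ℕ} (hj : j < q) (k : ℕ) :
    fuzzyScale ρ q ^ j • bodyMap ρ L (limitHom ψ q (Matrix.fromBlocks
          ((adE (spinM (q + 1)) ^ k) (spinP (q + 1) ^ j)) 0 0 0))
        = (((√(weight q j))⁻¹ / (1 + blockRatio q j) : ℝ) : ℂ) • projSphere ρ ((sphJm ^ k) (xPlus ^ j)) ∧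
      fuzzyScale ρ q ^ j • bodyMap ρ L (limitHom ψ q (Matrix.fromBlocks 0 0 0
          ((adE (spinM q) ^ k) (spinP q ^ j))))
        = (((√(weight q j))⁻¹ * blockRatio q j / (1 + blockRatio q j) : ℝ) : ℂ) •
          projSphere ρ ((sphJm ^ k) (xPlus ^ j)) := by
  set g := projSphere ρ ((sphJm ^ k) (xPlus ^ j)) with hg
  set a := bodyMap ρ L (limitHom ψ q (Matrix.fromBlocks
    ((adE (spinM (q + 1)) ^ k) (spinP (q + 1) ^ j)) 0 0 0)) with ha
  set b := bodyMap ρ L (limitHom ψ q (Matrix.fromBlocks 0 0 0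
    ((adE (spinM q) ^ k) (spinP q ^ j)))) with hb
  have hw := weight_pos q j
  have hw' := weight_pos q (j + 1)
  have hsw : 0 < √(weight q j) := Real.sqrt_pos.2 hw
  have hsw' : 0 < √(weight q (j + 1)) := Real.sqrt_pos.2 hw'
  have hn0 : ∀ n, (ncTopCoeff q n : ℂ) ≠ 0 := fun n => by exact_mod_cast (ncTopCoeff_pos q n).ne'
  -- The first equation: on the superspin `j` ladder the matrix is `J_+^j` on both blocks.
  have e1 : fuzzyScale ρ q ^ j • (a + b) = (((√(weight q j))⁻¹ : ℝ) : ℂ) • g := by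
    have h1 := congrArg (bodyMap ρ L) (limitHom_super_sTop hψ (q := q) (n := 2 * j) (by omega) k)
    rw [nTop_even, sTop_even, ospP_pow, adE_pow_fromBlocks, map_smul, map_smul, bodyMap_projSuper,
      superJm_pow_empty, (evenTop_apply j).1, ← hg] at h1
    have h2 : Matrix.fromBlocks ((adE (spinM (q + 1)) ^ k) (spinP (q + 1) ^ j)) 0 0
        ((adE (spinM q) ^ k) (spinP q ^ j))
        = Matrix.fromBlocks ((adE (spinM (q + 1)) ^ k) (spinP (q + 1) ^ j)) 0 0 0
          + Matrix.fromBlocks 0 0 0 ((adE (spinM q) ^ k) (spinP q ^ j)) := by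
      rw [Matrix.fromBlocks_add]; simp
    rw [h2, map_add, map_add, ← ha, ← hb] at h1
    apply smul_right_injective _ (hn0 (2 * j))
    simp only
    rw [smul_comm, h1, smul_smul, smul_smul, fuzzyScale_pow, ← Complex.ofReal_mul, ← Complex.ofReal_mul]
    congr 2
    have h3 := ncTopCoeff_even hρ q j
    field_simp
    linarith
  -- The second equation: `J_5` applied to the odd top vector gives `J_+^j` with the block factors
  -- of `oddComm_nTop_odd`, and on the classical side a body with factor `-ρ²/2`.
  have e2 : fuzzyScale ρ q ^ j • (((j : ℂ) - q) • a - ((q : ℂ) + 1 + j) • b)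
      = ((-(((q : ℝ) + 1) / √(weight q (j + 1))) : ℝ) : ℂ) • g := by
    have h1 := congrArg (bodyMap ρ L) (limitHom_super_superQ hψ (q := q) (n := 2 * j) (by omega) k)
    rw [oddComm_nTop_odd, adE_pow_fromBlocks, map_smul, map_smul, map_smul, map_smul,
      bodyMap_projSuper, projSphere_superQ_sTop_empty hρ, ← hg] at h1
    have h2 : Matrix.fromBlocks ((((j : ℂ) - q) / 4) • (adE (spinM (q + 1)) ^ k) (spinP (q + 1) ^ j)) 0 0
        ((-((q : ℂ) + 1 + j) / 4) • (adE (spinM q) ^ k) (spinP q ^ j))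
        = (((j : ℂ) - q) / 4) • Matrix.fromBlocks ((adE (spinM (q + 1)) ^ k) (spinP (q + 1) ^ j)) 0 0 0
          + (-((q : ℂ) + 1 + j) / 4) • Matrix.fromBlocks 0 0 0 ((adE (spinM q) ^ k) (spinP q ^ j)) := by
      rw [Matrix.fromBlocks_smul, Matrix.fromBlocks_smul, Matrix.fromBlocks_add]; simp
    rw [h2, map_add, map_add, map_smul, map_smul, map_smul, map_smul, ← ha, ← hb] at h1
    have h5 : ((j : ℂ) - q) • a - ((q : ℂ) + 1 + j) • b
        = (4 : ℂ) • ((((j : ℂ) - q) / 4) • a + (-((q : ℂ) + 1 + j) / 4) • b) := by module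
    apply smul_right_injective _ (hn0 (2 * j + 1))
    simp only
    rw [h5, smul_comm, smul_comm _ (4 : ℂ), h1, smul_smul, smul_smul, smul_smul, smul_smul, fuzzyScale_pow]
    have h6 : (-(ρ : ℂ) ^ 2 / 2) = ((-ρ ^ 2 / 2 : ℝ) : ℂ) := by push_cast; ring
    have h7 : (4 : ℂ) = ((4 : ℝ) : ℂ) := by norm_num
    rw [h6, h7, ← Complex.ofReal_mul, ← Complex.ofReal_mul, ← Complex.ofReal_mul, ← Complex.ofReal_mul]
    congr 2
    have h3 := ncTopCoeff_odd hρ q j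
    have h8 : (ρ : ℝ) ≠ 0 := hρ.ne'
    field_simp
    rw [pow_succ, pow_succ] at h3
    linear_combination (2 : ℝ) * h3
  have hT : 0 ≤ blockRatio q j := Real.sqrt_nonneg _
  have hT2 := blockRatio_sq hj
  rw [sqrt_weight_succ hj] at e2
  set t := blockRatio q j
  set u := (√(weight q j))⁻¹ with hu
  have h2j : (2 * (j : ℂ) + 1) ≠ 0 := by exact_mod_cast (by omega : 2 * j + 1 ≠ 0)
  have h1t : (1 + (t : ℂ)) ≠ 0 := by
    have : (1 + t) ≠ 0 := by positivity
    exact_mod_cast this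
  have hT2' : (t : ℂ) ^ 2 * ((q : ℂ) + j + 1) = (q : ℂ) - j := by exact_mod_cast hT2
  have e2' : fuzzyScale ρ q ^ j • (((j : ℂ) - q) • a - ((q : ℂ) + 1 + j) • b)
      = (-(((q : ℂ) + j + 1) * t * u)) • g := by
    rw [e2]
    congr 1
    rw [hu]; push_cast; ring
  constructor
  · apply smul_right_injective _ (mul_ne_zero h2j h1t)
    simp only
    -- Adding `q + j + 1` times the first equation to the second eliminates `b`. By `blockRatio_sq`,
    -- `(q+j+1)(1-t)(1+t) = 2j + 1`.
    have h3 : (2 * (j : ℂ) + 1) • (fuzzyScale ρ q ^ j • a) = (((q : ℂ) + j + 1) * (1 - t) * u) • g := by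
      have h5 : (2 * (j : ℂ) + 1) • (fuzzyScale ρ q ^ j • a)
          = ((q : ℂ) + j + 1) • (fuzzyScale ρ q ^ j • (a + b))
            + fuzzyScale ρ q ^ j • (((j : ℂ) - q) • a - ((q : ℂ) + 1 + j) • b) := by module
      rw [h5, e1, e2']
      module
    have h4 : ((2 * (j : ℂ) + 1) * (1 + t)) * ((u / (1 + t) : ℝ) : ℂ)
        = (1 + t) * (((q : ℂ) + j + 1) * (1 - t) * u) := by
      rw [Complex.ofReal_div, Complex.ofReal_add, Complex.ofReal_one, mul_assoc,
        mul_div_cancel₀ _ h1t]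
      linear_combination (u : ℂ) * hT2'
    rw [mul_comm (2 * (j : ℂ) + 1), mul_smul, h3, smul_smul, smul_smul, mul_comm (1 + (t : ℂ)) (2 * j + 1), h4]
  · apply smul_right_injective _ (mul_ne_zero h2j h1t)
    simp only
    have h3 : (2 * (j : ℂ) + 1) • (fuzzyScale ρ q ^ j • b)
        = ((((q : ℂ) + j + 1) * t - ((q : ℂ) - j)) * u) • g := by
      have h5 : (2 * (j : ℂ) + 1) • (fuzzyScale ρ q ^ j • b)
          = (-((q : ℂ) - j)) • (fuzzyScale ρ q ^ j • (a + b))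
            - fuzzyScale ρ q ^ j • (((j : ℂ) - q) • a - ((q : ℂ) + 1 + j) • b) := by module
      rw [h5, e1, e2']
      module
    have h4 : ((2 * (j : ℂ) + 1) * (1 + t)) * ((u * t / (1 + t) : ℝ) : ℂ)
        = (1 + t) * ((((q : ℂ) + j + 1) * t - ((q : ℂ) - j)) * u) := by
      rw [Complex.ofReal_div, Complex.ofReal_add, Complex.ofReal_one, mul_assoc,
        mul_div_cancel₀ _ h1t, Complex.ofReal_mul]
      linear_combination -(u : ℂ) * hT2'
    rw [mul_comm (2 * (j : ℂ) + 1), mul_smul, h3, smul_smul, smul_smul, mul_comm (1 + (t : ℂ)) (2 * j + 1), h4]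

end Families

end
end FuzzySupersphere

namespace FuzzySupersphere
noncomputable section
open MvPolynomial (X C pderiv)
open Filter (Tendsto atTop)

/-! ### Sequences of endomorphisms of the superspin modules -/

/-- Sequences of elements of the truncated superspheres of positive level. -/
abbrev SuperSeq : Type := ∀ n : ℕ, NSs (n + 1)

namespace SuperSeq

/-- The lowering derivation. -/
def lower : Module.End ℂ SuperSeq :=
  LinearMap.pi fun n => adE (ospM (n + 1)) ∘ₗ LinearMap.proj n

theorem lower_apply (r : SuperSeq) (n : ℕ) : lower r n = adE (ospM (n + 1)) (r n) := rfl

theorem lower_pow_apply (k : ℕ) (r : SuperSeq) (n : ℕ) :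
    (lower ^ k) r n = (adE (ospM (n + 1)) ^ k) (r n) := by
  induction k with
  | zero => rfl
  | succ k ih => rw [pow_succ', Module.End.mul_apply, lower_apply, ih, pow_succ', Module.End.mul_apply]

theorem lower_mul (r s : SuperSeq) : lower (r * s) = lower r * s + r * lower s :=
  funext fun _ => adE_mul _ _ _

/-- Even sequences, together with the symbols of their two blocks. -/
def evenSymbols (ρ : ℝ) : Submodule ℂ (SuperSeq × Poly × Poly) where
  carrier := {r | ∃ a b : ∀ q, NSp q, (a, r.2.1) ∈ Symbols.symbols ρ ∧ (b, r.2.2) ∈ Symbols.symbols ρ ∧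
    ∀ n, r.1 n = Matrix.fromBlocks (a (n + 1)) 0 0 (b n)}
  zero_mem' := ⟨0, 0, Submodule.zero_mem _, Submodule.zero_mem _, fun _ => Matrix.fromBlocks_zero.symm⟩
  add_mem' := by
    rintro r s ⟨a, b, ha, hb, e⟩ ⟨a', b', ha', hb', e'⟩
    refine ⟨a + a', b + b', Submodule.add_mem _ ha ha', Submodule.add_mem _ hb hb', fun n => ?_⟩
    rw [Prod.fst_add, Pi.add_apply, e, e', Matrix.fromBlocks_add, add_zero, add_zero]; rfl
  smul_mem' := by
    rintro c r ⟨a, b, ha, hb, e⟩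
    refine ⟨c • a, c • b, Submodule.smul_mem _ _ ha, Submodule.smul_mem _ _ hb, fun n => ?_⟩
    rw [Prod.smul_fst, Pi.smul_apply, e, Matrix.fromBlocks_smul, smul_zero, smul_zero]; rfl

variable {ρ : ℝ}

theorem mul_mem_evenSymbols {r s : SuperSeq × Poly × Poly} (hr : r ∈ evenSymbols ρ)
    (hs : s ∈ evenSymbols ρ) : r * s ∈ evenSymbols ρ := by
  obtain ⟨a, b, ha, hb, e⟩ := hr
  obtain ⟨a', b', ha', hb', e'⟩ := hs
  refine ⟨a * a', b * b', Symbols.mul_mem ha ha', Symbols.mul_mem hb hb', fun n => ?_⟩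
  rw [Prod.fst_mul, Pi.mul_apply, e, e', Matrix.fromBlocks_multiply]
  simp

theorem lower_mem_evenSymbols {r : SuperSeq} {F G : Poly} (hr : (r, F, G) ∈ evenSymbols ρ) :
    (lower r, sphJm F, sphJm G) ∈ evenSymbols ρ := by
  obtain ⟨a, b, ha, hb, e⟩ := hr
  have ha' := Symbols.lower_mem ha
  have hb' := Symbols.lower_mem hb
  rw [Symbols.lower_apply] at ha' hb'
  refine ⟨fun q => adE (spinM (q + 1)) (a q), fun q => adE (spinM (q + 1)) (b q), ha', hb',
    fun n => ?_⟩
  have h := adE_pow_fromBlocks (n + 1) 1 (a (n + 1)) (b n)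
  rw [pow_one, pow_one, pow_one] at h
  change adE (ospM (n + 1)) (r n) = _
  rw [show r n = _ from e n, h]

theorem lower_pow_mem_evenSymbols {r : SuperSeq} {F G : Poly} (hr : (r, F, G) ∈ evenSymbols ρ) (k : ℕ) :
    ((lower ^ k) r, (sphJm ^ k) F, (sphJm ^ k) G) ∈ evenSymbols ρ := by
  induction k with
  | zero => exact hr
  | succ k ih =>
    simp only [pow_succ', Module.End.mul_apply]
    exact lower_mem_evenSymbols ih

theorem relation_mem_evenSymbols (G G' : Poly) :
    ((0 : SuperSeq), (radSq - C ((ρ : ℂ) ^ 2)) * G, (radSq - C ((ρ : ℂ) ^ 2)) * G') ∈ evenSymbols ρ :=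
  ⟨0, 0, Symbols.negligible_le ⟨Filter.Eventually.of_forall fun _ => rfl, G, rfl⟩,
    Symbols.negligible_le ⟨Filter.Eventually.of_forall fun _ => rfl, G', rfl⟩,
    fun _ => Matrix.fromBlocks_zero.symm⟩

theorem tendsto_fuzzyScale_ratio (hρ : 0 < ρ) :
    Tendsto (fun n => fuzzyScale ρ (n + 1) / fuzzyScale ρ n) atTop (𝓝 1) := by
  have h := (Complex.continuous_ofReal.tendsto 1).comp (tendsto_ratio 1 2)
  rw [Complex.ofReal_one] at h
  refine h.congr fun n => ?_
  have h1 : (ρ : ℂ) ≠ 0 := by exact_mod_cast hρ.ne'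
  have h2 : (n : ℂ) + 1 ≠ 0 := by exact_mod_cast n.succ_ne_zero
  have h3 : (n : ℂ) + 2 ≠ 0 := by exact_mod_cast (n + 1).succ_ne_zero
  have h4 : (n : ℂ) + 1 + 1 ≠ 0 := by rwa [add_assoc, one_add_one_eq_two]
  rw [fuzzyScale, fuzzyScale, Function.comp_apply]
  push_cast
  field_simp
  ring

/-- Powers of the raising operator, with convergent coefficients on the two blocks. -/
theorem top_mem_evenSymbols (hρ : 0 < ρ) {c c' : ℕ → ℂ} {d d' : ℂ} (hc : Tendsto c atTop (𝓝 d))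
    (hc' : Tendsto c' atTop (𝓝 d')) (j : ℕ) :
    ((fun n => fuzzyScale ρ (n + 1) ^ j • Matrix.fromBlocks (c n • spinP (n + 1 + 1) ^ j) 0 0
      (c' n • spinP (n + 1) ^ j) : SuperSeq), d • xPlus ^ j, d' • xPlus ^ j) ∈ evenSymbols ρ := by
  have h1 : Tendsto (fun q => c (q - 1)) atTop (𝓝 d) := hc.comp (Filter.tendsto_sub_atTop_nat 1)
  -- At level `n + 1` the smaller block is the spin `n/2` module, whose own scale is `fuzzyScale ρ
  -- n`. The powers of the ratio of scales converge to `1` and are absorbed into the coefficient.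
  have h2 := hc'.mul ((tendsto_fuzzyScale_ratio hρ).pow j)
  rw [one_pow, mul_one] at h2
  have ha := Symbols.scale_mem h1 (Symbols.symX_pow_mem (ρ := ρ) j)
  have hb := Symbols.scale_mem h2 (Symbols.symX_pow_mem (ρ := ρ) j)
  rw [Symbols.scale_apply] at ha hb
  refine ⟨fun q => c (q - 1) • (fuzzyScale ρ q • spinP (q + 1)) ^ j,
    fun q => (c' q * (fuzzyScale ρ (q + 1) / fuzzyScale ρ q) ^ j) •
      (fuzzyScale ρ q • spinP (q + 1)) ^ j, ha, hb, fun n => ?_⟩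
  have h3 := fuzzyScale_ne_zero hρ n
  simp only
  rw [Matrix.fromBlocks_smul, smul_zero, smul_zero, Nat.add_sub_cancel, smul_pow, smul_pow, smul_smul, smul_smul, smul_smul, smul_smul, mul_comm (c n), mul_assoc (c' n), ← mul_pow,
    mul_comm (c' n), div_mul_cancel₀ _ h3]

/-! ### Odd generators and their products. -/

/-- The inverse of the dimension, as a scale for odd elements. -/
def oddScale (n : ℕ) : ℂ := ((n : ℂ) + 2)⁻¹

theorem oddScale_mul (n : ℕ) : oddScale n * (((n + 1 : ℕ) : ℂ) + 1) = 1 := by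
  have h3 : (n : ℂ) + 2 ≠ 0 := by exact_mod_cast (n + 1).succ_ne_zero
  rw [oddScale, Nat.cast_succ, add_assoc, one_add_one_eq_two, inv_mul_cancel₀ h3]

theorem fuzzyScale_succ (ρ : ℝ) (n : ℕ) : fuzzyScale ρ (n + 1) = 2 * ρ * oddScale n := by
  rw [fuzzyScale, oddScale, Nat.cast_succ, add_assoc, one_add_one_eq_two]; rfl

theorem tendsto_oddScale : Tendsto oddScale atTop (𝓝 0) := by
  have h := (Filter.tendsto_add_atTop_iff_nat 1).2
    (tendsto_one_div_add_atTop_nhds_zero_nat (𝕜 := ℂ))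
  refine h.congr fun n => ?_
  rw [oddScale, Nat.cast_succ, add_assoc, one_add_one_eq_two, one_div]

/-- The scaled odd generators. -/
def odd4 : SuperSeq := fun n => oddScale n • ospQ4 (n + 1)

/-- The scaled odd generators. -/
def odd5 : SuperSeq := fun n => oddScale n • ospQ5 (n + 1)

theorem lower_odd4 : lower odd4 = odd5 :=
  funext fun n => by
    rw [lower_apply, odd4, odd5, map_smul, adE_apply, (isOsp_nc (n + 1)).mq]

theorem lower_odd5 : lower odd5 = 0 :=
  funext fun n => by
    rw [lower_apply, odd5, map_smul, adE_apply, (isOsp_nc (n + 1)).comm_mr.eq, sub_self, smul_zero]; rfl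

theorem oddScale_sq_smul_mul (n : ℕ) (a b : NSs (n + 1)) :
    (oddScale n • a) * (oddScale n • b) = oddScale n ^ 2 • (a * b) := by
  rw [smul_mul_smul_comm, sq]

/-- One factor `oddScale` turns `J_+` into a constant multiple of the scaled generator, which has a
symbol; the other tends to zero, so the symbol is zero. -/
theorem raise_mem (hρ : 0 < ρ) :
    ((fun n => oddScale n ^ 2 • ospP (n + 1) : SuperSeq), 0, 0) ∈ evenSymbols ρ := by
  have h0 : (ρ : ℂ) ≠ 0 := by exact_mod_cast hρ.ne'
  have h1 : Tendsto (fun n => oddScale n / (2 * ρ)) atTop (𝓝 0) := by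
    have h := tendsto_oddScale.div_const (2 * (ρ : ℂ))
    rwa [zero_div] at h
  have h := top_mem_evenSymbols hρ h1 h1 1
  rw [zero_smul] at h
  convert h using 2
  funext n
  have e : fuzzyScale ρ (n + 1) * (oddScale n / (2 * ρ)) = oddScale n ^ 2 := by
    rw [fuzzyScale_succ]; field_simp
  rw [pow_one, pow_one, pow_one, ospP, Matrix.fromBlocks_smul, Matrix.fromBlocks_smul, smul_zero,
    smul_zero, smul_zero, smul_zero, smul_smul, smul_smul, e]

theorem diag_mem (hρ : 0 < ρ) :
    ((fun n => oddScale n ^ 2 • ospZ (n + 1) : SuperSeq), 0, 0) ∈ evenSymbols ρ := by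
  have h := Submodule.smul_mem _ (-1 / 2 : ℂ) (lower_mem_evenSymbols (raise_mem hρ))
  simp only [Prod.smul_mk, map_zero, smul_zero] at h
  convert h using 2
  funext n
  rw [Pi.smul_apply, lower_apply, map_smul, adE_apply, ← neg_sub, (isSl2_nc (n + 1)).pm]
  module

theorem low_mem (hρ : 0 < ρ) :
    ((fun n => oddScale n ^ 2 • ospM (n + 1) : SuperSeq), 0, 0) ∈ evenSymbols ρ := by
  have h := lower_mem_evenSymbols (diag_mem hρ)
  simp only [map_zero] at h
  convert h using 2
  funext n
  rw [lower_apply, map_smul, adE_apply, ← neg_sub, (isSl2_nc (n + 1)).zm, neg_neg]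

/-- The entries of `ospK` grow linearly in the level, against a square of the decaying scale. This
is the case `j = 0` of `top_mem_evenSymbols`. -/
theorem commutator_mem (hρ : 0 < ρ) :
    ((fun n => oddScale n ^ 2 • ospK (n + 1) : SuperSeq), 0, 0) ∈ evenSymbols ρ := by
  have h2 : ∀ n, oddScale n * ((n : ℂ) + 2) = 1 := fun n => by
    rw [← oddScale_mul n, Nat.cast_succ, add_assoc, one_add_one_eq_two]
  have h1 : Tendsto (fun n => oddScale n ^ 2 * (-((n + 1 : ℕ) : ℂ) / 4)) atTop (𝓝 0) := by
    have h := (tendsto_oddScale.mul (tendsto_oddScale.sub_const 1)).div_const 4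
    rw [zero_mul, zero_div] at h
    refine h.congr fun n => ?_
    push_cast
    linear_combination (oddScale n / 4) * h2 n
  have h1' : Tendsto (fun n => oddScale n ^ 2 * ((((n + 1 : ℕ) : ℂ) + 1) / 4)) atTop (𝓝 0) := by
    have h := tendsto_oddScale.div_const 4
    rw [zero_div] at h
    refine h.congr fun n => ?_
    push_cast
    linear_combination (-oddScale n / 4) * h2 n
  have h := top_mem_evenSymbols hρ h1 h1' 0
  rw [zero_smul] at h
  convert h using 2
  funext n
  rw [pow_zero, pow_zero, pow_zero, one_smul, ospK, Matrix.fromBlocks_smul, smul_zero, smul_zero,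
    smul_smul, smul_smul]

/-- Products of two odd generators are linear in the even generators and `ospK`, hence of first
order in the level, while the scale is quadratic. -/
theorem odd_mul_odd_generators_mem (hρ : 0 < ρ) :
    (odd4 * odd4, 0, 0) ∈ evenSymbols ρ ∧ (odd4 * odd5, 0, 0) ∈ evenSymbols ρ ∧
      (odd5 * odd4, 0, 0) ∈ evenSymbols ρ ∧ (odd5 * odd5, 0, 0) ∈ evenSymbols ρ := by
  have h44 := Submodule.smul_mem _ (1 / 4 : ℂ) (raise_mem hρ)
  have h45 := Submodule.smul_mem _ (1 / 2 : ℂ) (Submodule.sub_mem _ (commutator_mem hρ)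
      (Submodule.smul_mem _ (1 / 2 : ℂ) (diag_mem hρ)))
  have h54 := Submodule.smul_mem _ (-1 / 2 : ℂ) (Submodule.add_mem _ (commutator_mem hρ)
      (Submodule.smul_mem _ (1 / 2 : ℂ) (diag_mem hρ)))
  have h55 := Submodule.smul_mem _ (-1 / 4 : ℂ) (low_mem hρ)
  simp only [Prod.smul_mk, Prod.mk_sub_mk, Prod.mk_add_mk, smul_zero, sub_zero, add_zero]
    at h44 h45 h54 h55
  refine ⟨?_, ?_, ?_, ?_⟩
  · convert h44 using 2
    funext n
    simp only [Pi.mul_apply, Pi.smul_apply, odd4]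
    rw [oddScale_sq_smul_mul, (isOsp_nc (n + 1)).qq, smul_comm]
  · convert h45 using 2
    funext n
    simp only [Pi.mul_apply, Pi.smul_apply, Pi.sub_apply, odd4, odd5]
    rw [oddScale_sq_smul_mul, ospQ4_mul_ospQ5]
    module
  · convert h54 using 2
    funext n
    simp only [Pi.mul_apply, Pi.smul_apply, Pi.add_apply, odd4, odd5]
    rw [oddScale_sq_smul_mul, ospQ5_mul_ospQ4]
    module
  · convert h55 using 2
    funext n
    simp only [Pi.mul_apply, Pi.smul_apply, odd5]
    rw [oddScale_sq_smul_mul, (isOsp_nc (n + 1)).rr, smul_comm]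

/-- Even sequences that have a symbol. -/
def evenSeq (ρ : ℝ) : Submodule ℂ SuperSeq := (evenSymbols ρ).map (LinearMap.fst ℂ _ _)

theorem mem_evenSeq {r : SuperSeq} {s : Poly × Poly} (h : (r, s) ∈ evenSymbols ρ) : r ∈ evenSeq ρ :=
  ⟨_, h, rfl⟩

theorem lower_mem_evenSeq {r : SuperSeq} (h : r ∈ evenSeq ρ) : lower r ∈ evenSeq ρ := by
  obtain ⟨⟨r, F, G⟩, h, rfl⟩ := h
  exact mem_evenSeq (lower_mem_evenSymbols h)

theorem sandwich_mem {r m s : SuperSeq} (hr : r ∈ evenSeq ρ) (hm : (m, 0, 0) ∈ evenSymbols ρ)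
    (hs : s ∈ evenSeq ρ) : (r * m * s, 0, 0) ∈ evenSymbols ρ := by
  obtain ⟨⟨r, F⟩, hr, rfl⟩ := hr
  obtain ⟨⟨s, G⟩, hs, rfl⟩ := hs
  have h := mul_mem_evenSymbols (mul_mem_evenSymbols hr hm) hs
  have e : ((r, F) * (m, 0, 0) * (s, G) : SuperSeq × Poly × Poly) = (r * m * s, 0, 0) :=
    Prod.ext rfl (by
      change F * (0, 0) * G = (0, 0)
      rw [Prod.mk_zero_zero, mul_zero, zero_mul])
  rwa [e] at h

/-- Odd sequences with the appropriate decay. -/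
def oddSeq (ρ : ℝ) : Submodule ℂ SuperSeq where
  carrier := {o | (∃ r ∈ evenSeq ρ, ∃ s ∈ evenSeq ρ, o = r * odd4 + s * odd5) ∧
    ∃ r ∈ evenSeq ρ, ∃ s ∈ evenSeq ρ, o = odd4 * r + odd5 * s}
  zero_mem' := ⟨⟨0, Submodule.zero_mem _, 0, Submodule.zero_mem _, by simp⟩,
    ⟨0, Submodule.zero_mem _, 0, Submodule.zero_mem _, by simp⟩⟩
  add_mem' := by
    rintro o o' ⟨⟨r, hr, s, hs, e⟩, ⟨t, ht, u, hu, f⟩⟩ ⟨⟨r', hr', s', hs', e'⟩, ⟨t', ht', u', hu', f'⟩⟩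
    refine ⟨⟨_, Submodule.add_mem _ hr hr', _, Submodule.add_mem _ hs hs', ?_⟩,
      ⟨_, Submodule.add_mem _ ht ht', _, Submodule.add_mem _ hu hu', ?_⟩⟩
    · rw [e, e', add_mul, add_mul]; abel
    · rw [f, f', mul_add, mul_add]; abel
  smul_mem' := by
    rintro c o ⟨⟨r, hr, s, hs, e⟩, ⟨t, ht, u, hu, f⟩⟩
    refine ⟨⟨_, Submodule.smul_mem _ c hr, _, Submodule.smul_mem _ c hs, ?_⟩,
      ⟨_, Submodule.smul_mem _ c ht, _, Submodule.smul_mem _ c hu, ?_⟩⟩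
    · rw [e, smul_add, smul_mul_assoc, smul_mul_assoc]
    · rw [f, smul_add, mul_smul_comm, mul_smul_comm]

theorem lower_mem_oddSeq {o : SuperSeq} (h : o ∈ oddSeq ρ) : lower o ∈ oddSeq ρ := by
  obtain ⟨⟨r, hr, s, hs, e⟩, ⟨t, ht, u, hu, f⟩⟩ := h
  refine ⟨⟨_, lower_mem_evenSeq hr, _, Submodule.add_mem _ hr (lower_mem_evenSeq hs), ?_⟩,
      ⟨_, lower_mem_evenSeq ht, _, Submodule.add_mem _ ht (lower_mem_evenSeq hu), ?_⟩⟩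
  · rw [e, map_add, lower_mul, lower_mul, lower_odd4, lower_odd5, mul_zero, add_zero, add_mul]; abel
  · rw [f, map_add, lower_mul, lower_mul, lower_odd4, lower_odd5, zero_mul, zero_add, mul_add]; abel

theorem lower_pow_mem_oddSeq {o : SuperSeq} (h : o ∈ oddSeq ρ) (k : ℕ) : (lower ^ k) o ∈ oddSeq ρ := by
  induction k with
  | zero => exact h
  | succ k ih => rw [pow_succ', Module.End.mul_apply]; exact lower_mem_oddSeq ih

/-- The left factor is written with its odd generators on the right, the right factor with them on
the left, so that they meet in the middle. This is why `oddSeq` requires both forms. -/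
theorem odd_mul_odd_mem (hρ : 0 < ρ) {o o' : SuperSeq} (h : o ∈ oddSeq ρ) (h' : o' ∈ oddSeq ρ) :
    (o * o', 0, 0) ∈ evenSymbols ρ := by
  obtain ⟨⟨r, hr, s, hs, rfl⟩, -⟩ := h
  obtain ⟨-, ⟨t, ht, u, hu, rfl⟩⟩ := h'
  obtain ⟨h44, h45, h54, h55⟩ := odd_mul_odd_generators_mem hρ
  have h := Submodule.add_mem _
    (Submodule.add_mem _ (sandwich_mem hr h44 ht) (sandwich_mem hr h45 hu))
    (Submodule.add_mem _ (sandwich_mem hs h54 ht) (sandwich_mem hs h55 hu))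
  have e : (r * odd4 + s * odd5) * (odd4 * t + odd5 * u)
      = r * (odd4 * odd4) * t + r * (odd4 * odd5) * u + (s * (odd5 * odd4) * t + s * (odd5 * odd5) * u) := by
    noncomm_ring
  rw [e]
  simpa using h

theorem parity_even {e : SuperSeq} {s : Poly × Poly} (h : (e, s) ∈ evenSymbols ρ) (n : ℕ) :
    parity (n + 1) (e n) = e n := by
  obtain ⟨a, b, -, -, e1⟩ := h
  change ∀ n, e n = _ at e1
  rw [e1, parity_fromBlocks, neg_zero, neg_zero]

theorem parity_odd {o : SuperSeq} (h : o ∈ oddSeq ρ) (n : ℕ) :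
    parity (n + 1) (o n) = -o n := by
  obtain ⟨⟨r, ⟨⟨r, F⟩, hr, rfl⟩, s, ⟨⟨s, G⟩, hs, rfl⟩, rfl⟩, -⟩ := h
  change parity (n + 1) (r n * (oddScale n • ospQ4 (n + 1)) + s n * (oddScale n • ospQ5 (n + 1)))
    = -(r n * (oddScale n • ospQ4 (n + 1)) + s n * (oddScale n • ospQ5 (n + 1)))
  rw [parity_add, parity_mul, parity_mul, parity_even hr, parity_even hs, parity_smul, parity_smul,
    ospQ4_eq, ospQ5_eq, parity_fromBlocks, parity_fromBlocks, neg_add, ← mul_neg, ← mul_neg,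
    ← smul_neg, ← smul_neg, Matrix.fromBlocks_neg, Matrix.fromBlocks_neg, neg_zero, neg_zero]

end SuperSeq

end
end FuzzySupersphere

namespace FuzzySupersphere
noncomputable section
open MvPolynomial (X C pderiv)
open Filter (Tendsto atTop)

/-! ### Symbols of polynomial functions -/

theorem ncTopCoeff_even_eq {ρ : ℝ} (hρ : 0 < ρ) (q j : ℕ) : (ncTopCoeff q (2 * j) : ℂ)
    = fuzzyScale ρ q ^ j * ((superTopCoeff ρ (2 * j) * √(weight q j) : ℝ) : ℂ) := by
  rw [fuzzyScale_pow, ← Complex.ofReal_mul]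
  congr 1
  have h := ncTopCoeff_even hρ q j
  field_simp
  linarith

theorem ncTopCoeff_odd_eq {ρ : ℝ} (hρ : 0 < ρ) (q j : ℕ) : (ncTopCoeff q (2 * j + 1) : ℂ)
    = fuzzyScale ρ q ^ j *
      ((2 * ρ ^ 2 * superTopCoeff ρ (2 * j + 1) * √(weight q (j + 1)) / (q + 1) : ℝ) : ℂ) := by
  rw [fuzzyScale_pow, ← Complex.ofReal_mul]
  congr 1
  have h := ncTopCoeff_odd hρ q j
  rw [pow_succ, pow_succ] at h
  field_simp
  linarith

namespace SuperSeq

variable {ρ : ℝ}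

theorem raise_pow_mem (hρ : 0 < ρ) {c : ℕ → ℂ} {d : ℂ} (hc : Tendsto c atTop (𝓝 d)) (j : ℕ) :
    ((fun n => (fuzzyScale ρ (n + 1) ^ j * c n) • ospP (n + 1) ^ j : SuperSeq),
      d • xPlus ^ j, d • xPlus ^ j) ∈ evenSymbols ρ := by
  convert top_mem_evenSymbols hρ hc hc j using 2
  funext n
  rw [ospP_pow, Matrix.fromBlocks_smul, Matrix.fromBlocks_smul]
  simp only [smul_zero, smul_smul]

theorem raise_pow_mul_grading_mem (hρ : 0 < ρ) {c : ℕ → ℂ} {d : ℂ} (hc : Tendsto c atTop (𝓝 d)) (j : ℕ) :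
    ((fun n => (fuzzyScale ρ (n + 1) ^ j * c n) • (ospP (n + 1) ^ j * grading (n + 1)) : SuperSeq),
      d • xPlus ^ j, (-d) • xPlus ^ j) ∈ evenSymbols ρ := by
  convert top_mem_evenSymbols hρ hc hc.neg j using 2
  funext n
  rw [ospP_pow, grading, Matrix.fromBlocks_multiply, Matrix.fromBlocks_smul, Matrix.fromBlocks_smul]
  simp [smul_smul]

theorem raise_pow_mul_odd_mem (hρ : 0 < ρ) {c : ℕ → ℂ} {d : ℂ} (hc : Tendsto c atTop (𝓝 d)) (j : ℕ) :
    (fun n => (fuzzyScale ρ (n + 1) ^ j * c n * oddScale n) • (ospP (n + 1) ^ j * ospQ4 (n + 1)) :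
      SuperSeq) ∈ oddSeq ρ := by
  have h := mem_evenSeq (raise_pow_mem hρ hc j)
  refine ⟨⟨_, h, 0, Submodule.zero_mem _, ?_⟩, ⟨_, h, 0, Submodule.zero_mem _, ?_⟩⟩
  · rw [zero_mul, add_zero]
    funext n
    simp only [Pi.mul_apply, odd4]
    rw [smul_mul_smul_comm]
  · rw [mul_zero, add_zero]
    funext n
    simp only [Pi.mul_apply, odd4]
    rw [smul_mul_smul_comm, ((isOsp_nc (n + 1)).comm_pq.pow_left j).eq, mul_comm (oddScale n)]

/-- The grading has opposite symbols on the two blocks, which is allowed for the coefficients of an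
odd sequence. Moving `J_4` to the left changes the sign. -/
theorem raise_pow_mul_grading_mul_odd_mem (hρ : 0 < ρ) {c : ℕ → ℂ} {d : ℂ}
    (hc : Tendsto c atTop (𝓝 d)) (j : ℕ) :
    (fun n => (fuzzyScale ρ (n + 1) ^ j * c n * oddScale n) •
      (ospP (n + 1) ^ j * (grading (n + 1) * ospQ4 (n + 1))) : SuperSeq) ∈ oddSeq ρ := by
  have h := mem_evenSeq (raise_pow_mul_grading_mem hρ hc j)
  refine ⟨⟨_, h, 0, Submodule.zero_mem _, ?_⟩,
    ⟨_, Submodule.neg_mem _ h, 0, Submodule.zero_mem _, ?_⟩⟩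
  · rw [zero_mul, add_zero]
    funext n
    simp only [Pi.mul_apply, odd4]
    rw [smul_mul_smul_comm, mul_assoc (ospP (n + 1) ^ j)]
  · rw [mul_zero, add_zero]
    funext n
    simp only [Pi.mul_apply, Pi.neg_apply, odd4]
    rw [mul_neg, smul_mul_smul_comm, grading_Q4, mul_neg, ← mul_assoc (ospP (n + 1) ^ j),
      ← mul_assoc (ospQ4 (n + 1)), ((isOsp_nc (n + 1)).comm_pq.pow_left j).eq, mul_comm (oddScale n),
      smul_neg]

end SuperSeq

section Families

open SuperSeq

variable {ρ : ℝ} {L : ℕ} {ψ : ∀ q, superTrunc ρ L q ≃ₗ[ℂ] NSs q} {φ : ∀ q, sphTrunc ρ q ≃ₗ[ℂ] NSp q}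

/-- The polynomial superfunctions whose images in the truncated superspheres have a symbol. -/
def symbolic (ψ : ∀ q, superTrunc ρ L q ≃ₗ[ℂ] NSs q) : Submodule ℂ SuperPoly where
  carrier := {F | ∃ e o, (e, F ∅, F ∅) ∈ evenSymbols ρ ∧ o ∈ oddSeq ρ ∧
    ∀ᶠ n in atTop, limitHom ψ (n + 1) (e n + o n) = projSuper ρ L F}
  zero_mem' := ⟨0, 0, Submodule.zero_mem _, Submodule.zero_mem _,
    Filter.Eventually.of_forall fun n => by
      change limitHom ψ (n + 1) (0 + 0) = _
      rw [add_zero, map_zero, map_zero]⟩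
  add_mem' := by
    rintro F G ⟨e, o, he, ho, h⟩ ⟨e', o', he', ho', h'⟩
    refine ⟨e + e', o + o', Submodule.add_mem _ he he', Submodule.add_mem _ ho ho', ?_⟩
    filter_upwards [h, h'] with n a a'
    rw [Pi.add_apply, Pi.add_apply, add_add_add_comm, map_add, a, a', map_add]
  smul_mem' := by
    rintro c F ⟨e, o, he, ho, h⟩
    refine ⟨c • e, c • o, Submodule.smul_mem _ _ he, Submodule.smul_mem _ _ ho, ?_⟩
    filter_upwards [h] with n a
    rw [Pi.smul_apply, Pi.smul_apply, ← smul_add, map_smul, a, map_smul]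

theorem symbolic_of_even {F : SuperPoly} {e : SuperSeq} {G : Poly} (he : (e, G, G) ∈ evenSymbols ρ)
    (hG : G = F ∅) (h : ∀ᶠ n in atTop, limitHom ψ (n + 1) (e n) = projSuper ρ L F) : F ∈ symbolic ψ := by
  subst hG
  refine ⟨e, 0, he, Submodule.zero_mem _, ?_⟩
  filter_upwards [h] with n a
  rw [Pi.zero_apply, add_zero, a]

theorem symbolic_of_odd {F : SuperPoly} {o : SuperSeq} (ho : o ∈ oddSeq ρ)
    (hF : F ∅ = 0) (h : ∀ᶠ n in atTop, limitHom ψ (n + 1) (o n) = projSuper ρ L F) : F ∈ symbolic ψ := by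
  refine ⟨0, o, by rw [hF]; exact Submodule.zero_mem _, ho, ?_⟩
  filter_upwards [h] with n a
  rw [Pi.zero_apply, zero_add, a]

theorem tendsto_const_mul_sqrt_weight (s : ℝ) (j : ℕ) :
    Tendsto (fun n => ((s * √(weight (n + 1) j) : ℝ) : ℂ)) atTop (𝓝 s) := by
  have h := (((tendsto_sqrt_weight j).comp (Filter.tendsto_add_atTop_nat 1)).const_mul s)
  rw [mul_one] at h
  exact (Complex.continuous_ofReal.tendsto s).comp h

theorem oddScale_eq (n : ℕ) : oddScale n = (((n + 1 : ℕ) : ℂ) + 1)⁻¹ :=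
  eq_inv_of_mul_eq_one_left (oddScale_mul n)

theorem symbolic_sTop (hρ : 0 < ρ) (hψ : ∀ q, SuperMatches (ψ q)) (n k : ℕ) :
    (superTopCoeff ρ n : ℂ) • (superJm ^ k) (sTop n) ∈ symbolic ψ := by
  have hlim : ∀ᶠ m in atTop, limitHom ψ (m + 1)
      ((lower ^ k) (fun m => (ncTopCoeff (m + 1) n : ℂ) • nTop (m + 1) n) m)
      = projSuper ρ L ((superTopCoeff ρ n : ℂ) • (superJm ^ k) (sTop n)) := by
    filter_upwards [Filter.eventually_ge_atTop n] with m hm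
    rw [map_smul, ← limitHom_super_sTop hψ (q := m + 1) (by omega), lower_pow_apply, map_smul, map_smul]
  rcases Nat.even_or_odd' n with ⟨j, rfl | rfl⟩
  · have h := lower_pow_mem_evenSymbols (raise_pow_mem hρ
      (tendsto_const_mul_sqrt_weight (superTopCoeff ρ (2 * j)) j) j) k
    simp only [← ncTopCoeff_even_eq hρ, ← nTop_even] at h
    refine symbolic_of_even h ?_ hlim
    rw [Pi.smul_apply, superJm_pow_empty, sTop_even, (evenTop_apply j).1, map_smul]
  · have h := lower_pow_mem_oddSeq (raise_pow_mul_grading_mul_odd_mem hρ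
      (tendsto_const_mul_sqrt_weight (2 * ρ ^ 2 * superTopCoeff ρ (2 * j + 1)) (j + 1)) j) k
    have e : ∀ m, fuzzyScale ρ (m + 1) ^ j *
        ((2 * ρ ^ 2 * superTopCoeff ρ (2 * j + 1) * √(weight (m + 1) (j + 1)) : ℝ) : ℂ) * oddScale m
        = ncTopCoeff (m + 1) (2 * j + 1) := fun m => by
      rw [ncTopCoeff_odd_eq hρ, oddScale_eq]
      push_cast
      ring
    simp only [e, ← nTop_odd] at h
    refine symbolic_of_odd h ?_ hlim
    rw [Pi.smul_apply, superJm_pow_empty, sTop_odd, (oddTop_apply j).1, map_zero, smul_zero]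

/-- The second ladders: even matrices for even `n`, where the two blocks carry different
coefficients with a common limit, and odd matrices for odd `n`. -/
theorem symbolic_superQ_sTop (hρ : 0 < ρ) (hψ : ∀ q, SuperMatches (ψ q)) (n k : ℕ) :
    (superTopCoeff ρ (n + 1) : ℂ) • (superJm ^ k) (superQ 1 (sTop (n + 1))) ∈ symbolic ψ := by
  have hlim : ∀ᶠ m in atTop, limitHom ψ (m + 1)
      ((lower ^ k) (fun m => (ncTopCoeff (m + 1) (n + 1) : ℂ) •
        oddComm (m + 1) (ospQ5 (m + 1)) (nTop (m + 1) (n + 1))) m)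
      = projSuper ρ L ((superTopCoeff ρ (n + 1) : ℂ) • (superJm ^ k) (superQ 1 (sTop (n + 1)))) := by
    filter_upwards [Filter.eventually_ge_atTop n] with m hm
    rw [map_smul, ← limitHom_super_superQ hψ (q := m + 1) (by omega), lower_pow_apply, map_smul, map_smul]
  rcases Nat.even_or_odd' n with ⟨j, rfl | rfl⟩
  · set s := superTopCoeff ρ (2 * j + 1) with hs
    have hsc := tendsto_const_mul_sqrt_weight (2 * ρ ^ 2 * s) (j + 1)
    have hj : Tendsto (fun n => (j : ℂ) * oddScale n) atTop (𝓝 0) := by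
      have h := tendsto_oddScale.const_mul (j : ℂ)
      rwa [mul_zero] at h
    have hc := (hsc.mul ((hj.sub (tendsto_oddScale.const_sub 1)).div_const 4))
    have hc' := (hsc.mul ((hj.const_add 1).neg.div_const 4))
    have h := top_mem_evenSymbols hρ hc hc' j
    have e1 : ((2 * ρ ^ 2 * s : ℝ) : ℂ) * ((0 - (1 - 0)) / 4) = (s : ℂ) * (-(ρ : ℂ) ^ 2 / 2) := by
      push_cast; ring
    have e2 : ((2 * ρ ^ 2 * s : ℝ) : ℂ) * (-(1 + 0) / 4) = (s : ℂ) * (-(ρ : ℂ) ^ 2 / 2) := by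
      push_cast; ring
    rw [e1, e2] at h
    have h1 := lower_pow_mem_evenSymbols h k
    -- The block coefficients converge to `-ρ²/2`, whereas the polynomial has `-radSq/2`. A
    -- negligible multiple of `radSq - ρ²` corrects the symbol.
    have h2 := Submodule.smul_mem _ ((s : ℂ) * (-1 / 2)) (relation_mem_evenSymbols (ρ := ρ)
      ((sphJm ^ k) (xPlus ^ j)) ((sphJm ^ k) (xPlus ^ j)))
    have h3 := Submodule.add_mem _ h1 h2
    simp only [Prod.smul_mk, Prod.mk_add_mk, smul_zero, add_zero] at h3
    have e : ∀ m : ℕ, fuzzyScale ρ (m + 1) ^ j • Matrix.fromBlocks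
          ((((2 * ρ ^ 2 * s * √(weight (m + 1) (j + 1)) : ℝ) : ℂ) *
            (((j : ℂ) * oddScale m - (1 - oddScale m)) / 4)) • spinP (m + 1 + 1) ^ j) 0 0
          ((((2 * ρ ^ 2 * s * √(weight (m + 1) (j + 1)) : ℝ) : ℂ) *
            (-(1 + (j : ℂ) * oddScale m) / 4)) • spinP (m + 1) ^ j)
        = (ncTopCoeff (m + 1) (2 * j + 1) : ℂ) •
          oddComm (m + 1) (ospQ5 (m + 1)) (nTop (m + 1) (2 * j + 1)) := fun m => by
      have h0 := oddScale_mul m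
      have h4 : ((2 * ρ ^ 2 * s * √(weight (m + 1) (j + 1)) / (((m + 1 : ℕ) : ℝ) + 1) : ℝ) : ℂ)
          = ((2 * ρ ^ 2 * s * √(weight (m + 1) (j + 1)) : ℝ) : ℂ) * oddScale m := by
        rw [oddScale_eq]; push_cast; ring
      rw [ncTopCoeff_odd_eq hρ, oddComm_nTop_odd, ← hs, h4, mul_smul (fuzzyScale ρ (m + 1) ^ j)]
      congr 1
      rw [Matrix.fromBlocks_smul, smul_smul, smul_smul, smul_zero, smul_zero]
      generalize ((2 * ρ ^ 2 * s * √(weight (m + 1) (j + 1)) : ℝ) : ℂ) = w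
      congr 2
      · linear_combination (w / 4) * h0
      · linear_combination (w / 4) * h0
    simp only [e] at h3
    refine symbolic_of_even h3 ?_ hlim
    rw [Pi.smul_apply, superJm_pow_empty, sTop_odd, superQ_one_oddTop, Pi.smul_apply, Pi.add_apply,
      Pi.single_eq_same, Pi.single_eq_of_ne (by decide), add_zero, map_smul, map_smul,
      sphJm_pow_mul_radSq, sub_mul, ← MvPolynomial.smul_eq_C_mul, mul_comm radSq]
    module
  -- The normalization has `j + 1` powers of `fuzzyScale` but only `j` factors `J_+`; the spare
  -- power is `2ρ · oddScale` and goes with `J_4`.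
  · have h := lower_pow_mem_oddSeq (raise_pow_mul_odd_mem hρ
      (tendsto_const_mul_sqrt_weight (-(2 * ρ * ((j : ℝ) + 1) * superTopCoeff ρ (2 * (j + 1)))) (j + 1)) j) k
    rw [show 2 * j + 1 + 1 = 2 * (j + 1) by ring] at hlim ⊢
    have e : ∀ m : ℕ, (fuzzyScale ρ (m + 1) ^ j * ((-(2 * ρ * ((j : ℝ) + 1) * superTopCoeff ρ (2 * (j + 1)))
          * √(weight (m + 1) (j + 1)) : ℝ) : ℂ) * oddScale m) • (ospP (m + 1) ^ j * ospQ4 (m + 1))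
        = (ncTopCoeff (m + 1) (2 * (j + 1)) : ℂ) •
          oddComm (m + 1) (ospQ5 (m + 1)) (nTop (m + 1) (2 * (j + 1))) := fun m => by
      rw [ncTopCoeff_even_eq hρ, oddComm_nTop_even, Nat.add_sub_cancel, smul_smul,
        pow_succ (fuzzyScale ρ (m + 1)), fuzzyScale_succ ρ m]
      congr 1
      push_cast
      ring
    simp only [e] at h
    refine symbolic_of_odd h ?_ hlim
    rw [Pi.smul_apply, superJm_pow_empty, sTop_even, superQ_one_evenTop,
      Pi.single_eq_of_ne (by decide), map_zero, smul_zero]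

theorem ladderSpan_le_symbolic (hρ : 0 < ρ) (hψ : ∀ q, SuperMatches (ψ q)) (p : ℕ) :
    ladderSpan superJm (superGens ρ p) ≤ symbolic ψ := by
  rw [ladderSpan_le_iff]
  rintro (n | n) k
  · simp only [superGens, Sum.elim_inl, superTop_eq, map_smul]
    exact symbolic_sTop hρ hψ n k
  · simp only [superGens, Sum.elim_inr, superTop_eq, map_smul]
    exact symbolic_superQ_sTop hρ hψ n k

/-- On each rung `φ_q⁻¹` multiplies by a coefficient that tends to `1`; dividing by it, eventually,
gives an exact preimage. -/
theorem exists_sphSymbol (hρ : 0 < ρ) (hφ : ∀ q, SphMatches (φ q)) (F : Poly) :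
    ∃ a, (a, F) ∈ Symbols.symbols ρ ∧ ∀ᶠ q in atTop, limitHom φ q (a q) = projSphere ρ F := by
  let N : Submodule ℂ Poly :=
    { carrier := {F | ∃ a, (a, F) ∈ Symbols.symbols ρ ∧
        ∀ᶠ q in atTop, limitHom φ q (a q) = projSphere ρ F}
      zero_mem' := ⟨0, Submodule.zero_mem _, Filter.Eventually.of_forall fun q => by
        rw [Pi.zero_apply, map_zero, map_zero]⟩
      add_mem' := by
        rintro F G ⟨a, ha, h⟩ ⟨b, hb, h'⟩
        refine ⟨a + b, Submodule.add_mem _ ha hb, ?_⟩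
        filter_upwards [h, h'] with n e e'
        rw [Pi.add_apply, map_add, e, e', map_add]
      smul_mem' := by
        rintro c F ⟨a, ha, h⟩
        refine ⟨c • a, Submodule.smul_mem _ _ ha, ?_⟩
        filter_upwards [h] with n e
        rw [Pi.smul_apply, map_smul, e, map_smul] }
  refine Symbols.poly_mem_of_ladders ρ (N := N) (fun j k => ?_) (fun G => ?_) F
  · obtain ⟨c, hc, h⟩ := tendsto_limitHom_sph hρ hφ j k
    have hi := hc.inv₀ one_ne_zero
    rw [inv_one] at hi
    have hm := Symbols.scale_mem hi (Symbols.lower_pow_symX_pow_mem (ρ := ρ) j k)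
    rw [Symbols.scale_apply, Symbols.lower_pow_apply, one_smul] at hm
    refine ⟨_, hm, ?_⟩
    filter_upwards [h, hc.eventually_ne one_ne_zero] with q e hq
    rw [map_smul, Symbols.symX_pow]
    simp only
    rw [e, smul_smul, inv_mul_cancel₀ hq, one_smul]
  · refine ⟨0, Symbols.negligible_le ⟨Filter.Eventually.of_forall fun _ => rfl, G, rfl⟩,
      Filter.Eventually.of_forall fun q => ?_⟩
    rw [Pi.zero_apply, map_zero, sub_mul, mul_comm radSq, map_sub, projSphere_mul_radSq hρ,
      ← MvPolynomial.smul_eq_C_mul, map_smul, sub_self]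

/-! ### Convergence of products -/

/-- The inclusion of the endomorphisms of the component of larger spin. -/
def upperBlock (q : ℕ) : NSp q →ₗ[ℂ] NSs q where
  toFun a := Matrix.fromBlocks a 0 0 0
  map_add' a b := by rw [Matrix.fromBlocks_add]; simp
  map_smul' c a := by rw [Matrix.fromBlocks_smul]; simp

/-- The inclusion of the endomorphisms of the component of smaller spin. -/
def lowerBlock (q : ℕ) : NSp q →ₗ[ℂ] NSs (q + 1) where
  toFun a := Matrix.fromBlocks 0 0 0 a
  map_add' a b := by rw [Matrix.fromBlocks_add]; simp
  map_smul' c a := by rw [Matrix.fromBlocks_smul]; simp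

theorem LiftConv.shift {u : ℕ → SmoothSphere ρ} {w : SmoothSphere ρ} (h : LiftConv ρ u w) :
    LiftConv ρ (fun n => u (n + 1)) w := by
  obtain ⟨U, W, h1, h2, h3⟩ := h
  exact ⟨fun n => U (n + 1), W, (Filter.tendsto_add_atTop_nat 1).eventually h1, h2,
    h3.comp (Filter.tendsto_add_atTop_nat 1)⟩

theorem tendsto_weight_inv (j : ℕ) : Tendsto (fun q => (√(weight q j))⁻¹) atTop (𝓝 1) := by
  have h := (tendsto_sqrt_weight j).inv₀ one_ne_zero
  rwa [inv_one] at h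

/-- The coefficients of `body_blocks` converge to `1/2` on every rung, and convergence on rungs
extends to all symbols. -/
theorem liftConv_upperBlock (hρ : 0 < ρ) (hψ : ∀ q, SuperMatches (ψ q)) {a : ∀ q, NSp q} {F : Poly}
    (h : (a, F) ∈ Symbols.symbols ρ) :
    LiftConv ρ (fun q => (bodyMap ρ L (limitHom ψ q (Matrix.fromBlocks (a q) 0 0 0)) : SmoothSphere ρ))
      (((1 / 2 : ℂ) • projSphere ρ F : polySphere ρ)) := by
  have hl : ∀ j k, ∃ c : ℕ → ℂ, Tendsto c atTop (𝓝 (1 / 2)) ∧ ∀ᶠ q in atTop,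
      (bodyMap ρ L ∘ₗ limitHom ψ q ∘ₗ upperBlock q)
        ((adE (spinM (q + 1)) ^ k) ((fuzzyScale ρ q • spinP (q + 1)) ^ j))
        = c q • projSphere ρ ((sphJm ^ k) (xPlus ^ j)) := fun j k => by
    refine ⟨fun q => (((√(weight q j))⁻¹ / (1 + blockRatio q j) : ℝ) : ℂ), ?_, ?_⟩
    · have h := (tendsto_weight_inv j).div ((tendsto_blockRatio j).const_add 1) (by norm_num)
      have h2 := (Complex.continuous_ofReal.tendsto _).comp h
      rwa [show ((1 / (1 + 1) : ℝ) : ℂ) = 1 / 2 by norm_num] at h2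
    · filter_upwards [Filter.eventually_gt_atTop j] with q hq
      rw [← (body_blocks hρ hψ hq k).1, smul_pow, map_smul, map_smul]
      rfl
  exact liftConv_of_ladders (s := (a, F)) hρ (fun q => bodyMap ρ L ∘ₗ limitHom ψ q ∘ₗ upperBlock q) hl h

theorem liftConv_lowerBlock (hρ : 0 < ρ) (hψ : ∀ q, SuperMatches (ψ q)) {b : ∀ q, NSp q} {F : Poly}
    (h : (b, F) ∈ Symbols.symbols ρ) :
    LiftConv ρ (fun q => (bodyMap ρ L (limitHom ψ (q + 1) (Matrix.fromBlocks 0 0 0 (b q))) : SmoothSphere ρ))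
      (((1 / 2 : ℂ) • projSphere ρ F : polySphere ρ)) := by
  have hl : ∀ j k, ∃ c : ℕ → ℂ, Tendsto c atTop (𝓝 (1 / 2)) ∧ ∀ᶠ q in atTop,
      (bodyMap ρ L ∘ₗ limitHom ψ (q + 1) ∘ₗ lowerBlock q)
        ((adE (spinM (q + 1)) ^ k) ((fuzzyScale ρ q • spinP (q + 1)) ^ j))
        = c q • projSphere ρ ((sphJm ^ k) (xPlus ^ j)) := fun j k => by
    -- The extra factor compares the scale of level `q + 1`, used by `body_blocks`, with that of
    -- level `q`, used by the symbol of the smaller block.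
    refine ⟨fun q => ((fuzzyScale ρ (q + 1) / fuzzyScale ρ q) ^ j)⁻¹ * (((√(weight (q + 1) j))⁻¹ *
      blockRatio (q + 1) j / (1 + blockRatio (q + 1) j) : ℝ) : ℂ), ?_, ?_⟩
    · have h := ((tendsto_weight_inv j).mul (tendsto_blockRatio j)).div
        ((tendsto_blockRatio j).const_add 1) (by norm_num)
      have h2 := ((Complex.continuous_ofReal.tendsto _).comp h).comp (Filter.tendsto_add_atTop_nat 1)
      have h4 := (((tendsto_fuzzyScale_ratio hρ).pow j).inv₀ (by norm_num)).mul h2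
      rwa [show (((1 : ℂ) ^ j)⁻¹ * ((1 * 1 / (1 + 1) : ℝ) : ℂ)) = 1 / 2 by norm_num] at h4
    · filter_upwards [Filter.eventually_gt_atTop j] with q hq
      rw [mul_smul, ← (body_blocks hρ hψ (show j < q + 1 by omega) k).2, smul_pow, map_smul, map_smul,
        smul_smul, div_pow, inv_div, div_mul_cancel₀ _ (pow_ne_zero _ (fuzzyScale_ne_zero hρ _))]
      rfl
  exact liftConv_of_ladders (s := (b, F)) hρ
    (fun q => bodyMap ρ L ∘ₗ limitHom ψ (q + 1) ∘ₗ lowerBlock q) hl h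

theorem liftConv_evenSymbols (hρ : 0 < ρ) (hψ : ∀ q, SuperMatches (ψ q)) {e : SuperSeq} {F : Poly}
    (h : (e, F, F) ∈ evenSymbols ρ) :
    LiftConv ρ (fun n => (bodyMap ρ L (limitHom ψ (n + 1) (e n)) : SmoothSphere ρ))
      (projSphere ρ F : polySphere ρ) := by
  obtain ⟨a, b, ha, hb, h⟩ := h
  have h1 := (liftConv_upperBlock hρ hψ ha).shift.add (liftConv_lowerBlock hρ hψ hb)
  have e1 : (((1 / 2 : ℂ) • projSphere ρ F : polySphere ρ) : SmoothSphere ρ)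
      + (((1 / 2 : ℂ) • projSphere ρ F : polySphere ρ) : SmoothSphere ρ) = (projSphere ρ F : polySphere ρ) := by
    rw [← Subalgebra.coe_add, ← add_smul]; norm_num
  rw [e1] at h1
  refine h1.congr' (Filter.Eventually.of_forall fun n => ?_)
  simp only at h ⊢
  rw [h, ← Subalgebra.coe_add, ← map_add, ← map_add, Matrix.fromBlocks_add]
  simp

/-- Parity does not change the body but changes the sign of `a`, so the body equals its own
negative. -/
theorem bodyMap_limitHom_odd (hρ : 0 < ρ) (hψ : ∀ q, SuperMatches (ψ q)) {q : ℕ} {a : NSs q}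
    (h : parity q a = -a) : bodyMap ρ L (limitHom ψ q a) = 0 := by
  obtain ⟨F, hF, e⟩ := exists_superRep (ψ := ψ) hρ q a
  have e' : limitHom ψ q (parity q a) = projSuper ρ L (superParity F) := (hψ q).parity hρ hF e
  have h1 : bodyMap ρ L (limitHom ψ q (parity q a)) = bodyMap ρ L (limitHom ψ q a) := by
    rw [e, e', bodyMap_projSuper, bodyMap_projSuper, (superParity_apply F).1]
  rw [h, map_neg, map_neg] at h1
  have h2 : (2 : ℂ) • bodyMap ρ L (limitHom ψ q a) = 0 := by
    rw [two_smul]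
    nth_rewrite 1 [← h1]
    exact neg_add_cancel _
  exact (smul_eq_zero.1 h2).resolve_left two_ne_zero

theorem exists_seq_of_mem (hρ : 0 < ρ) (hψ : ∀ q, SuperMatches (ψ q)) {p : ℕ} {f : polySuper ρ L}
    (hf : f ∈ superTrunc ρ L p) : ∃ F e o, bodyMap ρ L f = projSphere ρ F ∧ (e, F, F) ∈ evenSymbols ρ ∧
      o ∈ oddSeq ρ ∧ ∀ᶠ n in atTop, ∀ hn : f ∈ superTrunc ρ L (n + 1), ψ (n + 1) ⟨f, hn⟩ = e n + o n := by
  rw [superTrunc_eq hρ] at hf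
  obtain ⟨F, hF, rfl⟩ := hf
  obtain ⟨e, o, he, ho, h⟩ := ladderSpan_le_symbolic (ψ := ψ) hρ hψ p hF
  refine ⟨F ∅, e, o, bodyMap_projSuper .., he, ho, ?_⟩
  filter_upwards [h] with n a hn
  rw [← LinearEquiv.eq_symm_apply]
  exact Subtype.ext a.symm

/-- Even times even has the product of the bodies as symbol on both blocks, odd times odd has symbol
zero, and the mixed terms are odd and have no body. -/
theorem tendsto_super_product (hρ : 0 < ρ) (hψ : ∀ q, SuperMatches (ψ q)) {p : ℕ} {f g : polySuper ρ L}
    (hf : f ∈ superTrunc ρ L p) (hg : g ∈ superTrunc ρ L p) :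
    Tendsto (fun q : Set.Ici p => (bodyMap ρ L (limitHom ψ q.1
        (ψ q.1 ⟨f, superTrunc_mono ρ L q.2 hf⟩ * ψ q.1 ⟨g, superTrunc_mono ρ L q.2 hg⟩)) : SmoothSphere ρ))
      atTop (𝓝 (bodyMap ρ L f * bodyMap ρ L g : SmoothSphere ρ)) := by
  obtain ⟨F, e, o, hF, he, ho, h⟩ := exists_seq_of_mem hρ hψ hf
  obtain ⟨G, e', o', hG, he', ho', h'⟩ := exists_seq_of_mem hρ hψ hg
  have h1 := Submodule.add_mem _ (mul_mem_evenSymbols he he') (odd_mul_odd_mem hρ ho ho')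
  simp only [Prod.mk_mul_mk, Prod.mk_add_mk, add_zero] at h1
  have h2 := (liftConv_evenSymbols (ψ := ψ) hρ hψ h1).tendsto
  have e1 : (bodyMap ρ L f * bodyMap ρ L g : SmoothSphere ρ) = (projSphere ρ (F * G) : polySphere ρ) := by
    rw [hF, hG]
    exact (map_mul (polyOnSphere ρ) F G).symm
  rw [e1]
  -- The sequence is extended by zero below `p`, so that the limit can be taken over all of `ℕ` and
  -- along the shift `q = n + 1`.
  let u : ℕ → SmoothSphere ρ := fun q => if hq : p ≤ q then (bodyMap ρ L (limitHom ψ q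
        (ψ q ⟨f, superTrunc_mono ρ L hq hf⟩ * ψ q ⟨g, superTrunc_mono ρ L hq hg⟩)) : SmoothSphere ρ) else 0
  have hu : Tendsto u atTop (𝓝 (projSphere ρ (F * G) : polySphere ρ)) := by
    rw [← Filter.tendsto_add_atTop_iff_nat 1]
    refine h2.congr' ?_
    filter_upwards [h, h', Filter.eventually_ge_atTop p] with n a a' hn
    have hp : p ≤ n + 1 := by omega
    simp only [u, dif_pos hp]
    rw [a, a']
    have e2 : (e n + o n) * (e' n + o' n) = (e * e' + o * o') n + (e n * o' n + o n * e' n) := by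
      simp only [Pi.add_apply, Pi.mul_apply]; noncomm_ring
    have e3 : parity (n + 1) (e n * o' n + o n * e' n) = -(e n * o' n + o n * e' n) := by
      rw [parity_add, parity_mul, parity_mul, parity_even he, parity_even he', parity_odd ho,
        parity_odd ho']
      noncomm_ring
    rw [e2, map_add, map_add, bodyMap_limitHom_odd hρ hψ e3, add_zero]
  have h3 := (Filter.tendsto_comp_val_Ici_atTop (a := p)).2 hu
  refine h3.congr fun q => ?_
  have hq : p ≤ q.1 := q.2
  simp only [u, dif_pos hq]

theorem tendsto_fuzzyProd (hρ : 0 < ρ) (hφ : ∀ q, SphMatches (φ q)) {p : ℕ} {f g : polySphere ρ}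
    (hf : ∀ q, p ≤ q → f ∈ sphTrunc ρ q) (hg : ∀ q, p ≤ q → g ∈ sphTrunc ρ q) :
    Tendsto (fun q : Set.Ici p => fuzzyProd φ q.1 ⟨f, hf q.1 q.2⟩ ⟨g, hg q.1 q.2⟩)
      atTop (𝓝 (f * g : SmoothSphere ρ)) := by
  obtain ⟨F, hF⟩ : ∃ F, projSphere ρ F = f := (polyOnSphere ρ).rangeRestrict_surjective f
  obtain ⟨G, hG⟩ : ∃ G, projSphere ρ G = g := (polyOnSphere ρ).rangeRestrict_surjective g
  obtain ⟨a, ha, h⟩ := exists_sphSymbol hρ hφ F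
  obtain ⟨b, hb, h'⟩ := exists_sphSymbol hρ hφ G
  have h2 := (liftConv_of_ladders hρ (fun q => limitHom φ q) (tendsto_limitHom_sph hρ hφ)
    (Symbols.mul_mem ha hb)).tendsto
  have e1 : (((1 : ℂ) • projSphere ρ ((a, F) * (b, G) : SymbolRing).2 : polySphere ρ) : SmoothSphere ρ)
      = f * g := by
    rw [one_smul, ← hF, ← hG]
    exact map_mul (polyOnSphere ρ) F G
  rw [e1] at h2
  let u : ℕ → SmoothSphere ρ := fun q => if hq : p ≤ q then
    fuzzyProd φ q ⟨f, hf q hq⟩ ⟨g, hg q hq⟩ else 0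
  have hu : Tendsto u atTop (𝓝 (f * g : SmoothSphere ρ)) := by
    refine h2.congr' ?_
    filter_upwards [h, h', Filter.eventually_ge_atTop p] with q c c' hq
    have d : φ q ⟨f, hf q hq⟩ = a q := by
      rw [← LinearEquiv.eq_symm_apply]; exact Subtype.ext (hF.symm.trans c.symm)
    have d' : φ q ⟨g, hg q hq⟩ = b q := by
      rw [← LinearEquiv.eq_symm_apply]; exact Subtype.ext (hG.symm.trans c'.symm)
    simp only [u, dif_pos hq, fuzzyProd]
    rw [d, d']
    rfl
  have h3 := (Filter.tendsto_comp_val_Ici_atTop (a := p)).2 hu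
  refine h3.congr fun q => ?_
  have hq : p ≤ q.1 := q.2
  simp only [u, dif_pos hq]

end Families

end
end FuzzySupersphere

theorem proposition4 (ρ : ℝ) (hρ : 0 < ρ) (L : ℕ) (hL : 2 ≤ L) :
    -- the maps `ψ_q` of the supersphere and of the sphere exist and are unique
    (∀ q, ∃! ψ : superTrunc ρ L q ≃ₗ[ℂ] NSs q, IsPsi ψ) ∧
    (∀ q, ∃! φ : sphTrunc ρ q ≃ₗ[ℂ] NSp q, IsPsiHat φ) ∧
    -- the body map respects the truncations, so that `β_q` is defined
    ∃ hβ : ∀ q, ∀ f ∈ superTrunc ρ L q, bodyMap ρ L f ∈ sphTrunc ρ q,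
    ∀ (ψ : ∀ q, superTrunc ρ L q ≃ₗ[ℂ] NSs q) (φ : ∀ q, sphTrunc ρ q ≃ₗ[ℂ] NSp q),
      (∀ q, IsPsi (ψ q)) → (∀ q, IsPsiHat (φ q)) →
      -- both systems consist of (graded) `sl(2)`-modules and (even) module homomorphisms
      (∀ q r (h : q ≤ r) (a : NSs q),
        transition (superTrunc_mono ρ L) ψ q r h (parity q a)
            = parity r (transition (superTrunc_mono ρ L) ψ q r h a) ∧
          ∀ i, transition (superTrunc_mono ρ L) ψ q r h (evenComm (ospJ q i) a)
            = evenComm (ospJ r i) (transition (superTrunc_mono ρ L) ψ q r h a)) ∧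
      (∀ q r (h : q ≤ r) (b : NSp q) (i : Fin 3),
        transition (sphTrunc_mono ρ) φ q r h (evenComm (spinJ q i) b)
          = evenComm (spinJ r i) (transition (sphTrunc_mono ρ) φ q r h b)) ∧
      -- every `β_q` is a surjective even `sl(2)`-module homomorphism
      (∀ q, Function.Surjective (ncBody hβ ψ φ q)) ∧
      (∀ q (a : NSs q), ncBody hβ ψ φ q (parity q a) = ncBody hβ ψ φ q a) ∧
      (∀ q (a : NSs q) (i : Fin 3),
        ncBody hβ ψ φ q (evenComm (ospJ q i) a) = evenComm (spinJ q i) (ncBody hβ ψ φ q a)) ∧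
      -- the direct limits are the polynomial (super)functions
      Function.Bijective (fromLimit (superTrunc_mono ρ L) ψ) ∧
      Function.Bijective (fromLimit (sphTrunc_mono ρ) φ) ∧
      -- the `β_q` form a homomorphism of directed systems, whose limit is the body map
      (∃ hc : ∀ q r (h : q ≤ r),
          ncBody hβ ψ φ r ∘ₗ transition (superTrunc_mono ρ L) ψ q r h
            = transition (sphTrunc_mono ρ) φ q r h ∘ₗ ncBody hβ ψ φ q,
        ∀ z, fromLimit (sphTrunc_mono ρ) φ (Module.DirectLimit.map (ncBody hβ ψ φ) hc z)
          = bodyMap ρ L (fromLimit (superTrunc_mono ρ L) ψ z)) ∧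
      -- multiplicativity in the limit, in the Fréchet topology of `C^∞(S_ρ, ℂ)`
      (∀ f g : polySuper ρ L,
        (∃ p, f ∈ superTrunc ρ L p ∧ g ∈ superTrunc ρ L p) ∧
        ∀ (p : ℕ) (hf : f ∈ superTrunc ρ L p) (hg : g ∈ superTrunc ρ L p),
          Filter.Tendsto
            (fun q : Set.Ici p =>
              (limitHom φ q.1 (ncBody hβ ψ φ q.1
                (ψ q.1 ⟨f, superTrunc_mono ρ L q.2 hf⟩ *
                  ψ q.1 ⟨g, superTrunc_mono ρ L q.2 hg⟩)) : SmoothSphere ρ))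
            Filter.atTop (𝓝 (bodyMap ρ L f * bodyMap ρ L g : SmoothSphere ρ)) ∧
          Filter.Tendsto
            (fun q : Set.Ici p =>
              fuzzyProd φ q.1 ⟨bodyMap ρ L f, hβ q.1 f (superTrunc_mono ρ L q.2 hf)⟩
                ⟨bodyMap ρ L g, hβ q.1 g (superTrunc_mono ρ L q.2 hg)⟩)
            Filter.atTop (𝓝 (bodyMap ρ L f * bodyMap ρ L g : SmoothSphere ρ))) := by
  refine ⟨existsUnique_isPsi hρ hL, existsUnique_isPsiHat hρ, bodyMap_mem hρ L, ?_⟩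
  intro ψ φ hψ' hφ'
  have hψ : ∀ q, SuperMatches (ψ q) := fun q => (isPsi_iff (ψ q)).1 (hψ' q)
  have hφ : ∀ q, SphMatches (φ q) := fun q => (isPsiHat_iff (φ q)).1 (hφ' q)
  refine ⟨transition_super hρ hψ, transition_sph hρ hφ, ncBody_surjective hρ, ncBody_parity hρ hψ,
    ncBody_evenComm hρ hψ hφ, fromLimit_bijective _ ψ (exists_mem_superTrunc hρ),
    fromLimit_bijective _ φ (exists_mem_sphTrunc hρ),
    ⟨ncBody_transition, fromLimit_map_ncBody ncBody_transition⟩, fun f g => ⟨?_, fun p hf hg => ⟨?_, ?_⟩⟩⟩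
  · obtain ⟨p, hp⟩ := exists_mem_superTrunc hρ f
    obtain ⟨r, hr⟩ := exists_mem_superTrunc hρ g
    exact ⟨max p r, superTrunc_mono ρ L (le_max_left p r) hp, superTrunc_mono ρ L (le_max_right p r) hr⟩
  · refine (tendsto_super_product hρ hψ hf hg).congr fun q => ?_
    rw [limitHom_ncBody]
  · exact tendsto_fuzzyProd hρ hφ (fun q hq => bodyMap_mem hρ L q f (superTrunc_mono ρ L hq hf))
      (fun q hq => bodyMap_mem hρ L q g (superTrunc_mono ρ L hq hg))
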